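/- **Setting.** Let $X$ be a smooth $(n+1)$-dimensional manifold, possibly with boundary $\partial X$, with a volume form $\eta$, and let $\pi:Y\to X$ be a smooth fibration (surjective submersion) with $m$-dimensional fibres and $\partial Y=\pi^{-1}(\partial X)$; manifolds are Hausdorff and second countable. Let $Z=J^1\pi$ be the bundle of $1$-jets of local sections of $\pi$, with projections $\pi_{XZ}:Z\to X$, $\pi_{YZ}:Z\to Y$, induced coordinates $(x^\mu,y^i,z^i_\mu)$, and $\partial Z=\pi_{XZ}^{-1}(\partial X)$. For a local section $\phi$ of $\pi$, $j^1\phi$ denotes its $1$-jet prolongation. A *contact form* is a smooth $1$-form $\theta$ on $Z$ with $(j^1\phi)^*\theta=0$ for all local sections $\phi$, and $\mathcal I(\mathcal C)$ is the ideal of the algebra of smooth forms on $Z$ generated by the contact forms and their differentials. For a smooth Lagrangian function $L:Z\to\mathbb R$ let $\Theta_L=L\eta+(S_\eta)^*(dL)$ be the Poincaré–Cartan form ($S_\eta$ is the vertical endomorphism); in fibred coordinates with $\eta=d^{n+1}x$, $$\Theta_L=L\,d^{n+1}x+\frac{\partial L}{\partial z^i_\mu}\,(dy^i-z^i_\nu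 dx^\nu)\wedge d^nx_\mu ,\qquad d^nx_\mu=\iota_{\partial/\partial x^\mu}d^{n+1}x .$$ Put $\Omega_L=-d\Theta_L$. Let $i_B:B\hookrightarrow Z$ be the inclusion of a subbundle $B$ of $\partial Z\to\partial X$ (the boundary condition), and let $\Pi$ be an $n$-form on $B$ with $i_B^*\Theta_L=d\Pi$. A *solution* over an open set $U\subseteq X$ is a smooth section $\phi$ of $\pi$ over $U$ that satisfies the Euler–Lagrange equations $$(j^1\phi)^*(\iota_\zeta\Omega_L)=0\quad\text{on }U\text{ for every vector field }\zeta\text{ on }Z$$ and the boundary condition $j^1\phi(U\cap\partial X)\subseteq B$. A *Cartan symmetry* is a vector field $\xi$ on $Z$ such that $\pounds_\xi\,\mathcal I(\mathcal C)\subseteq\mathcal I(\mathcal C)$; there is an $n$-form $\alpha$ on $Z$, with $i_B^*\alpha$ exact, such that $\pounds_\xi\Theta_L-d\alpha\in\mathcal I(\mathcal C)$; and $\xi$ is tangent to $B$ with $\pounds_{\xi|_B}\Pi=0$. For an open $W\subseteq U$ and an open interval $T\ni 0$, say that *the flow of $\xi$ is defined and projectable along $j^1\phi|_W$ for times in $T$*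 if the integral curve $t\mapsto\Psi_t(x)$ of $\xi$ with $\Psi_0(x)=j^1\phi(x)$ exists for all $x\in W$ and $t\in T$ and depends smoothly on $(t,x)$, and for every $t\in T$ the map $\psi_t:=\pi_{XZ}\circ\Psi_t$ is a diffeomorphism of $W$ onto an open subset of $X$. **Proposition.** Let $\xi$ be a Cartan symmetry and let $\phi$ be a solution over an open set $U\subseteq X$. 1. For every compact $K\subseteq U$ there are $\varepsilon>0$ and an open $W$ with $K\subseteq W\subseteq U$ such that the flow of $\xi$ is defined and projectable along $j^1\phi|_W$ for $|t|<\varepsilon$, and such that for all these $t$ there is a solution $\phi_t$ over $\psi_t(W)$ (in particular it satisfies the Euler–Lagrange equations and the boundary condition) with $$\Psi_t=j^1\phi_t\circ\psi_t\ \text{ on } W,\qquad\text{that is,}\qquad j^1\phi_t=\Psi_t\circ\psi_t^{-1},\quad \phi_t=\pi_{YZ}\circ\Psi_t\circ\psi_t^{-1}.$$ 2. More generally, whenever the flow of $\xi$ is defined and projectable along $j^1\phi|_W$ for times in an open interval $T\ni0$, with $W\subseteq U$ open, then for every $t\in T$ there is a section $\phi_t$ over $\psi_t(W)$ with $\Psi_t=j^1\phi_t\circ\psi_t$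 on $W$, and $\phi_t$ satisfies the Euler–Lagrange equations; if $B$ is closed in $Z$, it also satisfies the boundary condition. -/

import Mathlib

open Set Function
open scoped Manifold ContDiff Topology

noncomputable section

namespace FieldTheory

section Wedge
variable {V : Type*} [AddCommGroup V] [Module ℝ V] [TopologicalSpace V]

/-- The multilinear map `(v₁, …, v_{p+q}) ↦ a (v₁, …, v_p) * b (v_{p+1}, …, v_{p+q})`. -/
def tensorForm {p q : ℕ} (a : V [⋀^Fin p]→L[ℝ] ℝ) (b : V [⋀^Fin q]→L[ℝ] ℝ) :
    ContinuousMultilinearMap ℝ (fun _ : Fin (p + q) => V) ℝ where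
  toMultilinearMap := ((LinearMap.mul' ℝ ℝ).compMultilinearMap
    (MultilinearMap.domCoprod a.toMultilinearMap b.toMultilinearMap)).domDomCongr finSumFinEquiv
  cont := by
    change Continuous fun v : Fin (p + q) → V =>
      a (fun i => v (Fin.castAdd q i)) * b (fun i => v (Fin.natAdd p i))
    exact (a.cont.comp (by fun_prop)).mul (b.cont.comp (by fun_prop))

theorem tensorForm_apply {p q : ℕ} (a : V [⋀^Fin p]→L[ℝ] ℝ) (b : V [⋀^Fin q]→L[ℝ] ℝ)
    (v : Fin (p + q) → V) : tensorForm a b v =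
      a (fun i => v (Fin.castAdd q i)) * b (fun i => v (Fin.natAdd p i)) := rfl

/-- The exterior product `a ∧ b`, normalized by `1 / (p! q!)`, so that for instance
`(a ∧ b) (v, w) = a v * b w - a w * b v` for covectors `a` and `b`. -/
def wedgeAt [ContinuousAdd V] {p q : ℕ} (a : V [⋀^Fin p]→L[ℝ] ℝ) (b : V [⋀^Fin q]→L[ℝ] ℝ) :
    V [⋀^Fin (p + q)]→L[ℝ] ℝ :=
  ((p.factorial * q.factorial : ℝ)⁻¹) • (tensorForm a b).alternatization
end Wedge

section Forms
variable {E : Type*} [NormedAddCommGroup E] [NormedSpace ℝ E] {H : Type*} [TopologicalSpace H]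
  (I : ModelWithCorners ℝ E H) {M : Type*} [TopologicalSpace M] [ChartedSpace H M]
  {E' : Type*} [NormedAddCommGroup E'] [NormedSpace ℝ E'] {H' : Type*} [TopologicalSpace H']
  (I' : ModelWithCorners ℝ E' H') {M' : Type*} [TopologicalSpace M'] [ChartedSpace H' M']

/-- Differential forms of degree `k` on `M` (not necessarily smooth). -/
abbrev Form (M : Type*) [TopologicalSpace M] [ChartedSpace H M] (k : ℕ) : Type _ :=
  (x : M) → TangentSpace I x [⋀^Fin k]→L[ℝ] ℝ

/-- The pullback `f^* τ`. -/
def pullback (f : M → M') {k : ℕ} (τ : Form I' M' k) : Form I M k :=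
  fun x => (τ (f x)).compContinuousLinearMap (mfderiv I I' f x)

/-- The form `τ` in the preferred chart at `x₀`, that is, its pullback by the inverse of the
chart. -/
def chartRep {k : ℕ} (τ : Form I M k) (x₀ : M) (u : E) : E [⋀^Fin k]→L[ℝ] ℝ :=
  (τ ((extChartAt I x₀).symm u)).compContinuousLinearMap
    (mfderivWithin 𝓘(ℝ, E) I (extChartAt I x₀).symm (range I) u)

/-- `τ` is a `C^∞` form. -/
def IsSmoothForm {k : ℕ} (τ : Form I M k) : Prop :=
  ∀ x₀ : M, ContDiffOn ℝ ∞ (chartRep I τ x₀) (extChartAt I x₀).target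

/-- The exterior derivative, computed at `x` in the preferred chart at `x`. -/
def extD {k : ℕ} (τ : Form I M k) : Form I M (k + 1) :=
  fun x => ContinuousAlternatingMap.compContinuousLinearMap
    (extDerivWithin (chartRep I τ x) (range I) (extChartAt I x x))
    (mfderiv I 𝓘(ℝ, E) (extChartAt I x) x)

/-- The exterior product of forms. -/
def wedge {p q : ℕ} (τ : Form I M p) (υ : Form I M q) : Form I M (p + q) :=
  fun x => wedgeAt (τ x) (υ x)

/-- The contraction `ι_ξ τ`, inserting `ξ` in the first slot. -/
def contract (ξ : (x : M) → TangentSpace I x) {k : ℕ} (τ : Form I M (k + 1)) : Form I M k :=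
  fun x => ContinuousAlternatingMap.curryLeft (E := E) (τ x) (ξ x)

/-- The Lie derivative of forms, `£_ξ = d ι_ξ + ι_ξ d` (and `£_ξ f = ι_ξ df` in degree `0`). -/
def lieD (ξ : (x : M) → TangentSpace I x) : {k : ℕ} → Form I M k → Form I M k
  | 0, τ => contract I ξ (extD I τ)
  | _ + 1, τ => extD I (contract I ξ τ) + contract I ξ (extD I τ)

/-- Exactness; the only exact form of degree `0` is `0`. -/
def IsExact : {k : ℕ} → Form I M k → Prop
  | 0, τ => τ = 0
  | k + 1, τ => ∃ β : Form I M k, IsSmoothForm I β ∧ τ = extD I β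

/-- `ξ` is a `C^∞` vector field. -/
def IsSmoothField [IsManifold I 1 M] (ξ : (x : M) → TangentSpace I x) : Prop :=
  ContMDiff I I.tangent ∞ (fun x => (⟨x, ξ x⟩ : TangentBundle I M))

end Forms

section Tangent
variable {E : Type*} [NormedAddCommGroup E] [NormedSpace ℝ E] {H : Type*} [TopologicalSpace H]
  (I : ModelWithCorners ℝ E H) {M : Type*} [TopologicalSpace M] [ChartedSpace H M]
  {E' : Type*} [NormedAddCommGroup E'] [NormedSpace ℝ E'] {H' : Type*} [TopologicalSpace H']
  (I' : ModelWithCorners ℝ E' H') {M' : Type*} [TopologicalSpace M'] [ChartedSpace H' M']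

/-- The tangent map of `f` at `x`, the tangent spaces being identified with the model spaces as in
the definition of `TangentSpace`. -/
def tmap (f : M → M') (x : M) : E →L[ℝ] E' := mfderiv I I' f x

theorem tmap_symm_comp {e : OpenPartialHomeomorph M M'} (he : e.MDifferentiable I I') {x : M}
    (hx : x ∈ e.source) : (tmap I' I e.symm (e x)).comp (tmap I I' e x) = .id ℝ E :=
  he.symm_comp_deriv hx

theorem tmap_comp_symm {e : OpenPartialHomeomorph M M'} (he : e.MDifferentiable I I') {x : M'}
    (hx : x ∈ e.target) : (tmap I I' e (e.symm x)).comp (tmap I' I e.symm x) = .id ℝ E' :=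
  he.comp_symm_deriv hx

end Tangent

section Jets
variable {E : Type*} [NormedAddCommGroup E] [NormedSpace ℝ E] {H : Type*} [TopologicalSpace H]
  (I : ModelWithCorners ℝ E H) (F : Type*) [NormedAddCommGroup F] [NormedSpace ℝ F]
  (X : Type*) [TopologicalSpace X] [ChartedSpace H X]
  (Y : Type*) [TopologicalSpace Y] [ChartedSpace (ModelProd H F) Y]

/-- `c` and `e` are smooth charts of `X` and `Y` in which `proj : Y → X` is the projection
`(x, y) ↦ x`, that is, `e` gives fibred coordinates over `c`. -/
structure IsAdaptedPair {F : Type*} [NormedAddCommGroup F]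
    [NormedSpace ℝ F] {X : Type*} [TopologicalSpace X] [ChartedSpace H X]
    {Y : Type*} [TopologicalSpace Y] [ChartedSpace (ModelProd H F) Y]
    (proj : Y → X) (c : OpenPartialHomeomorph X H) (e : OpenPartialHomeomorph Y (ModelProd H F)) :
    Prop where
  base_mem : c ∈ IsManifold.maximalAtlas I ∞ X
  total_mem : e ∈ IsManifold.maximalAtlas (I.prod 𝓘(ℝ, F)) ∞ Y
  mapsTo : ∀ y ∈ e.source, proj y ∈ c.source
  fst_eq : ∀ y ∈ e.source, (e y).1 = c (proj y)

/-- A fibration `Y → X` (surjective submersion) with `∂Y` lying over `∂X`: around every point of `Y`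
there are fibred coordinates. -/
structure FiberedManifold where
  proj : Y → X
  surjective : Surjective proj
  exists_adapted : ∀ y : Y, ∃ (c : OpenPartialHomeomorph X H)
    (e : OpenPartialHomeomorph Y (ModelProd H F)), IsAdaptedPair I proj c e ∧ y ∈ e.source

variable {I F X Y}

/-- The first jet bundle: a `1`-jet at `x = π y` of a section through `y` is a linear section
`T_x X → T_y Y` of the tangent map `T_y π`. -/
structure FiberedManifold.Jet (π : FiberedManifold I F X Y) where
  pt : Y
  lin : TangentSpace I (π.proj pt) →L[ℝ] TangentSpace (I.prod 𝓘(ℝ, F)) pt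
  right_inv : (mfderiv (I.prod 𝓘(ℝ, F)) I π.proj pt).comp lin = .id ℝ _

namespace IsAdaptedPair
variable {π : FiberedManifold I F X Y} {c : OpenPartialHomeomorph X H}
    {e : OpenPartialHomeomorph Y (ModelProd H F)}

theorem mdiff_base (h : IsAdaptedPair I π.proj c e) : c.MDifferentiable I I :=
  ⟨(contMDiffOn_of_mem_maximalAtlas h.base_mem).mdifferentiableOn (by simp),
    (contMDiffOn_symm_of_mem_maximalAtlas h.base_mem).mdifferentiableOn (by simp)⟩

theorem mdiff_total (h : IsAdaptedPair I π.proj c e) :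
    e.MDifferentiable (I.prod 𝓘(ℝ, F)) (I.prod 𝓘(ℝ, F)) :=
  ⟨(contMDiffOn_of_mem_maximalAtlas h.total_mem).mdifferentiableOn (by simp),
    (contMDiffOn_symm_of_mem_maximalAtlas h.total_mem).mdifferentiableOn (by simp)⟩

theorem hasMFDerivAt_fst (p : ModelProd H F) :
    HasMFDerivAt (I.prod 𝓘(ℝ, F)) I (fun q : ModelProd H F => q.1) p
      (ContinuousLinearMap.fst ℝ E F) := by
  refine ⟨continuous_fst.continuousAt, ?_⟩
  have h : HasFDerivWithinAt (Prod.fst : E × F → E) (ContinuousLinearMap.fst ℝ E F)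
      (range (I.prod 𝓘(ℝ, F))) (extChartAt (I.prod 𝓘(ℝ, F)) p p) := hasFDerivWithinAt_fst
  refine HasFDerivWithinAt.congr h ?_ ?_
  · rintro _ ⟨q, rfl⟩
    change I (I.symm (I q.1)) = I q.1
    rw [I.left_inv]
  · change I (I.symm (I p.1)) = I p.1
    rw [I.left_inv]

theorem mdiff_proj (h : IsAdaptedPair I π.proj c e) {y : Y} (hy : y ∈ e.source) :
    MDifferentiableAt (I.prod 𝓘(ℝ, F)) I π.proj y := by
  have h1 : MDifferentiableAt (I.prod 𝓘(ℝ, F)) I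
      (c.symm ∘ ((fun q : ModelProd H F => q.1) ∘ e)) y := by
    refine MDifferentiableAt.comp (I' := I) y ?_
      ((hasMFDerivAt_fst _).mdifferentiableAt.comp y (h.mdiff_total.mdifferentiableAt hy))
    refine h.mdiff_base.mdifferentiableAt_symm ?_
    simp only [comp_apply, h.fst_eq y hy]
    exact c.map_source (h.mapsTo y hy)
  refine h1.congr_of_eventuallyEq ?_
  filter_upwards [e.open_source.mem_nhds hy] with y' hy'
  simp [h.fst_eq y' hy', c.left_inv (h.mapsTo y' hy')]

theorem fst_comp (h : IsAdaptedPair I π.proj c e) {y : Y} (hy : y ∈ e.source) :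
    (ContinuousLinearMap.fst ℝ E F).comp (tmap (I.prod 𝓘(ℝ, F)) (I.prod 𝓘(ℝ, F)) e y)
      = (tmap I I c (π.proj y)).comp (tmap (I.prod 𝓘(ℝ, F)) I π.proj y) := by
  have h1 := (hasMFDerivAt_fst (I := I) (e y)).comp y
    (h.mdiff_total.mdifferentiableAt hy).hasMFDerivAt
  have h2 := (h.mdiff_base.mdifferentiableAt (h.mapsTo y hy)).hasMFDerivAt.comp y
    (h.mdiff_proj hy).hasMFDerivAt
  have h3 : (c ∘ π.proj) =ᶠ[𝓝 y] ((fun q : ModelProd H F => q.1) ∘ e) := by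
    filter_upwards [e.open_source.mem_nhds hy] with y' hy'
    simp [h.fst_eq y' hy']
  exact hasMFDerivAt_unique (h1.congr_of_eventuallyEq h3) h2

end IsAdaptedPair

namespace FiberedManifold
variable (π : FiberedManifold I F X Y) {c : OpenPartialHomeomorph X H}
    {e : OpenPartialHomeomorph Y (ModelProd H F)}

/-- The linear map of a jet, on the model spaces. -/
def Jet.clm {π : FiberedManifold I F X Y} (z : π.Jet) : E →L[ℝ] E × F := z.lin

theorem Jet.ext_clm {π : FiberedManifold I F X Y} {z z' : π.Jet} (h : z.pt = z'.pt)
    (h' : z.clm = z'.clm) : z = z' := by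
  obtain ⟨y, s, hs⟩ := z
  obtain ⟨y', s', hs'⟩ := z'
  obtain rfl : y = y' := h
  obtain rfl : s = s' := h'
  rfl

theorem Jet.tmap_comp_clm (z : π.Jet) :
    (tmap (I.prod 𝓘(ℝ, F)) I π.proj z.pt).comp z.clm = .id ℝ E := z.right_inv

/-- The coordinates `z^i_μ` of a jet in fibred coordinates. -/
def jetCoord (c : OpenPartialHomeomorph X H) (e : OpenPartialHomeomorph Y (ModelProd H F))
    (z : π.Jet) : E →L[ℝ] F :=
  (ContinuousLinearMap.snd ℝ E F).comp ((tmap (I.prod 𝓘(ℝ, F)) (I.prod 𝓘(ℝ, F)) e z.pt).comp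
    (z.clm.comp (tmap I I c.symm (c (π.proj z.pt)))))

/-- The jet with coordinates `(p, A) = ((x^μ, y^i), z^i_μ)`. -/
def jetOfCoord (h : IsAdaptedPair I π.proj c e) (p : ModelProd H F) (hp : p ∈ e.target)
    (A : E →L[ℝ] F) : π.Jet where
  pt := e.symm p
  lin := (tmap (I.prod 𝓘(ℝ, F)) (I.prod 𝓘(ℝ, F)) e.symm p).comp
    (((ContinuousLinearMap.id ℝ E).prod A).comp (tmap I I c (π.proj (e.symm p))))
  right_inv := by
    have hy := e.map_target hp
    have hx := h.mapsTo _ hy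
    have h1 := h.fst_comp hy
    have h2 := tmap_comp_symm _ _ h.mdiff_total hp
    have h3 := tmap_symm_comp _ _ h.mdiff_base hx
    have h4 : tmap (I.prod 𝓘(ℝ, F)) I π.proj (e.symm p) =
      (tmap I I c.symm (c (π.proj (e.symm p)))).comp ((ContinuousLinearMap.fst ℝ E F).comp
        (tmap (I.prod 𝓘(ℝ, F)) (I.prod 𝓘(ℝ, F)) e (e.symm p))) := by
      rw [h1, ← ContinuousLinearMap.comp_assoc, h3, ContinuousLinearMap.id_comp]
    change (tmap (I.prod 𝓘(ℝ, F)) I π.proj (e.symm p)).comp _ = ContinuousLinearMap.id ℝ E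
    rw [h4]
    refine ContinuousLinearMap.ext fun v => ?_
    have h2' := fun w => DFunLike.congr_fun h2 w
    have h3' := fun w => DFunLike.congr_fun h3 w
    simp only [ContinuousLinearMap.comp_apply, ContinuousLinearMap.id_apply] at h2' h3'
    change tmap I I c.symm (c (π.proj (e.symm p)))
      (tmap (I.prod 𝓘(ℝ, F)) (I.prod 𝓘(ℝ, F)) e (e.symm p)
        (tmap (I.prod 𝓘(ℝ, F)) (I.prod 𝓘(ℝ, F)) e.symm p
          (((ContinuousLinearMap.id ℝ E).prod A) (tmap I I c (π.proj (e.symm p)) v)))).1 = v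
    rw [h2']
    exact h3' v

/-- The chart `(x^μ, y^i, z^i_μ)` of the jet bundle induced by fibred coordinates on `Y`. -/
def jetChart (h : IsAdaptedPair I π.proj c e) (hne : e.source.Nonempty) :
    PartialEquiv π.Jet (ModelProd (ModelProd H F) (E →L[ℝ] F)) where
  toFun z := (e z.pt, π.jetCoord c e z)
  invFun q :=
    open Classical in
    if hq : q.1 ∈ e.target then π.jetOfCoord h q.1 hq q.2
    else π.jetOfCoord h (e hne.some) (e.map_source hne.some_mem) 0
  source := {z | z.pt ∈ e.source}
  target := e.target ×ˢ univ
  map_source' z hz := ⟨e.map_source hz, mem_univ _⟩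
  map_target' q hq := by
    have hq' : q.1 ∈ e.target := hq.1
    simp only [hq', dite_true]
    exact e.map_target hq'
  left_inv' z hz := by
    have hz' : z.pt ∈ e.source := hz
    simp only [e.map_source hz', dite_true]
    have hx := h.mapsTo _ hz'
    have h1 := fun w => DFunLike.congr_fun (h.fst_comp hz') w
    have h2 := fun w => DFunLike.congr_fun (tmap_symm_comp _ _ h.mdiff_total hz') w
    have h3 := fun w => DFunLike.congr_fun (tmap_symm_comp _ _ h.mdiff_base hx) w
    have h4 := fun w => DFunLike.congr_fun (tmap_comp_symm _ _ h.mdiff_base (c.map_source hx)) w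
    have h5 := fun w => DFunLike.congr_fun (Jet.tmap_comp_clm π z) w
    rw [c.left_inv hx] at h4
    simp only [ContinuousLinearMap.comp_apply, ContinuousLinearMap.id_apply,
      ContinuousLinearMap.coe_fst'] at h1 h2 h3 h4 h5
    refine Jet.ext_clm (e.left_inv hz') ?_
    change (tmap (I.prod 𝓘(ℝ, F)) (I.prod 𝓘(ℝ, F)) e.symm (e z.pt)).comp
      (((ContinuousLinearMap.id ℝ E).prod (π.jetCoord c e z)).comp
        (tmap I I c (π.proj (e.symm (e z.pt))))) = _
    rw [e.left_inv hz']
    refine ContinuousLinearMap.ext fun v => ?_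
    have key : ∀ w : E, (w, π.jetCoord c e z w) =
        tmap (I.prod 𝓘(ℝ, F)) (I.prod 𝓘(ℝ, F)) e z.pt
          (z.clm (tmap I I c.symm (c (π.proj z.pt)) w)) := by
      intro w
      refine Prod.ext ?_ rfl
      rw [h1, h5, h4]
    simp only [ContinuousLinearMap.comp_apply, ContinuousLinearMap.prod_apply,
      ContinuousLinearMap.id_apply, key, h2, h3]
  right_inv' q hq := by
    have hq' : q.1 ∈ e.target := hq.1
    simp only [hq', dite_true]
    have hy := e.map_target hq'
    have hx := h.mapsTo _ hy
    have h2 := fun w => DFunLike.congr_fun (tmap_comp_symm _ _ h.mdiff_total hq') w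
    have h4 := fun w => DFunLike.congr_fun (tmap_comp_symm _ _ h.mdiff_base (c.map_source hx)) w
    rw [c.left_inv hx] at h4
    simp only [ContinuousLinearMap.comp_apply, ContinuousLinearMap.id_apply] at h2 h4
    refine Prod.ext (e.right_inv hq') ?_
    refine ContinuousLinearMap.ext fun v => ?_
    change (tmap (I.prod 𝓘(ℝ, F)) (I.prod 𝓘(ℝ, F)) e (e.symm q.1)
      (tmap (I.prod 𝓘(ℝ, F)) (I.prod 𝓘(ℝ, F)) e.symm q.1
        (((ContinuousLinearMap.id ℝ E).prod q.2) (tmap I I c (π.proj (e.symm q.1))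
          (tmap I I c.symm (c (π.proj (e.symm q.1))) v))))).2 = q.2 v
    rw [h2, h4]
    rfl


theorem tmap_model {E' : Type*} [NormedAddCommGroup E'] [NormedSpace ℝ E'] {H' : Type*}
    [TopologicalSpace H'] {I' : ModelWithCorners ℝ E' H'} {f : H → H'} {p : H}
    (hf : MDifferentiableAt I I' f p) :
    tmap I I' f p = fderivWithin ℝ (I' ∘ f ∘ I.symm) (range I) (I p) :=
  hf.mfderiv

theorem tmap_comp_tmap_symm {M : Type*} [TopologicalSpace M] [ChartedSpace H M]
    {e e' : OpenPartialHomeomorph M H} (he : e.MDifferentiable I I) (he' : e'.MDifferentiable I I)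
    {p : H} (hp : p ∈ e.target) (hp' : e.symm p ∈ e'.source) :
    (tmap I I e' (e.symm p)).comp (tmap I I e.symm p) =
      fderivWithin ℝ (I ∘ (e' ∘ e.symm) ∘ I.symm) (range I) (I p) := by
  have h1 := he'.mdifferentiableAt hp'
  have h2 := he.mdifferentiableAt_symm hp
  rw [← tmap_model (h1.comp p h2)]
  exact (mfderiv_comp p h1 h2).symm

theorem contDiffOn_transition {M : Type*} [TopologicalSpace M] [ChartedSpace H M]
    {e e' : OpenPartialHomeomorph M H} (he : e ∈ IsManifold.maximalAtlas I ∞ M)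
    (he' : e' ∈ IsManifold.maximalAtlas I ∞ M) :
    ContDiffOn ℝ ∞ (I ∘ (e' ∘ e.symm) ∘ I.symm)
      (I.symm ⁻¹' (e.symm ≫ₕ e').source ∩ range I) := by
  have h := IsManifold.compatible_of_mem_maximalAtlas he he'
  rw [contDiffGroupoid, mem_groupoid_of_pregroupoid] at h
  exact h.1


/-- The transition map between two jet charts, in extended coordinates. -/
def jetTransition (I : ModelWithCorners ℝ E H) (c c' : OpenPartialHomeomorph X H)
    (e e' : OpenPartialHomeomorph Y (ModelProd H F)) (w : (E × F) × (E →L[ℝ] F)) :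
    (E × F) × (E →L[ℝ] F) :=
  ((I.prod 𝓘(ℝ, F) ∘ (e' ∘ e.symm) ∘ (I.prod 𝓘(ℝ, F)).symm) w.1,
    (ContinuousLinearMap.snd ℝ E F).comp
      ((fderivWithin ℝ (I.prod 𝓘(ℝ, F) ∘ (e' ∘ e.symm) ∘ (I.prod 𝓘(ℝ, F)).symm)
          (range (I.prod 𝓘(ℝ, F))) w.1).comp
        ((ContinuousLinearMap.inl ℝ E F + (ContinuousLinearMap.inr ℝ E F).comp w.2).comp
          (fderivWithin ℝ (I ∘ (c ∘ c'.symm) ∘ I.symm) (range I)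
            ((I.prod 𝓘(ℝ, F) ∘ (e' ∘ e.symm) ∘ (I.prod 𝓘(ℝ, F)).symm) w.1).1))))

theorem contDiffOn_jetTransition {c' : OpenPartialHomeomorph X H}
    {e' : OpenPartialHomeomorph Y (ModelProd H F)} (h : IsAdaptedPair I π.proj c e)
    (h' : IsAdaptedPair I π.proj c' e') :
    ContDiffOn ℝ ∞ (jetTransition I c c' e e')
      (((I.prod 𝓘(ℝ, F)).symm ⁻¹' (e.symm ≫ₕ e').source ∩ range (I.prod 𝓘(ℝ, F))) ×ˢ univ) := by
  set s := (I.prod 𝓘(ℝ, F)).symm ⁻¹' (e.symm ≫ₕ e').source ∩ range (I.prod 𝓘(ℝ, F)) with hs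
  set g := I.prod 𝓘(ℝ, F) ∘ (e' ∘ e.symm) ∘ (I.prod 𝓘(ℝ, F)).symm with hg
  set a := I ∘ (c ∘ c'.symm) ∘ I.symm with ha
  have hsu : UniqueDiffOn ℝ s := (I.prod 𝓘(ℝ, F)).uniqueDiffOn_preimage (e.symm ≫ₕ e').open_source
  have hg1 : ContDiffOn ℝ ∞ g s := contDiffOn_transition h.total_mem h'.total_mem
  have hg2 : ContDiffOn ℝ ∞ (fun u => fderivWithin ℝ g (range (I.prod 𝓘(ℝ, F))) u) s := by
    refine (hg1.fderivWithin hsu (m := ∞) (by simp)).congr fun u hu => ?_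
    have hopen : (I.prod 𝓘(ℝ, F)).symm ⁻¹' (e.symm ≫ₕ e').source ∈ 𝓝 u :=
      ((e.symm ≫ₕ e').open_source.preimage (I.prod 𝓘(ℝ, F)).continuous_symm).mem_nhds hu.1
    rw [hs, inter_comm, fderivWithin_inter hopen]
  set s' := I.symm ⁻¹' (c'.symm ≫ₕ c).source ∩ range I with hs'
  have hsu' : UniqueDiffOn ℝ s' := I.uniqueDiffOn_preimage (c'.symm ≫ₕ c).open_source
  have ha1 : ContDiffOn ℝ ∞ a s' := contDiffOn_transition h'.base_mem h.base_mem
  have ha2 : ContDiffOn ℝ ∞ (fun u => fderivWithin ℝ a (range I) u) s' := by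
    refine (ha1.fderivWithin hsu' (m := ∞) (by simp)).congr fun u hu => ?_
    have hopen : I.symm ⁻¹' (c'.symm ≫ₕ c).source ∈ 𝓝 u :=
      ((c'.symm ≫ₕ c).open_source.preimage I.continuous_symm).mem_nhds hu.1
    rw [hs', inter_comm, fderivWithin_inter hopen]
  have hmaps : ∀ u ∈ s, (g u).1 ∈ s' := by
    rintro _ ⟨hu, q, rfl⟩
    rw [mem_preimage, ModelWithCorners.left_inv] at hu
    have hq : q ∈ e.target ∧ e.symm q ∈ e'.source := by simpa using hu
    have hx := h.mapsTo _ (e.map_target hq.1)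
    have hx' := h'.mapsTo _ hq.2
    have : (g (I.prod 𝓘(ℝ, F) q)).1 = I (c' (π.proj (e.symm q))) := by
      rw [← h'.fst_eq _ hq.2]
      simp only [hg, comp_apply, ModelWithCorners.left_inv]
      rfl
    rw [this]
    refine ⟨?_, mem_range_self _⟩
    simp [hx', hx, c'.left_inv hx']
  have hfst : ContDiffOn ℝ ∞ (Prod.fst : (E × F) × (E →L[ℝ] F) → E × F) (s ×ˢ univ) :=
    contDiff_fst.contDiffOn
  have hm : MapsTo (Prod.fst : (E × F) × (E →L[ℝ] F) → E × F) (s ×ˢ univ) s := fun w hw => hw.1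
  have hg1' := hg1.comp hfst hm
  have hg2' := hg2.comp hfst hm
  have ha2' := ha2.comp (contDiff_fst.contDiffOn.comp hg1' (mapsTo_univ _ _))
    (fun w hw => hmaps _ hw.1)
  refine hg1'.prodMk ?_
  refine contDiffOn_const.clm_comp (hg2'.clm_comp (ContDiffOn.clm_comp ?_ ha2'))
  exact contDiffOn_const.add (contDiffOn_const.clm_comp contDiff_snd.contDiffOn)

theorem jetChart_symm_apply (h : IsAdaptedPair I π.proj c e) (hne : e.source.Nonempty)
    (q : ModelProd (ModelProd H F) (E →L[ℝ] F)) (hq : q.1 ∈ e.target) :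
    (π.jetChart h hne).symm q = π.jetOfCoord h q.1 hq q.2 :=
  dif_pos hq

theorem jetChart_trans_source {c' : OpenPartialHomeomorph X H}
    {e' : OpenPartialHomeomorph Y (ModelProd H F)} (h : IsAdaptedPair I π.proj c e)
    (hne : e.source.Nonempty)
    (h' : IsAdaptedPair I π.proj c' e') (hne' : e'.source.Nonempty) :
    ((π.jetChart h hne).symm.trans (π.jetChart h' hne')).source =
      (e.symm ≫ₕ e').source ×ˢ univ := by
  ext q
  constructor
  · rintro ⟨⟨hq, -⟩, h2⟩
    change ((π.jetChart h hne).symm q).pt ∈ e'.source at h2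
    rw [π.jetChart_symm_apply h hne q hq] at h2
    exact ⟨⟨hq, h2⟩, mem_univ _⟩
  · rintro ⟨⟨hq, h2⟩, -⟩
    refine ⟨⟨hq, mem_univ _⟩, ?_⟩
    change ((π.jetChart h hne).symm q).pt ∈ e'.source
    rw [π.jetChart_symm_apply h hne q hq]
    exact h2

theorem jetChart_trans_apply {c' : OpenPartialHomeomorph X H}
    {e' : OpenPartialHomeomorph Y (ModelProd H F)} (h : IsAdaptedPair I π.proj c e)
    (hne : e.source.Nonempty)
    (h' : IsAdaptedPair I π.proj c' e') (hne' : e'.source.Nonempty)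
    (q : ModelProd (ModelProd H F) (E →L[ℝ] F)) (hq : q.1 ∈ (e.symm ≫ₕ e').source) :
    ((I.prod 𝓘(ℝ, F)).prod 𝓘(ℝ, E →L[ℝ] F)) (π.jetChart h' hne' ((π.jetChart h hne).symm q)) =
      jetTransition I c c' e e' (((I.prod 𝓘(ℝ, F)).prod 𝓘(ℝ, E →L[ℝ] F)) q) := by
  obtain ⟨p, A⟩ := q
  have hp : p ∈ e.target ∧ e.symm p ∈ e'.source := by simpa using hq
  have hx := h.mapsTo _ (e.map_target hp.1)
  have hx' := h'.mapsTo _ hp.2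
  rw [π.jetChart_symm_apply h hne (p, A) hp.1]
  have hg : (I.prod 𝓘(ℝ, F) ∘ (e' ∘ e.symm) ∘ (I.prod 𝓘(ℝ, F)).symm) (I.prod 𝓘(ℝ, F) p) =
      I.prod 𝓘(ℝ, F) (e' (e.symm p)) := by
    simp only [comp_apply, ModelWithCorners.left_inv]
  have h2 := tmap_comp_tmap_symm h.mdiff_total h'.mdiff_total hp.1 hp.2
  have h3 := tmap_comp_tmap_symm h'.mdiff_base h.mdiff_base (c'.map_source hx')
    (by rwa [c'.left_inv hx'])
  rw [c'.left_inv hx'] at h3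
  refine Prod.ext hg.symm ?_
  change (ContinuousLinearMap.snd ℝ E F).comp
    ((tmap (I.prod 𝓘(ℝ, F)) (I.prod 𝓘(ℝ, F)) e' (e.symm p)).comp
      (((tmap (I.prod 𝓘(ℝ, F)) (I.prod 𝓘(ℝ, F)) e.symm p).comp
        (((ContinuousLinearMap.id ℝ E).prod A).comp (tmap I I c (π.proj (e.symm p))))).comp
        (tmap I I c'.symm (c' (π.proj (e.symm p)))))) =
    (ContinuousLinearMap.snd ℝ E F).comp
      ((fderivWithin ℝ (I.prod 𝓘(ℝ, F) ∘ (e' ∘ e.symm) ∘ (I.prod 𝓘(ℝ, F)).symm)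
          (range (I.prod 𝓘(ℝ, F))) (I.prod 𝓘(ℝ, F) p)).comp
        ((ContinuousLinearMap.inl ℝ E F + (ContinuousLinearMap.inr ℝ E F).comp A).comp
          (fderivWithin ℝ (I ∘ (c ∘ c'.symm) ∘ I.symm) (range I)
            ((I.prod 𝓘(ℝ, F) ∘ (e' ∘ e.symm) ∘ (I.prod 𝓘(ℝ, F)).symm)
              (I.prod 𝓘(ℝ, F) p)).1)))
  have h4 : (I.prod 𝓘(ℝ, F) (e' (e.symm p))).1 = I (c' (π.proj (e.symm p))) := by
    rw [← h'.fst_eq _ hp.2]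
    rfl
  have h5 : (ContinuousLinearMap.id ℝ E).prod A =
      ContinuousLinearMap.inl ℝ E F + (ContinuousLinearMap.inr ℝ E F).comp A := by
    ext v <;> simp
  rw [hg, h4, ← h2, ← h3, ← h5]
  rfl

/-- A chart of `X` around `π y`, over which `totalChart y` is fibred. -/
def baseChart (y : Y) : OpenPartialHomeomorph X H := (π.exists_adapted y).choose

/-- Fibred coordinates around `y`. -/
def totalChart (y : Y) : OpenPartialHomeomorph Y (ModelProd H F) :=
  (π.exists_adapted y).choose_spec.choose

theorem isAdaptedPair (y : Y) : IsAdaptedPair I π.proj (π.baseChart y) (π.totalChart y) :=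
  (π.exists_adapted y).choose_spec.choose_spec.1

theorem mem_totalChart_source (y : Y) : y ∈ (π.totalChart y).source :=
  (π.exists_adapted y).choose_spec.choose_spec.2

/-- The atlas of the jet bundle formed by all the induced charts. -/
def jetCore : ChartedSpaceCore (ModelProd (ModelProd H F) (E →L[ℝ] F)) π.Jet where
  atlas := {f | ∃ (c : OpenPartialHomeomorph X H) (e : OpenPartialHomeomorph Y (ModelProd H F))
    (h : IsAdaptedPair I π.proj c e) (hne : e.source.Nonempty), f = π.jetChart h hne}
  chartAt z := π.jetChart (π.isAdaptedPair z.pt) ⟨z.pt, π.mem_totalChart_source z.pt⟩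
  mem_chart_source z := π.mem_totalChart_source z.pt
  chart_mem_atlas z := ⟨_, _, _, _, rfl⟩
  open_source := by
    rintro _ _ ⟨c, e, h, hne, rfl⟩ ⟨c', e', h', hne', rfl⟩
    rw [jetChart_trans_source]
    exact (e.symm ≫ₕ e').open_source.prod isOpen_univ
  continuousOn_toFun := by
    rintro _ _ ⟨c, e, h, hne, rfl⟩ ⟨c', e', h', hne', rfl⟩
    rw [jetChart_trans_source]
    set K := (I.prod 𝓘(ℝ, F)).prod 𝓘(ℝ, E →L[ℝ] F) with hK
    have h1 : ContinuousOn (K.symm ∘ jetTransition I c c' e e' ∘ K)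
        ((e.symm ≫ₕ e').source ×ˢ univ) := by
      refine K.continuous_symm.comp_continuousOn
        ((π.contDiffOn_jetTransition h h').continuousOn.comp K.continuous.continuousOn ?_)
      intro q hq
      refine ⟨⟨?_, mem_range_self q.1⟩, mem_univ _⟩
      change (I.prod 𝓘(ℝ, F)).symm (I.prod 𝓘(ℝ, F) q.1) ∈ (e.symm ≫ₕ e').source
      rw [ModelWithCorners.left_inv]
      exact hq.1
    refine h1.congr fun q hq => ?_
    have h2 := π.jetChart_trans_apply h hne h' hne' q hq.1
    simp only [comp_apply]
    rw [← h2, ModelWithCorners.left_inv]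
    rfl

instance instTopologicalSpaceJet : TopologicalSpace π.Jet := π.jetCore.toTopologicalSpace

instance instChartedSpaceJet :
    ChartedSpace (ModelProd (ModelProd H F) (E →L[ℝ] F)) π.Jet :=
  π.jetCore.toChartedSpace

instance instIsManifoldJet : IsManifold ((I.prod 𝓘(ℝ, F)).prod 𝓘(ℝ, E →L[ℝ] F)) ∞ π.Jet := by
  refine isManifold_of_contDiffOn _ _ _ ?_
  intro f f' hf hf'
  obtain ⟨_, ⟨_, rfl⟩, _, ⟨⟨c, e, h, hne, rfl⟩, rfl⟩, hf⟩ := hf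
  obtain ⟨_, ⟨_, rfl⟩, _, ⟨⟨c', e', h', hne', rfl⟩, rfl⟩, hf'⟩ := hf'
  obtain rfl := hf
  obtain rfl := hf'
  set K := (I.prod 𝓘(ℝ, F)).prod 𝓘(ℝ, E →L[ℝ] F) with hK
  have hsub : ∀ w ∈ K.symm ⁻¹' ((e.symm ≫ₕ e').source ×ˢ univ) ∩ range K,
      w ∈ (((I.prod 𝓘(ℝ, F)).symm ⁻¹' (e.symm ≫ₕ e').source ∩ range (I.prod 𝓘(ℝ, F))) ×ˢ univ) := by
    rintro _ ⟨hw, q, rfl⟩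
    exact ⟨⟨hw.1, mem_range_self q.1⟩, mem_univ _⟩
  change ContDiffOn ℝ ∞ (K ∘ ((π.jetChart h hne).symm.trans (π.jetChart h' hne')) ∘ K.symm)
    (K.symm ⁻¹' ((π.jetChart h hne).symm.trans (π.jetChart h' hne')).source ∩ range K)
  rw [jetChart_trans_source]
  refine ((π.contDiffOn_jetTransition h h').mono hsub).congr ?_
  rintro _ ⟨hw, q, rfl⟩
  rw [mem_preimage, ModelWithCorners.left_inv] at hw
  have h2 := π.jetChart_trans_apply h hne h' hne' q hw.1
  rw [← h2]
  simp only [comp_apply, ModelWithCorners.left_inv]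
  rfl

/-- The model with corners of the jet bundle; the first factor carries the boundary. -/
abbrev jetModel (I : ModelWithCorners ℝ E H) (F : Type*) [NormedAddCommGroup F]
    [NormedSpace ℝ F] :
    ModelWithCorners ℝ ((E × F) × (E →L[ℝ] F)) (ModelProd (ModelProd H F) (E →L[ℝ] F)) :=
  (I.prod 𝓘(ℝ, F)).prod 𝓘(ℝ, E →L[ℝ] F)

/-- The projection `π_XZ` of the jet bundle to `X`. -/
def projX (z : π.Jet) : X := π.proj z.pt

/-- The projection `π_YZ` of the jet bundle to `Y`. -/
def projY (z : π.Jet) : Y := z.pt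

/-- `φ` is a smooth section of `π` over the open set `U`; its values off `U` are irrelevant. -/
structure IsSectionOn (φ : X → Y) (U : Set X) : Prop where
  smooth : ContMDiffOn I (I.prod 𝓘(ℝ, F)) ∞ φ U
  proj_eq : ∀ x ∈ U, π.proj (φ x) = x

/-- An arbitrary jet at a point over `x`, used as a default value only. -/
def someJet (x : X) : π.Jet :=
  let y := (π.surjective x).choose
  π.jetOfCoord (π.isAdaptedPair y) (π.totalChart y y)
    ((π.totalChart y).map_source (π.mem_totalChart_source y)) 0

open scoped Classical in
/-- The `1`-jet prolongation `j¹φ`: the jet at `x` is the tangent map `T_x φ`. The condition holds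
at every point of an open set on which `φ` is a smooth section. -/
def j1 (φ : X → Y) (x : X) : π.Jet :=
  if h : π.proj (φ x) = x ∧
      (tmap (I.prod 𝓘(ℝ, F)) I π.proj (φ x)).comp (tmap I (I.prod 𝓘(ℝ, F)) φ x) = .id ℝ E then
    { pt := φ x
      lin := tmap I (I.prod 𝓘(ℝ, F)) φ x
      right_inv := h.2 }
  else π.someJet x

/-- A contact `1`-form: a smooth `1`-form on the jet bundle whose pullback by the prolongation of
every local section vanishes. -/
def IsContactForm (θ : Form (jetModel I F) π.Jet 1) : Prop :=
  IsSmoothForm (jetModel I F) θ ∧ ∀ (U : Set X) (φ : X → Y), IsOpen U → π.IsSectionOn φ U →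
    ∀ x ∈ U, pullback I (jetModel I F) (π.j1 φ) θ x = 0

/-- The differential ideal generated by the contact forms, that is, the ideal of the algebra of
smooth forms generated by the contact forms and their differentials. -/
inductive InContactIdeal : (k : ℕ) → Form (jetModel I F) π.Jet k → Prop
  | zero (k : ℕ) : InContactIdeal k 0
  | add {k : ℕ} {τ υ : Form (jetModel I F) π.Jet k} (hτ : InContactIdeal k τ)
      (hυ : InContactIdeal k υ) : InContactIdeal k (τ + υ)
  | contact {q : ℕ} {θ : Form (jetModel I F) π.Jet 1} {β : Form (jetModel I F) π.Jet q}
      (hθ : π.IsContactForm θ) (hβ : IsSmoothForm (jetModel I F) β) :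
      InContactIdeal (1 + q) (wedge (jetModel I F) θ β)
  | extD_contact {q : ℕ} {θ : Form (jetModel I F) π.Jet 1} {β : Form (jetModel I F) π.Jet q}
      (hθ : π.IsContactForm θ) (hβ : IsSmoothForm (jetModel I F) β) :
      InContactIdeal (1 + 1 + q) (wedge (jetModel I F) (extD (jetModel I F) θ) β)

/-- The vertical part `T π_YZ (V) - z (T π_XZ (V))` of a tangent vector `V` at the jet `z`; its
components are the values `θ^i (V)`, where `θ^i = dy^i - z^i_μ dx^μ`. -/
def contactPart (z : π.Jet) : TangentSpace (jetModel I F) z →L[ℝ] E × F :=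
  tmap (jetModel I F) (I.prod 𝓘(ℝ, F)) π.projY z - z.clm.comp (tmap (jetModel I F) I π.projX z)

/-- The vertical lift `f^i_μ dx^μ ⊗ ∂/∂y^i ↦ f^i_μ ∂/∂z^i_μ` of linear maps from `T_x X` to the
vertical tangent space at `y`, in the coordinates around `z` that define `TangentSpace` at `z`. It
is the velocity at `t = 0` of the curve `t ↦ z + t f`. -/
def vlift (z : π.Jet) : (E →L[ℝ] E × F) →L[ℝ] TangentSpace (jetModel I F) z :=
  (ContinuousLinearMap.inr ℝ (E × F) (E →L[ℝ] F)).comp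
    ((ContinuousLinearMap.compL ℝ E (E × F) F ((ContinuousLinearMap.snd ℝ E F).comp
        (tmap (I.prod 𝓘(ℝ, F)) (I.prod 𝓘(ℝ, F)) (π.totalChart z.pt) z.pt))).comp
      ((ContinuousLinearMap.compL ℝ E E (E × F)).flip
        (tmap I I (π.baseChart z.pt).symm (π.baseChart z.pt (π.projX z)))))

end FiberedManifold
end Jets

section Lagrangian
variable {n : ℕ} {H : Type*} [TopologicalSpace H]
  {I : ModelWithCorners ℝ (EuclideanSpace ℝ (Fin (n + 1))) H}
  {F : Type*} [NormedAddCommGroup F] [NormedSpace ℝ F]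
  {X : Type*} [TopologicalSpace X] [ChartedSpace H X]
  {Y : Type*} [TopologicalSpace Y] [ChartedSpace (ModelProd H F) Y]

namespace FiberedManifold
variable (π : FiberedManifold I F X Y)

/-- The map `v ↦ ∑_μ dL ((dx^μ ⊗ v)^v) ∂/∂x^μ` from vertical tangent vectors at `y` to `T_x X`; in
coordinates, `v ↦ ∑_μ (∂L/∂z^i_μ) v^i ∂/∂x^μ`. -/
def momentum (L : π.Jet → ℝ) (z : π.Jet) :
    (EuclideanSpace ℝ (Fin (n + 1)) × F) →L[ℝ] EuclideanSpace ℝ (Fin (n + 1)) :=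
  ∑ μ : Fin (n + 1),
    (((tmap (jetModel I F) 𝓘(ℝ, ℝ) L z).comp (π.vlift z)).comp
      (ContinuousLinearMap.smulRightL ℝ (EuclideanSpace ℝ (Fin (n + 1)))
        (EuclideanSpace ℝ (Fin (n + 1)) × F) (EuclideanSpace.proj μ))).smulRight
      (EuclideanSpace.single μ (1 : ℝ))

/-- The Poincaré-Cartan `(n+1)`-form `Θ_L = L η + S_η^* (dL)`. The second term is
`(V_0, …, V_n) ↦ ∑_i (-1)^i η (p (θ V_i), T π_XZ V_0, …, T π_XZ V_n)` (with `T π_XZ V_i` omitted),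
where `θ` is `contactPart` and `p` is `momentum`; in coordinates with `η = d^{n+1}x` it is
`(∂L/∂z^i_μ) θ^i ∧ d^n x_μ`. -/
def poincareCartan (η : Form I X (n + 1)) (L : π.Jet → ℝ) :
    Form (jetModel I F) π.Jet (n + 1) :=
  fun z => L z • pullback (jetModel I F) I π.projX η z +
    (show TangentSpace (jetModel I F) z [⋀^Fin (n + 1)]→L[ℝ] ℝ from
      ContinuousAlternatingMap.alternatizeUncurryFin
        (E := (EuclideanSpace ℝ (Fin (n + 1)) × F) × (EuclideanSpace ℝ (Fin (n + 1)) →L[ℝ] F))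
      ((ContinuousAlternatingMap.compContinuousLinearMapCLM (ι := Fin n)
          (tmap (jetModel I F) I π.projX z)).comp
        ((ContinuousAlternatingMap.curryLeft (E := EuclideanSpace ℝ (Fin (n + 1)))
          (η (π.projX z))).comp ((π.momentum L z).comp (π.contactPart z)))))

/-- The Poincaré-Cartan `(n+2)`-form `Ω_L = - dΘ_L`. -/
def poincareCartanD (η : Form I X (n + 1)) (L : π.Jet → ℝ) :
    Form (jetModel I F) π.Jet (n + 2) :=
  -extD (jetModel I F) (π.poincareCartan η L)

/-- The Euler-Lagrange equations `(j¹φ)^* (ι_ζ Ω_L) = 0`, for all vector fields `ζ` on the jet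
bundle, for a section `φ` over `U`. -/
def EulerLagrangeOn (η : Form I X (n + 1)) (L : π.Jet → ℝ) (U : Set X) (φ : X → Y) : Prop :=
  ∀ ζ : (z : π.Jet) → TangentSpace (jetModel I F) z, IsSmoothField (jetModel I F) ζ →
    ∀ x ∈ U, pullback I (jetModel I F) (π.j1 φ)
      (contract (jetModel I F) ζ (π.poincareCartanD η L)) x = 0

variable (k : ℕ) {B : Type*} [TopologicalSpace B] [ChartedSpace (EuclideanSpace ℝ (Fin k)) B]

/-- `iB : B → Z` is the inclusion of a subbundle of `∂Z → ∂X`, where `∂Z` is the part of the jet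
bundle over `∂X`: an embedded submanifold (without boundary) such that `B → ∂X` is onto and a
submersion, `∂X` being of dimension `n`. -/
structure IsBoundarySubbundle (iB : B → π.Jet) : Prop where
  embedding : Manifold.IsSmoothEmbedding 𝓘(ℝ, EuclideanSpace ℝ (Fin k)) (jetModel I F) ∞ iB
  range_proj : range (π.projX ∘ iB) = I.boundary X
  submersion : ∀ b : B, Module.finrank ℝ
    (LinearMap.range (tmap 𝓘(ℝ, EuclideanSpace ℝ (Fin k)) I (π.projX ∘ iB) b).toLinearMap) = n

/-- A Cartan symmetry, for the boundary condition `iB : B → Z` and an `n`-form `P` on `B` with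
`iB^* Θ_L = dP`. The vector field `ξB` is the restriction of `ξ` to `B`, to which `ξ` is tangent. -/
structure IsCartanSymmetry [IsManifold 𝓘(ℝ, EuclideanSpace ℝ (Fin k)) 1 B]
    (η : Form I X (n + 1)) (L : π.Jet → ℝ) (iB : B → π.Jet)
    (P : Form 𝓘(ℝ, EuclideanSpace ℝ (Fin k)) B n)
    (ξ : (z : π.Jet) → TangentSpace (jetModel I F) z) : Prop where
  smooth : IsSmoothField (jetModel I F) ξ
  lieD_mem : ∀ (q : ℕ) (τ : Form (jetModel I F) π.Jet q), π.InContactIdeal q τ →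
    π.InContactIdeal q (lieD (jetModel I F) ξ τ)
  exists_form : ∃ α : Form (jetModel I F) π.Jet n, IsSmoothForm (jetModel I F) α ∧
    IsExact 𝓘(ℝ, EuclideanSpace ℝ (Fin k))
      (pullback 𝓘(ℝ, EuclideanSpace ℝ (Fin k)) (jetModel I F) iB α) ∧
    π.InContactIdeal (n + 1)
      (lieD (jetModel I F) ξ (π.poincareCartan η L) - extD (jetModel I F) α)
  tangent : ∃ ξB : (b : B) → TangentSpace 𝓘(ℝ, EuclideanSpace ℝ (Fin k)) b,
    IsSmoothField 𝓘(ℝ, EuclideanSpace ℝ (Fin k)) ξB ∧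
    (∀ b, mfderiv 𝓘(ℝ, EuclideanSpace ℝ (Fin k)) (jetModel I F) iB b (ξB b) = ξ (iB b)) ∧
    lieD 𝓘(ℝ, EuclideanSpace ℝ (Fin k)) ξB P = 0

/-- `j¹φ` satisfies the boundary condition over `U`. -/
def BoundaryConditionOn (iB : B → π.Jet) (U : Set X) (φ : X → Y) : Prop :=
  ∀ x ∈ U, x ∈ I.boundary X → π.j1 φ x ∈ range iB

/-- `Ψ t x`, for `t` in the open interval `(a, b)` around `0` and `x ∈ W`, is the point that the flow
of `ξ` reaches at time `t` from `j¹φ (x)`, and for every such `t` the map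
`ψ_t = π_XZ ∘ Ψ t` is a diffeomorphism of `W` onto an open subset of `X`. -/
structure IsFlowAlong (ξ : (z : π.Jet) → TangentSpace (jetModel I F) z) (φ : X → Y) (a b : ℝ)
    (W : Set X) (Ψ : ℝ → X → π.Jet) : Prop where
  start : ∀ x ∈ W, Ψ 0 x = π.j1 φ x
  integralCurve : ∀ x ∈ W, IsMIntegralCurveOn (I := jetModel I F) (fun t => Ψ t x) ξ (Ioo a b)
  smooth : ContMDiffOn (𝓘(ℝ, ℝ).prod I) (jetModel I F) ∞ (fun p : ℝ × X => Ψ p.1 p.2)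
    (Ioo a b ×ˢ W)
  isOpen_image : ∀ t ∈ Ioo a b, IsOpen ((fun x => π.projX (Ψ t x)) '' W)
  exists_inverse : ∀ t ∈ Ioo a b, ∃ g : X → X,
    ContMDiffOn I I ∞ g ((fun x => π.projX (Ψ t x)) '' W) ∧ ∀ x ∈ W, g (π.projX (Ψ t x)) = x

end FiberedManifold
end Lagrangian

end FieldTheory

end

/-! Two things have to be shown: the flow of `ξ` carries solutions to solutions for as long as it
stays projectable, and near a compact set it stays projectable for a short time.

Persistence is a pointwise argument with linear ordinary differential equations. Near an interior
point use jet coordinates `(x, y, A)`; let `q (t, x)` be the flow along `j¹φ` and `T` its derivative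
in `x`, so that `T' = Dξ T`. Elements of the contact ideal vanish along prolongations, and every
contact vector with nonzero base part is tangent to some prolongation; hence preserving the ideal
forces the Lie derivative of `θ = dy - A dx` to vanish on `ker θ`. Then `θ ∘ T` solves a homogeneous
linear equation and stays zero (`contactForm_comp_eq_zero`): after reparametrization by `ψ_t`, the
flow is a prolongation at every time.

For the Euler-Lagrange equations, differentiate `dΘ (ζ, T v_0, …, T v_n)` in `t`. The result is
`(£_ξ dΘ) (ζ, T v)` minus `dΘ (Dξ ζ, T v)`, and `£_ξ dΘ = dτ` for `τ = £_ξ Θ - dα`, a form that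
vanishes along all prolongations. The term with `dτ` is zero for vertical `ζ`, for two reasons. If
`ζ = (0, 0, B)`, then `dΘ (ζ, ·)` vanishes along every prolongation, solution or not, because the
momenta in `Θ` are the derivatives of `L`; this identity can be differentiated along the flow. If `ζ
= (0, V, 0)`, vary a section `u` to `u + ε f V`: as `τ` is a null Lagrangian, `f G` is, for every
function `f`, the divergence of a first order operator in `f`, where `G` is the contraction in
question. Testing with polynomials of degree at most two gives `G = 0`
(`eq_zero_of_forall_eq_divergence`), without any integration. What remains is a homogeneous linear
equation for the covector `V ↦ dΘ ((0, V, 0), T v)`, which is zero at one time and so at all times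
(`propagation_model`). Connectedness of the time interval spreads this to all times
(`IsFlowAlong.isJetSolutionAt`), and boundary points of `X` are reached as limits of interior points
(`IsFlowAlong.exists_solution`).

The boundary condition rests on uniqueness of integral curves, which also holds at boundary points.
A curve of `ξ` that meets `B` agrees nearby with a curve of `ξ|_B`; if `B` is closed it can never
leave.

Existence is delicate because `ξ` may point out of the jet bundle at boundary points that are not in
`B`. In a half-space chart extend `ξ` to a Lipschitz field on the whole vector space and solve there
(`exists_flow_of_halfSpace`). Curves that start over `∂X` start in `B` and so stay over `∂X`. The
base projection of the flow differs from the identity by a map with Lipschitz constant `1/4`, so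
comparing an inner point with the boundary point below it keeps inner curves in the half-space.
Smooth dependence up to the boundary follows from the linearized equation and Grönwall's inequality
(`contDiffOn_of_hasDerivAt`), and `ψ_t` is inverted as a perturbation of the identity
(`exists_inverse_of_halfSpace`). The local flows agree by uniqueness, and a tube argument gives
injectivity near the compact set (`exists_isFlowAlong_of_isCompact`). -/

noncomputable section

namespace FieldTheory

/-! ### Smooth families of alternating forms and Cartan's formula -/

section AlternatingCalculus

variable {G : Type*} [NormedAddCommGroup G] [NormedSpace ℝ G]
  {V : Type*} [NormedAddCommGroup V] [NormedSpace ℝ V]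
  {V' : Type*} [NormedAddCommGroup V'] [NormedSpace ℝ V'] {s : Set G} {r : WithTop ℕ∞}

/-- `ContinuousAlternatingMap.curryLeft` as a continuous linear map. -/
def curryLeftL (V : Type*) [NormedAddCommGroup V] [NormedSpace ℝ V] (k : ℕ) :
    (V [⋀^Fin (k + 1)]→L[ℝ] ℝ) →L[ℝ] (V →L[ℝ] V [⋀^Fin k]→L[ℝ] ℝ) :=
  (ContinuousAlternatingMap.curryLeftLI (𝕜 := ℝ) (E := V) (F := ℝ) (n := k)).toContinuousLinearMap

@[simp]
theorem curryLeftL_apply {k : ℕ} (a : V [⋀^Fin (k + 1)]→L[ℝ] ℝ) :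
    curryLeftL V k a = a.curryLeft := rfl

theorem contDiff_curryLeft {k : ℕ} : ContDiff ℝ r
    (fun a : V [⋀^Fin (k + 1)]→L[ℝ] ℝ => a.curryLeft) := by
  have h := ContinuousLinearMap.contDiff (𝕜 := ℝ) (E := V [⋀^Fin (k + 1)]→L[ℝ] ℝ)
    (F := V →L[ℝ] V [⋀^Fin k]→L[ℝ] ℝ) (n := r) (curryLeftL V k)
  exact h

theorem hasFDerivAt_curryLeft {k : ℕ} (a : V [⋀^Fin (k + 1)]→L[ℝ] ℝ) :
    HasFDerivAt (fun a : V [⋀^Fin (k + 1)]→L[ℝ] ℝ => a.curryLeft) (curryLeftL V k) a :=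
  ContinuousLinearMap.hasFDerivAt (E := V [⋀^Fin (k + 1)]→L[ℝ] ℝ)
    (F := V →L[ℝ] V [⋀^Fin k]→L[ℝ] ℝ) (curryLeftL V k)

/-- Currying off one argument at a time reduces evaluation to repeated application of linear maps,
by induction on the degree. -/
theorem contDiffWithinAt_alternating_apply {k : ℕ} {f : G → V [⋀^Fin k]→L[ℝ] ℝ}
    {g : Fin k → G → V} {x₀ : G}
    (hf : ContDiffWithinAt ℝ r f s x₀) (hg : ∀ i, ContDiffWithinAt ℝ r (g i) s x₀) :
    ContDiffWithinAt ℝ r (fun x => f x (fun i => g i x)) s x₀ := by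
  induction k with
  | zero =>
    have h : (fun x => f x (fun i => g i x)) =
        fun x => ContinuousAlternatingMap.apply ℝ V ℝ (fun i : Fin 0 => (0 : V)) (f x) := by
      funext x
      exact congrArg (f x) (Subsingleton.elim _ _)
    rw [h]
    exact (ContinuousLinearMap.contDiff _).comp_contDiffWithinAt hf
  | succ k ih =>
    have h : (fun x => f x (fun i => g i x)) =
        fun x => (f x).curryLeft (g 0 x) (fun i => g i.succ x) := by
      funext x
      rw [ContinuousAlternatingMap.curryLeft_apply_apply]
      congr 1
      funext i
      cases i using Fin.cases <;> rfl
    rw [h]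
    have h1 : ContDiffWithinAt ℝ r (fun x => (f x).curryLeft) s x₀ :=
      contDiff_curryLeft.comp_contDiffWithinAt hf
    exact ih (h1.clm_apply (hg 0)) (fun i => hg i.succ)

theorem contDiffOn_alternating_apply {k : ℕ} {f : G → V [⋀^Fin k]→L[ℝ] ℝ} {g : Fin k → G → V}
    (hf : ContDiffOn ℝ r f s) (hg : ∀ i, ContDiffOn ℝ r (g i) s) :
    ContDiffOn ℝ r (fun x => f x (fun i => g i x)) s :=
  fun x hx => contDiffWithinAt_alternating_apply (hf x hx) fun i => hg i x hx

/-- An alternating form is determined by its values on tuples of basis vectors, and an injective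
linear map has a linear left inverse. Hence smoothness of a family of forms can be tested on
constant vectors. -/
theorem exists_leftInverse_alternating_apply [FiniteDimensional ℝ V] (k : ℕ) :
    ∃ (N : ℕ) (v : (Fin k → Fin N) → Fin k → V)
      (R : ((Fin k → Fin N) → ℝ) →L[ℝ] (V [⋀^Fin k]→L[ℝ] ℝ)),
      ∀ a : V [⋀^Fin k]→L[ℝ] ℝ, R (fun j => a (v j)) = a := by
  let b := Module.finBasis ℝ V
  let T : (V [⋀^Fin k]→L[ℝ] ℝ) →ₗ[ℝ] ((Fin k → Fin (Module.finrank ℝ V)) → ℝ) :=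
    { toFun := fun a j => a (fun i => b (j i))
      map_add' := fun _ _ => rfl
      map_smul' := fun _ _ => rfl }
  have hT : LinearMap.ker T = ⊥ := by
    rw [LinearMap.ker_eq_bot]
    intro a a' h
    apply ContinuousAlternatingMap.toAlternatingMap_injective
    exact b.ext_alternating fun j _ => congrFun h j
  obtain ⟨R, hR⟩ := LinearMap.exists_leftInverse_of_injective T hT
  exact ⟨_, fun j i => b (j i), R.toContinuousLinearMap, fun a => DFunLike.congr_fun hR a⟩

theorem contDiffWithinAt_alternating_iff [FiniteDimensional ℝ V] {k : ℕ}
    {f : G → V [⋀^Fin k]→L[ℝ] ℝ} {x₀ : G} :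
    ContDiffWithinAt ℝ r f s x₀ ↔ ∀ v, ContDiffWithinAt ℝ r (fun x => f x v) s x₀ := by
  refine ⟨fun h v => contDiffWithinAt_alternating_apply h fun _ => contDiffWithinAt_const,
    fun h => ?_⟩
  obtain ⟨N, v, R, hR⟩ := exists_leftInverse_alternating_apply (V := V) k
  have h1 : f = fun x => R (fun j => f x (v j)) := funext fun x => (hR _).symm
  rw [h1]
  exact R.contDiff.comp_contDiffWithinAt (contDiffWithinAt_pi.2 fun j => h _)

theorem contDiffOn_alternating_iff [FiniteDimensional ℝ V] {k : ℕ} {f : G → V [⋀^Fin k]→L[ℝ] ℝ} :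
    ContDiffOn ℝ r f s ↔ ∀ v, ContDiffOn ℝ r (fun x => f x v) s :=
  ⟨fun h v x hx => contDiffWithinAt_alternating_iff.1 (h x hx) v,
    fun h x hx => contDiffWithinAt_alternating_iff.2 fun v => h v x hx⟩

theorem contDiffWithinAt_alternating_comp [FiniteDimensional ℝ V'] {k : ℕ}
    {f : G → V [⋀^Fin k]→L[ℝ] ℝ} {g : G → V' →L[ℝ] V} {x₀ : G}
    (hf : ContDiffWithinAt ℝ r f s x₀) (hg : ContDiffWithinAt ℝ r g s x₀) :
    ContDiffWithinAt ℝ r (fun x => (f x).compContinuousLinearMap (g x)) s x₀ :=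
  contDiffWithinAt_alternating_iff.2 fun v =>
    contDiffWithinAt_alternating_apply (g := fun i x => g x (v i)) hf
      fun _ => hg.clm_apply contDiffWithinAt_const

/-- Every summand of the alternation has as a factor a value of `a` on some of the given vectors. So
whatever kills the generators of an ideal kills the ideal. -/
theorem wedgeAt_apply_eq_zero {p q : ℕ} (a : V [⋀^Fin p]→L[ℝ] ℝ) (b : V [⋀^Fin q]→L[ℝ] ℝ)
    (v : Fin (p + q) → V) (h : ∀ j : Fin p → Fin (p + q), a (fun i => v (j i)) = 0) :
    wedgeAt a b v = 0 := by
  rw [wedgeAt, ContinuousAlternatingMap.smul_apply,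
    ContinuousMultilinearMap.alternatization_apply_apply]
  rw [Finset.sum_eq_zero, smul_zero]
  intro σ _
  have : (tensorForm a b) (fun i => v (σ i)) = 0 := by
    rw [tensorForm_apply, h (fun i => σ (Fin.castAdd q i)), zero_mul]
  change _ • (tensorForm a b) (fun i => v (σ i)) = 0
  rw [this, smul_zero]

/-- When both exterior derivatives are expanded, the terms that differentiate `Ω` along some `g i`
cancel. The derivative of `Ω` along `ξ` and the terms that differentiate `ξ` survive: this is `£_ξ =
d ι_ξ + ι_ξ d` in coordinates. -/
theorem cartan_formula {k : ℕ} {Ω : V → V [⋀^Fin (k + 1)]→L[ℝ] ℝ} {ξ : V → V} {w : V}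
    (hΩ : DifferentiableAt ℝ Ω w) (hξ : DifferentiableAt ℝ ξ w) (g : Fin (k + 1) → V) :
    extDeriv (fun u => (Ω u).curryLeft (ξ u)) w g + extDeriv Ω w (Fin.cons (ξ w) g) =
      fderiv ℝ Ω w (ξ w) g + ∑ i, Ω w (update g i (fderiv ℝ ξ w (g i))) := by
  have hc' : HasFDerivAt (fun u => (Ω u).curryLeft) ((curryLeftL V k).comp (fderiv ℝ Ω w)) w := by
    have h := HasFDerivAt.comp (𝕜 := ℝ) (F := V [⋀^Fin (k + 1)]→L[ℝ] ℝ)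
      (G := V →L[ℝ] V [⋀^Fin k]→L[ℝ] ℝ) w (hasFDerivAt_curryLeft (Ω w)) hΩ.hasFDerivAt
    exact h
  have hc : HasFDerivAt (fun u => (Ω u).curryLeft (ξ u))
      (((Ω w).curryLeft).comp (fderiv ℝ ξ w) +
        ((curryLeftL V k).comp (fderiv ℝ Ω w)).flip (ξ w)) w :=
    hc'.clm_apply hξ.hasFDerivAt
  have h2 : (Fin.removeNth (0 : Fin (k + 2)) (Fin.cons (ξ w) g : Fin (k + 2) → V)) = g := by
    funext i; simp [Fin.removeNth]
  have h1 : extDeriv Ω w (Fin.cons (ξ w) g) = fderiv ℝ Ω w (ξ w) g - ∑ i : Fin (k + 1),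
      (-1 : ℤ) ^ (i : ℕ) • fderiv ℝ Ω w (g i) (Matrix.vecCons (ξ w) (i.removeNth g)) := by
    rw [extDeriv, ContinuousAlternatingMap.alternatizeUncurryFin_apply, Fin.sum_univ_succ]
    simp only [Fin.val_zero, pow_zero, one_smul, Fin.cons_zero, Fin.val_succ, Fin.cons_succ]
    rw [h2, sub_eq_add_neg, ← Finset.sum_neg_distrib]
    congr 1
    refine Finset.sum_congr rfl fun i _ => ?_
    rw [pow_succ, mul_neg_one, neg_smul]
    congr 3
    funext j
    refine Fin.cases ?_ (fun j => ?_) j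
    · simp [Fin.removeNth]
    · simp [Fin.removeNth]
  rw [h1, extDeriv, ContinuousAlternatingMap.alternatizeUncurryFin_apply, hc.fderiv]
  -- The alternating sign is the cost of moving the new vector from the front into slot `i`.
  have h3 : ∀ i : Fin (k + 1), (-1 : ℤ) ^ (i : ℕ) • (Ω w) (Matrix.vecCons
      (fderiv ℝ ξ w (g i)) (i.removeNth g)) = Ω w (update g i (fderiv ℝ ξ w (g i))) := by
    intro i
    have := (Ω w).toAlternatingMap.map_insertNth i (fderiv ℝ ξ w (g i)) (i.removeNth g)
    rw [Fin.insertNth_removeNth] at this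
    exact this.symm
  simp only [add_apply, ContinuousLinearMap.flip_apply,
    ContinuousLinearMap.comp_apply, ContinuousAlternatingMap.add_apply,
    curryLeftL_apply,
    ContinuousAlternatingMap.curryLeft_apply_apply, smul_add, Finset.sum_add_distrib, h3]
  ring

theorem cartan_formula_of_closed {k : ℕ} {Ω : V → V [⋀^Fin (k + 1)]→L[ℝ] ℝ} {ξ : V → V} {w : V}
    (hΩ : DifferentiableAt ℝ Ω w) (hξ : DifferentiableAt ℝ ξ w) (hd : extDeriv Ω w = 0)
    (g : Fin (k + 1) → V) :
    extDeriv (fun u => (Ω u).curryLeft (ξ u)) w g =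
      fderiv ℝ Ω w (ξ w) g + ∑ i, Ω w (update g i (fderiv ℝ ξ w (g i))) := by
  have h := cartan_formula hΩ hξ g
  rw [hd] at h
  rw [← h]
  exact (add_zero _).symm

end AlternatingCalculus

/-! ### Uniqueness for linear equations -/

section LinearODE

variable {G : Type*} [NormedAddCommGroup G] [NormedSpace ℝ G]

/-- This is uniqueness against the zero solution. It carries both the contact condition and the
Euler-Lagrange equations from one time to all others. -/
theorem eq_zero_of_hasDerivAt_linear {A : ℝ → G →L[ℝ] G} {u : ℝ → G} {a b t₁ : ℝ}
    (hA : ContinuousOn A (Ioo a b)) (hu : ∀ t ∈ Ioo a b, HasDerivAt u (A t (u t)) t)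
    (ht₁ : t₁ ∈ Ioo a b) (h0 : u t₁ = 0) : ∀ t ∈ Ioo a b, u t = 0 := by
  intro t ht
  -- `A` may be unbounded towards the ends of the interval, so a Lipschitz constant is taken on a
  -- compact interval `[c, d]` around both `t` and `t₁`.
  obtain ⟨c, hac, hc⟩ := exists_between (lt_min ht.1 ht₁.1)
  obtain ⟨d, hd, hdb⟩ := exists_between (max_lt ht.2 ht₁.2)
  have hsub : Icc c d ⊆ Ioo a b := fun s hs => ⟨hac.trans_le hs.1, hs.2.trans_lt hdb⟩
  obtain ⟨K, hK⟩ := isCompact_Icc.exists_bound_of_continuousOn (hA.mono hsub)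
  have hlip : ∀ s ∈ Ioo c d, LipschitzOnWith K.toNNReal (fun y => A s y) univ := fun s hs =>
    ((A s).lipschitz.weaken (by
      rw [← NNReal.coe_le_coe]
      exact (hK s ⟨hs.1.le, hs.2.le⟩).trans (Real.le_coe_toNNReal K))).lipschitzOnWith
  have h1 := ODE_solution_unique_of_mem_Ioo (v := fun s y => A s y) (s := fun _ => univ)
    (K := K.toNNReal) (f := u) (g := fun _ => 0) (t₀ := t₁) (a := c) (b := d) hlip
    ⟨lt_of_lt_of_le hc (min_le_right _ _), lt_of_le_of_lt (le_max_right _ _) hd⟩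
    (fun s hs => ⟨hu s (hsub ⟨hs.1.le, hs.2.le⟩), mem_univ _⟩)
    (fun s _ => ⟨by simpa using hasDerivAt_const s (0 : G), mem_univ _⟩) h0
  exact h1 ⟨lt_of_lt_of_le hc (min_le_left _ _), lt_of_le_of_lt (le_max_left _ _) hd⟩

end LinearODE

/-! ### An algebraic substitute for the fundamental lemma of the calculus of variations -/

section Divergence

variable {E : Type*} [NormedAddCommGroup E] [NormedSpace ℝ E]

/-- Second derivatives are symmetric and the coefficients antisymmetric, so the double sum equals
its own negative. -/
theorem sum_fderiv_fderiv_eq_zero_of_antisymm {N : ℕ} (e : Fin N → E) {O : Set E} (hO : IsOpen O)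
    {c : Fin N → Fin N → E → ℝ} (hc : ∀ j i, ContDiffOn ℝ 2 (c j i) O)
    (hanti : ∀ j i, ∀ x ∈ O, c j i x + c i j x = 0) {x : E} (hx : x ∈ O) :
    ∑ i, ∑ j, fderiv ℝ (fun y => fderiv ℝ (c j i) y (e j)) x (e i) = 0 := by
  have hd : ∀ j i, fderiv ℝ (fun y => fderiv ℝ (c j i) y (e j)) x (e i) =
      fderiv ℝ (fderiv ℝ (c j i)) x (e i) (e j) := by
    intro j i
    have h1 : DifferentiableAt ℝ (fderiv ℝ (c j i)) x :=
      (((hc j i).contDiffAt (hO.mem_nhds hx)).fderiv_right (m := 1) (by norm_num)).differentiableAt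
        (by norm_num)
    have h2 := (h1.hasFDerivAt.clm_apply (hasFDerivAt_const (e j) x)).fderiv
    rw [h2]
    simp
  have hsymm : ∀ j i, fderiv ℝ (fderiv ℝ (c j i)) x (e i) (e j) =
      fderiv ℝ (fderiv ℝ (c j i)) x (e j) (e i) := fun j i =>
    (((hc j i).contDiffAt (hO.mem_nhds hx)).isSymmSndFDerivAt (by simp)) (e i) (e j)
  have hneg : ∀ j i, fderiv ℝ (fderiv ℝ (c j i)) x = - fderiv ℝ (fderiv ℝ (c i j)) x := by
    intro j i
    have h0 : c j i =ᶠ[𝓝 x] -c i j := by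
      filter_upwards [hO.mem_nhds hx] with y hy
      have := hanti j i y hy
      simp only [Pi.neg_apply]
      linarith
    have h1 : fderiv ℝ (-c i j) = -fderiv ℝ (c i j) := funext fun y => fderiv_neg
    rw [h0.fderiv.fderiv_eq, h1, fderiv_neg]
  have hS : ∑ i, ∑ j, fderiv ℝ (fderiv ℝ (c j i)) x (e i) (e j) =
      - ∑ i, ∑ j, fderiv ℝ (fderiv ℝ (c j i)) x (e i) (e j) := by
    conv_rhs => rw [Finset.sum_comm]
    rw [← Finset.sum_neg_distrib]
    refine Finset.sum_congr rfl fun i _ => ?_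
    rw [← Finset.sum_neg_distrib]
    refine Finset.sum_congr rfl fun j _ => ?_
    rw [hsymm i j, hneg i j]
    simp
  simp only [hd]
  linarith

/-- If the function `f G` is the divergence of a first order linear differential operator in `f`,
for every `f`, then `G` vanishes. -/
theorem eq_zero_of_forall_eq_divergence {N : ℕ} (e : Fin N → E) (l : Fin N → E →L[ℝ] ℝ)
    (hel : ∀ a j, l a (e j) = if a = j then 1 else 0) {O : Set E} (hO : IsOpen O)
    {G : E → ℝ} {b : Fin N → E → ℝ} {c : Fin N → Fin N → E → ℝ}
    (hb : ∀ j, DifferentiableOn ℝ (b j) O) (hc : ∀ j i, ContDiffOn ℝ 2 (c j i) O)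
    (h : ∀ f : E → ℝ, ContDiff ℝ ∞ f → ∀ x ∈ O, f x * G x =
      -∑ j, fderiv ℝ (fun y => f y * b j y + ∑ i, fderiv ℝ f y (e i) * c j i y) x (e j)) :
    ∀ x ∈ O, G x = 0 := by
  have hb' : ∀ j, ∀ x ∈ O, HasFDerivAt (b j) (fderiv ℝ (b j) x) x := fun j x hx =>
    ((hb j).differentiableAt (hO.mem_nhds hx)).hasFDerivAt
  have hc' : ∀ j i, ∀ x ∈ O, HasFDerivAt (c j i) (fderiv ℝ (c j i) x) x := fun j i x hx =>
    (((hc j i).differentiableOn (by norm_num)).differentiableAt (hO.mem_nhds hx)).hasFDerivAt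
  have hl : ∀ a x, HasFDerivAt (fun y => l a y) (l a) x := fun a x => (l a).hasFDerivAt
  -- Test with `f = 1`: `G` is minus the divergence of `b`.
  have h1 : ∀ x ∈ O, G x = -∑ j, fderiv ℝ (b j) x (e j) := by
    intro x hx
    have := h (fun _ => 1) contDiff_const x hx
    simpa using this
  -- Test with the coordinate function `l a`: given the previous identity, `b a` is minus the
  -- divergence of `c · a`.
  have h2 : ∀ a, ∀ x ∈ O, b a x = -∑ j, fderiv ℝ (c j a) x (e j) := by
    intro a x hx
    have hfa : ∀ y, fderiv ℝ (fun y => l a y) y = l a := fun y => (hl a y).fderiv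
    have := h (fun y => l a y) (l a).contDiff x hx
    have hfun : ∀ j, (fun y => l a y * b j y + ∑ i, fderiv ℝ (fun y => l a y) y (e i) * c j i y) =
        fun y => l a y * b j y + c j a y := by
      intro j
      funext y
      simp [hfa, hel]
    have hder : ∀ j, fderiv ℝ (fun y => l a y * b j y + c j a y) x (e j) =
        l a x * fderiv ℝ (b j) x (e j) + (if a = j then b j x else 0) +
          fderiv ℝ (c j a) x (e j) := by
      intro j
      refine (DFunLike.congr_fun (((hl a x).mul (hb' j x hx)).add (hc' j a x hx)).fderiv
        (e j)).trans ?_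
      simp [hel]
    simp only [hfun, hder, Finset.sum_add_distrib, ← Finset.mul_sum, Finset.sum_ite_eq,
      Finset.mem_univ, if_true] at this
    rw [h1 x hx] at this
    linarith
  -- Test with the product `l a * l d`: the previous identities absorb everything except the
  -- symmetric part of `c`.
  have h3 : ∀ a d, ∀ x ∈ O, c a d x + c d a x = 0 := by
    intro a d x hx
    have hfa : ∀ y, fderiv ℝ (fun y => l a y * l d y) y = l a y • l d + l d y • l a :=
      fun y => ((hl a y).mul (hl d y)).fderiv
    have := h (fun y => l a y * l d y) ((l a).contDiff.mul (l d).contDiff) x hx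
    have hfun : ∀ j, (fun y => l a y * l d y * b j y +
        ∑ i, fderiv ℝ (fun y => l a y * l d y) y (e i) * c j i y) =
        fun y => l a y * l d y * b j y + (l a y * c j d y + l d y * c j a y) := by
      intro j
      funext y
      simp only [hfa, add_apply, smul_apply, hel,
        smul_eq_mul, mul_ite, mul_one, mul_zero, add_mul, Finset.sum_add_distrib, ite_mul, zero_mul,
        Finset.sum_ite_eq, Finset.mem_univ, if_true]
    have hder : ∀ j, fderiv ℝ (fun y => l a y * l d y * b j y +
        (l a y * c j d y + l d y * c j a y)) x (e j) =
        l a x * l d x * fderiv ℝ (b j) x (e j) + l a x * (if d = j then b j x else 0) +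
          l d x * (if a = j then b j x else 0) +
          l a x * fderiv ℝ (c j d) x (e j) + (if a = j then c j d x else 0) +
          l d x * fderiv ℝ (c j a) x (e j) + (if d = j then c j a x else 0) := by
      intro j
      refine (DFunLike.congr_fun ((((hl a x).mul (hl d x)).mul (hb' j x hx)).add
        (((hl a x).mul (hc' j d x hx)).add ((hl d x).mul (hc' j a x hx)))).fderiv (e j)).trans ?_
      simp only [add_apply, smul_apply, hel, Pi.mul_apply, smul_eq_mul]
      split_ifs <;> ring
    simp only [hfun, hder, Finset.sum_add_distrib, ← Finset.mul_sum, Finset.sum_ite_eq,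
      Finset.mem_univ, if_true] at this
    rw [h1 x hx] at this
    have h2a := h2 a x hx
    have h2d := h2 d x hx
    rw [h2a, h2d] at this
    linear_combination this
  intro x hx
  -- Substituting `h2` into `h1` exhibits `G` as the double divergence of the antisymmetric `c`.
  have hz := sum_fderiv_fderiv_eq_zero_of_antisymm e hO hc h3 hx
  rw [h1 x hx]
  have h4 : ∀ a, fderiv ℝ (b a) x (e a) =
      -∑ j, fderiv ℝ (fun y => fderiv ℝ (c j a) y (e j)) x (e a) := by
    intro a
    have h0 : b a =ᶠ[𝓝 x] fun y => -∑ j, fderiv ℝ (c j a) y (e j) := by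
      filter_upwards [hO.mem_nhds hx] with y hy using h2 a y hy
    have hdj : ∀ j, DifferentiableAt ℝ (fun y => fderiv ℝ (c j a) y (e j)) x := fun j =>
      ((((hc j a).contDiffAt (hO.mem_nhds hx)).fderiv_right (m := 1)
        (by norm_num)).differentiableAt (by norm_num)).clm_apply (differentiableAt_const _)
    rw [h0.fderiv_eq, fderiv_fun_neg, fderiv_fun_sum fun j _ => hdj j]
    simp
  simp only [h4, Finset.sum_neg_distrib, neg_neg]
  exact hz

end Divergence

theorem minSmoothness_two_le_infty : minSmoothness ℝ 2 ≤ (∞ : WithTop ℕ∞) := by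
  rw [minSmoothness_of_isRCLikeNormedField]
  exact WithTop.coe_le_coe.2 le_top

/-! ### Jets between vector spaces and the first variation of a form -/

section JetSpaceModel

variable {E : Type*} [NormedAddCommGroup E] [NormedSpace ℝ E]
  {F : Type*} [NormedAddCommGroup F] [NormedSpace ℝ F]

/-- The projection `(x, y, A) ↦ x` of the model of the jet bundle. -/
def baseProj (E F : Type*) [NormedAddCommGroup E] [NormedSpace ℝ E] [NormedAddCommGroup F]
    [NormedSpace ℝ F] : ((E × F) × (E →L[ℝ] F)) →L[ℝ] E :=
  (ContinuousLinearMap.fst ℝ E F).comp (ContinuousLinearMap.fst ℝ (E × F) (E →L[ℝ] F))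

@[simp]
theorem baseProj_apply (w : (E × F) × (E →L[ℝ] F)) : baseProj E F w = w.1.1 := rfl

/-- The `F`-valued contact form `dy - A dx` at the point `w = (x, y, A)`. -/
def contactForm (w : (E × F) × (E →L[ℝ] F)) : ((E × F) × (E →L[ℝ] F)) →L[ℝ] F :=
  (ContinuousLinearMap.snd ℝ E F).comp (ContinuousLinearMap.fst ℝ (E × F) (E →L[ℝ] F)) -
    w.2.comp (baseProj E F)

@[simp]
theorem contactForm_apply (w v : (E × F) × (E →L[ℝ] F)) :
    contactForm w v = v.1.2 - w.2 v.1.1 := rfl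

theorem contDiff_contactForm {r : WithTop ℕ∞} :
    ContDiff ℝ r (contactForm : ((E × F) × (E →L[ℝ] F)) → _ →L[ℝ] F) :=
  contDiff_const.sub (contDiff_snd.clm_comp contDiff_const)

/-- The `1`-jet of a function between vector spaces. -/
def jetMap (u : E → F) (x : E) : (E × F) × (E →L[ℝ] F) := ((x, u x), fderiv ℝ u x)

variable {O : Set E} {u : E → F}

theorem contDiffOn_jetMap (hO : IsOpen O) (hu : ContDiffOn ℝ ∞ u O) :
    ContDiffOn ℝ ∞ (jetMap u) O :=
  (contDiffOn_id.prodMk hu).prodMk (hu.fderiv_of_isOpen hO (by simp))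

theorem hasFDerivAt_jetMap (hO : IsOpen O) (hu : ContDiffOn ℝ ∞ u O) {x : E} (hx : x ∈ O) :
    HasFDerivAt (jetMap u) (((ContinuousLinearMap.id ℝ E).prod (fderiv ℝ u x)).prod
      (fderiv ℝ (fderiv ℝ u) x)) x := by
  have h1 : HasFDerivAt u (fderiv ℝ u x) x :=
    ((hu.differentiableOn (by simp)).differentiableAt (hO.mem_nhds hx)).hasFDerivAt
  have h2 : HasFDerivAt (fderiv ℝ u) (fderiv ℝ (fderiv ℝ u) x) x :=
    (((hu.fderiv_of_isOpen hO (m := ∞) (by simp)).differentiableOn (by simp)).differentiableAt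
      (hO.mem_nhds hx)).hasFDerivAt
  exact ((hasFDerivAt_id x).prodMk h1).prodMk h2

/-- The exterior derivative of a form on a family `jetMap u + ε W`, contracted with `W`. -/
theorem extDeriv_cons_variation {n : ℕ}
    {D : Set ((E × F) × (E →L[ℝ] F))} (hD : IsOpen D)
    {τ : ((E × F) × (E →L[ℝ] F)) → ((E × F) × (E →L[ℝ] F)) [⋀^Fin (n + 1)]→L[ℝ] ℝ}
    (hτ : ContDiffOn ℝ ∞ τ D) (hO : IsOpen O) {σ W : E → (E × F) × (E →L[ℝ] F)}
    (hσ : ContDiffOn ℝ ∞ σ O) (hW : ContDiffOn ℝ ∞ W O) {x : E} (hx : x ∈ O) (hxD : σ x ∈ D)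
    (e : Fin (n + 1) → E) :
    extDeriv τ (σ x) (Fin.cons (W x) fun i => fderiv ℝ σ x (e i)) =
      deriv (fun ε : ℝ => τ (σ x + ε • W x) fun i => fderiv ℝ (fun y => σ y + ε • W y) x (e i)) 0 -
      ∑ j : Fin (n + 1), fderiv ℝ (fun y => (-1) ^ (j : ℕ) *
        τ (σ y) (Fin.cons (W y) fun k => fderiv ℝ σ y (e (j.succAbove k)))) x (e j) := by
  -- The family is one map on `ℝ × E`, so that `d` commutes with the pullback by `S`. The formula is
  -- `d (S^* τ)` evaluated on `(∂_ε, e_0, …, e_n)`: omitting `∂_ε` gives the derivative in `ε`,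
  -- omitting `e_j` gives the divergence terms.
  set S : ℝ × E → (E × F) × (E →L[ℝ] F) := fun p => σ p.2 + p.1 • W p.2 with hS
  have hO' : IsOpen ((univ : Set ℝ) ×ˢ O) := isOpen_univ.prod hO
  have hmaps : MapsTo (Prod.snd : ℝ × E → E) ((univ : Set ℝ) ×ˢ O) O := fun p hp => hp.2
  have hSs : ContDiffOn ℝ ∞ S (univ ×ˢ O) :=
    (hσ.comp contDiff_snd.contDiffOn hmaps).add
      (contDiff_fst.contDiffOn.smul (hW.comp contDiff_snd.contDiffOn hmaps))
  have hσ' : ∀ y ∈ O, HasFDerivAt σ (fderiv ℝ σ y) y := fun y hy =>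
    ((hσ.differentiableOn (by simp)).differentiableAt (hO.mem_nhds hy)).hasFDerivAt
  have hW' : ∀ y ∈ O, HasFDerivAt W (fderiv ℝ W y) y := fun y hy =>
    ((hW.differentiableOn (by simp)).differentiableAt (hO.mem_nhds hy)).hasFDerivAt
  have hSd : ∀ (ε : ℝ), ∀ y ∈ O, HasFDerivAt S ((fderiv ℝ σ y).comp (.snd ℝ ℝ E) +
      (ε • (fderiv ℝ W y).comp (.snd ℝ ℝ E) +
        (ContinuousLinearMap.fst ℝ ℝ E).smulRight (W y))) (ε, y) := by
    intro ε y hy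
    have h1 : HasFDerivAt (fun p : ℝ × E => σ p.2) ((fderiv ℝ σ y).comp (.snd ℝ ℝ E)) (ε, y) :=
      HasFDerivAt.comp (ε, y) (f := Prod.snd) (hσ' y hy) hasFDerivAt_snd
    have h2 : HasFDerivAt (fun p : ℝ × E => W p.2) ((fderiv ℝ W y).comp (.snd ℝ ℝ E)) (ε, y) :=
      HasFDerivAt.comp (ε, y) (f := Prod.snd) (hW' y hy) hasFDerivAt_snd
    exact h1.add (HasFDerivAt.smul (hasFDerivAt_fst (p := (ε, y))) h2)
  have hpar : ∀ (ε : ℝ), ∀ y ∈ O, ∀ v, fderiv ℝ S (ε, y) (0, v) =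
      fderiv ℝ (fun y => σ y + ε • W y) y v := by
    intro ε y hy v
    have h1 : HasFDerivAt (fun y => σ y + ε • W y) (fderiv ℝ σ y + ε • fderiv ℝ W y) y :=
      (hσ' y hy).add ((hW' y hy).const_smul ε)
    rw [(hSd ε y hy).fderiv, h1.fderiv]
    simp
  have hpar0 : ∀ y ∈ O, ∀ v, fderiv ℝ S (0, y) (0, v) = fderiv ℝ σ y v := by
    intro y hy v
    rw [(hSd 0 y hy).fderiv]
    simp
  have hone : ∀ y ∈ O, fderiv ℝ S (0, y) (1, 0) = W y := by
    intro y hy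
    rw [(hSd 0 y hy).fderiv]
    simp
  have hS0 : ∀ y, S (0, y) = σ y := fun y => by simp [hS]
  set β : ℝ × E → (ℝ × E) [⋀^Fin (n + 1)]→L[ℝ] ℝ :=
    fun p => (τ (S p)).compContinuousLinearMap (fderiv ℝ S p) with hβ
  have hSx : S (0, x) ∈ D := by rw [hS0]; exact hxD
  have hmem : ((0 : ℝ), x) ∈ (univ : Set ℝ) ×ˢ O := ⟨mem_univ _, hx⟩
  have hτd : DifferentiableAt ℝ τ (S (0, x)) :=
    (hτ.differentiableOn (by simp)).differentiableAt (hD.mem_nhds hSx)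
  have hSat : ContDiffAt ℝ ∞ S (0, x) := hSs.contDiffAt (hO'.mem_nhds hmem)
  have hpull : extDeriv β (0, x) = _ :=
    extDeriv_pullback (r := ∞) hτd hSat minSmoothness_two_le_infty
  have hβd : DifferentiableAt ℝ β (0, x) := by
    have hcomp : DifferentiableAt ℝ (fun p => τ (S p)) (0, x) :=
      DifferentiableAt.comp (G := ((E × F) × (E →L[ℝ] F)) [⋀^Fin (n + 1)]→L[ℝ] ℝ) (0, x) hτd
        (hSat.differentiableAt (by simp))
    refine hcomp.continuousAlternatingMapCompContinuousLinearMap ?_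
    exact ((hSs.fderiv_of_isOpen hO' (m := ∞) (by simp)).contDiffAt
      (hO'.mem_nhds hmem)).differentiableAt (by simp)
  have key := DFunLike.congr_fun hpull
    (Fin.cons ((1 : ℝ), (0 : E)) fun i => ((0 : ℝ), e i) : Fin (n + 2) → ℝ × E)
  rw [extDeriv_apply hβd, Fin.sum_univ_succ,
    ContinuousAlternatingMap.compContinuousLinearMap_apply] at key
  have hvec : (fderiv ℝ S (0, x)) ∘ (Fin.cons ((1 : ℝ), (0 : E)) fun i => ((0 : ℝ), e i) :
      Fin (n + 2) → ℝ × E) =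
      (Fin.cons (W x) fun i => fderiv ℝ σ x (e i) :
        Fin (n + 2) → (E × F) × (E →L[ℝ] F)) := by
    funext i
    refine Fin.cases ?_ (fun i => ?_) i
    · simp [hone x hx]
    · simp [hpar0 x hx]
  rw [hvec, hS0] at key
  rw [← key, sub_eq_add_neg, ← Finset.sum_neg_distrib]
  have hev : ∀ v : Fin (n + 1) → ℝ × E, DifferentiableAt ℝ (fun p => β p v) (0, x) := fun v =>
    hβd.continuousAlternatingMap_apply fun _ => differentiableAt_const _
  congr 1
  · have h0 : (Fin.removeNth (0 : Fin (n + 2)) (Fin.cons ((1 : ℝ), (0 : E)) fun i =>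
        ((0 : ℝ), e i) : Fin (n + 2) → ℝ × E)) = fun i => ((0 : ℝ), e i) := by
      funext i; simp [Fin.removeNth]
    rw [h0]
    simp only [Fin.val_zero, pow_zero, one_smul, Fin.cons_zero]
    have h1 : HasDerivAt (fun ε : ℝ => (ε, x)) ((1 : ℝ), (0 : E)) 0 :=
      (hasDerivAt_id (0 : ℝ)).prodMk (hasDerivAt_const _ _)
    have h2 := ((hev fun i => ((0 : ℝ), e i)).hasFDerivAt.comp_hasDerivAt (0 : ℝ) h1).deriv
    rw [← h2]
    congr 1
    funext ε
    change τ (S (ε, x)) (fun i => fderiv ℝ S (ε, x) (0, e i)) = _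
    congr 1
    funext i
    exact hpar ε x hx (e i)
  · refine Finset.sum_congr rfl fun j _ => ?_
    have h0 : (Fin.removeNth j.succ (Fin.cons ((1 : ℝ), (0 : E)) fun i =>
        ((0 : ℝ), e i) : Fin (n + 2) → ℝ × E)) =
        (Fin.cons ((1 : ℝ), (0 : E)) fun k : Fin n => ((0 : ℝ), e (j.succAbove k))) := by
      funext i
      refine Fin.cases ?_ (fun i => ?_) i
      · simp [Fin.removeNth]
      · simp [Fin.removeNth]
    rw [h0]
    simp only [Fin.val_succ, Fin.cons_succ]
    set vj : Fin (n + 1) → ℝ × E :=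
      Fin.cons ((1 : ℝ), (0 : E)) fun k : Fin n => ((0 : ℝ), e (j.succAbove k)) with hvj
    have h1 : HasFDerivAt (fun y : E => ((0 : ℝ), y))
        ((0 : E →L[ℝ] ℝ).prod (ContinuousLinearMap.id ℝ E)) x :=
      (hasFDerivAt_const _ _).prodMk (hasFDerivAt_id x)
    have h2 := (hev vj).hasFDerivAt.comp x h1
    have h3 : (fun y => (-1 : ℝ) ^ (j : ℕ) *
        τ (σ y) (Fin.cons (W y) fun k => fderiv ℝ σ y (e (j.succAbove k)))) =ᶠ[𝓝 x]
        fun y => (-1 : ℝ) ^ (j : ℕ) * ((fun p => β p vj) ∘ fun y : E => ((0 : ℝ), y)) y := by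
      filter_upwards [hO.mem_nhds hx] with y hy
      congr 1
      change _ = τ (S (0, y)) (fun i => fderiv ℝ S (0, y) (vj i))
      rw [hS0]
      congr 1
      funext i
      refine Fin.cases ?_ (fun i => ?_) i
      · simp [hvj, hone y hy]
      · simp [hvj, hpar0 y hy]
    rw [h3.fderiv_eq, (h2.const_mul _).fderiv]
    simp [pow_succ]

end JetSpaceModel

/-! ### Forms of top degree and traces -/

section TopDegree

variable {E : Type*} [NormedAddCommGroup E] [NormedSpace ℝ E]

theorem alternating_eq_zero_of_basis {N : ℕ} (e : Module.Basis (Fin N) ℝ E)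
    (a : E [⋀^Fin N]→L[ℝ] ℝ) (h : a e = 0) : a = 0 := by
  have h1 := a.toAlternatingMap.eq_smul_basis_det e
  refine ContinuousAlternatingMap.ext fun v => ?_
  have h2 := DFunLike.congr_fun h1 v
  have h3 : a.toAlternatingMap e = 0 := h
  rw [h3, zero_smul] at h2
  exact h2

theorem alternating_apply_eq_zero_of_finrank_lt {N : ℕ} [FiniteDimensional ℝ E]
    (hE : Module.finrank ℝ E < N) (a : E [⋀^Fin N]→L[ℝ] ℝ) (v : Fin N → E) : a v = 0 := by
  refine a.toAlternatingMap.map_linearDependent v fun hv => ?_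
  have := hv.fintype_card_le_finrank
  rw [Fintype.card_fin] at this
  omega

/-- When `T (e i)` is expanded in the basis, only its component along `e i` survives among the other
basis vectors, which leaves the diagonal entries of `T`. With `T = p ∘ B` this turns the momentum
term of the Poincaré-Cartan form into `∂L/∂z`. -/
theorem sum_alternating_cons_removeNth {N : ℕ} (e : Module.Basis (Fin (N + 1)) ℝ E)
    (a : E [⋀^Fin (N + 1)]→L[ℝ] ℝ) (T : E →ₗ[ℝ] E) :
    ∑ i : Fin (N + 1), (-1 : ℝ) ^ (i : ℕ) * a (Fin.cons (T (e i)) (i.removeNth e)) =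
      LinearMap.trace ℝ E T * a e := by
  have h1 : ∀ i : Fin (N + 1), (-1 : ℝ) ^ (i : ℕ) * a (Fin.cons (T (e i)) (i.removeNth e)) =
      e.repr (T (e i)) i * a e := by
    intro i
    have h2 := a.toAlternatingMap.map_insertNth i (T (e i)) (i.removeNth e)
    have h3 : (-1 : ℝ) ^ (i : ℕ) * a (Fin.cons (T (e i)) (i.removeNth e)) =
        a (update e i (T (e i))) := by
      rw [Fin.insertNth_removeNth] at h2
      refine Eq.trans ?_ h2.symm
      rw [zsmul_eq_mul]
      push_cast
      rfl
    rw [h3]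
    conv_lhs => rw [← e.sum_repr (T (e i))]
    have h4 := map_sum (a.toContinuousLinearMap e i) (fun j => e.repr (T (e i)) j • e j)
      Finset.univ
    refine Eq.trans h4 ?_
    rw [Finset.sum_eq_single i]
    · change a (update e i _) = _
      rw [a.map_update_smul, update_eq_self, smul_eq_mul]
    · intro j _ hj
      change a (update e i _) = _
      rw [a.map_update_smul, a.map_eq_zero_of_eq (i := i) (j := j) _ (by simp [hj]) hj.symm,
        smul_zero]
    · simp
  simp only [h1, ← Finset.sum_mul]
  rw [LinearMap.trace_eq_matrix_trace ℝ e, Matrix.trace]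
  simp [LinearMap.toMatrix_apply]

end TopDegree

/-! ### Null forms and the Poincaré-Cartan form along a jet -/

section JetSpaceModel

variable {E : Type*} [NormedAddCommGroup E] [NormedSpace ℝ E]
  {F : Type*} [NormedAddCommGroup F] [NormedSpace ℝ F] {O : Set E} {u : E → F} {n : ℕ}

/-- Let `τ` be a form whose pullbacks by all `1`-jets vanish. If `dτ` contracted with vertical
vectors of the form `(0, 0, B)` is zero along the `1`-jet of `u`, then it is so for `(0, V, 0)`. -/
theorem extDeriv_cons_eq_zero_of_null [FiniteDimensional ℝ E]
    (hE : Module.finrank ℝ E = n + 1) {D : Set ((E × F) × (E →L[ℝ] F))} (hD : IsOpen D)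
    {τ : ((E × F) × (E →L[ℝ] F)) → ((E × F) × (E →L[ℝ] F)) [⋀^Fin (n + 1)]→L[ℝ] ℝ}
    (hτ : ContDiffOn ℝ ∞ τ D)
    (hnull : ∀ (O' : Set E) (u' : E → F), IsOpen O' → ContDiffOn ℝ ∞ u' O' → ∀ x ∈ O',
      jetMap u' x ∈ D → ∀ v : Fin (n + 1) → E,
        τ (jetMap u' x) (fun i => fderiv ℝ (jetMap u') x (v i)) = 0)
    (hO : IsOpen O) (hu : ContDiffOn ℝ ∞ u O) (huD : ∀ x ∈ O, jetMap u x ∈ D)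
    (hvert : ∀ x ∈ O, ∀ (B : E →L[ℝ] F) (v : Fin (n + 1) → E), extDeriv τ (jetMap u x)
      (Fin.cons ((0, 0), B) fun i => fderiv ℝ (jetMap u) x (v i)) = 0)
    {x : E} (hx : x ∈ O) (V : F) (v : Fin (n + 1) → E) :
    extDeriv τ (jetMap u x) (Fin.cons ((0, V), 0) fun i => fderiv ℝ (jetMap u) x (v i)) = 0 := by
  let e : Module.Basis (Fin (n + 1)) ℝ E := Module.finBasisOfFinrankEq ℝ E hE
  let l : Fin (n + 1) → E →L[ℝ] ℝ := fun i => LinearMap.toContinuousLinearMap (e.coord i)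
  have hel : ∀ a j, l a (e j) = if a = j then 1 else 0 := by
    intro a j
    simp only [l, LinearMap.coe_toContinuousLinearMap', Module.Basis.coord_apply,
      Module.Basis.repr_self, Finsupp.single_apply, eq_comm]
  have hσ := contDiffOn_jetMap hO hu
  have hσ1 : ∀ v, ContDiffOn ℝ ∞ (fun y => fderiv ℝ (jetMap u) y v) O := fun v =>
    (hσ.fderiv_of_isOpen hO (by simp)).clm_apply contDiffOn_const
  have hτσ : ContDiffOn ℝ ∞ (fun y => τ (jetMap u y)) O := hτ.comp hσ huD
  have hsm : ∀ (w : (E × F) × (E →L[ℝ] F)) (j : Fin (n + 1)), ContDiffOn ℝ ∞ (fun y =>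
      (-1 : ℝ) ^ (j : ℕ) * τ (jetMap u y)
        (Fin.cons w fun k => fderiv ℝ (jetMap u) y (e (j.succAbove k)))) O := by
    intro w j
    refine contDiffOn_const.mul ?_
    have := contDiffOn_alternating_apply (g := fun (i : Fin (n + 1)) y =>
      (Fin.cons w fun k => fderiv ℝ (jetMap u) y (e (j.succAbove k)) :
        Fin (n + 1) → (E × F) × (E →L[ℝ] F)) i) hτσ ?_
    · exact this
    · intro i
      refine Fin.cases ?_ (fun i => ?_) i
      · exact contDiffOn_const
      · exact hσ1 _
  -- `G` is the contraction of `dτ` with `V`; `b` and `c` are the coefficients of `f` and of its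
  -- partial derivatives in the divergence terms of the variation formula.
  have key := eq_zero_of_forall_eq_divergence e l hel hO
    (G := fun y => extDeriv τ (jetMap u y)
      (Fin.cons ((0, V), 0) fun i => fderiv ℝ (jetMap u) y (e i)))
    (b := fun j y => (-1 : ℝ) ^ (j : ℕ) * τ (jetMap u y)
      (Fin.cons ((0, V), 0) fun k => fderiv ℝ (jetMap u) y (e (j.succAbove k))))
    (c := fun j i y => (-1 : ℝ) ^ (j : ℕ) * τ (jetMap u y)
      (Fin.cons ((0, 0), (l i).smulRight V) fun k => fderiv ℝ (jetMap u) y (e (j.succAbove k))))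
    (fun j => (hsm _ j).differentiableOn (by simp))
    (fun j i => (hsm _ j).of_le (WithTop.coe_le_coe.2 le_top)) ?_
  · have h1 : ((extDeriv τ (jetMap u x)).curryLeft ((0, V), 0)).compContinuousLinearMap
        (fderiv ℝ (jetMap u) x) = 0 := alternating_eq_zero_of_basis e _ (key x hx)
    exact DFunLike.congr_fun h1 v
  intro f hf y hy
  -- `W` is the variation field of the family `u + ε f V`, read on `1`-jets.
  set W : E → (E × F) × (E →L[ℝ] F) := fun y => ((0, f y • V), (fderiv ℝ f y).smulRight V) with hW
  have hWs : ContDiffOn ℝ ∞ W O := by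
    have h1 : ContDiff ℝ ∞ (fderiv ℝ f) := hf.fderiv_right (by simp)
    have h2 : ContDiff ℝ ∞ W :=
      (contDiff_const.prodMk (hf.smul contDiff_const)).prodMk (h1.smulRight contDiff_const)
    exact h2.contDiffOn
  have hWdec : ∀ y, W y = f y • (((0, V), 0) : (E × F) × (E →L[ℝ] F)) +
      ∑ i, fderiv ℝ f y (e i) • (((0, 0), (l i).smulRight V) : (E × F) × (E →L[ℝ] F)) := by
    intro y
    have h1 : fderiv ℝ f y = ∑ i, fderiv ℝ f y (e i) • l i := by
      refine ContinuousLinearMap.coe_injective (e.ext fun j => ?_)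
      change _ = (∑ i, fderiv ℝ f y (e i) • l i) (e j)
      simp [hel]
    refine Prod.ext (Prod.ext ?_ ?_) ?_
    · simp [hW, Prod.fst_sum]
    · simp [hW, Prod.fst_sum]
    · simp only [hW, Prod.snd_add, Prod.smul_snd, smul_zero, zero_add, Prod.snd_sum]
      conv_lhs => rw [h1]
      refine ContinuousLinearMap.ext fun z => ?_
      simp [Finset.sum_smul, smul_smul]
  have hexp : ∀ (k : ℕ) (a : ((E × F) × (E →L[ℝ] F)) [⋀^Fin (k + 1)]→L[ℝ] ℝ) (y : E)
      (g : Fin k → (E × F) × (E →L[ℝ] F)), a (Fin.cons (W y) g) =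
      f y * a (Fin.cons ((0, V), 0) g) +
      ∑ i, fderiv ℝ f y (e i) * a (Fin.cons ((0, 0), (l i).smulRight V) g) := by
    intro k a y g
    change (a.curryLeft (W y)) g = _
    rw [hWdec, map_add, map_smul, map_sum]
    simp only [map_smul, ContinuousAlternatingMap.add_apply, ContinuousAlternatingMap.smul_apply,
      ContinuousAlternatingMap.sum_apply, smul_eq_mul]
    rfl
  have hvar := extDeriv_cons_variation hD hτ hO hσ hWs hy (huD y hy) e
  rw [hexp] at hvar
  simp only [hvert y hy, mul_zero, Finset.sum_const_zero, add_zero] at hvar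
  rw [hvar]
  -- The varied maps are again `1`-jets, on which `τ` vanishes. The derivative in `ε` is therefore
  -- zero and only the divergence remains.
  have hd0 : deriv (fun ε : ℝ => τ (jetMap u y + ε • W y) fun i =>
      fderiv ℝ (fun y => jetMap u y + ε • W y) y (e i)) 0 = 0 := by
    have hev : (fun ε : ℝ => τ (jetMap u y + ε • W y) fun i =>
        fderiv ℝ (fun y => jetMap u y + ε • W y) y (e i)) =ᶠ[𝓝 0] fun _ => 0 := by
      have hcont : ContinuousAt (fun ε : ℝ => jetMap u y + ε • W y) 0 := by fun_prop
      have hmem : ∀ᶠ ε : ℝ in 𝓝 0, jetMap u y + ε • W y ∈ D :=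
        hcont (hD.mem_nhds (by simpa using huD y hy))
      filter_upwards [hmem] with ε hε
      have hu' : ContDiffOn ℝ ∞ (fun y => u y + ε • (f y • V)) O :=
        hu.add (contDiffOn_const.smul (hf.contDiffOn.smul contDiffOn_const))
      have heq : ∀ z ∈ O, jetMap (fun y => u y + ε • (f y • V)) z = jetMap u z + ε • W z := by
        intro z hz
        have h1 : HasFDerivAt (fun y => u y + ε • (f y • V))
            (fderiv ℝ u z + ε • ((fderiv ℝ f z).smulRight V)) z :=
          ((hu.differentiableOn (by simp)).differentiableAt (hO.mem_nhds hz)).hasFDerivAt.add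
            (((hf.differentiable (by simp)).differentiableAt.hasFDerivAt.smul_const V).const_smul ε)
        simp [jetMap, hW, h1.fderiv]
      have heq' : jetMap (fun y => u y + ε • (f y • V)) =ᶠ[𝓝 y] fun z => jetMap u z + ε • W z := by
        filter_upwards [hO.mem_nhds hy] with z hz using heq z hz
      have := hnull O _ hO hu' y hy (by rw [heq y hy]; exact hε) e
      rw [heq y hy, heq'.fderiv_eq] at this
      exact this
    rw [hev.deriv_eq, deriv_const]
  rw [hd0, zero_sub]
  congr 1
  refine Finset.sum_congr rfl fun j _ => ?_
  congr 2
  funext z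
  rw [hexp, mul_add, Finset.mul_sum]
  congr 1
  · ring
  · refine Finset.sum_congr rfl fun i _ => by ring

/-- The Poincaré-Cartan form in coordinates. The linear map `p w` is
`v ↦ ∑_μ (∂L/∂z^i_μ) v^i ∂/∂x^μ`. -/
def pcModel (η : E → E [⋀^Fin (n + 1)]→L[ℝ] ℝ) (L : (E × F) × (E →L[ℝ] F) → ℝ)
    (p : (E × F) × (E →L[ℝ] F) → F →L[ℝ] E) (w : (E × F) × (E →L[ℝ] F)) :
    ((E × F) × (E →L[ℝ] F)) [⋀^Fin (n + 1)]→L[ℝ] ℝ :=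
  L w • (η w.1.1).compContinuousLinearMap (baseProj E F) +
    ContinuousAlternatingMap.alternatizeUncurryFin
      ((ContinuousAlternatingMap.compContinuousLinearMapCLM (ι := Fin n) (baseProj E F)).comp
        ((η w.1.1).curryLeft.comp ((p w).comp (contactForm w))))

theorem pcModel_apply (η : E → E [⋀^Fin (n + 1)]→L[ℝ] ℝ) (L : (E × F) × (E →L[ℝ] F) → ℝ)
    (p : (E × F) × (E →L[ℝ] F) → F →L[ℝ] E) (w : (E × F) × (E →L[ℝ] F))
    (V : Fin (n + 1) → (E × F) × (E →L[ℝ] F)) :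
    pcModel η L p w V = L w * η w.1.1 (fun i => (V i).1.1) +
      ∑ i : Fin (n + 1), (-1 : ℝ) ^ (i : ℕ) *
        η w.1.1 (Fin.cons (p w (contactForm w (V i))) (i.removeNth fun k => (V k).1.1)) := by
  rw [pcModel, ContinuousAlternatingMap.add_apply, ContinuousAlternatingMap.smul_apply,
    ContinuousAlternatingMap.alternatizeUncurryFin_apply]
  congr 1
  refine Finset.sum_congr rfl fun i _ => ?_
  rw [zsmul_eq_mul]
  push_cast
  rfl

/-- The form is built from `dx` and the contact form alone, and neither sees the directions `∂/∂z`.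
-/
theorem pcModel_apply_eq_zero (η : E → E [⋀^Fin (n + 1)]→L[ℝ] ℝ)
    (L : (E × F) × (E →L[ℝ] F) → ℝ) (p : (E × F) × (E →L[ℝ] F) → F →L[ℝ] E)
    (w : (E × F) × (E →L[ℝ] F)) (V : Fin (n + 1) → (E × F) × (E →L[ℝ] F)) (i : Fin (n + 1))
    (h1 : (V i).1.1 = 0) (h2 : (V i).1.2 = 0) : pcModel η L p w V = 0 := by
  rw [pcModel_apply, (η w.1.1).map_coord_zero i h1, mul_zero, zero_add]
  refine Finset.sum_eq_zero fun j _ => ?_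
  by_cases hj : j = i
  · subst hj
    rw [(η w.1.1).map_coord_zero 0 (by simp [h1, h2]), mul_zero]
  · obtain ⟨k, rfl⟩ := Fin.exists_succAbove_eq (Ne.symm hj)
    rw [(η w.1.1).map_coord_zero k.succ (by simp [Fin.removeNth, h1]), mul_zero]

/-- Along a `1`-jet, the derivative of the Poincaré-Cartan form contracted with a vector of the form
`(0, 0, B)` vanishes. -/
theorem extDeriv_pcModel_cons_vertical [FiniteDimensional ℝ E]
    (hE : Module.finrank ℝ E = n + 1) {D : Set ((E × F) × (E →L[ℝ] F))} (hD : IsOpen D)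
    {η : E → E [⋀^Fin (n + 1)]→L[ℝ] ℝ} {L : (E × F) × (E →L[ℝ] F) → ℝ}
    {p : (E × F) × (E →L[ℝ] F) → F →L[ℝ] E}
    {τ : ((E × F) × (E →L[ℝ] F)) → ((E × F) × (E →L[ℝ] F)) [⋀^Fin (n + 1)]→L[ℝ] ℝ}
    (hτ : ContDiffOn ℝ ∞ τ D) (hτpc : ∀ w ∈ D, τ w = pcModel η L p w)
    (hL : ContDiffOn ℝ ∞ L D) (hp : ContDiffOn ℝ ∞ p D)
    (htr : ∀ w ∈ D, ∀ B : E →L[ℝ] F,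
      LinearMap.trace ℝ E ((p w).comp B : E →L[ℝ] E) = fderiv ℝ L w (0, B))
    (hO : IsOpen O) (hu : ContDiffOn ℝ ∞ u O) {x : E} (hx : x ∈ O) (hxD : jetMap u x ∈ D)
    (B : E →L[ℝ] F) (v : Fin (n + 1) → E) :
    extDeriv τ (jetMap u x) (Fin.cons ((0, 0), B) fun i => fderiv ℝ (jetMap u) x (v i)) = 0 := by
  let e : Module.Basis (Fin (n + 1)) ℝ E := Module.finBasisOfFinrankEq ℝ E hE
  suffices h : extDeriv τ (jetMap u x)
      (Fin.cons ((0, 0), B) fun i => fderiv ℝ (jetMap u) x (e i)) = 0 by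
    have h1 : ((extDeriv τ (jetMap u x)).curryLeft ((0, 0), B)).compContinuousLinearMap
        (fderiv ℝ (jetMap u) x) = 0 := alternating_eq_zero_of_basis e _ h
    exact DFunLike.congr_fun h1 v
  have hσ := contDiffOn_jetMap hO hu
  have hvar := extDeriv_cons_variation hD hτ hO hσ
    (W := fun _ => (((0, 0), B) : (E × F) × (E →L[ℝ] F))) contDiffOn_const hx hxD e
  rw [hvar]
  have hσc : ContinuousAt (jetMap u) x := (hσ.continuousOn.continuousAt (hO.mem_nhds hx))
  -- The divergence terms vanish identically near `x`, since the first slot holds a vector `(0, 0,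
  -- B)`.
  have hsum : ∀ j : Fin (n + 1), fderiv ℝ (fun y => (-1 : ℝ) ^ (j : ℕ) *
      τ (jetMap u y) (Fin.cons ((0, 0), B) fun k => fderiv ℝ (jetMap u) y (e (j.succAbove k)))) x
      (e j) = 0 := by
    intro j
    have hev : (fun y => (-1 : ℝ) ^ (j : ℕ) * τ (jetMap u y)
        (Fin.cons ((0, 0), B) fun k => fderiv ℝ (jetMap u) y (e (j.succAbove k)))) =ᶠ[𝓝 x]
        fun _ => 0 := by
      filter_upwards [hσc (hD.mem_nhds hxD)] with y hy
      rw [hτpc _ hy, pcModel_apply_eq_zero _ _ _ _ _ 0 rfl rfl, mul_zero]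
    rw [hev.fderiv_eq]
    simp
  simp only [hsum, Finset.sum_const_zero, sub_zero]
  set σ := jetMap u x with hσx
  set ζ : (E × F) × (E →L[ℝ] F) := ((0, 0), B) with hζ
  have hT : ∀ (ε : ℝ) v, fderiv ℝ (fun y => jetMap u y + ε • ζ) x v =
      ((v, fderiv ℝ u x v), fderiv ℝ (fderiv ℝ u) x v) := by
    intro ε v
    rw [fderiv_add_const, (hasFDerivAt_jetMap hO hu hx).fderiv]
    rfl
  have hline : HasDerivAt (fun ε : ℝ => σ + ε • ζ) ζ 0 := by
    simpa using ((hasDerivAt_id (0 : ℝ)).smul_const ζ).const_add σ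
  have hσ0 : σ + (0 : ℝ) • ζ = σ := by simp
  have hLd : HasDerivAt (fun ε : ℝ => L (σ + ε • ζ)) (fderiv ℝ L σ ζ) 0 := by
    have h1 : HasFDerivAt L (fderiv ℝ L σ) (σ + (0 : ℝ) • ζ) := by
      rw [hσ0]
      exact ((hL.differentiableOn (by simp)).differentiableAt (hD.mem_nhds hxD)).hasFDerivAt
    exact h1.comp_hasDerivAt (0 : ℝ) hline
  -- Moving `A` to `A + ε B` makes the contact form of the tangent vectors equal to `-ε B`, so along
  -- the variation the form is `L η - ε h`.
  set h : ℝ → ℝ := fun ε => ∑ i : Fin (n + 1), (-1 : ℝ) ^ (i : ℕ) *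
    η x (Fin.cons (p (σ + ε • ζ) (B (e i))) (i.removeNth e)) with hh
  have hpd : DifferentiableAt ℝ (fun ε : ℝ => p (σ + ε • ζ)) 0 := by
    have h1 : DifferentiableAt ℝ p (σ + (0 : ℝ) • ζ) := by
      rw [hσ0]
      exact (hp.differentiableOn (by simp)).differentiableAt (hD.mem_nhds hxD)
    exact h1.comp (0 : ℝ) hline.differentiableAt
  have hhd : DifferentiableAt ℝ h 0 := by
    refine DifferentiableAt.fun_sum fun i _ => ?_
    refine DifferentiableAt.const_mul ?_ _
    have h1 : (fun ε : ℝ => η x (Fin.cons (p (σ + ε • ζ) (B (e i))) (i.removeNth e))) =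
        fun ε => ((ContinuousAlternatingMap.apply ℝ E ℝ (i.removeNth e)).comp
          (η x).curryLeft) (p (σ + ε • ζ) (B (e i))) := rfl
    rw [h1]
    exact (ContinuousLinearMap.differentiableAt _).comp (0 : ℝ)
      (hpd.clm_apply (differentiableAt_const _))
  have hev : (fun ε : ℝ => τ (σ + ε • ζ) fun i => fderiv ℝ (fun y => jetMap u y + ε • ζ) x (e i))
      =ᶠ[𝓝 0] fun ε => L (σ + ε • ζ) * η x e - ε * h ε := by
    have hmem : ∀ᶠ ε : ℝ in 𝓝 0, σ + ε • ζ ∈ D :=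
      hline.continuousAt (hD.mem_nhds (by rw [hσ0]; exact hxD))
    filter_upwards [hmem] with ε hε
    rw [hτpc _ hε, pcModel_apply]
    have hbase : (σ + ε • ζ).1.1 = x := by simp [hσx, hζ, jetMap]
    have hcf : ∀ i, contactForm (σ + ε • ζ) (fderiv ℝ (fun y => jetMap u y + ε • ζ) x (e i)) =
        -(ε • B (e i)) := by
      intro i
      rw [hT]
      simp [hσx, hζ, jetMap]
    simp only [hcf]
    simp only [hT, hbase, hh]
    rw [sub_eq_add_neg, Finset.mul_sum, ← Finset.sum_neg_distrib]
    congr 1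
    refine Finset.sum_congr rfl fun i _ => ?_
    have h1 : η x (Fin.cons (p (σ + ε • ζ) (-(ε • B (e i)))) (i.removeNth e)) =
        -(ε * η x (Fin.cons (p (σ + ε • ζ) (B (e i))) (i.removeNth e))) := by
      change (η x).curryLeft _ _ = -(ε * (η x).curryLeft _ _)
      rw [map_neg, map_smul, map_neg, map_smul]
      rfl
    change _ * η x (Fin.cons (p (σ + ε • ζ) (-(ε • B (e i)))) (i.removeNth e)) = _
    rw [h1]
    ring
  have hder : HasDerivAt (fun ε : ℝ => L (σ + ε • ζ) * η x e - ε * h ε)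
      (fderiv ℝ L σ ζ * η x e - (1 * h 0 + 0 * deriv h 0)) 0 :=
    (hLd.mul_const _).sub ((hasDerivAt_id (0 : ℝ)).mul hhd.hasDerivAt)
  rw [hev.deriv_eq, hder.deriv]
  -- By the trace identity and `htr`, `h 0` is the derivative of `L` along `B` times `η`, and
  -- cancels the derivative of the first term. This is what the choice of momenta achieves.
  have h0 : h 0 = LinearMap.trace ℝ E ((p σ).comp B : E →L[ℝ] E) * η x e := by
    rw [← sum_alternating_cons_removeNth e (η x)]
    simp only [hh, hσ0]
    rfl
  rw [h0, htr σ hxD B]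
  have : fderiv ℝ L σ ζ = fderiv ℝ L σ (0, B) := rfl
  rw [this]
  ring

end JetSpaceModel

/-! ### The variational equation along a flow -/

section Variational

variable {E : Type*} [NormedAddCommGroup E] [NormedSpace ℝ E]
  {G : Type*} [NormedAddCommGroup G] [NormedSpace ℝ G]

/-- The spatial derivative of a family of integral curves satisfies the variational equation. -/
theorem hasDerivAt_spatial_fderiv {Q : Set (ℝ × E)} (hQ : IsOpen Q) {p : ℝ × E → G}
    (hp : ContDiffOn ℝ ∞ p Q) {ξ : G → G}
    (hξp : ∀ q ∈ Q, fderiv ℝ p q (1, 0) = ξ (p q)) {t : ℝ} {x : E} (htx : (t, x) ∈ Q)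
    (hξ : DifferentiableAt ℝ ξ (p (t, x))) :
    HasDerivAt (fun s => (fderiv ℝ p (s, x)).comp (ContinuousLinearMap.inr ℝ ℝ E))
      ((fderiv ℝ ξ (p (t, x))).comp ((fderiv ℝ p (t, x)).comp (ContinuousLinearMap.inr ℝ ℝ E)))
      t := by
  have hp' : ContDiffAt ℝ ∞ p (t, x) := hp.contDiffAt (hQ.mem_nhds htx)
  have hd2 : DifferentiableAt ℝ (fderiv ℝ p) (t, x) :=
    ((hp.fderiv_of_isOpen hQ (m := ∞) (by simp)).contDiffAt
      (hQ.mem_nhds htx)).differentiableAt (by simp)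
  have h1 : HasDerivAt (fun s : ℝ => (s, x)) ((1 : ℝ), (0 : E)) t :=
    (hasDerivAt_id t).prodMk (hasDerivAt_const _ _)
  have h2 : HasDerivAt (fun s => fderiv ℝ p (s, x)) (fderiv ℝ (fderiv ℝ p) (t, x) (1, 0)) t :=
    hd2.hasFDerivAt.comp_hasDerivAt t h1
  have h3 := h2.clm_comp (hasDerivAt_const t (ContinuousLinearMap.inr ℝ ℝ E))
  convert! h3 using 1
  refine ContinuousLinearMap.ext fun v => ?_
  -- Mixed derivatives in time and space commute, so differentiating the flow equation in space
  -- gives the equation for the spatial derivative.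
  have hsymm := hp'.isSymmSndFDerivAt minSmoothness_two_le_infty (1, 0) (0, v)
  have h4 : HasFDerivAt (fun q => fderiv ℝ p q (1, 0))
      ((fderiv ℝ (fderiv ℝ p) (t, x)).flip (1, 0)) (t, x) := by
    have := hd2.hasFDerivAt.clm_apply (hasFDerivAt_const ((1 : ℝ), (0 : E)) (t, x))
    simpa using this
  have h5 : (fun q => fderiv ℝ p q (1, 0)) =ᶠ[𝓝 (t, x)] fun q => ξ (p q) := by
    filter_upwards [hQ.mem_nhds htx] with q hq using hξp q hq
  have h6 : HasFDerivAt (fun q => ξ (p q)) ((fderiv ℝ ξ (p (t, x))).comp (fderiv ℝ p (t, x)))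
      (t, x) := hξ.hasFDerivAt.comp (t, x) (hp'.differentiableAt (by simp)).hasFDerivAt
  have h7 := DFunLike.congr_fun (h4.unique (h6.congr_of_eventuallyEq h5)) ((0 : ℝ), v)
  simp only [ContinuousLinearMap.comp_zero, add_zero, ContinuousLinearMap.comp_apply,
    ContinuousLinearMap.inr_apply, ContinuousLinearMap.flip_apply] at h7 ⊢
  rw [← h7]
  simpa using hsymm.symm

/-- In finite dimension a linear map is recovered, continuously and linearly, from its values on a
basis. -/
theorem hasDerivAt_of_forall_apply [FiniteDimensional ℝ E] {f : ℝ → E →L[ℝ] G} {f' : E →L[ℝ] G}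
    {t : ℝ} (hf : ∀ v, HasDerivAt (fun s => f s v) (f' v) t) : HasDerivAt f f' t := by
  let b := Module.finBasis ℝ E
  let T : (Fin (Module.finrank ℝ E) → G) →L[ℝ] E →L[ℝ] G :=
    ∑ i, (ContinuousLinearMap.smulRightL ℝ E G (LinearMap.toContinuousLinearMap (b.coord i))).comp
      (ContinuousLinearMap.proj i)
  have hT : ∀ g : E →L[ℝ] G, T (fun i => g (b i)) = g := by
    intro g
    refine ContinuousLinearMap.coe_injective (b.ext fun j => ?_)
    simp [T, sum_apply, Finsupp.single_apply, ite_smul]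
  have h1 : HasDerivAt (fun s i => f s (b i)) (fun i => f' (b i)) t :=
    hasDerivAt_pi.2 fun i => hf (b i)
  have h2 := T.hasFDerivAt.comp_hasDerivAt t h1
  rw [hT] at h2
  exact h2.congr_of_eventuallyEq (Filter.Eventually.of_forall fun s => (hT (f s)).symm)

theorem hasDerivAt_const_sub_comp_const {V : Type*} [NormedAddCommGroup V] [NormedSpace ℝ V]
    {f : ℝ → E →L[ℝ] G} {f' : E →L[ℝ] G} {t : ℝ} (hf : HasDerivAt f f' t) (A : V →L[ℝ] E)
    (C : V →L[ℝ] G) : HasDerivAt (fun s => C - (f s).comp A) (-(f'.comp A)) t :=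
  (((ContinuousLinearMap.compL ℝ V E G).flip A).hasFDerivAt.comp_hasDerivAt t hf).const_sub C

/-- The derivative of a closed form along a solution of the variational equation. -/
theorem hasDerivAt_closed_form {k : ℕ} {Ω : G → G [⋀^Fin (k + 1)]→L[ℝ] ℝ} {ξ : G → G}
    {q : ℝ → G} {h : ℝ → E →L[ℝ] G} {t : ℝ} (hq : HasDerivAt q (ξ (q t)) t)
    (hh : HasDerivAt h ((fderiv ℝ ξ (q t)).comp (h t)) t)
    (hΩ : DifferentiableAt ℝ Ω (q t)) (hξ : DifferentiableAt ℝ ξ (q t))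
    (hd : extDeriv Ω (q t) = 0) (ζ : G) (v : Fin k → E) :
    HasDerivAt (fun s => Ω (q s) (Fin.cons ζ fun i => h s (v i)))
      (extDeriv (fun w => (Ω w).curryLeft (ξ w)) (q t) (Fin.cons ζ fun i => h t (v i)) -
        Ω (q t) (Fin.cons (fderiv ℝ ξ (q t) ζ) fun i => h t (v i))) t := by
  have hv : ∀ i, HasDerivAt (fun s => h s (v i)) (fderiv ℝ ξ (q t) (h t (v i))) t := by
    intro i
    have := hh.clm_apply (hasDerivAt_const t (v i))
    simpa using this
  have hΩq : HasFDerivAt (fun s => Ω (q s))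
      (ContinuousLinearMap.toSpanSingleton ℝ (fderiv ℝ Ω (q t) (ξ (q t)))) t := by
    have h0 := hΩ.hasFDerivAt.comp t hq.hasFDerivAt
    refine h0.congr_fderiv (ContinuousLinearMap.ext fun r => ?_)
    simp
  let g : Fin (k + 1) → ℝ → G := Fin.cons (fun _ => ζ) fun i s => h s (v i)
  let g' : Fin (k + 1) → G := Fin.cons 0 fun i => fderiv ℝ ξ (q t) (h t (v i))
  have hg : ∀ i, HasFDerivAt (g i) (ContinuousLinearMap.toSpanSingleton ℝ (g' i)) t := by
    intro i
    refine Fin.cases ?_ (fun i => ?_) i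
    · exact (hasDerivAt_const t ζ).hasFDerivAt
    · exact (hv i).hasFDerivAt
  have hgs : ∀ s, (fun i => g i s) = (Fin.cons ζ fun i => h s (v i) : Fin (k + 1) → G) := by
    intro s
    funext i
    refine Fin.cases ?_ (fun i => ?_) i <;> rfl
  have hmain := (HasFDerivAt.continuousAlternatingMap_apply hΩq hg).hasDerivAt
  simp only [hgs] at hmain
  convert! hmain using 1
  -- Cartan's formula has a term with `Dξ ζ` in the first slot. The product rule has none, because
  -- `ζ` is constant; this accounts for the subtracted term.
  rw [cartan_formula_of_closed hΩ hξ hd, Fin.sum_univ_succ]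
  simp only [Fin.cons_zero, Fin.cons_succ, Fin.update_cons_zero]
  simp only [add_apply, ContinuousLinearMap.comp_apply,
    sum_apply, ContinuousLinearMap.toSpanSingleton_apply, one_smul,
    ContinuousAlternatingMap.apply_apply]
  rw [Fin.sum_univ_succ]
  have hz : (Ω (q t)).toContinuousLinearMap (Fin.cons ζ fun i => h t (v i)) 0 (g' 0) = 0 :=
    map_zero _
  rw [hz, zero_add, add_sub_assoc, add_sub_cancel_left]
  rfl

end Variational

/-! ### Propagation of the contact condition and of the Euler-Lagrange equations in coordinates -/

section JetSpaceModel

variable {E : Type*} [NormedAddCommGroup E] [NormedSpace ℝ E]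
  {F : Type*} [NormedAddCommGroup F] [NormedSpace ℝ F]
  {ξ : (E × F) × (E →L[ℝ] F) → (E × F) × (E →L[ℝ] F)} {D : Set ((E × F) × (E →L[ℝ] F))}
  {q : ℝ → (E × F) × (E →L[ℝ] F)} {h : ℝ → E →L[ℝ] (E × F) × (E →L[ℝ] F)} {a b t₁ : ℝ}

/-- The Lie derivative of the contact form in coordinates. -/
def lieContact (ξ : (E × F) × (E →L[ℝ] F) → (E × F) × (E →L[ℝ] F)) (w : (E × F) × (E →L[ℝ] F)) :
    ((E × F) × (E →L[ℝ] F)) →L[ℝ] F :=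
  (contactForm w).comp (fderiv ℝ ξ w) - (ξ w).2.comp (baseProj E F)

theorem hasDerivAt_contactForm {q : ℝ → (E × F) × (E →L[ℝ] F)} {q' : (E × F) × (E →L[ℝ] F)} {t : ℝ}
    (hq : HasDerivAt q q' t) :
    HasDerivAt (fun s => contactForm (q s)) (-q'.2.comp (baseProj E F)) t :=
  hasDerivAt_const_sub_comp_const hq.snd _ _

/-- If the Lie derivative of the contact form along `ξ` vanishes on the kernel of the contact form,
then solutions of the variational equation stay in this kernel. -/
theorem contactForm_comp_eq_zero (hD : IsOpen D) (hξ : ContDiffOn ℝ ∞ ξ D)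
    (hker : ∀ w ∈ D, ∀ v, contactForm w v = 0 → lieContact ξ w v = 0)
    (hq : ∀ t ∈ Ioo a b, HasDerivAt q (ξ (q t)) t) (hqD : ∀ t ∈ Ioo a b, q t ∈ D)
    (hh : ∀ t ∈ Ioo a b, HasDerivAt h ((fderiv ℝ ξ (q t)).comp (h t)) t) (ht₁ : t₁ ∈ Ioo a b)
    (h0 : (contactForm (q t₁)).comp (h t₁) = 0) :
    ∀ t ∈ Ioo a b, (contactForm (q t)).comp (h t) = 0 := by
  -- `J` is a right inverse of the contact form at every point. The derivative of `contactForm (q t)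
  -- ∘ h t` is `lieContact ∘ h t`; as `lieContact` kills the kernel of the contact form, it factors
  -- as `lieContact ∘ J ∘ contactForm`, which closes the equation.
  let J : F →L[ℝ] (E × F) × (E →L[ℝ] F) :=
    (ContinuousLinearMap.inl ℝ (E × F) (E →L[ℝ] F)).comp (ContinuousLinearMap.inr ℝ E F)
  have hqc : ContinuousOn q (Ioo a b) := fun t ht => (hq t ht).continuousAt.continuousWithinAt
  have hξq : ContinuousOn (fun t => ξ (q t)) (Ioo a b) := hξ.continuousOn.comp hqc hqD
  have hDξq : ContinuousOn (fun t => fderiv ℝ ξ (q t)) (Ioo a b) :=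
    (hξ.fderiv_of_isOpen hD (m := ∞) (by simp)).continuousOn.comp hqc hqD
  have hcfq : ContinuousOn (fun t => contactForm (q t)) (Ioo a b) :=
    (contDiff_contactForm (E := E) (F := F) (r := 0)).continuous.comp_continuousOn hqc
  have hlc : ContinuousOn (fun t => lieContact ξ (q t)) (Ioo a b) :=
    (hcfq.clm_comp hDξq).sub
      ((continuous_snd.comp_continuousOn hξq).clm_comp continuousOn_const)
  refine eq_zero_of_hasDerivAt_linear
    (A := fun t => ContinuousLinearMap.compL ℝ E F F ((lieContact ξ (q t)).comp J)) ?_ ?_ ht₁ h0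
  · exact (ContinuousLinearMap.continuous _).comp_continuousOn (hlc.clm_comp continuousOn_const)
  · intro t ht
    have h4 := (hasDerivAt_contactForm (hq t ht)).clm_comp (hh t ht)
    refine HasDerivAt.congr_deriv h4 ?_
    symm
    refine ContinuousLinearMap.ext fun v => ?_
    have h5 := hker (q t) (hqD t ht) (h t v - J (contactForm (q t) (h t v))) (by simp [J])
    rw [map_sub, sub_eq_zero] at h5
    have h6 : lieContact ξ (q t) (h t v) = contactForm (q t) (fderiv ℝ ξ (q t) (h t v)) -
      (ξ (q t)).2 (baseProj E F (h t v)) := rfl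
    rw [h6] at h5
    change lieContact ξ (q t) (J (contactForm (q t) (h t v))) =
      -(ξ (q t)).2 (baseProj E F (h t v)) + contactForm (q t) (fderiv ℝ ξ (q t) (h t v))
    rw [← h5]
    abel

variable {n : ℕ}

/-- A contact vector differs from a tangent vector `T c` with the same base part by some `(0, 0,
B)`. The vector `T c` contributes nothing either, since it makes `n + 2` arguments from a space of
dimension `n + 1`. -/
theorem form_cons_eq_zero_of_contactForm_eq_zero [FiniteDimensional ℝ E]
    (hE : Module.finrank ℝ E = n + 1)
    (a : ((E × F) × (E →L[ℝ] F)) [⋀^Fin (n + 2)]→L[ℝ] ℝ) {w : (E × F) × (E →L[ℝ] F)}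
    {T : E →L[ℝ] (E × F) × (E →L[ℝ] F)} (hT : (contactForm w).comp T = 0)
    (hsurj : Surjective fun v => (T v).1.1)
    (hvert : ∀ (B : E →L[ℝ] F) (v : Fin (n + 1) → E), a (Fin.cons ((0, 0), B) fun i => T (v i)) = 0)
    (ζ : (E × F) × (E →L[ℝ] F)) (hζ : contactForm w ζ = 0) (v : Fin (n + 1) → E) :
    a (Fin.cons ζ fun i => T (v i)) = 0 := by
  obtain ⟨c, hc⟩ := hsurj ζ.1.1
  have h1 : a (Fin.cons (T c) fun i => T (v i)) = 0 := by
    have h2 := alternating_apply_eq_zero_of_finrank_lt (N := n + 2) (by omega)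
      (a.compContinuousLinearMap T) (Fin.cons c v)
    rw [ContinuousAlternatingMap.compContinuousLinearMap_apply] at h2
    rw [← h2]
    congr 1
    funext i
    refine Fin.cases ?_ (fun i => ?_) i <;> rfl
  have h3 : ζ - T c = ((0, 0), ζ.2 - (T c).2) := by
    have h4 : contactForm w (ζ - T c) = 0 := by
      have : contactForm w (T c) = 0 := DFunLike.congr_fun hT c
      rw [map_sub, hζ, this, sub_zero]
    have h5 : (ζ - T c).1.1 = 0 := by
      have : (T c).1.1 = ζ.1.1 := hc
      simp [this]
    refine Prod.ext (Prod.ext h5 ?_) rfl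
    rw [contactForm_apply, h5, map_zero, sub_zero] at h4
    exact h4
  have h6 : a (Fin.cons ζ fun i => T (v i)) =
      a (Fin.cons (ζ - T c) fun i => T (v i)) + a (Fin.cons (T c) fun i => T (v i)) := by
    rw [← a.cons_add, sub_add_cancel]
  rw [h6, h1, add_zero, h3]
  exact hvert _ v

variable {Ω : (E × F) × (E →L[ℝ] F) → ((E × F) × (E →L[ℝ] F)) [⋀^Fin (n + 2)]→L[ℝ] ℝ}

/-- The identity `hvert` holds at all times, so its time derivative vanishes. The correction term `Ω
(Dξ ζ, …)` vanishes as well: for `ζ = (0, 0, B)` the hypothesis `hker` puts `Dξ ζ` into the kernel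
of the contact form. -/
theorem extDeriv_contract_vertical [FiniteDimensional ℝ E] (hE : Module.finrank ℝ E = n + 1)
    (hD : IsOpen D) (hξ : ContDiffOn ℝ ∞ ξ D) (hΩ : ContDiffOn ℝ ∞ Ω D)
    (hΩd : ∀ w ∈ D, extDeriv Ω w = 0)
    (hker : ∀ w ∈ D, ∀ v, contactForm w v = 0 → lieContact ξ w v = 0)
    (hq : ∀ t ∈ Ioo a b, HasDerivAt q (ξ (q t)) t) (hqD : ∀ t ∈ Ioo a b, q t ∈ D)
    (hh : ∀ t ∈ Ioo a b, HasDerivAt h ((fderiv ℝ ξ (q t)).comp (h t)) t)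
    (hcf : ∀ t ∈ Ioo a b, (contactForm (q t)).comp (h t) = 0)
    (hsurj : ∀ t ∈ Ioo a b, Surjective fun v => (h t v).1.1)
    (hvert : ∀ t ∈ Ioo a b, ∀ (B : E →L[ℝ] F) (v : Fin (n + 1) → E),
      Ω (q t) (Fin.cons ((0, 0), B) fun i => h t (v i)) = 0)
    {t : ℝ} (ht : t ∈ Ioo a b) (B : E →L[ℝ] F) (v : Fin (n + 1) → E) :
    extDeriv (fun w => (Ω w).curryLeft (ξ w)) (q t)
      (Fin.cons ((0, 0), B) fun i => h t (v i)) = 0 := by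
  have h1 := hasDerivAt_closed_form (hq t ht) (hh t ht)
    ((hΩ.differentiableOn (by simp)).differentiableAt (hD.mem_nhds (hqD t ht)))
    ((hξ.differentiableOn (by simp)).differentiableAt (hD.mem_nhds (hqD t ht)))
    (hΩd _ (hqD t ht)) ((0, 0), B) v
  have h2 : (fun s => Ω (q s) (Fin.cons ((0, 0), B) fun i => h s (v i))) =ᶠ[𝓝 t] fun _ => 0 := by
    filter_upwards [Ioo_mem_nhds ht.1 ht.2] with s hs using hvert s hs B v
  have h3 := h1.unique ((hasDerivAt_const t (0 : ℝ)).congr_of_eventuallyEq h2)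
  have h4 := hker (q t) (hqD t ht) ((0, 0), B) (by simp)
  have h5 : contactForm (q t) (fderiv ℝ ξ (q t) ((0, 0), B)) = 0 := by
    have : lieContact ξ (q t) ((0, 0), B) = contactForm (q t) (fderiv ℝ ξ (q t) ((0, 0), B)) -
      (ξ (q t)).2 0 := rfl
    rw [this, map_zero, sub_zero] at h4
    exact h4
  rw [form_cons_eq_zero_of_contactForm_eq_zero hE _ (hcf t ht) (hsurj t ht) (hvert t ht) _ h5,
    sub_zero] at h3
  exact h3

/-- Propagation of the Euler-Lagrange equations along the flow, in coordinates. -/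
theorem form_cons_eq_zero_of_propagation [FiniteDimensional ℝ E] [FiniteDimensional ℝ F]
    (hE : Module.finrank ℝ E = n + 1)
    (hD : IsOpen D) (hξ : ContDiffOn ℝ ∞ ξ D) (hΩ : ContDiffOn ℝ ∞ Ω D)
    (hΩd : ∀ w ∈ D, extDeriv Ω w = 0)
    (hq : ∀ t ∈ Ioo a b, HasDerivAt q (ξ (q t)) t) (hqD : ∀ t ∈ Ioo a b, q t ∈ D)
    (hh : ∀ t ∈ Ioo a b, HasDerivAt h ((fderiv ℝ ξ (q t)).comp (h t)) t)
    (hcf : ∀ t ∈ Ioo a b, (contactForm (q t)).comp (h t) = 0)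
    (hsurj : ∀ t ∈ Ioo a b, Surjective fun v => (h t v).1.1)
    (hvert : ∀ t ∈ Ioo a b, ∀ (B : E →L[ℝ] F) (v : Fin (n + 1) → E),
      Ω (q t) (Fin.cons ((0, 0), B) fun i => h t (v i)) = 0)
    (hnull : ∀ t ∈ Ioo a b, ∀ (V : F) (v : Fin (n + 1) → E),
      extDeriv (fun w => (Ω w).curryLeft (ξ w)) (q t)
        (Fin.cons ((0, V), 0) fun i => h t (v i)) = 0)
    (ht₁ : t₁ ∈ Ioo a b)
    (h0 : ∀ ζ (v : Fin (n + 1) → E), Ω (q t₁) (Fin.cons ζ fun i => h t₁ (v i)) = 0) :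
    ∀ t ∈ Ioo a b, ∀ ζ (v : Fin (n + 1) → E), Ω (q t) (Fin.cons ζ fun i => h t (v i)) = 0 := by
  let J : F →L[ℝ] (E × F) × (E →L[ℝ] F) :=
    (ContinuousLinearMap.inl ℝ (E × F) (E →L[ℝ] F)).comp (ContinuousLinearMap.inr ℝ E F)
  -- Contact vectors give zero, so only the part `J (θ ζ)` of `ζ` counts and the unknown is a
  -- covector on `F`.
  have hdec : ∀ t ∈ Ioo a b, ∀ ζ (v : Fin (n + 1) → E), Ω (q t) (Fin.cons ζ fun i => h t (v i)) =
      Ω (q t) (Fin.cons (J (contactForm (q t) ζ)) fun i => h t (v i)) := by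
    intro t ht ζ v
    have h1 := form_cons_eq_zero_of_contactForm_eq_zero hE (Ω (q t)) (hcf t ht) (hsurj t ht)
      (hvert t ht) (ζ - J (contactForm (q t) ζ)) (by simp [J]) v
    have h2 := (Ω (q t)).cons_add (fun i => h t (v i)) (ζ - J (contactForm (q t) ζ))
      (J (contactForm (q t) ζ))
    rw [h1, sub_add_cancel, zero_add] at h2
    exact h2
  suffices hmain : ∀ v : Fin (n + 1) → E, ∀ t ∈ Ioo a b,
      ((ContinuousAlternatingMap.apply ℝ _ ℝ (fun i => h t (v i))).comp
        (Ω (q t)).curryLeft).comp J = 0 by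
    intro t ht ζ v
    rw [hdec t ht]
    exact DFunLike.congr_fun (hmain v t ht) _
  intro v
  have hqc : ContinuousOn q (Ioo a b) := fun t ht => (hq t ht).continuousAt.continuousWithinAt
  have hDξq : ContinuousOn (fun t => fderiv ℝ ξ (q t)) (Ioo a b) :=
    (hξ.fderiv_of_isOpen hD (m := ∞) (by simp)).continuousOn.comp hqc hqD
  have hcfq : ContinuousOn (fun t => contactForm (q t)) (Ioo a b) :=
    (contDiff_contactForm (E := E) (F := F) (r := 0)).continuous.comp_continuousOn hqc
  -- By `hnull` the derivative of `Ω (J V, T v)` is `-Ω (Dξ J V, T v)`, and `hdec` rewrites this as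
  -- the same covector at `Λ t V`.
  let Λ : ℝ → F →L[ℝ] F := fun t => -((contactForm (q t)).comp ((fderiv ℝ ξ (q t)).comp J))
  have hΛ : ContinuousOn Λ (Ioo a b) :=
    (hcfq.clm_comp (hDξq.clm_comp continuousOn_const)).neg
  refine eq_zero_of_hasDerivAt_linear (t₁ := t₁)
    (A := fun t => (ContinuousLinearMap.compL ℝ F F ℝ).flip (Λ t)) ?_ ?_ ht₁ ?_
  · exact (ContinuousLinearMap.continuous _).comp_continuousOn hΛ
  · intro t ht
    have hpt : ∀ V : F, HasDerivAt (fun s => (((ContinuousAlternatingMap.apply ℝ _ ℝ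
        (fun i => h s (v i))).comp (Ω (q s)).curryLeft).comp J) V)
        (((ContinuousLinearMap.compL ℝ F F ℝ).flip (Λ t)
          (((ContinuousAlternatingMap.apply ℝ _ ℝ (fun i => h t (v i))).comp
            (Ω (q t)).curryLeft).comp J)) V) t := by
      intro V
      have h1 := hasDerivAt_closed_form (hq t ht) (hh t ht)
        ((hΩ.differentiableOn (by simp)).differentiableAt (hD.mem_nhds (hqD t ht)))
        ((hξ.differentiableOn (by simp)).differentiableAt (hD.mem_nhds (hqD t ht)))
        (hΩd _ (hqD t ht)) ((0, V), 0) v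
      rw [hnull t ht, zero_sub, hdec t ht] at h1
      convert! h1 using 1
      change Ω (q t) (Fin.cons (J (-contactForm (q t) (fderiv ℝ ξ (q t) (J V)))) _) =
        -Ω (q t) (Fin.cons (J (contactForm (q t) (fderiv ℝ ξ (q t) (J V)))) _)
      change (Ω (q t)).curryLeft _ _ = -(Ω (q t)).curryLeft _ _
      rw [map_neg, map_neg]
      rfl
    exact hasDerivAt_of_forall_apply hpt
  · refine ContinuousLinearMap.ext fun V => ?_
    exact h0 _ v

end JetSpaceModel

/-! ### Differential forms and vector fields in charts -/

section ChartForms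

variable {E : Type*} [NormedAddCommGroup E] [NormedSpace ℝ E] {H : Type*} [TopologicalSpace H]
  {I : ModelWithCorners ℝ E H} {M : Type*} [TopologicalSpace M] [ChartedSpace H M]
  {k : ℕ} {τ υ : Form I M k} {x₀ x₁ : M} {u : E}

theorem tmap_extChartAt_self [IsManifold I 1 M] (x : M) :
    tmap I 𝓘(ℝ, E) (extChartAt I x) x = .id ℝ E :=
  mfderiv_extChartAt_self

/-- The value of a form, as an alternating map on the model space. -/
def formAt (τ : Form I M k) (y : M) : E [⋀^Fin k]→L[ℝ] ℝ := τ y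

/-- The derivative of the inverse of the preferred chart at `x₀`. -/
def tmapSymm (I : ModelWithCorners ℝ E H) (x₀ : M) (u : E) : E →L[ℝ] E :=
  mfderivWithin 𝓘(ℝ, E) I (extChartAt I x₀).symm (range I) u

theorem chartRep_eq (τ : Form I M k) (x₀ : M) (u : E) : chartRep I τ x₀ u =
    (formAt τ ((extChartAt I x₀).symm u)).compContinuousLinearMap (tmapSymm I x₀ u) := rfl

theorem tmapSymm_tmap [IsManifold I 1 M] {y : M} (hy : y ∈ (extChartAt I x₀).source) (v : E) :
    tmapSymm I x₀ (extChartAt I x₀ y) (tmap I 𝓘(ℝ, E) (extChartAt I x₀) y v) = v :=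
  DFunLike.congr_fun (mfderivWithin_extChartAt_symm_comp_mfderiv_extChartAt' (I := I) hy) v

theorem tmap_tmapSymm [IsManifold I 1 M] (hu : u ∈ (extChartAt I x₀).target) (v : E) :
    tmap I 𝓘(ℝ, E) (extChartAt I x₀) ((extChartAt I x₀).symm u) (tmapSymm I x₀ u v) = v :=
  DFunLike.congr_fun (mfderiv_extChartAt_comp_mfderivWithin_extChartAt_symm (I := I) hu) v

theorem formAt_eq_chartRep [IsManifold I 1 M] (τ : Form I M k) {y : M}
    (hy : y ∈ (extChartAt I x₀).source) (v : Fin k → E) :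
    formAt τ y v = chartRep I τ x₀ (extChartAt I x₀ y)
      (fun i => tmap I 𝓘(ℝ, E) (extChartAt I x₀) y (v i)) := by
  rw [chartRep_eq, ContinuousAlternatingMap.compContinuousLinearMap_apply,
    (extChartAt I x₀).left_inv hy]
  congr 1
  funext i
  exact (tmapSymm_tmap hy (v i)).symm

theorem tmap_comp_tmapSymm [IsManifold I 1 M] (hu : u ∈ (extChartAt I x₀).target)
    (hu₁ : (extChartAt I x₀).symm u ∈ (extChartAt I x₁).source) :
    (tmap I 𝓘(ℝ, E) (extChartAt I x₁) ((extChartAt I x₀).symm u)).comp (tmapSymm I x₀ u) =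
    fderivWithin ℝ (extChartAt I x₁ ∘ (extChartAt I x₀).symm) (range I) u := by
  have hU : UniqueMDiffWithinAt 𝓘(ℝ, E) (range I) u :=
    I.uniqueMDiffOn u (extChartAt_target_subset_range x₀ hu)
  rw [← mfderivWithin_eq_fderivWithin]
  rw [mfderiv_comp_mfderivWithin (I' := I) u
    (mdifferentiableAt_extChartAt (by rwa [← extChartAt_source (I := I)]))
    (mdifferentiableWithinAt_extChartAt_symm hu) hU]
  rfl

theorem chartRep_eq_transition [IsManifold I 1 M] (τ : Form I M k)
    (hu : u ∈ (extChartAt I x₀).target)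
    (hu₁ : (extChartAt I x₀).symm u ∈ (extChartAt I x₁).source) :
    chartRep I τ x₀ u =
      (chartRep I τ x₁ (extChartAt I x₁ ((extChartAt I x₀).symm u))).compContinuousLinearMap
      (fderivWithin ℝ (extChartAt I x₁ ∘ (extChartAt I x₀).symm) (range I) u) := by
  refine ContinuousAlternatingMap.ext fun v => ?_
  rw [chartRep_eq, ContinuousAlternatingMap.compContinuousLinearMap_apply,
    formAt_eq_chartRep τ hu₁, ← tmap_comp_tmapSymm hu hu₁]
  rfl

theorem IsSmoothForm.contDiffWithinAt (hτ : IsSmoothForm I τ)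
    (hu : u ∈ (extChartAt I x₀).target) :
    ContDiffWithinAt ℝ ∞ (chartRep I τ x₀) (range I) u :=
  (hτ x₀ u hu).mono_of_mem_nhdsWithin (extChartAt_target_mem_nhdsWithin_of_mem hu)

theorem isSmoothForm_of_contDiffWithinAt
    (h : ∀ x₀ : M, ∀ u ∈ (extChartAt I x₀).target,
      ContDiffWithinAt ℝ ∞ (chartRep I τ x₀) (range I) u) : IsSmoothForm I τ :=
  fun x₀ u hu => (h x₀ u hu).mono (extChartAt_target_subset_range x₀)

theorem eventually_mem_target_of_mem (hu : u ∈ (extChartAt I x₀).target)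
    (hu₁ : (extChartAt I x₀).symm u ∈ (extChartAt I x₁).source) :
    ∀ᶠ w in 𝓝[range I] u, w ∈ (extChartAt I x₀).target ∧
      (extChartAt I x₀).symm w ∈ (extChartAt I x₁).source := by
  have h1 := (continuousAt_extChartAt_symm'' hu).continuousWithinAt (s := range I)
  filter_upwards [extChartAt_target_mem_nhdsWithin_of_mem hu,
    h1.preimage_mem_nhdsWithin ((isOpen_extChartAt_source x₁).mem_nhds hu₁)] with w hw hw'
  exact ⟨hw, hw'⟩

theorem IsSmoothForm.add (hτ : IsSmoothForm I τ) (hυ : IsSmoothForm I υ) :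
    IsSmoothForm I (τ + υ) := fun x₀ => (hτ x₀).add (hυ x₀)

theorem IsSmoothForm.neg (hτ : IsSmoothForm I τ) : IsSmoothForm I (-τ) := fun x₀ => (hτ x₀).neg

theorem IsSmoothForm.sub (hτ : IsSmoothForm I τ) (hυ : IsSmoothForm I υ) :
    IsSmoothForm I (τ - υ) := fun x₀ => (hτ x₀).sub (hυ x₀)

variable [IsManifold I ∞ M]

theorem contDiffWithinAt_transition (hu : u ∈ (extChartAt I x₀).target)
    (hu₁ : (extChartAt I x₀).symm u ∈ (extChartAt I x₁).source) :
    ContDiffWithinAt ℝ ∞ (extChartAt I x₁ ∘ (extChartAt I x₀).symm) (range I) u :=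
  contDiffWithinAt_ext_coord_change x₁ x₀ (by simpa using! And.intro hu hu₁)

theorem mem_closure_interior_range (hu : u ∈ range I) : u ∈ closure (interior (range I)) :=
  I.range_subset_closure_interior hu

/-- `extD` is computed at each point in the chart of that very point. Naturality of the exterior
derivative under transition maps shows that a single chart gives the same result. -/
theorem chartRep_extD (hτ : IsSmoothForm I τ) (hu : u ∈ (extChartAt I x₀).target) :
    chartRep I (extD I τ) x₀ u = extDerivWithin (chartRep I τ x₀) (range I) u := by
  have : IsManifold I 1 M := IsManifold.of_le (n := ∞) (by simp)
  set x := (extChartAt I x₀).symm u with hx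
  have hxs : (extChartAt I x₀).symm u ∈ (extChartAt I x).source := mem_extChartAt_source x
  have huR := extChartAt_target_subset_range x₀ hu
  have h1 : chartRep I τ x₀ =ᶠ[𝓝[range I] u] fun w =>
      (chartRep I τ x ((extChartAt I x ∘ (extChartAt I x₀).symm) w)).compContinuousLinearMap
        (fderivWithin ℝ (extChartAt I x ∘ (extChartAt I x₀).symm) (range I) w) := by
    filter_upwards [eventually_mem_target_of_mem hu hxs] with w hw
    exact chartRep_eq_transition τ hw.1 hw.2
  rw [h1.extDerivWithin_eq_of_mem huR]
  rw [extDerivWithin_pullback (f := extChartAt I x ∘ (extChartAt I x₀).symm) (t := range I) (r := ∞)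
    ((hτ.contDiffWithinAt (mem_extChartAt_target x)).differentiableWithinAt (by simp))
    (contDiffWithinAt_transition hu hxs) minSmoothness_two_le_infty I.uniqueDiffOn
    (mem_closure_interior_range huR) huR (fun w _ => mem_range_self _)]
  rw [← tmap_comp_tmapSymm hu hxs]
  rfl

theorem IsSmoothForm.extD (hτ : IsSmoothForm I τ) : IsSmoothForm I (extD I τ) := by
  refine isSmoothForm_of_contDiffWithinAt fun x₀ u hu => ?_
  have huR := extChartAt_target_subset_range x₀ hu
  have h1 : ContDiffWithinAt ℝ ∞ (fderivWithin ℝ (chartRep I τ x₀) (range I)) (range I) u :=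
    (hτ.contDiffWithinAt hu).fderivWithin_right I.uniqueDiffOn (by simp) huR
  have hA : ContDiff ℝ ∞ fun a : E →L[ℝ] E [⋀^Fin k]→L[ℝ] ℝ =>
      ContinuousAlternatingMap.alternatizeUncurryFin a :=
    ContinuousLinearMap.contDiff (𝕜 := ℝ) (E := E →L[ℝ] E [⋀^Fin k]→L[ℝ] ℝ)
      (F := E [⋀^Fin (k + 1)]→L[ℝ] ℝ) (n := ∞)
      (ContinuousAlternatingMap.alternatizeUncurryFinCLM ℝ E ℝ)
  have h2 : ContDiffWithinAt ℝ ∞ (extDerivWithin (chartRep I τ x₀) (range I)) (range I) u :=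
    hA.comp_contDiffWithinAt h1
  refine h2.congr_of_eventuallyEq_of_mem ?_ huR
  filter_upwards [extChartAt_target_mem_nhdsWithin_of_mem hu] with w hw
  exact chartRep_extD hτ hw

/-- A vector field in the preferred chart at `x₀`. -/
def fieldRep (ξ : (x : M) → TangentSpace I x) (x₀ : M) (u : E) : E :=
  tmap I 𝓘(ℝ, E) (extChartAt I x₀) ((extChartAt I x₀).symm u) (ξ ((extChartAt I x₀).symm u))

/-- The representation is the fibre component of `ξ` in the trivialization of the tangent bundle at
`x₀`, composed with the inverse chart. -/
theorem contDiffWithinAt_fieldRep [IsManifold I 1 M] {ξ : (x : M) → TangentSpace I x}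
    (hξ : IsSmoothField I ξ)
    (hu : u ∈ (extChartAt I x₀).target) : ContDiffWithinAt ℝ ∞ (fieldRep ξ x₀) (range I) u := by
  have hx : (extChartAt I x₀).symm u ∈ (chartAt H x₀).source := by
    rw [← extChartAt_source (I := I)]
    exact (extChartAt I x₀).map_target hu
  have h1 := ((trivializationAt E (TangentSpace I) x₀).contMDiffAt_section_iff (IB := I) (n := ∞)
    (s := ξ) (x₀ := (extChartAt I x₀).symm u) hx).1 (hξ _)
  have h2 : ContMDiffWithinAt 𝓘(ℝ, E) I ∞ (extChartAt I x₀).symm (range I) u :=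
    contMDiffWithinAt_extChartAt_symm_range x₀ hu
  have h3 := h1.comp_contMDiffWithinAt u h2
  refine ContDiffWithinAt.congr_of_eventuallyEq_of_mem h3.contDiffWithinAt ?_
    (extChartAt_target_subset_range x₀ hu)
  filter_upwards [extChartAt_target_mem_nhdsWithin_of_mem hu] with w hw
  have hw' : (extChartAt I x₀).symm w ∈ (chartAt H x₀).source := by
    rw [← extChartAt_source (I := I)]
    exact (extChartAt I x₀).map_target hw
  have h4 := TangentBundle.continuousLinearMapAt_trivializationAt (I := I) hw'
  change mfderiv I 𝓘(ℝ, E) (extChartAt I x₀) ((extChartAt I x₀).symm w) _ = _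
  rw [← h4]
  exact (trivializationAt E (TangentSpace I) x₀).continuousLinearMapAt_apply_of_mem ℝ hw' _

omit [IsManifold I ∞ M] in
theorem tmapSymm_fieldRep [IsManifold I 1 M] (ξ : (x : M) → TangentSpace I x)
    (hu : u ∈ (extChartAt I x₀).target) :
    tmapSymm I x₀ u (fieldRep ξ x₀ u) = ξ ((extChartAt I x₀).symm u) := by
  have h := tmapSymm_tmap (I := I) ((extChartAt I x₀).map_target hu)
    (ξ ((extChartAt I x₀).symm u))
  rwa [(extChartAt I x₀).right_inv hu] at h

omit [IsManifold I ∞ M] in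
theorem chartRep_contract [IsManifold I 1 M] (ξ : (x : M) → TangentSpace I x)
    (τ : Form I M (k + 1)) (hu : u ∈ (extChartAt I x₀).target) :
    chartRep I (contract I ξ τ) x₀ u = (chartRep I τ x₀ u).curryLeft (fieldRep ξ x₀ u) := by
  refine ContinuousAlternatingMap.ext fun v => ?_
  change formAt τ ((extChartAt I x₀).symm u) (Fin.cons (ξ ((extChartAt I x₀).symm u) : E)
    fun i => tmapSymm I x₀ u (v i)) = formAt τ ((extChartAt I x₀).symm u)
      (fun i => tmapSymm I x₀ u ((Fin.cons (fieldRep ξ x₀ u) v : Fin (k + 1) → E) i))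
  congr 1
  funext i
  refine Fin.cases ?_ (fun i => ?_) i
  · exact (tmapSymm_fieldRep ξ hu).symm
  · rfl

theorem IsSmoothForm.contract [IsManifold I 1 M] {ξ : (x : M) → TangentSpace I x}
    (hξ : IsSmoothField I ξ) {τ : Form I M (k + 1)} (hτ : IsSmoothForm I τ) :
    IsSmoothForm I (contract I ξ τ) := by
  refine isSmoothForm_of_contDiffWithinAt fun x₀ u hu => ?_
  have h1 : ContDiffWithinAt ℝ ∞ (fun w => (chartRep I τ x₀ w).curryLeft) (range I) u :=
    contDiff_curryLeft.comp_contDiffWithinAt (hτ.contDiffWithinAt hu)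
  refine (h1.clm_apply (contDiffWithinAt_fieldRep hξ hu)).congr_of_eventuallyEq_of_mem ?_
    (extChartAt_target_subset_range x₀ hu)
  filter_upwards [extChartAt_target_mem_nhdsWithin_of_mem hu] with w hw
  exact chartRep_contract ξ τ hw

theorem IsSmoothForm.lieD [IsManifold I 1 M] {ξ : (x : M) → TangentSpace I x}
    (hξ : IsSmoothField I ξ) {τ : Form I M (k + 1)} (hτ : IsSmoothForm I τ) :
    IsSmoothForm I (lieD I ξ τ) :=
  (hτ.contract hξ).extD.add (hτ.extD.contract hξ)

/-- The part of the model space covered by the interior of the preferred chart at `x₀`. -/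
def chartDomain (I : ModelWithCorners ℝ E H) (x₀ : M) : Set E := interior (extChartAt I x₀).target

omit [IsManifold I ∞ M] in
theorem isOpen_chartDomain (x₀ : M) : IsOpen (chartDomain I x₀) := isOpen_interior

omit [IsManifold I ∞ M] in
theorem chartDomain_subset (x₀ : M) : chartDomain I x₀ ⊆ (extChartAt I x₀).target :=
  interior_subset

omit [IsManifold I ∞ M] in
theorem range_mem_nhds (hu : u ∈ chartDomain I x₀) : range I ∈ 𝓝 u :=
  Filter.mem_of_superset (mem_interior_iff_mem_nhds.1 hu) (extChartAt_target_subset_range x₀)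

theorem extDerivWithin_of_mem_nhds {f : E → E [⋀^Fin k]→L[ℝ] ℝ} {s : Set E} (hs : s ∈ 𝓝 u) :
    extDerivWithin f s u = extDeriv f u := by
  rw [extDerivWithin, extDeriv, fderivWithin_of_mem_nhds hs]

omit [IsManifold I ∞ M] in
theorem IsSmoothForm.contDiffOn (hτ : IsSmoothForm I τ) (x₀ : M) :
    ContDiffOn ℝ ∞ (chartRep I τ x₀) (chartDomain I x₀) := (hτ x₀).mono (chartDomain_subset x₀)

theorem contDiffOn_fieldRep [IsManifold I 1 M] {ξ : (x : M) → TangentSpace I x}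
    (hξ : IsSmoothField I ξ) (x₀ : M) : ContDiffOn ℝ ∞ (fieldRep ξ x₀) (chartDomain I x₀) :=
  fun _ hu => (contDiffWithinAt_fieldRep hξ (chartDomain_subset x₀ hu)).mono
    ((chartDomain_subset x₀).trans (extChartAt_target_subset_range x₀))

theorem chartRep_extD_of_mem_chartDomain (hτ : IsSmoothForm I τ) (hu : u ∈ chartDomain I x₀) :
    chartRep I (FieldTheory.extD I τ) x₀ u = extDeriv (chartRep I τ x₀) u := by
  rw [chartRep_extD hτ (chartDomain_subset x₀ hu), extDerivWithin_of_mem_nhds (range_mem_nhds hu)]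

theorem chartRep_lieD_of_mem_chartDomain [IsManifold I 1 M] {ξ : (x : M) → TangentSpace I x}
    (hξ : IsSmoothField I ξ) {τ : Form I M (k + 1)} (hτ : IsSmoothForm I τ)
    (hu : u ∈ chartDomain I x₀) :
    chartRep I (FieldTheory.lieD I ξ τ) x₀ u =
      extDeriv (fun w => (chartRep I τ x₀ w).curryLeft (fieldRep ξ x₀ w)) u +
      (extDeriv (chartRep I τ x₀) u).curryLeft (fieldRep ξ x₀ u) := by
  change chartRep I (FieldTheory.extD I (FieldTheory.contract I ξ τ)) x₀ u +
    chartRep I (FieldTheory.contract I ξ (FieldTheory.extD I τ)) x₀ u = _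
  rw [chartRep_extD_of_mem_chartDomain (hτ.contract hξ) hu,
    chartRep_contract ξ _ (chartDomain_subset x₀ hu), chartRep_extD_of_mem_chartDomain hτ hu]
  congr 1
  refine Filter.EventuallyEq.extDeriv_eq ?_
  filter_upwards [(isOpen_chartDomain x₀).mem_nhds hu] with w hw
  exact chartRep_contract ξ τ (chartDomain_subset x₀ hw)

theorem isInteriorPoint_iff_mem_chartDomain {y : M} (hy : y ∈ (extChartAt I x₀).source) :
    I.IsInteriorPoint y ↔ extChartAt I x₀ y ∈ chartDomain I x₀ :=
  I.isInteriorPoint_iff_of_mem_atlas (n := ∞) (by simp) (chart_mem_atlas H x₀)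
    (by rwa [← extChartAt_source (I := I)])

omit [IsManifold I ∞ M] in
theorem mem_chartDomain_of_mem_interior_range (hu : u ∈ (extChartAt I x₀).target)
    (hu' : u ∈ interior (range I)) : u ∈ chartDomain I x₀ := by
  obtain ⟨h, rfl⟩ := extChartAt_target_subset_range x₀ hu
  refine (chartAt H x₀).mem_interior_extend_target ?_ hu'
  rw [extChartAt_target, mem_inter_iff, mem_preimage, I.left_inv] at hu
  exact hu.1

theorem isInteriorPoint_symm (hu : u ∈ chartDomain I x₀) :
    I.IsInteriorPoint ((extChartAt I x₀).symm u) := by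
  have h := chartDomain_subset x₀ hu
  rw [isInteriorPoint_iff_mem_chartDomain ((extChartAt I x₀).map_target h),
    (extChartAt I x₀).right_inv h]
  exact hu

end ChartForms

/-! ### Pullbacks in charts, and passage from interior points to the boundary -/

section Pullback

variable {E : Type*} [NormedAddCommGroup E] [NormedSpace ℝ E] {H : Type*} [TopologicalSpace H]
  {I : ModelWithCorners ℝ E H} {M : Type*} [TopologicalSpace M] [ChartedSpace H M]
  {E' : Type*} [NormedAddCommGroup E'] [NormedSpace ℝ E'] {H' : Type*} [TopologicalSpace H']
  {I' : ModelWithCorners ℝ E' H'} {M' : Type*} [TopologicalSpace M'] [ChartedSpace H' M']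
  {E'' : Type*} [NormedAddCommGroup E''] [NormedSpace ℝ E''] {H'' : Type*} [TopologicalSpace H'']
  {I'' : ModelWithCorners ℝ E'' H''} {M'' : Type*} [TopologicalSpace M''] [ChartedSpace H'' M'']
  {k : ℕ} {f : M → M'} {U : Set M} {x₀ : M} {x₁ : M'} {u : E}

theorem tmap_comp {g : M' → M''} {x : M} (hg : MDifferentiableAt I' I'' g (f x))
    (hf : MDifferentiableAt I I' f x) :
    tmap I I'' (g ∘ f) x = (tmap I' I'' g (f x)).comp (tmap I I' f x) :=
  mfderiv_comp x hg hf

theorem tmap_congr {f g : M → M'} {x : M} (h : f =ᶠ[𝓝 x] g) : tmap I I' f x = tmap I I' g x :=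
  h.mfderiv_eq

/-- The map `f` in the preferred charts at `x₀` and `x₁`. -/
def mapRep (I : ModelWithCorners ℝ E H) (I' : ModelWithCorners ℝ E' H') (f : M → M') (x₀ : M)
    (x₁ : M') : E → E' := extChartAt I' x₁ ∘ f ∘ (extChartAt I x₀).symm

variable [IsManifold I 1 M] [IsManifold I' 1 M']

theorem tmap_extChartAt_comp_tmapSymm
    (hu : u ∈ (extChartAt I x₀).target) (hf : MDifferentiableAt I I' f ((extChartAt I x₀).symm u))
    (hu₁ : f ((extChartAt I x₀).symm u) ∈ (extChartAt I' x₁).source) :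
    (tmap I' 𝓘(ℝ, E') (extChartAt I' x₁) (f ((extChartAt I x₀).symm u))).comp
      ((tmap I I' f ((extChartAt I x₀).symm u)).comp (tmapSymm I x₀ u)) =
    fderivWithin ℝ (mapRep I I' f x₀ x₁) (range I) u := by
  have hU : UniqueMDiffWithinAt 𝓘(ℝ, E) (range I) u :=
    I.uniqueMDiffOn u (extChartAt_target_subset_range x₀ hu)
  rw [← mfderivWithin_eq_fderivWithin, mapRep]
  have h1 : MDifferentiableAt I' 𝓘(ℝ, E') (extChartAt I' x₁) (f ((extChartAt I x₀).symm u)) :=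
    mdifferentiableAt_extChartAt (by rwa [← extChartAt_source (I := I')])
  have h2 : MDifferentiableWithinAt 𝓘(ℝ, E) I' (f ∘ (extChartAt I x₀).symm) (range I) u :=
    MDifferentiableAt.comp_mdifferentiableWithinAt (I' := I) u hf
      (mdifferentiableWithinAt_extChartAt_symm hu)
  rw [mfderiv_comp_mfderivWithin (I' := I') u h1 h2 hU,
    mfderiv_comp_mfderivWithin (I' := I) u hf (mdifferentiableWithinAt_extChartAt_symm hu) hU]
  rfl

theorem chartRep_pullback (τ : Form I' M' k)
    (hu : u ∈ (extChartAt I x₀).target) (hf : MDifferentiableAt I I' f ((extChartAt I x₀).symm u))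
    (hu₁ : f ((extChartAt I x₀).symm u) ∈ (extChartAt I' x₁).source) :
    chartRep I (pullback I I' f τ) x₀ u =
      (chartRep I' τ x₁ (mapRep I I' f x₀ x₁ u)).compContinuousLinearMap
        (fderivWithin ℝ (mapRep I I' f x₀ x₁) (range I) u) := by
  refine ContinuousAlternatingMap.ext fun v => ?_
  rw [← tmap_extChartAt_comp_tmapSymm hu hf hu₁]
  exact formAt_eq_chartRep τ hu₁ _

variable [IsManifold I ∞ M] [IsManifold I' ∞ M']

omit [IsManifold I 1 M] [IsManifold I' 1 M'] in
theorem contDiffWithinAt_mapRep (hu : u ∈ (extChartAt I x₀).target)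
    (hf : ContMDiffAt I I' ∞ f ((extChartAt I x₀).symm u))
    (hu₁ : f ((extChartAt I x₀).symm u) ∈ (extChartAt I' x₁).source) :
    ContDiffWithinAt ℝ ∞ (mapRep I I' f x₀ x₁) (range I) u := by
  have h1 : ContMDiffWithinAt 𝓘(ℝ, E) I ∞ (extChartAt I x₀).symm (range I) u :=
    contMDiffWithinAt_extChartAt_symm_range x₀ hu
  have h2 : ContMDiffAt I' 𝓘(ℝ, E') ∞ (extChartAt I' x₁) (f ((extChartAt I x₀).symm u)) :=
    contMDiffAt_extChartAt' (by rwa [← extChartAt_source (I := I')])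
  exact (h2.comp_contMDiffWithinAt u (hf.comp_contMDiffWithinAt u h1)).contDiffWithinAt

omit [IsManifold I 1 M] [IsManifold I' 1 M'] [IsManifold I ∞ M] [IsManifold I' ∞ M'] in
theorem eventually_mem_chart {f : M → M'} (hf : ContMDiffOn I I' ∞ f U) (hU : IsOpen U)
    (hu : u ∈ (extChartAt I x₀).target) (huU : (extChartAt I x₀).symm u ∈ U)
    (hu₁ : f ((extChartAt I x₀).symm u) ∈ (extChartAt I' x₁).source) :
    ∀ᶠ w in 𝓝[range I] u, w ∈ (extChartAt I x₀).target ∧ (extChartAt I x₀).symm w ∈ U ∧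
      f ((extChartAt I x₀).symm w) ∈ (extChartAt I' x₁).source := by
  have h1 := (continuousAt_extChartAt_symm'' hu).continuousWithinAt (s := range I)
  have h2 : ContinuousAt f ((extChartAt I x₀).symm u) :=
    (hf.continuousOn.continuousAt (hU.mem_nhds huU))
  filter_upwards [extChartAt_target_mem_nhdsWithin_of_mem hu,
    h1.preimage_mem_nhdsWithin (hU.mem_nhds huU),
    h1.preimage_mem_nhdsWithin (h2.preimage_mem_nhds ((isOpen_extChartAt_source x₁).mem_nhds hu₁))]
    with w hw hw' hw''
  exact ⟨hw, hw', hw''⟩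

omit [IsManifold I 1 M] [IsManifold I' 1 M'] in
theorem chartRep_pullback_eventuallyEq (τ : Form I' M' k) (hf : ContMDiffOn I I' ∞ f U)
    (hU : IsOpen U) (hu : u ∈ (extChartAt I x₀).target) (huU : (extChartAt I x₀).symm u ∈ U)
    (hu₁ : f ((extChartAt I x₀).symm u) ∈ (extChartAt I' x₁).source) :
    chartRep I (pullback I I' f τ) x₀ =ᶠ[𝓝[range I] u] fun w =>
      (chartRep I' τ x₁ (mapRep I I' f x₀ x₁ w)).compContinuousLinearMap
        (fderivWithin ℝ (mapRep I I' f x₀ x₁) (range I) w) := by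
  have : IsManifold I 1 M := IsManifold.of_le (n := ∞) (by simp)
  have : IsManifold I' 1 M' := IsManifold.of_le (n := ∞) (by simp)
  filter_upwards [eventually_mem_chart hf hU hu huU hu₁] with w hw
  exact chartRep_pullback τ hw.1
    ((hf.contMDiffAt (hU.mem_nhds hw.2.1)).mdifferentiableAt (by simp)) hw.2.2

omit [IsManifold I 1 M] [IsManifold I' 1 M'] in
theorem contDiffWithinAt_chartRep_pullback [FiniteDimensional ℝ E] {τ : Form I' M' k}
    (hτ : IsSmoothForm I' τ)
    (hf : ContMDiffOn I I' ∞ f U) (hU : IsOpen U) (hu : u ∈ (extChartAt I x₀).target)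
    (huU : (extChartAt I x₀).symm u ∈ U) :
    ContDiffWithinAt ℝ ∞ (chartRep I (pullback I I' f τ) x₀) (range I) u := by
  set x₁ := f ((extChartAt I x₀).symm u) with hx₁
  have hu₁ : f ((extChartAt I x₀).symm u) ∈ (extChartAt I' x₁).source := mem_extChartAt_source x₁
  have huR := extChartAt_target_subset_range x₀ hu
  have h1 := contDiffWithinAt_mapRep (x₁ := x₁) hu (hf.contMDiffAt (hU.mem_nhds huU)) hu₁
  refine ContDiffWithinAt.congr_of_eventuallyEq_of_mem ?_
    (chartRep_pullback_eventuallyEq τ hf hU hu huU hu₁) huR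
  have hd : ContDiffWithinAt ℝ ∞ (fderivWithin ℝ (mapRep I I' f x₀ x₁) (range I)) (range I) u :=
    h1.fderivWithin_right I.uniqueDiffOn (by simp) huR
  have hτ1 : ContDiffWithinAt ℝ ∞ (chartRep I' τ x₁) (range I') (mapRep I I' f x₀ x₁ u) :=
    hτ.contDiffWithinAt ((extChartAt I' x₁).map_source hu₁)
  have hτ2 : ContDiffWithinAt ℝ ∞ (fun w => chartRep I' τ x₁ (mapRep I I' f x₀ x₁ w)) (range I) u :=
    hτ1.comp u h1 (fun w _ => mem_range_self _)
  exact contDiffWithinAt_alternating_comp hτ2 hd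

omit [IsManifold I 1 M] [IsManifold I' 1 M'] [IsManifold I ∞ M] [IsManifold I' ∞ M'] in
theorem formAt_eq_zero_of_chartRep [IsManifold I 1 M] {τ : Form I M k} {x : M}
    (hx : x ∈ (extChartAt I x₀).source)
    (h : chartRep I τ x₀ (extChartAt I x₀ x) = 0) : τ x = 0 := by
  change formAt τ x = 0
  refine ContinuousAlternatingMap.ext fun v => ?_
  rw [formAt_eq_chartRep τ hx, h]
  rfl

omit [IsManifold I 1 M] [IsManifold I' 1 M'] [IsManifold I ∞ M] [IsManifold I' ∞ M'] in
theorem chartRep_eq_zero {τ : Form I M k} (h : τ ((extChartAt I x₀).symm u) = 0) :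
    chartRep I τ x₀ u = 0 := by
  change formAt τ ((extChartAt I x₀).symm u) = 0 at h
  rw [chartRep_eq, h]
  rfl

omit [IsManifold I 1 M] [IsManifold I' 1 M'] in
/-- The exterior derivative commutes with pullbacks. -/
theorem pullback_extD_eq_zero {τ : Form I' M' k} (hτ : IsSmoothForm I' τ)
    (hf : ContMDiffOn I I' ∞ f U) (hU : IsOpen U) (h : ∀ x ∈ U, pullback I I' f τ x = 0) :
    ∀ x ∈ U, pullback I I' f (extD I' τ) x = 0 := by
  have : IsManifold I 1 M := IsManifold.of_le (n := ∞) (by simp)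
  have : IsManifold I' 1 M' := IsManifold.of_le (n := ∞) (by simp)
  intro x hx
  refine formAt_eq_zero_of_chartRep (mem_extChartAt_source (I := I) x) ?_
  have hu := mem_extChartAt_target (I := I) x
  set u := extChartAt I x x with hu_def
  have hux : (extChartAt I x).symm u = x := extChartAt_to_inv x
  have huU : (extChartAt I x).symm u ∈ U := by rwa [hux]
  have huR := extChartAt_target_subset_range x hu
  set x₁ := f ((extChartAt I x).symm u) with hx₁
  have hu₁ : f ((extChartAt I x).symm u) ∈ (extChartAt I' x₁).source := mem_extChartAt_source x₁
  have hfu := hf.contMDiffAt (hU.mem_nhds huU)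
  rw [chartRep_pullback (x₁ := x₁) _ hu (hfu.mdifferentiableAt (by simp)) hu₁]
  have hT : mapRep I I' f x x₁ u ∈ (extChartAt I' x₁).target := (extChartAt I' x₁).map_source hu₁
  rw [chartRep_extD hτ hT]
  rw [← extDerivWithin_pullback (t := range I') (r := ∞)
    ((hτ.contDiffWithinAt hT).differentiableWithinAt (by simp))
    (contDiffWithinAt_mapRep hu hfu hu₁) minSmoothness_two_le_infty I.uniqueDiffOn
    (I.range_subset_closure_interior huR) huR (fun w _ => mem_range_self _)]
  have h1 : (fun w => (chartRep I' τ x₁ (mapRep I I' f x x₁ w)).compContinuousLinearMap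
        (fderivWithin ℝ (mapRep I I' f x x₁) (range I) w)) =ᶠ[𝓝[range I] u] fun _ => 0 := by
    filter_upwards [eventually_mem_chart hf hU hu huU hu₁] with w hw
    rw [← chartRep_pullback τ hw.1
      ((hf.contMDiffAt (hU.mem_nhds hw.2.1)).mdifferentiableAt (by simp)) hw.2.2]
    exact chartRep_eq_zero (h _ hw.2.1)
  rw [h1.extDerivWithin_eq_of_mem huR]
  rw [extDerivWithin, fderivWithin_const_apply]
  exact map_zero (ContinuousAlternatingMap.alternatizeUncurryFinCLM ℝ E ℝ)

omit [IsManifold I 1 M] [IsManifold I' 1 M'] in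
/-- A pullback that vanishes at the interior points vanishes. -/
theorem pullback_eq_zero_of_interior [FiniteDimensional ℝ E] {τ : Form I' M' k}
    (hτ : IsSmoothForm I' τ) (hf : ContMDiffOn I I' ∞ f U) (hU : IsOpen U)
    (h : ∀ x ∈ U, I.IsInteriorPoint x → pullback I I' f τ x = 0) :
    ∀ x ∈ U, pullback I I' f τ x = 0 := by
  have : IsManifold I 1 M := IsManifold.of_le (n := ∞) (by simp)
  intro x hx
  refine formAt_eq_zero_of_chartRep (mem_extChartAt_source (I := I) x) ?_
  have hu := mem_extChartAt_target (I := I) x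
  set u := extChartAt I x x with hu_def
  have hux : (extChartAt I x).symm u = x := extChartAt_to_inv x
  have huU : (extChartAt I x).symm u ∈ U := by rwa [hux]
  have huR := extChartAt_target_subset_range x hu
  have h1 := (contDiffWithinAt_chartRep_pullback hτ hf hU hu huU).continuousWithinAt.mono
    interior_subset
  -- `u` is a limit of interior points of the range. There the pullback vanishes, and its
  -- representation is continuous up to `u`.
  have hne : (𝓝[interior (range I)] u).NeBot :=
    mem_closure_iff_nhdsWithin_neBot.1 (I.range_subset_closure_interior huR)
  refine tendsto_nhds_unique_of_eventuallyEq h1 (tendsto_const_nhds (x := 0)) ?_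
  have h2 := (continuousAt_extChartAt_symm'' hu).continuousWithinAt (s := interior (range I))
  filter_upwards [nhdsWithin_mono _ interior_subset (extChartAt_target_mem_nhdsWithin_of_mem hu),
    h2.preimage_mem_nhdsWithin (hU.mem_nhds huU), self_mem_nhdsWithin] with w hw hw' hwi
  refine chartRep_eq_zero (h _ hw' ?_)
  exact isInteriorPoint_symm (mem_chartDomain_of_mem_interior_range hw hwi)

end Pullback

/-! ### Extension of local forms and tangent vectors by bump functions -/

section Cutoff

variable {E : Type*} [NormedAddCommGroup E] [NormedSpace ℝ E] [FiniteDimensional ℝ E]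
  {H : Type*} [TopologicalSpace H]
  {I : ModelWithCorners ℝ E H} {M : Type*} [TopologicalSpace M] [ChartedSpace H M]
  [T2Space M] [IsManifold I ∞ M] {k : ℕ} {x₀ : M} {u : E}

/-- The form `τ` on the model space, pulled back by the preferred chart at `x₀` and multiplied by a
bump function. -/
def cutoffForm (ρ : SmoothBumpFunction I x₀) (τ : E → E [⋀^Fin k]→L[ℝ] ℝ) : Form I M k :=
  fun y => ρ y • ((τ (extChartAt I x₀ y)).compContinuousLinearMap
    (tmap I 𝓘(ℝ, E) (extChartAt I x₀) y) : E [⋀^Fin k]→L[ℝ] ℝ)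

omit [T2Space M] [IsManifold I ∞ M] in
theorem formAt_cutoffForm (ρ : SmoothBumpFunction I x₀) (τ : E → E [⋀^Fin k]→L[ℝ] ℝ) (y : M) :
    formAt (cutoffForm ρ τ) y = ρ y • ((τ (extChartAt I x₀ y)).compContinuousLinearMap
      (tmap I 𝓘(ℝ, E) (extChartAt I x₀) y)) := rfl

omit [T2Space M] in
theorem chartRep_cutoffForm {x₁ : M} (ρ : SmoothBumpFunction I x₀) (τ : E → E [⋀^Fin k]→L[ℝ] ℝ)
    (hu : u ∈ (extChartAt I x₁).target)
    (hu₁ : (extChartAt I x₁).symm u ∈ (extChartAt I x₀).source) :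
    chartRep I (cutoffForm ρ τ) x₁ u = ρ ((extChartAt I x₁).symm u) •
      (τ ((extChartAt I x₀ ∘ (extChartAt I x₁).symm) u)).compContinuousLinearMap
      (fderivWithin ℝ (extChartAt I x₀ ∘ (extChartAt I x₁).symm) (range I) u) := by
  have : IsManifold I 1 M := IsManifold.of_le (n := ∞) (by simp)
  rw [chartRep_eq, formAt_cutoffForm, ← tmap_comp_tmapSymm hu hu₁]
  rfl

omit [T2Space M] in
theorem chartRep_cutoffForm_self (ρ : SmoothBumpFunction I x₀) (τ : E → E [⋀^Fin k]→L[ℝ] ℝ)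
    (hu : u ∈ (extChartAt I x₀).target) :
    chartRep I (cutoffForm ρ τ) x₀ u = ρ ((extChartAt I x₀).symm u) • τ u := by
  have : IsManifold I 1 M := IsManifold.of_le (n := ∞) (by simp)
  rw [chartRep_eq, formAt_cutoffForm]
  refine ContinuousAlternatingMap.ext fun v => ?_
  change ρ ((extChartAt I x₀).symm u) •
    τ (extChartAt I x₀ ((extChartAt I x₀).symm u)) (fun i => tmap I 𝓘(ℝ, E)
      (extChartAt I x₀) ((extChartAt I x₀).symm u) (tmapSymm I x₀ u (v i))) =
    ρ ((extChartAt I x₀).symm u) • τ u v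
  simp only [tmap_tmapSymm hu, (extChartAt I x₀).right_inv hu]

/-- Inside the chart this is a product of smooth factors. A point outside the chart has a
neighbourhood disjoint from the support of the bump function, which lies in the chart because `M` is
Hausdorff. -/
theorem isSmoothForm_cutoffForm (ρ : SmoothBumpFunction I x₀) {τ : E → E [⋀^Fin k]→L[ℝ] ℝ}
    (hτ : ContDiff ℝ ∞ τ) : IsSmoothForm I (cutoffForm ρ τ) := by
  refine isSmoothForm_of_contDiffWithinAt fun x₁ u hu => ?_
  have huR := extChartAt_target_subset_range x₁ hu
  by_cases hu₁ : (extChartAt I x₁).symm u ∈ (extChartAt I x₀).source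
  · have h0 := contDiffWithinAt_transition (I := I) hu hu₁
    have h1 : ContDiffWithinAt ℝ ∞ (fun w => ρ ((extChartAt I x₁).symm w)) (range I) u :=
      (ρ.contMDiffAt.comp_contMDiffWithinAt u
        (contMDiffWithinAt_extChartAt_symm_range x₁ hu)).contDiffWithinAt
    have h2 : ContDiffWithinAt ℝ ∞ (fderivWithin ℝ (extChartAt I x₀ ∘ (extChartAt I x₁).symm)
        (range I)) (range I) u := h0.fderivWithin_right I.uniqueDiffOn (by simp) huR
    have h3 : ContDiffWithinAt ℝ ∞ (fun w => τ ((extChartAt I x₀ ∘ (extChartAt I x₁).symm) w))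
        (range I) u := hτ.comp_contDiffWithinAt h0
    refine (h1.smul (contDiffWithinAt_alternating_comp h3 h2)).congr_of_eventuallyEq_of_mem ?_ huR
    filter_upwards [eventually_mem_target_of_mem hu hu₁] with w hw
    exact chartRep_cutoffForm ρ τ hw.1 hw.2
  · have h1 : (extChartAt I x₁).symm u ∈ (tsupport ρ)ᶜ :=
      fun h => hu₁ (ρ.tsupport_subset_extChartAt_source h)
    have h2 := (continuousAt_extChartAt_symm'' hu).continuousWithinAt (s := range I)
    refine ContDiffWithinAt.congr_of_eventuallyEq_of_mem (contDiffWithinAt_const (c := 0)) ?_ huR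
    filter_upwards [h2.preimage_mem_nhdsWithin
      ((isClosed_tsupport ρ).isOpen_compl.mem_nhds h1)] with w hw
    rw [chartRep_eq, formAt_cutoffForm, image_eq_zero_of_notMem_tsupport hw, zero_smul]
    rfl

/-- Take a section that is constant in a trivialization and multiply it by a bump function. This
makes the Euler-Lagrange equations, stated with global fields, a condition on single tangent
vectors. -/
theorem exists_isSmoothField_eq [IsManifold I 1 M] (x : M) (v : TangentSpace I x) :
    ∃ ζ : (y : M) → TangentSpace I y, IsSmoothField I ζ ∧ ζ x = v := by
  let ρ : SmoothBumpFunction I x := Classical.arbitrary _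
  let e := trivializationAt E (TangentSpace I) x
  have hxe : x ∈ e.baseSet := FiberBundle.mem_baseSet_trivializationAt' x
  refine ⟨fun y => ρ y • e.symm y (e ⟨x, v⟩).2, fun y => ?_, ?_⟩
  · by_cases hy : y ∈ e.baseSet
    · refine (e.contMDiffAt_section_iff (IB := I) (n := ∞) hy).2 ?_
      have h1 : ContMDiffAt I 𝓘(ℝ, E) ∞ (fun y => ρ y • (e ⟨x, v⟩).2) y :=
        ρ.contMDiffAt.smul contMDiffAt_const
      refine h1.congr_of_eventuallyEq ?_
      filter_upwards [e.open_baseSet.mem_nhds hy] with y' hy'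
      rw [← e.continuousLinearMapAt_apply_of_mem ℝ hy', map_smul,
        e.continuousLinearMapAt_apply_of_mem ℝ hy']
      congr 1
      rw [e.mk_symm hy', e.apply_symm_apply' hy']
    · have h1 : y ∈ (tsupport ρ)ᶜ := fun h => hy (ρ.tsupport_subset_chartAt_source h)
      have h2 : ContMDiffAt I I.tangent ∞
        (fun y => (⟨y, 0⟩ : TangentBundle I M)) y :=
        Bundle.contMDiff_zeroSection ℝ (TangentSpace I) y
      refine h2.congr_of_eventuallyEq ?_
      filter_upwards [(isClosed_tsupport ρ).isOpen_compl.mem_nhds h1] with y' hy'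
      rw [image_eq_zero_of_notMem_tsupport hy', zero_smul]
  · simp only [ρ.eq_one, one_smul]
    exact e.symm_apply_apply_mk hxe v

end Cutoff

/-! ### The jet bundle in its induced charts -/

section JetCharts

variable {E : Type*} [NormedAddCommGroup E] [NormedSpace ℝ E] {H : Type*} [TopologicalSpace H]
  {I : ModelWithCorners ℝ E H} {F : Type*} [NormedAddCommGroup F] [NormedSpace ℝ F]
  {X : Type*} [TopologicalSpace X] [ChartedSpace H X]
  {Y : Type*} [TopologicalSpace Y] [ChartedSpace (ModelProd H F) Y]

theorem contMDiff_model_fst :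
    ContMDiff (I.prod 𝓘(ℝ, F)) I ∞ (fun q : ModelProd H F => q.1) := by
  intro p
  rw [contMDiffAt_iff]
  refine ⟨continuous_fst.continuousAt, ?_⟩
  have h : ContDiffWithinAt ℝ ∞ (Prod.fst : E × F → E)
      (range (I.prod 𝓘(ℝ, F))) (extChartAt (I.prod 𝓘(ℝ, F)) p p) := contDiffWithinAt_fst
  refine h.congr ?_ ?_
  · rintro _ ⟨q, rfl⟩
    change I (I.symm (I q.1)) = I q.1
    rw [I.left_inv]
  · change I (I.symm (I p.1)) = I p.1
    rw [I.left_inv]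

namespace FiberedManifold
variable (π : FiberedManifold I F X Y)

theorem chartAt_jet_apply (z₀ z : π.Jet) :
    chartAt (ModelProd (ModelProd H F) (E →L[ℝ] F)) z₀ z =
      (π.totalChart z₀.pt z.pt, π.jetCoord (π.baseChart z₀.pt) (π.totalChart z₀.pt) z) := rfl

theorem extChartAt_jet_apply (z₀ z : π.Jet) :
    extChartAt (jetModel I F) z₀ z =
      ((I (π.totalChart z₀.pt z.pt).1, (π.totalChart z₀.pt z.pt).2),
        π.jetCoord (π.baseChart z₀.pt) (π.totalChart z₀.pt) z) := rfl

theorem mem_chartAt_jet_source {z₀ z : π.Jet} :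
    z ∈ (chartAt (ModelProd (ModelProd H F) (E →L[ℝ] F)) z₀).source ↔
      z.pt ∈ (π.totalChart z₀.pt).source := Iff.rfl

theorem mem_extChartAt_jet_source {z₀ z : π.Jet} :
    z ∈ (extChartAt (jetModel I F) z₀).source ↔ z.pt ∈ (π.totalChart z₀.pt).source := by
  rw [extChartAt_source, mem_chartAt_jet_source]

theorem mem_chartAt_jet_target {z₀ : π.Jet} {q : ModelProd (ModelProd H F) (E →L[ℝ] F)} :
    q ∈ (chartAt (ModelProd (ModelProd H F) (E →L[ℝ] F)) z₀).target ↔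
      q.1 ∈ (π.totalChart z₀.pt).target :=
  ⟨fun h => h.1, fun h => ⟨h, mem_univ _⟩⟩

theorem mem_extChartAt_jet_target {z₀ : π.Jet} {w : (E × F) × (E →L[ℝ] F)} :
    w ∈ (extChartAt (jetModel I F) z₀).target ↔
      ((I.symm w.1.1, w.1.2) : ModelProd H F) ∈ (π.totalChart z₀.pt).target ∧ w.1.1 ∈ range I := by
  rw [extChartAt_target, mem_inter_iff, mem_preimage, mem_chartAt_jet_target]
  refine and_congr Iff.rfl ?_
  constructor
  · rintro ⟨q, rfl⟩
    exact ⟨q.1.1, rfl⟩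
  · rintro ⟨p, hp⟩
    exact ⟨((p, w.1.2), w.2), Prod.ext (Prod.ext hp rfl) rfl⟩

theorem extChartAt_jet_fst_fst {z₀ z : π.Jet} (hz : z.pt ∈ (π.totalChart z₀.pt).source) :
    (extChartAt (jetModel I F) z₀ z).1.1 = I (π.baseChart z₀.pt (π.projX z)) := by
  rw [extChartAt_jet_apply, (π.isAdaptedPair z₀.pt).fst_eq _ hz]
  rfl

theorem contMDiff_projY : ContMDiff (jetModel I F) (I.prod 𝓘(ℝ, F)) ∞ π.projY := by
  intro z
  have h1 : ContMDiffAt (jetModel I F) (jetModel I F) ∞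
      (chartAt (ModelProd (ModelProd H F) (E →L[ℝ] F)) z) z :=
    contMDiffAt_of_mem_maximalAtlas (IsManifold.chart_mem_maximalAtlas z) (mem_chart_source _ z)
  have h2 : ContMDiffAt (jetModel I F) (I.prod 𝓘(ℝ, F)) ∞
      (fun q : ModelProd (ModelProd H F) (E →L[ℝ] F) => q.1)
      (chartAt (ModelProd (ModelProd H F) (E →L[ℝ] F)) z z) := contMDiff_model_fst _
  have h3 : ContMDiffAt (I.prod 𝓘(ℝ, F)) (I.prod 𝓘(ℝ, F)) ∞ (π.totalChart z.pt).symm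
      (π.totalChart z.pt z.pt) :=
    contMDiffAt_symm_of_mem_maximalAtlas (π.isAdaptedPair z.pt).total_mem
      ((π.totalChart z.pt).map_source (π.mem_totalChart_source z.pt))
  have h4 := h3.comp z (h2.comp z h1)
  refine h4.congr_of_eventuallyEq ?_
  filter_upwards [(chartAt (ModelProd (ModelProd H F) (E →L[ℝ] F)) z).open_source.mem_nhds
    (mem_chart_source _ z)] with z' hz'
  exact ((π.totalChart z.pt).left_inv hz').symm

theorem contMDiff_proj : ContMDiff (I.prod 𝓘(ℝ, F)) I ∞ π.proj := by
  intro y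
  have h1 : ContMDiffAt (I.prod 𝓘(ℝ, F)) (I.prod 𝓘(ℝ, F)) ∞ (π.totalChart y) y :=
    contMDiffAt_of_mem_maximalAtlas (π.isAdaptedPair y).total_mem (π.mem_totalChart_source y)
  have h2 : ContMDiffAt (I.prod 𝓘(ℝ, F)) I ∞ (fun q : ModelProd H F => q.1) (π.totalChart y y) :=
    contMDiff_model_fst _
  have h0 := (π.isAdaptedPair y).fst_eq y (π.mem_totalChart_source y)
  have h3 : ContMDiffAt I I ∞ (π.baseChart y).symm (π.totalChart y y).1 := by
    rw [h0]
    exact contMDiffAt_symm_of_mem_maximalAtlas (π.isAdaptedPair y).base_mem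
      ((π.baseChart y).map_source ((π.isAdaptedPair y).mapsTo _ (π.mem_totalChart_source y)))
  have h4 := ContMDiffAt.comp (I' := I) y h3 (h2.comp y h1)
  refine h4.congr_of_eventuallyEq ?_
  filter_upwards [(π.totalChart y).open_source.mem_nhds (π.mem_totalChart_source y)] with y' hy'
  simp only [comp_apply, (π.isAdaptedPair y).fst_eq y' hy']
  exact ((π.baseChart y).left_inv ((π.isAdaptedPair y).mapsTo _ hy')).symm

theorem contMDiff_projX : ContMDiff (jetModel I F) I ∞ π.projX :=
  π.contMDiff_proj.comp π.contMDiff_projY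

theorem tmap_projX (z : π.Jet) : tmap (jetModel I F) I π.projX z =
    (tmap (I.prod 𝓘(ℝ, F)) I π.proj z.pt).comp
      (tmap (jetModel I F) (I.prod 𝓘(ℝ, F)) π.projY z) :=
  tmap_comp ((π.contMDiff_proj _).mdifferentiableAt (by simp))
    ((π.contMDiff_projY _).mdifferentiableAt (by simp))

theorem tmap_totalChart_comp_projY {z₀ z : π.Jet} (hz : z.pt ∈ (π.totalChart z₀.pt).source) :
    (tmap (I.prod 𝓘(ℝ, F)) (I.prod 𝓘(ℝ, F)) (π.totalChart z₀.pt) z.pt).comp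
      (tmap (jetModel I F) (I.prod 𝓘(ℝ, F)) π.projY z) =
    (ContinuousLinearMap.fst ℝ (E × F) (E →L[ℝ] F)).comp
      (tmap (jetModel I F) 𝓘(ℝ, (E × F) × (E →L[ℝ] F)) (extChartAt (jetModel I F) z₀) z) := by
  have h := π.isAdaptedPair z₀.pt
  have h1 := tmap_comp (f := π.projY) (h.mdiff_total.mdifferentiableAt hz)
    ((π.contMDiff_projY z).mdifferentiableAt (by simp))
  have h2 : HasMFDerivAt (jetModel I F) (I.prod 𝓘(ℝ, F))
      (fun z' => (chartAt (ModelProd (ModelProd H F) (E →L[ℝ] F)) z₀ z').1) z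
      ((ContinuousLinearMap.fst ℝ (E × F) (E →L[ℝ] F)).comp
        (tmap (jetModel I F) 𝓘(ℝ, (E × F) × (E →L[ℝ] F)) (extChartAt (jetModel I F) z₀) z)) := by
    have h3 := (mdifferentiable_chart (I := jetModel I F) z₀).mdifferentiableAt hz
    have h4 := (IsAdaptedPair.hasMFDerivAt_fst (I := I.prod 𝓘(ℝ, F)) (F := E →L[ℝ] F)
      (chartAt (ModelProd (ModelProd H F) (E →L[ℝ] F)) z₀ z)).comp z h3.hasMFDerivAt
    have h5 : tmap (jetModel I F) 𝓘(ℝ, (E × F) × (E →L[ℝ] F)) (extChartAt (jetModel I F) z₀) z =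
      tmap (jetModel I F) (jetModel I F) (chartAt (ModelProd (ModelProd H F) (E →L[ℝ] F)) z₀) z :=
      (hasMFDerivAt_extChartAt (I := jetModel I F) hz).mfderiv
    rw [h5]
    exact h4
  exact h1.symm.trans h2.mfderiv

theorem tmap_baseChart_comp_projX {z₀ z : π.Jet} (hz : z.pt ∈ (π.totalChart z₀.pt).source) :
    (tmap I I (π.baseChart z₀.pt) (π.projX z)).comp (tmap (jetModel I F) I π.projX z) =
    (baseProj E F).comp
      (tmap (jetModel I F) 𝓘(ℝ, (E × F) × (E →L[ℝ] F)) (extChartAt (jetModel I F) z₀) z) := by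
  rw [tmap_projX, ← ContinuousLinearMap.comp_assoc]
  have h1 := (π.isAdaptedPair z₀.pt).fst_comp hz
  change ((tmap I I (π.baseChart z₀.pt) (π.proj z.pt)).comp _).comp _ = _
  rw [← h1, ContinuousLinearMap.comp_assoc, tmap_totalChart_comp_projY π hz]
  rfl

/-- The first component vanishes because a jet is a right inverse of the tangent map of `π`. The
second is the coordinate expression `dy - A dx`, since `A` is the jet read in the two charts. -/
theorem tmap_totalChart_contactPart {z₀ z : π.Jet} (hz : z.pt ∈ (π.totalChart z₀.pt).source)
    (V : (E × F) × (E →L[ℝ] F)) :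
    tmap (I.prod 𝓘(ℝ, F)) (I.prod 𝓘(ℝ, F)) (π.totalChart z₀.pt) z.pt (π.contactPart z V) =
      (0, contactForm (extChartAt (jetModel I F) z₀ z)
        (tmap (jetModel I F) 𝓘(ℝ, (E × F) × (E →L[ℝ] F)) (extChartAt (jetModel I F) z₀) z V)) := by
  have h := π.isAdaptedPair z₀.pt
  have hx := h.mapsTo _ hz
  have e1 := DFunLike.congr_fun (π.tmap_totalChart_comp_projY hz) V
  have e2 := DFunLike.congr_fun (π.tmap_baseChart_comp_projX hz) V
  have e3 := DFunLike.congr_fun (Jet.tmap_comp_clm π z)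
    (tmap (jetModel I F) I π.projX z V)
  have e4 := DFunLike.congr_fun (h.fst_comp hz) (z.clm (tmap (jetModel I F) I π.projX z V))
  have e5 := DFunLike.congr_fun (tmap_symm_comp _ _ h.mdiff_base hx)
    (tmap (jetModel I F) I π.projX z V)
  simp only [ContinuousLinearMap.comp_apply, ContinuousLinearMap.id_apply] at e1 e2 e3 e4 e5
  have hc : π.contactPart z V = tmap (jetModel I F) (I.prod 𝓘(ℝ, F)) π.projY z V -
    z.clm (tmap (jetModel I F) I π.projX z V) := rfl
  rw [hc, map_sub, e1]
  refine Prod.ext ?_ ?_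
  · rw [e3] at e4
    change _ - (tmap (I.prod 𝓘(ℝ, F)) (I.prod 𝓘(ℝ, F)) (π.totalChart z₀.pt) z.pt _).1 = 0
    have e6 : (tmap (I.prod 𝓘(ℝ, F)) (I.prod 𝓘(ℝ, F)) (π.totalChart z₀.pt) z.pt
      (z.clm (tmap (jetModel I F) I π.projX z V))).1 = _ := e4
    rw [e6]
    change tmap I I (π.baseChart z₀.pt) (π.proj z.pt) _ = _ at e2
    rw [e2]
    exact sub_self _
  · rw [contactForm_apply]
    change _ - (tmap (I.prod 𝓘(ℝ, F)) (I.prod 𝓘(ℝ, F)) (π.totalChart z₀.pt) z.pt _).2 =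
      _ - π.jetCoord (π.baseChart z₀.pt) (π.totalChart z₀.pt) z (baseProj E F _)
    rw [← e2]
    change _ = _ - (tmap (I.prod 𝓘(ℝ, F)) (I.prod 𝓘(ℝ, F)) (π.totalChart z₀.pt) z.pt
      (z.clm (tmap I I (π.baseChart z₀.pt).symm (π.baseChart z₀.pt (π.proj z.pt)) _))).2
    change tmap I I (π.baseChart z₀.pt).symm _ (tmap I I (π.baseChart z₀.pt) (π.projX z) _) =
      _ at e5
    rw [e5]
    rfl

theorem contactPart_eq_zero_iff {z₀ z : π.Jet} (hz : z.pt ∈ (π.totalChart z₀.pt).source)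
    (V : (E × F) × (E →L[ℝ] F)) :
    π.contactPart z V = 0 ↔ contactForm (extChartAt (jetModel I F) z₀ z)
        (tmap (jetModel I F) 𝓘(ℝ, (E × F) × (E →L[ℝ] F)) (extChartAt (jetModel I F) z₀) z
          V) = 0 := by
  have h1 := π.tmap_totalChart_contactPart hz V
  constructor
  · intro h
    rw [h, map_zero] at h1
    exact (congrArg Prod.snd h1).symm
  · intro h
    rw [h] at h1
    have h2 := DFunLike.congr_fun (tmap_symm_comp _ _ (π.isAdaptedPair z₀.pt).mdiff_total hz)
      (π.contactPart z V)
    rw [ContinuousLinearMap.comp_apply, h1] at h2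
    exact h2.symm.trans (map_zero _)

end FiberedManifold
end JetCharts

/-! ### Prolongations of sections -/

section Prolongation

variable {E : Type*} [NormedAddCommGroup E] [NormedSpace ℝ E] {H : Type*} [TopologicalSpace H]
  {I : ModelWithCorners ℝ E H} {F : Type*} [NormedAddCommGroup F] [NormedSpace ℝ F]
  {X : Type*} [TopologicalSpace X] [ChartedSpace H X]
  {Y : Type*} [TopologicalSpace Y] [ChartedSpace (ModelProd H F) Y]

theorem hasMFDerivAt_model_snd (p : ModelProd H F) :
    HasMFDerivAt (I.prod 𝓘(ℝ, F)) 𝓘(ℝ, F) (fun q : ModelProd H F => q.2) p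
      (ContinuousLinearMap.snd ℝ E F) := by
  refine ⟨continuous_snd.continuousAt, ?_⟩
  have h : HasFDerivWithinAt (Prod.snd : E × F → F) (ContinuousLinearMap.snd ℝ E F)
      (range (I.prod 𝓘(ℝ, F))) (extChartAt (I.prod 𝓘(ℝ, F)) p p) := hasFDerivWithinAt_snd
  exact h

theorem contMDiff_model_snd :
    ContMDiff (I.prod 𝓘(ℝ, F)) 𝓘(ℝ, F) ∞ (fun q : ModelProd H F => q.2) := by
  intro p
  rw [contMDiffAt_iff]
  refine ⟨continuous_snd.continuousAt, ?_⟩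
  have h : ContDiffWithinAt ℝ ∞ (Prod.snd : E × F → F)
      (range (I.prod 𝓘(ℝ, F))) (extChartAt (I.prod 𝓘(ℝ, F)) p p) := contDiffWithinAt_snd
  exact h

theorem contMDiffAt_model_prod {E' H' : Type*} [NormedAddCommGroup E'] [NormedSpace ℝ E']
    [TopologicalSpace H'] {I' : ModelWithCorners ℝ E' H'} {f : X → ModelProd H' F} {x : X}
    (h₁ : ContMDiffAt I I' ∞ (fun x => (f x).1) x)
    (h₂ : ContMDiffAt I 𝓘(ℝ, F) ∞ (fun x => (f x).2) x) :
    ContMDiffAt I (I'.prod 𝓘(ℝ, F)) ∞ f x := by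
  rw [contMDiffAt_iff] at *
  exact ⟨h₁.1.prodMk h₂.1, h₁.2.prodMk h₂.2⟩

namespace FiberedManifold
variable {π : FiberedManifold I F X Y} {c : OpenPartialHomeomorph X H}
  {e : OpenPartialHomeomorph Y (ModelProd H F)} {φ : X → Y} {U : Set X} {x : X}

theorem IsSectionOn.contMDiffAt (hφ : π.IsSectionOn φ U) (hU : IsOpen U) (hx : x ∈ U) :
    ContMDiffAt I (I.prod 𝓘(ℝ, F)) ∞ φ x := hφ.smooth.contMDiffAt (hU.mem_nhds hx)

theorem IsSectionOn.mdifferentiableAt (hφ : π.IsSectionOn φ U) (hU : IsOpen U) (hx : x ∈ U) :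
    MDifferentiableAt I (I.prod 𝓘(ℝ, F)) φ x :=
  (hφ.contMDiffAt hU hx).mdifferentiableAt (by simp)

theorem tmap_comp_eq_id {E' H' M : Type*} [NormedAddCommGroup E'] [NormedSpace ℝ E']
    [TopologicalSpace H'] {I' : ModelWithCorners ℝ E' H'} [TopologicalSpace M] [ChartedSpace H' M]
    {f : M → X} {σ : X → M} (hU : IsOpen U) (hx : x ∈ U) (hf : MDifferentiableAt I' I f (σ x))
    (hσ : MDifferentiableAt I I' σ x) (h : ∀ x ∈ U, f (σ x) = x) :
    (tmap I' I f (σ x)).comp (tmap I I' σ x) = .id ℝ E := by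
  rw [← tmap_comp hf hσ]
  have h1 : (f ∘ σ) =ᶠ[𝓝 x] id := by
    filter_upwards [hU.mem_nhds hx] with x' hx' using h x' hx'
  rw [tmap_congr h1]
  exact mfderiv_id

theorem IsSectionOn.tmap_proj_comp (hφ : π.IsSectionOn φ U) (hU : IsOpen U) (hx : x ∈ U) :
    (tmap (I.prod 𝓘(ℝ, F)) I π.proj (φ x)).comp (tmap I (I.prod 𝓘(ℝ, F)) φ x) = .id ℝ E :=
  tmap_comp_eq_id hU hx ((π.contMDiff_proj _).mdifferentiableAt (by simp))
    (hφ.mdifferentiableAt hU hx) hφ.proj_eq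

theorem IsSectionOn.pt_j1 (hφ : π.IsSectionOn φ U) (hU : IsOpen U) (hx : x ∈ U) :
    (π.j1 φ x).pt = φ x := by
  rw [j1, dif_pos ⟨hφ.proj_eq x hx, hφ.tmap_proj_comp hU hx⟩]

theorem IsSectionOn.clm_j1 (hφ : π.IsSectionOn φ U) (hU : IsOpen U) (hx : x ∈ U) :
    (π.j1 φ x).clm = tmap I (I.prod 𝓘(ℝ, F)) φ x := by
  rw [j1, dif_pos ⟨hφ.proj_eq x hx, hφ.tmap_proj_comp hU hx⟩]
  rfl

theorem IsSectionOn.projX_j1 (hφ : π.IsSectionOn φ U) (hU : IsOpen U) (hx : x ∈ U) :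
    π.projX (π.j1 φ x) = x := by
  rw [projX, hφ.pt_j1 hU hx, hφ.proj_eq x hx]

/-- The section `φ` in fibred coordinates. -/
def sectionRep (I : ModelWithCorners ℝ E H) (c : OpenPartialHomeomorph X H)
    (e : OpenPartialHomeomorph Y (ModelProd H F)) (φ : X → Y) (w : E) : F :=
  (e (φ (c.symm (I.symm w)))).2

theorem contMDiffAt_snd_comp_symm (h : IsAdaptedPair I π.proj c e) (hφ : π.IsSectionOn φ U)
    (hU : IsOpen U) (hx : x ∈ U) (hxe : φ x ∈ e.source) :
    ContMDiffAt I 𝓘(ℝ, F) ∞ ((fun q : ModelProd H F => q.2) ∘ e ∘ φ ∘ c.symm) (c x) := by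
  have hxc : x ∈ c.source := by
    have := h.mapsTo _ hxe
    rwa [hφ.proj_eq x hx] at this
  have h1 : ContMDiffAt I I ∞ c.symm (c x) :=
    contMDiffAt_symm_of_mem_maximalAtlas h.base_mem (c.map_source hxc)
  have h2 : ContMDiffAt I (I.prod 𝓘(ℝ, F)) ∞ φ (c.symm (c x)) := by
    rw [c.left_inv hxc]
    exact hφ.contMDiffAt hU hx
  have h3 : ContMDiffAt (I.prod 𝓘(ℝ, F)) (I.prod 𝓘(ℝ, F)) ∞ e (φ (c.symm (c x))) := by
    rw [c.left_inv hxc]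
    exact contMDiffAt_of_mem_maximalAtlas h.total_mem hxe
  exact (contMDiff_model_snd (I := I) _).comp (c x) (h3.comp (c x) (ContMDiffAt.comp (c x) h2 h1))

theorem contDiffWithinAt_sectionRep (h : IsAdaptedPair I π.proj c e) (hφ : π.IsSectionOn φ U)
    (hU : IsOpen U) (hx : x ∈ U) (hxe : φ x ∈ e.source) :
    ContDiffWithinAt ℝ ∞ (sectionRep I c e φ) (range I) (I (c x)) :=
  (contMDiffAt_iff.1 (contMDiffAt_snd_comp_symm h hφ hU hx hxe)).2

/-- The chain rule through `c`, `φ` and `e`: the coordinates `z^i_μ` of a prolongation are the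
partial derivatives of the section. -/
theorem jetCoord_j1 (h : IsAdaptedPair I π.proj c e) (hφ : π.IsSectionOn φ U)
    (hU : IsOpen U) (hx : x ∈ U) (hxe : φ x ∈ e.source) :
    π.jetCoord c e (π.j1 φ x) = fderivWithin ℝ (sectionRep I c e φ) (range I) (I (c x)) := by
  have hxc : x ∈ c.source := by
    have := h.mapsTo _ hxe
    rwa [hφ.proj_eq x hx] at this
  rw [jetCoord, hφ.clm_j1 hU hx, hφ.pt_j1 hU hx, hφ.proj_eq x hx]
  have h0 := (contMDiffAt_snd_comp_symm h hφ hU hx hxe).mdifferentiableAt (by simp)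
  refine Eq.trans ?_ (tmap_model h0)
  have h1 := h.mdiff_base.mdifferentiableAt_symm (c.map_source hxc)
  have hl := c.left_inv hxc
  have h2 : MDifferentiableAt I (I.prod 𝓘(ℝ, F)) φ (c.symm (c x)) := by
    rw [hl]
    exact hφ.mdifferentiableAt hU hx
  have h3 : MDifferentiableAt (I.prod 𝓘(ℝ, F)) (I.prod 𝓘(ℝ, F)) e (φ (c.symm (c x))) := by
    rw [hl]
    exact h.mdiff_total.mdifferentiableAt hxe
  have h4 := hasMFDerivAt_model_snd (I := I) (e (φ (c.symm (c x))))
  rw [tmap_comp (f := e ∘ φ ∘ c.symm) h4.mdifferentiableAt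
    (MDifferentiableAt.comp (I' := I.prod 𝓘(ℝ, F)) (c x) h3
      (MDifferentiableAt.comp (I' := I) (c x) h2 h1)),
    tmap_comp (f := φ ∘ c.symm) h3 (MDifferentiableAt.comp (I' := I) (c x) h2 h1),
    tmap_comp h2 h1]
  have h5 : tmap (I.prod 𝓘(ℝ, F)) 𝓘(ℝ, F) (fun q : ModelProd H F => q.2)
    ((e ∘ φ ∘ c.symm) (c x)) = ContinuousLinearMap.snd ℝ E F := h4.mfderiv
  rw [h5]
  simp only [comp_apply, hl]

/-- In an induced chart the prolongation consists of the section and the derivative of its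
coordinate representation. Near `x` it is the inverse chart applied to this smooth map. -/
theorem contMDiffOn_j1 (hφ : π.IsSectionOn φ U) (hU : IsOpen U) :
    ContMDiffOn I (jetModel I F) ∞ (π.j1 φ) U := by
  intro x hx
  refine ContMDiffAt.contMDiffWithinAt ?_
  set z₀ := π.j1 φ x with hz₀
  have hpt : z₀.pt = φ x := hφ.pt_j1 hU hx
  have h := π.isAdaptedPair z₀.pt
  set c := π.baseChart z₀.pt with hc
  set e := π.totalChart z₀.pt with he
  have hxe : φ x ∈ e.source := by
    rw [← hpt]
    exact π.mem_totalChart_source z₀.pt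
  have hxc : x ∈ c.source := by
    have := h.mapsTo _ hxe
    rwa [hφ.proj_eq x hx] at this
  have hev : ∀ᶠ x' in 𝓝 x, x' ∈ U ∧ φ x' ∈ e.source := by
    filter_upwards [hU.mem_nhds hx, (hφ.contMDiffAt hU hx).continuousAt.preimage_mem_nhds
      (e.open_source.mem_nhds hxe)] with x' h1 h2 using ⟨h1, h2⟩
  have hG1 : ContMDiffAt I (I.prod 𝓘(ℝ, F)) ∞ (fun x' => e (φ x')) x :=
    (contMDiffAt_of_mem_maximalAtlas h.total_mem hxe).comp x (hφ.contMDiffAt hU hx)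
  have hG2 : ContMDiffAt I 𝓘(ℝ, E →L[ℝ] F) ∞
      (fun x' => fderivWithin ℝ (sectionRep I c e φ) (range I) (I (c x'))) x := by
    have h1 : ContMDiffAt I 𝓘(ℝ, E) ∞ (fun x' => I (c x')) x :=
      I.contMDiff.contMDiffAt.comp x (contMDiffAt_of_mem_maximalAtlas h.base_mem hxc)
    have h2 : ContDiffWithinAt ℝ ∞ (fderivWithin ℝ (sectionRep I c e φ) (range I)) (range I)
        (I (c x)) :=
      (contDiffWithinAt_sectionRep h hφ hU hx hxe).fderivWithin_right I.uniqueDiffOn (by simp)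
        (mem_range_self _)
    have h3 := ContMDiffWithinAt.comp (t := range I) (s := univ) x h2.contMDiffWithinAt
      h1.contMDiffWithinAt (fun x' _ => mem_range_self _)
    exact contMDiffWithinAt_univ.1 h3
  let G : X → ModelProd (ModelProd H F) (E →L[ℝ] F) := fun x' =>
    (e (φ x'), fderivWithin ℝ (sectionRep I c e φ) (range I) (I (c x')))
  have hG : ContMDiffAt I (jetModel I F) ∞ G x :=
    contMDiffAt_model_prod (I' := I.prod 𝓘(ℝ, F)) hG1 hG2
  have hsymm : ContMDiffAt (jetModel I F) (jetModel I F) ∞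
      (chartAt (ModelProd (ModelProd H F) (E →L[ℝ] F)) z₀).symm
      ((e (φ x), fderivWithin ℝ (sectionRep I c e φ) (range I) (I (c x))) :
        ModelProd (ModelProd H F) (E →L[ℝ] F)) := by
    refine contMDiffAt_symm_of_mem_maximalAtlas (IsManifold.chart_mem_maximalAtlas z₀) ?_
    rw [mem_chartAt_jet_target]
    exact e.map_source hxe
  refine (ContMDiffAt.comp (I' := jetModel I F) x hsymm hG).congr_of_eventuallyEq ?_
  filter_upwards [hev] with x' hx'
  have h1 : (π.j1 φ x').pt ∈ e.source := by
    rw [hφ.pt_j1 hU hx'.1]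
    exact hx'.2
  have h2 := (chartAt (ModelProd (ModelProd H F) (E →L[ℝ] F)) z₀).left_inv
    (π.mem_chartAt_jet_source.2 h1)
  rw [← h2, chartAt_jet_apply, comp_apply]
  congr 1
  refine Prod.ext ?_ ?_
  · change e (π.j1 φ x').pt = _
    rw [hφ.pt_j1 hU hx'.1]
  · exact jetCoord_j1 h hφ hU hx'.1 hx'.2

/-- `j¹φ` projects to `φ` on `Y` and to the identity on `X`, so the two terms of the contact part
are both `Tφ v`. -/
theorem IsSectionOn.contactPart_comp_tmap_j1 (hφ : π.IsSectionOn φ U) (hU : IsOpen U) (hx : x ∈ U)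
    (v : E) : π.contactPart (π.j1 φ x) (tmap I (jetModel I F) (π.j1 φ) x v) = 0 := by
  have hj : MDifferentiableAt I (jetModel I F) (π.j1 φ) x :=
    ((contMDiffOn_j1 hφ hU).contMDiffAt (hU.mem_nhds hx)).mdifferentiableAt (by simp)
  have h1 : (tmap (jetModel I F) (I.prod 𝓘(ℝ, F)) π.projY (π.j1 φ x)).comp
      (tmap I (jetModel I F) (π.j1 φ) x) = tmap I (I.prod 𝓘(ℝ, F)) φ x := by
    rw [← tmap_comp ((π.contMDiff_projY _).mdifferentiableAt (by simp)) hj]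
    refine tmap_congr ?_
    filter_upwards [hU.mem_nhds hx] with x' hx' using hφ.pt_j1 hU hx'
  have h2 := tmap_comp_eq_id hU hx ((π.contMDiff_projX _).mdifferentiableAt (by simp)) hj
    (fun x hx => hφ.projX_j1 hU hx)
  have h3 := DFunLike.congr_fun h1 v
  have h4 := DFunLike.congr_fun h2 v
  rw [ContinuousLinearMap.comp_apply] at h3 h4
  change tmap (jetModel I F) (I.prod 𝓘(ℝ, F)) π.projY (π.j1 φ x) _ -
    (π.j1 φ x).clm (tmap (jetModel I F) I π.projX (π.j1 φ x) _) = 0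
  rw [h3, h4, hφ.clm_j1 hU hx]
  exact sub_self _

/-- A section of the jet bundle that annihilates the contact forms is the prolongation of a
section. -/
theorem j1_projY_comp {σ : X → π.Jet} (hσ : ContMDiffOn I (jetModel I F) ∞ σ U) (hU : IsOpen U)
    (hproj : ∀ x ∈ U, π.projX (σ x) = x) (hx : x ∈ U)
    (hc : ∀ v, π.contactPart (σ x) (tmap I (jetModel I F) σ x v) = 0) :
    π.j1 (π.projY ∘ σ) x = σ x := by
  have hσx : MDifferentiableAt I (jetModel I F) σ x :=
    (hσ.contMDiffAt (hU.mem_nhds hx)).mdifferentiableAt (by simp)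
  have hs : π.IsSectionOn (π.projY ∘ σ) U :=
    ⟨π.contMDiff_projY.comp_contMDiffOn hσ, hproj⟩
  refine Jet.ext_clm (hs.pt_j1 hU hx) ?_
  rw [hs.clm_j1 hU hx, tmap_comp ((π.contMDiff_projY _).mdifferentiableAt (by simp)) hσx]
  refine ContinuousLinearMap.ext fun v => ?_
  have h2 := DFunLike.congr_fun (tmap_comp_eq_id hU hx
    ((π.contMDiff_projX _).mdifferentiableAt (by simp)) hσx hproj) v
  have h3 : tmap (jetModel I F) (I.prod 𝓘(ℝ, F)) π.projY (σ x) (tmap I (jetModel I F) σ x v) -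
    (σ x).clm (tmap (jetModel I F) I π.projX (σ x) (tmap I (jetModel I F) σ x v)) = 0 := hc v
  rw [ContinuousLinearMap.comp_apply] at h2
  rw [h2] at h3
  exact sub_eq_zero.1 h3

end FiberedManifold
end Prolongation

/-! ### The contact ideal vanishes along prolongations -/

section ContactIdeal

variable {E : Type*} [NormedAddCommGroup E] [NormedSpace ℝ E] {H : Type*} [TopologicalSpace H]
  {I : ModelWithCorners ℝ E H} {F : Type*} [NormedAddCommGroup F] [NormedSpace ℝ F]
  {X : Type*} [TopologicalSpace X] [ChartedSpace H X]
  {Y : Type*} [TopologicalSpace Y] [ChartedSpace (ModelProd H F) Y]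

namespace FiberedManifold
variable {π : FiberedManifold I F X Y} {φ : X → Y} {U : Set X} {x : X}

/-- Jets at distinct points of `Y` are separated by neighbourhoods in `Y`; jets at the same point
lie in a common chart. -/
instance instT2SpaceJet [T2Space Y] : T2Space π.Jet := by
  rw [t2Space_iff_disjoint_nhds]
  intro z z' hne
  by_cases h : z.pt = z'.pt
  · have hz' : z' ∈ (extChartAt (jetModel I F) z).source := by
      rw [mem_extChartAt_jet_source, ← h]
      exact π.mem_totalChart_source z.pt
    have h1 : extChartAt (jetModel I F) z z ≠ extChartAt (jetModel I F) z z' :=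
      fun h2 => hne ((extChartAt (jetModel I F) z).injOn (mem_extChartAt_source z) hz' h2)
    exact (continuousAt_extChartAt z).disjoint (disjoint_nhds_nhds.2 h1)
      (continuousAt_extChartAt' hz')
  · exact (π.contMDiff_projY.continuous.tendsto z).disjoint (disjoint_nhds_nhds.2 h)
      (π.contMDiff_projY.continuous.tendsto z')

theorem wedge_pullback_eq_zero {p q : ℕ} {θ : Form (jetModel I F) π.Jet p}
    {β : Form (jetModel I F) π.Jet q} {f : X → π.Jet}
    (h : pullback I (jetModel I F) f θ x = 0) :
    pullback I (jetModel I F) f (wedge (jetModel I F) θ β) x = 0 := by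
  have h0 : ∀ v : Fin p → E, formAt θ (f x) (fun i => tmap I (jetModel I F) f x (v i)) = 0 :=
    fun v => DFunLike.congr_fun h v
  change (wedgeAt (formAt θ (f x)) (formAt β (f x))).compContinuousLinearMap
    (tmap I (jetModel I F) f x) = 0
  refine ContinuousAlternatingMap.ext fun v => ?_
  exact wedgeAt_apply_eq_zero (formAt θ (f x)) (formAt β (f x))
    (fun i => tmap I (jetModel I F) f x (v i)) fun j => h0 fun i => v (j i)

/-- By induction over the ideal: contact forms vanish by definition, their differentials because `d`
commutes with pullbacks, and a product vanishes with its first factor. -/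
theorem InContactIdeal.pullback_j1_eq_zero [IsManifold I ∞ X] {k : ℕ}
    {τ : Form (jetModel I F) π.Jet k}
    (hτ : π.InContactIdeal k τ) (hφ : π.IsSectionOn φ U) (hU : IsOpen U) :
    ∀ x ∈ U, pullback I (jetModel I F) (π.j1 φ) τ x = 0 := by
  induction hτ with
  | zero k => exact fun x hx => rfl
  | add _ _ h1 h2 =>
    intro x hx
    have e1 := h1 x hx
    have e2 := h2 x hx
    refine ContinuousAlternatingMap.ext fun v => ?_
    have e3 := congrArg₂ (· + ·) (DFunLike.congr_fun e1 v) (DFunLike.congr_fun e2 v)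
    exact e3.trans (add_zero 0)
  | contact hθ hβ => exact fun x hx => wedge_pullback_eq_zero (hθ.2 U φ hU hφ x hx)
  | extD_contact hθ hβ =>
    exact fun x hx => wedge_pullback_eq_zero
      (pullback_extD_eq_zero hθ.1 (contMDiffOn_j1 hφ hU) hU (hθ.2 U φ hU hφ) x hx)

variable {O : Set E} {u : E → F} {z₀ : π.Jet}

/-- Every local section in fibred coordinates is the representation of a local section. -/
theorem exists_section_of_jetMap (hO : IsOpen O) (hu : ContDiffOn ℝ ∞ u O) {y₀ : E} (hy₀ : y₀ ∈ O)
    (hD : jetMap u y₀ ∈ chartDomain (jetModel I F) z₀) :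
    ∃ (φ : X → Y) (U : Set X) (O' : Set E), IsOpen U ∧ π.IsSectionOn φ U ∧ IsOpen O' ∧ y₀ ∈ O' ∧
      O' ⊆ range I ∧ ∀ y ∈ O', I.symm y ∈ (π.baseChart z₀.pt).target ∧
        (π.baseChart z₀.pt).symm (I.symm y) ∈ U ∧
        π.j1 φ ((π.baseChart z₀.pt).symm (I.symm y)) ∈ (extChartAt (jetModel I F) z₀).source ∧
        extChartAt (jetModel I F) z₀ (π.j1 φ ((π.baseChart z₀.pt).symm (I.symm y))) =
          jetMap u y := by
  have h := π.isAdaptedPair z₀.pt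
  set c := π.baseChart z₀.pt with hc
  set e := π.totalChart z₀.pt with he
  let G : X → ModelProd H F := fun x => (c x, u (I (c x)))
  let U₁ : Set X := c.source ∩ c ⁻¹' (I ⁻¹' O)
  have hU₁ : IsOpen U₁ := c.isOpen_inter_preimage (hO.preimage I.continuous)
  have hG : ∀ x ∈ U₁, ContMDiffAt I (I.prod 𝓘(ℝ, F)) ∞ G x := by
    intro x hx
    have h1 : ContMDiffAt I I ∞ c x := contMDiffAt_of_mem_maximalAtlas h.base_mem hx.1
    refine contMDiffAt_model_prod h1 ?_
    have h2 : ContMDiffAt I 𝓘(ℝ, E) ∞ (fun x => I (c x)) x :=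
      I.contMDiff.contMDiffAt.comp x h1
    exact ContMDiffAt.comp (g := u) (f := fun x => I (c x)) x
      ((hu.contDiffAt (hO.mem_nhds hx.2)).contMDiffAt) h2
  let U : Set X := U₁ ∩ G ⁻¹' e.target
  have hU : IsOpen U := ContinuousOn.isOpen_inter_preimage
    (fun x hx => (hG x hx).continuousAt.continuousWithinAt) hU₁ e.open_target
  let φ : X → Y := fun x => e.symm (G x)
  have hproj : ∀ q ∈ e.target, π.proj (e.symm q) = c.symm q.1 ∧ q.1 ∈ c.target := by
    intro q hq
    have h1 := e.map_target hq
    have h2 := h.fst_eq _ h1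
    rw [e.right_inv hq] at h2
    rw [h2, c.left_inv (h.mapsTo _ h1)]
    exact ⟨rfl, c.map_source (h.mapsTo _ h1)⟩
  have hφ : π.IsSectionOn φ U := by
    refine ⟨fun x hx => ?_, fun x hx => ?_⟩
    · exact ((contMDiffAt_symm_of_mem_maximalAtlas h.total_mem hx.2).comp x
        (hG x hx.1)).contMDiffWithinAt
    · rw [(hproj _ hx.2).1]
      exact c.left_inv hx.1.1
  let O' : Set E := O ∩ jetMap u ⁻¹' chartDomain (jetModel I F) z₀
  have hO' : IsOpen O' := (contDiffOn_jetMap hO hu).continuousOn.isOpen_inter_preimage hO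
    (isOpen_chartDomain z₀)
  have hmem : ∀ y ∈ O', ((I.symm y, u y) : ModelProd H F) ∈ e.target ∧ y ∈ range I :=
    fun y hy => π.mem_extChartAt_jet_target.1 (chartDomain_subset z₀ hy.2)
  have hIy : ∀ y ∈ O', I (I.symm y) = y := fun y hy => I.right_inv (hmem y hy).2
  have hcy : ∀ y ∈ O', I.symm y ∈ c.target := fun y hy => (hproj _ (hmem y hy).1).2
  have hGy : ∀ y ∈ O', G (c.symm (I.symm y)) = ((I.symm y, u y) : ModelProd H F) := by
    intro y hy
    change (c (c.symm (I.symm y)), u (I (c (c.symm (I.symm y))))) = _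
    rw [c.right_inv (hcy y hy), hIy y hy]
  have hUy : ∀ y ∈ O', c.symm (I.symm y) ∈ U := by
    intro y hy
    refine ⟨⟨c.map_target (hcy y hy), ?_⟩, ?_⟩
    · rw [mem_preimage, c.right_inv (hcy y hy), mem_preimage, hIy y hy]
      exact hy.1
    · rw [mem_preimage, hGy y hy]
      exact (hmem y hy).1
  have hφy : ∀ y ∈ O', φ (c.symm (I.symm y)) = e.symm ((I.symm y, u y) : ModelProd H F) := by
    intro y hy
    change e.symm (G _) = _
    rw [hGy y hy]
  have hes : ∀ y ∈ O', φ (c.symm (I.symm y)) ∈ e.source := by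
    intro y hy
    rw [hφy y hy]
    exact e.map_target (hmem y hy).1
  refine ⟨φ, U, O', hU, hφ, hO', ⟨hy₀, hD⟩, fun y hy => (hmem y hy).2, fun y hy =>
    ⟨hcy y hy, hUy y hy, ?_, ?_⟩⟩
  · rw [mem_extChartAt_jet_source, hφ.pt_j1 hU (hUy y hy)]
    exact hes y hy
  · rw [extChartAt_jet_apply, hφ.pt_j1 hU (hUy y hy), jetCoord_j1 h hφ hU (hUy y hy) (hes y hy),
      c.right_inv (hcy y hy), hIy y hy, ← he, hφy y hy, e.right_inv (hmem y hy).1]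
    have hR : range I ∈ 𝓝 y := Filter.mem_of_superset (hO'.mem_nhds hy) fun y hy => (hmem y hy).2
    have hrep : sectionRep I c e φ =ᶠ[𝓝 y] u := by
      filter_upwards [hO'.mem_nhds hy] with y' hy'
      rw [sectionRep, hφy y' hy', e.right_inv (hmem y' hy').1]
    rw [fderivWithin_of_mem_nhds hR, hrep.fderiv_eq]
    exact Prod.ext (Prod.ext (hIy y hy) rfl) rfl

/-- A form whose pullbacks by prolongations vanish, in a chart. -/
theorem chartRep_jetMap_eq_zero {k : ℕ} {τ : Form (jetModel I F) π.Jet k}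
    (hτ : ∀ (φ : X → Y) (U : Set X), IsOpen U → π.IsSectionOn φ U → ∀ x ∈ U,
      pullback I (jetModel I F) (π.j1 φ) τ x = 0)
    (hO : IsOpen O) (hu : ContDiffOn ℝ ∞ u O) {y : E} (hy : y ∈ O)
    (hD : jetMap u y ∈ chartDomain (jetModel I F) z₀) (v : Fin k → E) :
    chartRep (jetModel I F) τ z₀ (jetMap u y) (fun i => fderiv ℝ (jetMap u) y (v i)) = 0 := by
  obtain ⟨φ, U, O', hU, hφ, hO', hyO', hR, hmem⟩ := exists_section_of_jetMap hO hu hy hD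
  set c := π.baseChart z₀.pt with hc
  obtain ⟨hy1, hy2, hy3, hy4⟩ := hmem y hyO'
  have hR' : range I ∈ 𝓝 y := Filter.mem_of_superset (hO'.mem_nhds hyO') hR
  have h1 : ContMDiffAt 𝓘(ℝ, E) I ∞ I.symm y := (I.contMDiffOn_symm y (hR hyO')).contMDiffAt hR'
  have h2 : ContMDiffAt I I ∞ c.symm (I.symm y) :=
    contMDiffAt_symm_of_mem_maximalAtlas (π.isAdaptedPair z₀.pt).base_mem hy1
  have h3 : MDifferentiableAt 𝓘(ℝ, E) I (c.symm ∘ I.symm) y :=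
    (ContMDiffAt.comp (I' := I) y h2 h1).mdifferentiableAt (by simp)
  have h4 : MDifferentiableAt I (jetModel I F) (π.j1 φ) (c.symm (I.symm y)) :=
    ((contMDiffOn_j1 hφ hU).contMDiffAt (hU.mem_nhds hy2)).mdifferentiableAt (by simp)
  have h5 : MDifferentiableAt (jetModel I F) 𝓘(ℝ, (E × F) × (E →L[ℝ] F))
      (extChartAt (jetModel I F) z₀) (π.j1 φ (c.symm (I.symm y))) :=
    mdifferentiableAt_extChartAt (by rwa [extChartAt_source] at hy3)
  have h6 : tmap 𝓘(ℝ, E) 𝓘(ℝ, (E × F) × (E →L[ℝ] F))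
      (extChartAt (jetModel I F) z₀ ∘ π.j1 φ ∘ c.symm ∘ I.symm) y = fderiv ℝ (jetMap u) y := by
    have h7 : (extChartAt (jetModel I F) z₀ ∘ π.j1 φ ∘ c.symm ∘ I.symm) =ᶠ[𝓝 y] jetMap u := by
      filter_upwards [hO'.mem_nhds hyO'] with y' hy' using (hmem y' hy').2.2.2
    rw [tmap_congr h7]
    exact mfderiv_eq_fderiv
  rw [tmap_comp (f := π.j1 φ ∘ c.symm ∘ I.symm) h5
    (MDifferentiableAt.comp (I' := I) y h4 h3), tmap_comp (f := c.symm ∘ I.symm) h4 h3] at h6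
  rw [← h6, ← hy4]
  have h8 := DFunLike.congr_fun (hτ φ U hU hφ _ hy2)
    (fun i => tmap 𝓘(ℝ, E) I (c.symm ∘ I.symm) y (v i))
  refine Eq.trans ?_ h8
  exact (formAt_eq_chartRep τ hy3 _).symm

end FiberedManifold
end ContactIdeal

/-! ### Contact vectors as tangent vectors of jets -/

section JetSpaceModel

variable {E : Type*} [NormedAddCommGroup E] [NormedSpace ℝ E]
  {F : Type*} [NormedAddCommGroup F] [NormedSpace ℝ F]

/-- Every vector `((c, A c), C)` with `c ≠ 0` is tangent to a `1`-jet through `((x, y), A)`. -/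
theorem exists_jetMap_tangent (w : (E × F) × (E →L[ℝ] F)) {c : E} (hc : c ≠ 0) (C : E →L[ℝ] F) :
    ∃ u : E → F, ContDiff ℝ ∞ u ∧ jetMap u w.1.1 = w ∧
      fderiv ℝ (jetMap u) w.1.1 c = ((c, w.2 c), C) := by
  obtain ⟨⟨x, y⟩, A⟩ := w
  obtain ⟨l, hl⟩ : ∃ l : E →L[ℝ] ℝ, l c = 1 := by
    obtain ⟨l, -, hl⟩ := exists_dual_vector ℝ c (norm_ne_zero_iff.2 hc)
    refine ⟨(‖c‖⁻¹ : ℝ) • l, ?_⟩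
    have : (‖c‖ : ℝ) ≠ 0 := norm_ne_zero_iff.2 hc
    simp [hl, this]
  -- The quadratic part has second derivative `(v, w) ↦ l v • C w + l w • C v - (l v * l w) • C c`.
  -- As `l c = 1`, it is `C w` for `v = c`; the last term of `u` removes the excess that symmetry
  -- produces.
  let u : E → F := fun t => y + A (t - x) + l (t - x) • C (t - x) -
    ((1 / 2 : ℝ) * l (t - x) ^ 2) • C c
  have hu : ContDiff ℝ ∞ u := by
    have h0 : ContDiff ℝ ∞ fun t : E => t - x := contDiff_id.sub contDiff_const
    have h1 : ContDiff ℝ ∞ fun t : E => l (t - x) := l.contDiff.comp h0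
    have h2 : ContDiff ℝ ∞ fun t : E => C (t - x) := C.contDiff.comp h0
    have h3 : ContDiff ℝ ∞ fun t : E => A (t - x) := A.contDiff.comp h0
    exact ((contDiff_const.add h3).add (h1.smul h2)).sub
      ((contDiff_const.mul (h1.pow 2)).smul contDiff_const)
  let u' : E → E →L[ℝ] F := fun t =>
    A + l.smulRight (C (t - x)) + l (t - x) • C - l (t - x) • l.smulRight (C c)
  have hu' : ∀ t, HasFDerivAt u (u' t) t := by
    intro t
    have h0 : HasFDerivAt (fun t : E => t - x) (ContinuousLinearMap.id ℝ E) t :=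
      (hasFDerivAt_id t).sub_const x
    have h1 : HasFDerivAt (fun t : E => l (t - x)) l t := l.hasFDerivAt.comp t h0
    have h2 : HasFDerivAt (fun t : E => C (t - x)) C t := C.hasFDerivAt.comp t h0
    have h3 : HasFDerivAt (fun t : E => A (t - x)) A t := A.hasFDerivAt.comp t h0
    have h4 := ((h3.const_add y).add (h1.smul h2)).sub
      (((h1.pow 2).const_mul (1 / 2 : ℝ)).smul_const (C c))
    refine HasFDerivAt.congr_fderiv h4 (ContinuousLinearMap.ext fun v => ?_)
    simp [u', smul_smul]
    module
  have hfu : fderiv ℝ u = u' := funext fun t => (hu' t).fderiv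
  have hu'' : HasFDerivAt u' (((ContinuousLinearMap.smulRightL ℝ E F l).comp C) +
      l.smulRight C - l.smulRight (l.smulRight (C c))) x := by
    have h0 : HasFDerivAt (fun t : E => t - x) (ContinuousLinearMap.id ℝ E) x :=
      (hasFDerivAt_id x).sub_const x
    have h1 : HasFDerivAt (fun t : E => l (t - x)) l x := l.hasFDerivAt.comp x h0
    have h2 : HasFDerivAt (fun t : E => l.smulRight (C (t - x)))
      ((ContinuousLinearMap.smulRightL ℝ E F l).comp C) x :=
      ((ContinuousLinearMap.smulRightL ℝ E F l).comp C).hasFDerivAt.comp x h0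
    exact ((h2.const_add A).add (h1.smul_const C)).sub (h1.smul_const (l.smulRight (C c)))
  refine ⟨u, hu, ?_, ?_⟩
  · refine Prod.ext (Prod.ext rfl ?_) ?_
    · simp [jetMap, u]
    · change fderiv ℝ u x = A
      rw [hfu]
      refine ContinuousLinearMap.ext fun v => ?_
      simp [u']
  · have h1 := (hasFDerivAt_jetMap isOpen_univ hu.contDiffOn (mem_univ x)).fderiv
    change fderiv ℝ (jetMap u) x c = _
    rw [h1, hfu, hu''.fderiv]
    refine Prod.ext (Prod.ext rfl ?_) ?_
    · simp [u']
    · refine ContinuousLinearMap.ext fun v => ?_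
      simp [hl]

/-- If the base part is nonzero, the vector is itself tangent to a jet. If it is zero, the vector is
the difference of two vectors with the same nonzero base part, which exists because `E` is
nontrivial. -/
theorem eq_zero_of_jetMap_tangent [Nontrivial E] {w : (E × F) × (E →L[ℝ] F)}
    {G : Type*} [NormedAddCommGroup G] [NormedSpace ℝ G] (Λ : ((E × F) × (E →L[ℝ] F)) →L[ℝ] G)
    (h : ∀ u : E → F, ContDiff ℝ ∞ u → jetMap u w.1.1 = w →
      ∀ c, Λ (fderiv ℝ (jetMap u) w.1.1 c) = 0) (V : (E × F) × (E →L[ℝ] F))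
    (hV : contactForm w V = 0) : Λ V = 0 := by
  have key : ∀ c : E, c ≠ 0 → ∀ C : E →L[ℝ] F, Λ ((c, w.2 c), C) = 0 := by
    intro c hc C
    obtain ⟨u, hu, h1, h2⟩ := exists_jetMap_tangent w hc C
    rw [← h2]
    exact h u hu h1 c
  rw [contactForm_apply, sub_eq_zero] at hV
  by_cases hc : V.1.1 = 0
  · obtain ⟨c, hc'⟩ := exists_ne (0 : E)
    have h1 : V = ((c, w.2 c), V.2) - ((c, w.2 c), 0) := by
      refine Prod.ext (Prod.ext ?_ ?_) ?_
      · simp [hc]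
      · simp [hV, hc]
      · simp
    rw [h1, map_sub, key c hc', key c hc', sub_zero]
  · have h1 : V = ((V.1.1, w.2 V.1.1), V.2) := Prod.ext (Prod.ext rfl hV) rfl
    rw [h1]
    exact key _ hc _

/-- A linear functional as an alternating map. -/
def covectorForm {V : Type*} [NormedAddCommGroup V] [NormedSpace ℝ V] (a : V →L[ℝ] ℝ) :
    V [⋀^Fin 1]→L[ℝ] ℝ := ContinuousAlternatingMap.ofSubsingleton ℝ V ℝ 0 a

theorem covectorForm_apply {V : Type*} [NormedAddCommGroup V] [NormedSpace ℝ V] (a : V →L[ℝ] ℝ)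
    (v : Fin 1 → V) : covectorForm a v = a (v 0) := rfl

theorem wedgeAt_one {V : Type*} [NormedAddCommGroup V] [NormedSpace ℝ V] (a : V [⋀^Fin 1]→L[ℝ] ℝ)
    (b : V [⋀^Fin 0]→L[ℝ] ℝ) (hb : ∀ v, b v = 1) : wedgeAt a b = a := by
  refine ContinuousAlternatingMap.ext fun v => ?_
  have h1 : wedgeAt a b v = ((Nat.factorial 1 * Nat.factorial 0 : ℝ)⁻¹) •
      ∑ σ : Equiv.Perm (Fin 1), Equiv.Perm.sign σ • tensorForm a b (fun i => v (σ i)) := by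
    rw [wedgeAt, ContinuousAlternatingMap.smul_apply,
      ContinuousMultilinearMap.alternatization_apply_apply]
    rfl
  have h2 : tensorForm a b (fun i => v ((default : Equiv.Perm (Fin 1)) i)) = a v := by
    rw [tensorForm_apply, hb, mul_one]
    congr 1
  rw [h1, Fintype.sum_unique, h2, Equiv.Perm.default_eq, Equiv.Perm.sign_one]
  simp

theorem fderiv_alternating_apply_eq {V : Type*} [NormedAddCommGroup V] [NormedSpace ℝ V] {k : ℕ}
    {f : V → V [⋀^Fin k]→L[ℝ] ℝ} {w h : V} (hf : DifferentiableAt ℝ f w) {v : Fin k → V} {d : ℝ}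
    (hd : HasDerivAt (fun s : ℝ => f (w + s • h) v) d 0) : fderiv ℝ f w h v = d := by
  have h3 : HasDerivAt (fun s : ℝ => w + s • h) h 0 := by
    simpa using ((hasDerivAt_id (0 : ℝ)).smul_const h).const_add w
  have h4 : HasDerivAt (fun s : ℝ => f (w + s • h)) (fderiv ℝ f w h) 0 :=
    hf.hasFDerivAt.comp_hasDerivAt_of_eq (0 : ℝ) h3 (by simp)
  have h5 := (ContinuousAlternatingMap.apply ℝ V ℝ v).hasFDerivAt.comp_hasDerivAt (0 : ℝ) h4
  exact HasDerivAt.unique h5 hd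

variable [FiniteDimensional ℝ E] [FiniteDimensional ℝ F]

theorem contDiff_covectorForm_contactForm (l : F →L[ℝ] ℝ) :
    ContDiff ℝ ∞ fun w : (E × F) × (E →L[ℝ] F) => covectorForm (l.comp (contactForm w)) := by
  rw [← contDiffOn_univ, contDiffOn_alternating_iff]
  intro v
  have h1 : ContDiff ℝ ∞ fun w : (E × F) × (E →L[ℝ] F) => contactForm w (v 0) :=
    contDiff_contactForm.clm_apply contDiff_const
  exact (l.contDiff.comp h1).contDiffOn

/-- The Lie derivative of a component of the contact form. -/
theorem lie_covectorForm_contactForm {ξ : (E × F) × (E →L[ℝ] F) → (E × F) × (E →L[ℝ] F)}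
    {w : (E × F) × (E →L[ℝ] F)} (hξ : DifferentiableAt ℝ ξ w) (l : F →L[ℝ] ℝ)
    (v : Fin 1 → (E × F) × (E →L[ℝ] F)) :
    (extDeriv (fun w => (covectorForm (l.comp (contactForm w))).curryLeft (ξ w)) w +
      (extDeriv (fun w => covectorForm (l.comp (contactForm w))) w).curryLeft (ξ w)) v =
      l (lieContact ξ w (v 0)) := by
  have hd := ((contDiff_covectorForm_contactForm (E := E) l).differentiable (by simp)) w
  rw [ContinuousAlternatingMap.add_apply]
  refine (cartan_formula hd hξ v).trans ?_
  rw [Fin.sum_univ_one]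
  have h1 : fderiv ℝ (fun w : (E × F) × (E →L[ℝ] F) => covectorForm (l.comp (contactForm w))) w
      (ξ w) v = l (-(ξ w).2 (v 0).1.1) := by
    have h3 : HasDerivAt (fun s : ℝ => w + s • ξ w) (ξ w) 0 := by
      simpa using ((hasDerivAt_id (0 : ℝ)).smul_const (ξ w)).const_add w
    have h4 : HasDerivAt (fun s : ℝ => l (contactForm (w + s • ξ w) (v 0)))
        (l (-(ξ w).2 (v 0).1.1)) 0 := by
      have h5 : HasDerivAt (fun s : ℝ => contactForm (w + s • ξ w) (v 0))
          (-(ξ w).2 (v 0).1.1) 0 := by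
        have h5 := (hasDerivAt_contactForm h3).clm_apply (hasDerivAt_const (0 : ℝ) (v 0))
        refine h5.congr_deriv ?_
        simp
      exact l.hasFDerivAt.comp_hasDerivAt (0 : ℝ) h5
    exact fderiv_alternating_apply_eq hd h4
  rw [h1, covectorForm_apply]
  change _ + l (contactForm w (update v 0 (fderiv ℝ ξ w (v 0)) 0)) =
    l (contactForm w (fderiv ℝ ξ w (v 0)) - (ξ w).2 (v 0).1.1)
  rw [update_self, map_neg, map_sub]
  ring

end JetSpaceModel

/-! ### The infinitesimal meaning of preserving the contact ideal -/

section ContactKernel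

variable {E : Type*} [NormedAddCommGroup E] [NormedSpace ℝ E] {H : Type*} [TopologicalSpace H]
  {I : ModelWithCorners ℝ E H} {F : Type*} [NormedAddCommGroup F] [NormedSpace ℝ F]
  {X : Type*} [TopologicalSpace X] [ChartedSpace H X]
  {Y : Type*} [TopologicalSpace Y] [ChartedSpace (ModelProd H F) Y]

/-- The constant function `1` as a form. -/
def oneForm (I : ModelWithCorners ℝ E H) (M : Type*) [TopologicalSpace M] [ChartedSpace H M] :
    Form I M 0 := fun _ => (ContinuousAlternatingMap.constOfIsEmpty ℝ E (Fin 0) (1 : ℝ) :)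

theorem isSmoothForm_oneForm (I : ModelWithCorners ℝ E H) (M : Type*) [TopologicalSpace M]
    [ChartedSpace H M] : IsSmoothForm I (oneForm I M) := by
  intro x₀
  refine contDiffOn_const (c := ContinuousAlternatingMap.constOfIsEmpty ℝ E (Fin 0) (1 : ℝ))
    |>.congr fun u hu => ?_
  rfl

theorem wedge_oneForm {M : Type*} [TopologicalSpace M] [ChartedSpace H M] (θ : Form I M 1) :
    wedge I θ (oneForm I M) = θ :=
  funext fun z => wedgeAt_one (V := E) (formAt θ z)
    (ContinuousAlternatingMap.constOfIsEmpty ℝ E (Fin 0) (1 : ℝ)) fun _ => rfl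

namespace FiberedManifold
variable {π : FiberedManifold I F X Y}
theorem inContactIdeal_of_isContactForm {θ : Form (jetModel I F) π.Jet 1}
    (hθ : π.IsContactForm θ) : π.InContactIdeal 1 θ := by
  have h1 := InContactIdeal.contact hθ (isSmoothForm_oneForm (jetModel I F) π.Jet)
  rw [wedge_oneForm] at h1
  exact h1

variable [FiniteDimensional ℝ E] [FiniteDimensional ℝ F] [T2Space Y]

/-- A component of the contact form in a chart, cut off. -/
def cutoffContact (z₀ : π.Jet) (ρ : SmoothBumpFunction (jetModel I F) z₀) (l : F →L[ℝ] ℝ) :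
    Form (jetModel I F) π.Jet 1 :=
  cutoffForm ρ fun w => covectorForm (l.comp (contactForm w))

theorem isContactForm_cutoffContact (z₀ : π.Jet) (ρ : SmoothBumpFunction (jetModel I F) z₀)
    (l : F →L[ℝ] ℝ) : π.IsContactForm (cutoffContact z₀ ρ l) := by
  refine ⟨isSmoothForm_cutoffForm ρ (contDiff_covectorForm_contactForm l), ?_⟩
  intro U φ hU hφ x hx
  refine ContinuousAlternatingMap.ext fun v => ?_
  by_cases hz : π.j1 φ x ∈ (extChartAt (jetModel I F) z₀).source
  · have h1 := hφ.contactPart_comp_tmap_j1 hU hx (v 0)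
    rw [mem_extChartAt_jet_source] at hz
    have h2 := π.tmap_totalChart_contactPart hz (tmap I (jetModel I F) (π.j1 φ) x (v 0))
    rw [h1, map_zero] at h2
    have h3 := congrArg Prod.snd h2
    change ρ (π.j1 φ x) • l (contactForm _ _) = 0
    refine (congrArg (fun a => ρ (π.j1 φ x) • l a) h3.symm).trans ?_
    simp
  · have h1 : ρ (π.j1 φ x) = 0 := image_eq_zero_of_notMem_tsupport
      fun h => hz (ρ.tsupport_subset_extChartAt_source h)
    change ρ (π.j1 φ x) • l (contactForm _ _) = 0
    rw [h1, zero_smul]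

/-- A vector field that preserves the contact ideal preserves the kernel of the contact form. -/
theorem exists_lieContact_eq_zero [IsManifold I ∞ X] [Nontrivial E]
    {ξ : (z : π.Jet) → TangentSpace (jetModel I F) z}
    (hξ : IsSmoothField (jetModel I F) ξ)
    (hlie : ∀ τ : Form (jetModel I F) π.Jet 1, π.InContactIdeal 1 τ →
      π.InContactIdeal 1 (lieD (jetModel I F) ξ τ)) (z₀ : π.Jet) :
    ∃ N : Set π.Jet, IsOpen N ∧ z₀ ∈ N ∧ ∀ w ∈ chartDomain (jetModel I F) z₀,
      (extChartAt (jetModel I F) z₀).symm w ∈ N → ∀ V, contactForm w V = 0 →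
        lieContact (fieldRep ξ z₀) w V = 0 := by
  let ρ : SmoothBumpFunction (jetModel I F) z₀ := Classical.arbitrary _
  refine ⟨interior {z | ρ z = 1}, isOpen_interior,
    mem_interior_iff_mem_nhds.2 ρ.eventuallyEq_one, ?_⟩
  intro w hw hwN V hV
  have hfield : DifferentiableAt ℝ (fieldRep ξ z₀) w :=
    ((contDiffOn_fieldRep hξ z₀).contDiffAt ((isOpen_chartDomain z₀).mem_nhds hw)).differentiableAt
      (by simp)
  -- The cut-off of `l ∘ θ` is a global contact form, so its Lie derivative lies in the ideal and
  -- vanishes along prolongations. Where the bump function is one, the local expression of this Lie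
  -- derivative is `l ∘ lieContact`.
  have key : ∀ l : F →L[ℝ] ℝ, l (lieContact (fieldRep ξ z₀) w V) = 0 := by
    intro l
    have hc := isContactForm_cutoffContact z₀ ρ l
    have h1 : ∀ (φ : X → Y) (U : Set X), IsOpen U → π.IsSectionOn φ U → ∀ x ∈ U,
        pullback I (jetModel I F) (π.j1 φ)
          (lieD (jetModel I F) ξ (cutoffContact z₀ ρ l)) x = 0 := fun φ U hU hφ =>
      (hlie _ (inContactIdeal_of_isContactForm hc)).pullback_j1_eq_zero hφ hU
    have hloc : ∀ᶠ w' in 𝓝 w, chartRep (jetModel I F) (cutoffContact z₀ ρ l) z₀ w' =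
        covectorForm (l.comp (contactForm w')) := by
      have hcont : ContinuousAt (extChartAt (jetModel I F) z₀).symm w :=
        continuousAt_extChartAt_symm'' (chartDomain_subset z₀ hw)
      filter_upwards [(isOpen_chartDomain z₀).mem_nhds hw,
        hcont.preimage_mem_nhds (isOpen_interior.mem_nhds hwN)] with w' hw' hw1
      have h2 := chartRep_cutoffForm_self ρ (fun w => covectorForm (l.comp (contactForm w)))
        (chartDomain_subset z₀ hw')
      refine h2.trans ?_
      have h3 : ρ ((extChartAt (jetModel I F) z₀).symm w') = 1 :=
        interior_subset (s := {z | ρ z = 1}) hw1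
      rw [h3, one_smul]
    have hlieRep : ∀ v : Fin 1 → (E × F) × (E →L[ℝ] F),
        chartRep (jetModel I F) (lieD (jetModel I F) ξ (cutoffContact z₀ ρ l)) z₀ w v =
          l (lieContact (fieldRep ξ z₀) w (v 0)) := by
      intro v
      have h2 := chartRep_lieD_of_mem_chartDomain hξ hc.1 hw
      rw [h2, ← lie_covectorForm_contactForm hfield l v]
      have h3 : extDeriv (chartRep (jetModel I F) (cutoffContact z₀ ρ l) z₀) w =
          extDeriv (fun w' => covectorForm (l.comp (contactForm w'))) w :=
        Filter.EventuallyEq.extDeriv_eq hloc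
      have h4 : extDeriv (fun w' => (chartRep (jetModel I F) (cutoffContact z₀ ρ l) z₀ w').curryLeft
          (fieldRep ξ z₀ w')) w =
          extDeriv (fun w' => (covectorForm (l.comp (contactForm w'))).curryLeft
            (fieldRep ξ z₀ w')) w := by
        refine Filter.EventuallyEq.extDeriv_eq ?_
        filter_upwards [hloc] with w' hw'
        rw [hw']
      rw [h3, h4]
    refine eq_zero_of_jetMap_tangent (w := w) (l.comp (lieContact (fieldRep ξ z₀) w)) ?_ V hV
    intro u hu huw c
    have h5 := chartRep_jetMap_eq_zero h1 isOpen_univ hu.contDiffOn (mem_univ w.1.1)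
      (z₀ := z₀) (by rwa [huw]) (fun _ => c)
    rw [huw] at h5
    rw [hlieRep] at h5
    exact h5
  by_contra hne
  obtain ⟨l, -, hl⟩ := exists_dual_vector ℝ (lieContact (fieldRep ξ z₀) w V) (norm_ne_zero_iff.2 hne)
  rw [key l] at hl
  exact hne (norm_eq_zero.1 (by simpa using hl.symm))

end FiberedManifold
end ContactKernel

/-! ### Forms on the base in charts, and vertical derivatives of the Lagrangian -/

section VerticalCurve

variable {E : Type*} [NormedAddCommGroup E] [NormedSpace ℝ E] {H : Type*} [TopologicalSpace H]
  {I : ModelWithCorners ℝ E H} {F : Type*} [NormedAddCommGroup F] [NormedSpace ℝ F]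
  {X : Type*} [TopologicalSpace X] [ChartedSpace H X]
  {Y : Type*} [TopologicalSpace Y] [ChartedSpace (ModelProd H F) Y]

/-- A form on `X` in a chart `c`. -/
def baseRep {k : ℕ} (η : Form I X k) (c : OpenPartialHomeomorph X H) (x : E) :
    E [⋀^Fin k]→L[ℝ] ℝ :=
  (formAt η (c.symm (I.symm x))).compContinuousLinearMap (tmap I I c.symm (I.symm x))

theorem tmapSymm_model (p : H) {x : E} (hx : x ∈ range I) :
    tmapSymm I p x = .id ℝ E := by
  have hx' : x ∈ (extChartAt I p).target := by
    simpa [extChartAt, chartAt_self_eq] using hx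
  refine ContinuousLinearMap.ext fun v => ?_
  have h1 := tmap_tmapSymm (I := I) hx' v
  have h2 : tmap I 𝓘(ℝ, E) (extChartAt I p) ((extChartAt I p).symm x) = .id ℝ E :=
    tmap_extChartAt_self ((extChartAt I p).symm x)
  rw [h2] at h1
  exact h1

theorem contDiffWithinAt_baseRep [IsManifold I ∞ X] [FiniteDimensional ℝ E] {k : ℕ} {η : Form I X k}
    (hη : IsSmoothForm I η)
    {c : OpenPartialHomeomorph X H} (hc : c ∈ IsManifold.maximalAtlas I ∞ X) {x : E}
    (hx : x ∈ range I) (hxc : I.symm x ∈ c.target) :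
    ContDiffWithinAt ℝ ∞ (baseRep (I := I) η c) (range I) x := by
  have hx' : x ∈ (extChartAt I (I.symm x)).target := by
    simpa [extChartAt, chartAt_self_eq] using hx
  have h1 : ContDiffWithinAt ℝ ∞ (chartRep I (pullback I I c.symm η) (I.symm x)) (range I) x :=
    contDiffWithinAt_chartRep_pullback hη (contMDiffOn_symm_of_mem_maximalAtlas hc) c.open_target hx'
      hxc
  refine h1.congr (fun y hy => ?_) ?_
  · rw [chartRep_eq, tmapSymm_model _ hy]
    rfl
  · rw [chartRep_eq, tmapSymm_model _ hx]
    rfl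

theorem formAt_eq_baseRep [IsManifold I ∞ X] {k : ℕ} (η : Form I X k)
    {c : OpenPartialHomeomorph X H} (hc : c.MDifferentiable I I) {x : X} (hx : x ∈ c.source)
    (v : Fin k → E) :
    formAt η x v = baseRep η c (I (c x)) (fun i => tmap I I c x (v i)) := by
  have h1 := fun w => DFunLike.congr_fun (tmap_symm_comp I I hc hx) w
  simp only [ContinuousLinearMap.comp_apply, ContinuousLinearMap.id_apply] at h1
  rw [baseRep, ContinuousAlternatingMap.compContinuousLinearMap_apply, I.left_inv, c.left_inv hx]
  congr 1
  funext i
  exact (h1 _).symm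

namespace FiberedManifold
variable {π : FiberedManifold I F X Y}

/-- The jet `z + g`, for a vertical linear map `g`. -/
def Jet.addVertical (z : π.Jet) (g : E →L[ℝ] E × F)
    (hg : (tmap (I.prod 𝓘(ℝ, F)) I π.proj z.pt).comp g = 0) : π.Jet where
  pt := z.pt
  lin := z.clm + g
  right_inv := by
    change (tmap (I.prod 𝓘(ℝ, F)) I π.proj z.pt).comp (z.clm + g) = .id ℝ E
    rw [ContinuousLinearMap.comp_add, hg, add_zero]
    exact z.tmap_comp_clm π

/-- The velocity of `s ↦ z + s g` in a chart. -/
def vliftRep (z₀ z : π.Jet) (g : E →L[ℝ] E × F) : E →L[ℝ] F :=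
  (ContinuousLinearMap.snd ℝ E F).comp
    ((tmap (I.prod 𝓘(ℝ, F)) (I.prod 𝓘(ℝ, F)) (π.totalChart z₀.pt) z.pt).comp
      (g.comp (tmap I I (π.baseChart z₀.pt).symm (π.baseChart z₀.pt (π.projX z)))))

theorem extChartAt_addVertical (z₀ z : π.Jet) (g : E →L[ℝ] E × F)
    (hg : (tmap (I.prod 𝓘(ℝ, F)) I π.proj z.pt).comp g = 0) :
    extChartAt (jetModel I F) z₀ (z.addVertical g hg) =
      extChartAt (jetModel I F) z₀ z + ((0, 0), vliftRep z₀ z g) := by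
  rw [extChartAt_jet_apply, extChartAt_jet_apply]
  refine Prod.ext (Prod.ext (add_zero _).symm (add_zero _).symm) ?_
  refine ContinuousLinearMap.ext fun v => ?_
  change (tmap (I.prod 𝓘(ℝ, F)) (I.prod 𝓘(ℝ, F)) (π.totalChart z₀.pt) z.pt
    ((z.clm + g) (tmap I I (π.baseChart z₀.pt).symm (π.baseChart z₀.pt (π.projX z)) v))).2 = _
  rw [add_apply, map_add]
  rfl

/-- A function on the jet bundle in the preferred chart at `z₀`. -/
def funRep (L : π.Jet → ℝ) (z₀ : π.Jet) : (E × F) × (E →L[ℝ] F) → ℝ :=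
  L ∘ (extChartAt (jetModel I F) z₀).symm

theorem contDiffWithinAt_funRep {L : π.Jet → ℝ} (hL : ContMDiff (jetModel I F) 𝓘(ℝ, ℝ) ∞ L)
    {z₀ : π.Jet} {w : (E × F) × (E →L[ℝ] F)} (hw : w ∈ (extChartAt (jetModel I F) z₀).target) :
    ContDiffWithinAt ℝ ∞ (funRep L z₀) (range (jetModel I F)) w :=
  ((hL _).comp_contMDiffWithinAt w (contMDiffWithinAt_extChartAt_symm_range z₀ hw)).contDiffWithinAt

/-- In any induced chart the curve `s ↦ z + s g` is an affine line in the last factor, hence stays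
in the range of the model even at boundary points. -/
theorem hasDerivAt_addVertical {L : π.Jet → ℝ} (hL : ContMDiff (jetModel I F) 𝓘(ℝ, ℝ) ∞ L)
    (z₀ : π.Jet) {z : π.Jet} (hz : z.pt ∈ (π.totalChart z₀.pt).source) (g : E →L[ℝ] E × F)
    (hg : ∀ s : ℝ, (tmap (I.prod 𝓘(ℝ, F)) I π.proj z.pt).comp (s • g) = 0) :
    HasDerivAt (fun s : ℝ => L (z.addVertical (s • g) (hg s)))
      (fderivWithin ℝ (funRep L z₀) (range (jetModel I F)) (extChartAt (jetModel I F) z₀ z)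
        ((0, 0), vliftRep z₀ z g)) 0 := by
  have hz' : z ∈ (extChartAt (jetModel I F) z₀).source :=
    (π.mem_extChartAt_jet_source).2 hz
  have hd := ((contDiffWithinAt_funRep hL ((extChartAt (jetModel I F) z₀).map_source hz')
    ).differentiableWithinAt (by simp)).hasFDerivWithinAt
  set κ := extChartAt (jetModel I F) z₀ with hκ
  set ζ : (E × F) × (E →L[ℝ] F) := ((0, 0), vliftRep z₀ z g) with hζ
  have hc : ∀ s : ℝ, κ (z.addVertical (s • g) (hg s)) = κ z + s • ζ := by
    intro s
    rw [hκ, extChartAt_addVertical, hζ]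
    congr 1
    refine Prod.ext (Prod.ext ?_ ?_) (ContinuousLinearMap.ext fun v => ?_)
    · exact (smul_zero s).symm
    · exact (smul_zero s).symm
    · change (tmap (I.prod 𝓘(ℝ, F)) (I.prod 𝓘(ℝ, F)) (π.totalChart z₀.pt) z.pt (s • _)).2 = _
      rw [map_smul]
      rfl
  have h3 : HasDerivWithinAt (fun s : ℝ => κ z + s • ζ) ζ univ 0 := by
    rw [hasDerivWithinAt_univ]
    simpa using ((hasDerivAt_id (0 : ℝ)).smul_const ζ).const_add (κ z)
  have hs : ∀ s : ℝ, z.addVertical (s • g) (hg s) ∈ κ.source := fun s =>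
    (π.mem_extChartAt_jet_source).2 hz
  have hmaps : MapsTo (fun s : ℝ => κ z + s • ζ) univ (range (jetModel I F)) := by
    intro s _
    change κ z + s • ζ ∈ _
    rw [← hc s]
    exact extChartAt_target_subset_range z₀ (κ.map_source (hs s))
  have h4 := HasFDerivWithinAt.comp_hasDerivWithinAt_of_eq (0 : ℝ) hd h3 hmaps (by simp)
  rw [hasDerivWithinAt_univ] at h4
  refine h4.congr_of_eventuallyEq (Filter.Eventually.of_forall fun s => ?_)
  change _ = L (κ.symm (κ z + s • ζ))
  rw [← hc s, κ.left_inv (hs s)]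

/-- Both sides are the derivative of `L` along the curve `s ↦ z + s g`, computed in the chart at `z`
and in the chart at `z₀`. The vertical lift is therefore independent of coordinates. -/
theorem tmap_vlift {L : π.Jet → ℝ} (hL : ContMDiff (jetModel I F) 𝓘(ℝ, ℝ) ∞ L)
    (z₀ : π.Jet) {z : π.Jet} (hz : z.pt ∈ (π.totalChart z₀.pt).source) (g : E →L[ℝ] E × F)
    (hg : (tmap (I.prod 𝓘(ℝ, F)) I π.proj z.pt).comp g = 0) :
    tmap (jetModel I F) 𝓘(ℝ, ℝ) L z (π.vlift z g) =
      fderivWithin ℝ (funRep L z₀) (range (jetModel I F)) (extChartAt (jetModel I F) z₀ z)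
        ((0, 0), vliftRep z₀ z g) := by
  have hg' : ∀ s : ℝ, (tmap (I.prod 𝓘(ℝ, F)) I π.proj z.pt).comp (s • g) = 0 := by
    intro s
    rw [ContinuousLinearMap.comp_smul, hg, smul_zero]
  have h1 := hasDerivAt_addVertical hL z₀ hz g hg'
  have h2 := hasDerivAt_addVertical hL z (π.mem_totalChart_source z.pt) g hg'
  refine Eq.trans ?_ (h2.unique h1)
  have h3 : tmap (jetModel I F) 𝓘(ℝ, ℝ) L z = fderivWithin ℝ (funRep L z) (range (jetModel I F))
      (extChartAt (jetModel I F) z z) := ((hL z).mdifferentiableAt (by simp)).mfderiv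
  rw [h3]
  rfl

end FiberedManifold
end VerticalCurve

/-! ### The Poincaré-Cartan form in a chart -/

section ChartRep
variable {n : ℕ} {H : Type*} [TopologicalSpace H]
  {I : ModelWithCorners ℝ (EuclideanSpace ℝ (Fin (n + 1))) H}
  {F : Type*} [NormedAddCommGroup F] [NormedSpace ℝ F]
  {X : Type*} [TopologicalSpace X] [ChartedSpace H X]
  {Y : Type*} [TopologicalSpace Y] [ChartedSpace (ModelProd H F) Y]

local notation "𝔼" => EuclideanSpace ℝ (Fin (n + 1))

theorem sum_proj_smul_single (A : 𝔼 →L[ℝ] ℝ) :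
    ∑ μ, A (EuclideanSpace.single μ (1 : ℝ)) • (EuclideanSpace.proj μ : 𝔼 →L[ℝ] ℝ) = A := by
  refine ContinuousLinearMap.ext fun v => ?_
  have h1 := (EuclideanSpace.basisFun (Fin (n + 1)) ℝ).sum_repr v
  conv_rhs => rw [← h1]
  simp [mul_comm]

/-- The vector `∑_μ Λ (dx^μ) ∂/∂x^μ` does not depend on the coordinates. -/
theorem sum_comp_smul_single (Λ : (𝔼 →L[ℝ] ℝ) →ₗ[ℝ] ℝ) (T T' : 𝔼 →L[ℝ] 𝔼)
    (h : T.comp T' = .id ℝ 𝔼) :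
    T (∑ μ, Λ ((EuclideanSpace.proj μ).comp T') • EuclideanSpace.single μ (1 : ℝ)) =
      ∑ μ, Λ (EuclideanSpace.proj μ) • EuclideanSpace.single μ (1 : ℝ) := by
  -- The vector in question is the one that represents `Λ`: every functional `A` takes the value `Λ
  -- A` on it. This description does not mention a basis.
  have key : ∀ A : 𝔼 →L[ℝ] ℝ, A (T (∑ μ, Λ ((EuclideanSpace.proj μ).comp T') •
      EuclideanSpace.single μ (1 : ℝ))) = Λ A := by
    intro A
    have h1 : A = ∑ μ, (A.comp T) (EuclideanSpace.single μ (1 : ℝ)) •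
        (EuclideanSpace.proj μ : 𝔼 →L[ℝ] ℝ).comp T' := by
      have h2 := congrArg (fun B : 𝔼 →L[ℝ] ℝ => B.comp T') (sum_proj_smul_single (A.comp T))
      have h3 : (A.comp T).comp T' = A := by
        rw [ContinuousLinearMap.comp_assoc, h, ContinuousLinearMap.comp_id]
      simp only [h3] at h2
      refine h2.symm.trans (ContinuousLinearMap.ext fun v => ?_)
      simp
    conv_rhs => rw [h1]
    simp [mul_comm]
  have key' : ∀ A : 𝔼 →L[ℝ] ℝ, A (∑ μ, Λ (EuclideanSpace.proj μ) •
      EuclideanSpace.single μ (1 : ℝ)) = Λ A := by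
    intro A
    conv_rhs => rw [← sum_proj_smul_single A]
    simp [mul_comm]
  refine PiLp.ext fun ν => ?_
  exact (key (EuclideanSpace.proj ν)).trans (key' (EuclideanSpace.proj ν)).symm

/-- The map `v ↦ ∑_μ (∂L/∂z^i_μ) v^i ∂/∂x^μ` of a linear functional `∂L/∂z`. -/
def momentumModel (Λ : (𝔼 →L[ℝ] F) →L[ℝ] ℝ) : F →L[ℝ] 𝔼 :=
  ∑ μ : Fin (n + 1), (Λ.comp (ContinuousLinearMap.smulRightL ℝ 𝔼 F (EuclideanSpace.proj μ))).smulRight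
    (EuclideanSpace.single μ (1 : ℝ))

theorem momentumModel_apply (Λ : (𝔼 →L[ℝ] F) →L[ℝ] ℝ) (v : F) : momentumModel Λ v =
    ∑ μ : Fin (n + 1), Λ ((EuclideanSpace.proj μ : 𝔼 →L[ℝ] ℝ).smulRight v) •
      EuclideanSpace.single μ (1 : ℝ) := by
  simp [momentumModel]

/-- `B` is the sum of the rank one maps `dx^μ ⊗ B (∂/∂x^μ)`, and the diagonal entry at `μ` is `Λ` of
the summand with index `μ`. This supplies the trace hypothesis of `extDeriv_pcModel_cons_vertical`.
-/
theorem trace_momentumModel_comp (Λ : (𝔼 →L[ℝ] F) →L[ℝ] ℝ) (B : 𝔼 →L[ℝ] F) :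
    LinearMap.trace ℝ 𝔼 ((momentumModel Λ).comp B : 𝔼 →L[ℝ] 𝔼) = Λ B := by
  rw [LinearMap.trace_eq_matrix_trace ℝ (EuclideanSpace.basisFun (Fin (n + 1)) ℝ).toBasis,
    Matrix.trace]
  have h1 : B = ∑ μ, (EuclideanSpace.proj μ : 𝔼 →L[ℝ] ℝ).smulRight
      (B (EuclideanSpace.single μ (1 : ℝ))) := by
    refine ContinuousLinearMap.ext fun v => ?_
    have h1 := (EuclideanSpace.basisFun (Fin (n + 1)) ℝ).sum_repr v
    conv_lhs => rw [← h1]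
    simp
  conv_rhs => rw [h1]
  rw [map_sum]
  refine Finset.sum_congr rfl fun μ _ => ?_
  rw [Matrix.diag_apply, LinearMap.toMatrix_apply]
  simp [momentumModel_apply, Finset.sum_apply]

namespace FiberedManifold
variable {π : FiberedManifold I F X Y}

/-- The derivative of the Lagrangian with respect to the velocities, in a chart. -/
def verticalDeriv (L : π.Jet → ℝ) (z₀ : π.Jet) (w : (𝔼 × F) × (𝔼 →L[ℝ] F)) :
    (𝔼 →L[ℝ] F) →L[ℝ] ℝ :=
  (fderivWithin ℝ (funRep L z₀) (range (jetModel I F)) w).comp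
    (ContinuousLinearMap.inr ℝ (𝔼 × F) (𝔼 →L[ℝ] F))

/-- The differential of `L` on vertical lifts transforms correctly by `tmap_vlift`, and the sum over
the frame is independent of the frame by `sum_comp_smul_single`. -/
theorem tmap_baseChart_momentum {L : π.Jet → ℝ} (hL : ContMDiff (jetModel I F) 𝓘(ℝ, ℝ) ∞ L)
    (z₀ : π.Jet) {z : π.Jet} (hz : z.pt ∈ (π.totalChart z₀.pt).source) {f : 𝔼 × F} {f' : F}
    (hf : tmap (I.prod 𝓘(ℝ, F)) (I.prod 𝓘(ℝ, F)) (π.totalChart z₀.pt) z.pt f = (0, f')) :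
    tmap I I (π.baseChart z₀.pt) (π.projX z) (π.momentum L z f) =
      momentumModel (verticalDeriv L z₀ (extChartAt (jetModel I F) z₀ z)) f' := by
  have h := π.isAdaptedPair z₀.pt
  have hx := h.mapsTo _ hz
  have hfv : tmap (I.prod 𝓘(ℝ, F)) I π.proj z.pt f = 0 := by
    have h1 := DFunLike.congr_fun (h.fst_comp hz) f
    have h2 := fun w => DFunLike.congr_fun (tmap_symm_comp I I h.mdiff_base hx) w
    simp only [ContinuousLinearMap.comp_apply, ContinuousLinearMap.id_apply, hf] at h1 h2
    rw [← h2 (tmap (I.prod 𝓘(ℝ, F)) I π.proj z.pt f), ← h1]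
    simp
  set T := tmap I I (π.baseChart z₀.pt) (π.projX z) with hT
  set T' := tmap I I (π.baseChart z₀.pt).symm (π.baseChart z₀.pt (π.projX z)) with hT'
  have hTT : T.comp T' = .id ℝ 𝔼 := by
    have h1 := tmap_comp_symm I I h.mdiff_base ((π.baseChart z₀.pt).map_source hx)
    rw [(π.baseChart z₀.pt).left_inv hx] at h1
    exact h1
  let Λ : (𝔼 →L[ℝ] ℝ) →ₗ[ℝ] ℝ :=
    { toFun := fun A => verticalDeriv L z₀ (extChartAt (jetModel I F) z₀ z) (A.smulRight f')
      map_add' := fun A A' => by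
        rw [← map_add]
        congr 1
        refine ContinuousLinearMap.ext fun v => ?_
        simp [add_smul]
      map_smul' := fun a A => by
        rw [RingHom.id_apply, ← map_smul]
        congr 1
        refine ContinuousLinearMap.ext fun v => ?_
        simp [mul_smul] }
  have h1 : π.momentum L z f = ∑ μ, Λ ((EuclideanSpace.proj μ).comp T') •
      EuclideanSpace.single μ (1 : ℝ) := by
    have h0 : π.momentum L z f = ∑ μ, (tmap (jetModel I F) 𝓘(ℝ, ℝ) L z
        (π.vlift z ((EuclideanSpace.proj μ : 𝔼 →L[ℝ] ℝ).smulRight f))) •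
        EuclideanSpace.single μ (1 : ℝ) := by
      rw [momentum, sum_apply]
      rfl
    rw [h0]
    refine Finset.sum_congr rfl fun μ _ => ?_
    congr 1
    rw [tmap_vlift hL z₀ hz]
    · refine congrArg _ (Prod.ext rfl (ContinuousLinearMap.ext fun v => ?_))
      change (tmap (I.prod 𝓘(ℝ, F)) (I.prod 𝓘(ℝ, F)) (π.totalChart z₀.pt) z.pt
        ((EuclideanSpace.proj μ : 𝔼 →L[ℝ] ℝ) (T' v) • f)).2 = _
      rw [map_smul, hf]
      rfl
    · refine ContinuousLinearMap.ext fun v => ?_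
      change tmap (I.prod 𝓘(ℝ, F)) I π.proj z.pt ((EuclideanSpace.proj μ : 𝔼 →L[ℝ] ℝ) v • f) = 0
      rw [map_smul, hfv, smul_zero]
  rw [h1, sum_comp_smul_single Λ T T' hTT, momentumModel_apply]
  rfl

/-- The Poincaré-Cartan form in a chart. -/
def pcRep (π : FiberedManifold I F X Y) (η : Form I X (n + 1)) (L : π.Jet → ℝ) (z₀ : π.Jet) :
    (𝔼 × F) × (𝔼 →L[ℝ] F) → ((𝔼 × F) × (𝔼 →L[ℝ] F)) [⋀^Fin (n + 1)]→L[ℝ] ℝ :=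
  pcModel (baseRep η (π.baseChart z₀.pt)) (funRep L z₀)
    fun w => momentumModel (verticalDeriv L z₀ w)

theorem poincareCartan_apply (η : Form I X (n + 1)) (L : π.Jet → ℝ) (z : π.Jet)
    (V : Fin (n + 1) → (𝔼 × F) × (𝔼 →L[ℝ] F)) :
    formAt (π.poincareCartan η L) z V =
      L z * formAt η (π.projX z) (fun i => tmap (jetModel I F) I π.projX z (V i)) +
      ∑ i : Fin (n + 1), (-1 : ℝ) ^ (i : ℕ) * formAt η (π.projX z)
        (Fin.cons (π.momentum L z (π.contactPart z (V i)))
          (i.removeNth fun k => tmap (jetModel I F) I π.projX z (V k))) := by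
  have h := ContinuousAlternatingMap.alternatizeUncurryFin_apply
    (E := (𝔼 × F) × (𝔼 →L[ℝ] F))
      ((ContinuousAlternatingMap.compContinuousLinearMapCLM (ι := Fin n)
          (tmap (jetModel I F) I π.projX z)).comp
        ((ContinuousAlternatingMap.curryLeft (E := 𝔼)
          (formAt η (π.projX z))).comp ((π.momentum L z).comp (π.contactPart z)))) V
  refine (congrArg (fun a => L z * formAt η (π.projX z)
    (fun i => tmap (jetModel I F) I π.projX z (V i)) + a) h).trans ?_
  congr 1
  refine Finset.sum_congr rfl fun i _ => ?_
  rw [zsmul_eq_mul]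
  push_cast
  rfl

variable [IsManifold I ∞ X]

/-- The base projection, the contact part, the momentum and `η` have each been computed in
coordinates; the intrinsic definition is assembled from them slot by slot. -/
theorem chartRep_poincareCartan (η : Form I X (n + 1)) {L : π.Jet → ℝ}
    (hL : ContMDiff (jetModel I F) 𝓘(ℝ, ℝ) ∞ L) (z₀ : π.Jet) {w : (𝔼 × F) × (𝔼 →L[ℝ] F)}
    (hw : w ∈ (extChartAt (jetModel I F) z₀).target) :
    chartRep (jetModel I F) (π.poincareCartan η L) z₀ w = π.pcRep η L z₀ w := by
  have : IsManifold (jetModel I F) 1 π.Jet := IsManifold.of_le (n := ∞) (by simp)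
  set z := (extChartAt (jetModel I F) z₀).symm w with hzdef
  have hzs : z ∈ (extChartAt (jetModel I F) z₀).source :=
    (extChartAt (jetModel I F) z₀).map_target hw
  have hz := (π.mem_extChartAt_jet_source).1 hzs
  have hκ : extChartAt (jetModel I F) z₀ z = w := (extChartAt (jetModel I F) z₀).right_inv hw
  have h := π.isAdaptedPair z₀.pt
  have hx : π.projX z ∈ (π.baseChart z₀.pt).source := h.mapsTo _ hz
  have hbase := fun V => DFunLike.congr_fun (π.tmap_baseChart_comp_projX hz) V
  have hcontact := fun V => tmap_baseChart_momentum hL z₀ hz (π.tmap_totalChart_contactPart hz V)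
  have hx1 : I (π.baseChart z₀.pt (π.projX z)) = w.1.1 := by
    rw [← π.extChartAt_jet_fst_fst hz, hκ]
  rw [hκ] at hcontact
  have hT : ∀ v, tmap (jetModel I F) 𝓘(ℝ, (𝔼 × F) × (𝔼 →L[ℝ] F)) (extChartAt (jetModel I F) z₀) z
      (tmapSymm (jetModel I F) z₀ w v) = v := fun v => tmap_tmapSymm hw v
  have hb : ∀ v, tmap I I (π.baseChart z₀.pt) (π.projX z)
      (tmap (jetModel I F) I π.projX z (tmapSymm (jetModel I F) z₀ w v)) = v.1.1 := by
    intro v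
    refine (hbase _).trans ?_
    rw [ContinuousLinearMap.comp_apply, hT]
    rfl
  refine ContinuousAlternatingMap.ext fun V => ?_
  rw [chartRep_eq, ContinuousAlternatingMap.compContinuousLinearMap_apply, ← hzdef, pcRep,
    pcModel_apply]
  rw [Function.comp_def, poincareCartan_apply, formAt_eq_baseRep η h.mdiff_base hx]
  simp only [hb, hx1]
  congr 1
  refine Finset.sum_congr rfl fun i _ => ?_
  rw [formAt_eq_baseRep η h.mdiff_base hx, hx1]
  congr 2
  funext j
  refine Fin.cases ?_ (fun j => ?_) j
  · refine (hcontact _).trans ?_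
    rw [hT]
    rfl
  · exact hb _

omit [IsManifold I ∞ X] in
theorem contDiffWithinAt_verticalDeriv {L : π.Jet → ℝ}
    (hL : ContMDiff (jetModel I F) 𝓘(ℝ, ℝ) ∞ L) (z₀ : π.Jet) {w : (𝔼 × F) × (𝔼 →L[ℝ] F)}
    (hw : w ∈ (extChartAt (jetModel I F) z₀).target) :
    ContDiffWithinAt ℝ ∞ (verticalDeriv L z₀) (range (jetModel I F)) w := by
  have h1 : ContDiffWithinAt ℝ ∞ (fderivWithin ℝ (funRep L z₀) (range (jetModel I F)))
      (range (jetModel I F)) w :=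
    (contDiffWithinAt_funRep hL hw).fderivWithin_right (jetModel I F).uniqueDiffOn (by simp)
      (extChartAt_target_subset_range z₀ hw)
  exact h1.clm_comp contDiffWithinAt_const

theorem contDiff_momentumModel : ContDiff ℝ ∞ (momentumModel (n := n) (F := F)) := by
  refine ContDiff.sum fun μ _ => ?_
  refine ContDiff.smulRight ?_ contDiff_const
  exact contDiff_id.clm_comp contDiff_const

variable [FiniteDimensional ℝ F]

theorem isSmoothForm_poincareCartan {η : Form I X (n + 1)} (hη : IsSmoothForm I η) {L : π.Jet → ℝ}
    (hL : ContMDiff (jetModel I F) 𝓘(ℝ, ℝ) ∞ L) :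
    IsSmoothForm (jetModel I F) (π.poincareCartan η L) := by
  refine isSmoothForm_of_contDiffWithinAt fun z₀ w hw => ?_
  have h1 : ContDiffWithinAt ℝ ∞ (π.pcRep η L z₀) (extChartAt (jetModel I F) z₀).target w := by
    rw [contDiffWithinAt_alternating_iff]
    intro V
    have hsub : (extChartAt (jetModel I F) z₀).target ⊆ range (jetModel I F) :=
      extChartAt_target_subset_range z₀
    have hw' := (π.mem_extChartAt_jet_target).1 hw
    have hη' : ContDiffWithinAt ℝ ∞ (fun w : (𝔼 × F) × (𝔼 →L[ℝ] F) =>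
        baseRep η (π.baseChart z₀.pt) w.1.1) (extChartAt (jetModel I F) z₀).target w := by
      have h2 : ContDiffWithinAt ℝ ∞ (baseRep (I := I) η (π.baseChart z₀.pt)) (range I) w.1.1 := by
        refine contDiffWithinAt_baseRep hη (π.isAdaptedPair z₀.pt).base_mem hw'.2 ?_
        have h3 := (π.totalChart z₀.pt).map_target hw'.1
        have h4 := (π.isAdaptedPair z₀.pt).fst_eq _ h3
        rw [(π.totalChart z₀.pt).right_inv hw'.1] at h4
        change ((I.symm w.1.1, w.1.2) : ModelProd H F).1 ∈ _
        rw [h4]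
        exact (π.baseChart z₀.pt).map_source ((π.isAdaptedPair z₀.pt).mapsTo _ h3)
      exact h2.comp w (contDiff_fst.fst).contDiffWithinAt
        fun v hv => ((π.mem_extChartAt_jet_target).1 hv).2
    have hL' := (contDiffWithinAt_funRep hL hw).mono hsub
    have hp : ContDiffWithinAt ℝ ∞ (fun w => momentumModel (verticalDeriv L z₀ w))
        (extChartAt (jetModel I F) z₀).target w :=
      contDiff_momentumModel.comp_contDiffWithinAt
        ((contDiffWithinAt_verticalDeriv hL z₀ hw).mono hsub)
    have h5 : (fun w => π.pcRep η L z₀ w V) = fun w => _ :=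
      funext fun w => pcModel_apply _ _ _ w V
    rw [h5]
    refine (hL'.mul (contDiffWithinAt_alternating_apply hη' fun i => contDiffWithinAt_const)).add ?_
    refine ContDiffWithinAt.sum fun i _ => contDiffWithinAt_const.mul ?_
    have h6 : ∀ j, ContDiffWithinAt ℝ ∞ (fun w : (𝔼 × F) × (𝔼 →L[ℝ] F) =>
        (Fin.cons (momentumModel (verticalDeriv L z₀ w) (contactForm w (V i)))
          (i.removeNth fun k => (V k).1.1) : Fin (n + 1) → 𝔼) j)
        (extChartAt (jetModel I F) z₀).target w := by
      intro j
      refine Fin.cases ?_ (fun j => ?_) j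
      · have h7 : ContDiff ℝ ∞ fun w : (𝔼 × F) × (𝔼 →L[ℝ] F) => contactForm w (V i) :=
          contDiff_contactForm.clm_apply contDiff_const
        exact hp.clm_apply h7.contDiffWithinAt
      · exact contDiffWithinAt_const
    exact contDiffWithinAt_alternating_apply hη' h6
  have h2 := h1.congr_of_mem (fun y hy => chartRep_poincareCartan η hL z₀ hy) hw
  exact h2.mono_of_mem_nhdsWithin (extChartAt_target_mem_nhdsWithin' (by
    exact (extChartAt (jetModel I F) z₀).map_target hw) |> fun h => by
      rwa [(extChartAt (jetModel I F) z₀).right_inv hw] at h)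

end FiberedManifold
end ChartRep

/-! ### Reparametrization to jets and the propagation theorem in coordinates -/

section LocalSection

variable {E : Type*} [NormedAddCommGroup E] [NormedSpace ℝ E] [FiniteDimensional ℝ E]
  {G : Type*} [NormedAddCommGroup G] [NormedSpace ℝ G]

/-- A local version of the inverse function theorem. -/
theorem exists_local_inverse {ψ : E → E} {O : Set E} (hO : IsOpen O) (hψ : ContDiffOn ℝ ∞ ψ O)
    (hsurj : ∀ x ∈ O, Surjective (fderiv ℝ ψ x)) {x₀ : E} (hx₀ : x₀ ∈ O) :
    ∃ (O' : Set E) (g : E → E), IsOpen O' ∧ ψ x₀ ∈ O' ∧ g (ψ x₀) = x₀ ∧ ContDiffOn ℝ ∞ g O' ∧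
      (∀ y ∈ O', g y ∈ O) ∧ ∀ y ∈ O', ψ (g y) = y := by
  have hequiv : ∀ x ∈ O, ∃ A : E ≃L[ℝ] E, HasFDerivAt ψ (A : E →L[ℝ] E) x := by
    intro x hx
    have h1 := (hψ.contDiffAt (hO.mem_nhds hx)).differentiableAt (by simp)
    have h2 : Injective (fderiv ℝ ψ x) :=
      LinearMap.injective_iff_surjective (f := (fderiv ℝ ψ x : E →ₗ[ℝ] E)).2 (hsurj x hx)
    refine ⟨ContinuousLinearEquiv.ofBijective (fderiv ℝ ψ x) (LinearMap.ker_eq_bot.2 h2)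
      (LinearMap.range_eq_top.2 (hsurj x hx)), ?_⟩
    rw [ContinuousLinearEquiv.coe_ofBijective]
    exact h1.hasFDerivAt
  obtain ⟨A, hA⟩ := hequiv x₀ hx₀
  have hψ₀ := hψ.contDiffAt (hO.mem_nhds hx₀)
  let R := hψ₀.toOpenPartialHomeomorph ψ hA (by simp)
  have hRψ : ∀ x, R x = ψ x := fun x => rfl
  have hxR : x₀ ∈ R.source := hψ₀.mem_toOpenPartialHomeomorph_source hA (by simp)
  refine ⟨R.target ∩ R.symm ⁻¹' O, R.symm, R.symm.isOpen_inter_preimage hO, ⟨R.map_source hxR, ?_⟩,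
    R.left_inv hxR, ?_, fun y hy => hy.2, fun y hy => R.right_inv hy.1⟩
  · rw [mem_preimage, ← hRψ, R.left_inv hxR]
    exact hx₀
  · intro y hy
    obtain ⟨A', hA'⟩ := hequiv _ hy.2
    exact (R.contDiffAt_symm hy.1 hA' (hψ.contDiffAt (hO.mem_nhds hy.2))).contDiffWithinAt

/-- By dimension, surjectivity makes `pr ∘ f` a local diffeomorphism, and `g` is its local inverse.
The isomorphism `A` is the derivative of `g`, so `f ∘ g` and `f` have the same tangent spaces. -/
theorem exists_section_of_family {f : E → G} {pr : G →L[ℝ] E} {O : Set E} (hO : IsOpen O)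
    (hf : ContDiffOn ℝ ∞ f O) (hsurj : ∀ x ∈ O, Surjective (pr.comp (fderiv ℝ f x))) {x₀ : E}
    (hx₀ : x₀ ∈ O) :
    ∃ (O' : Set E) (g : E → E), IsOpen O' ∧ pr (f x₀) ∈ O' ∧ g (pr (f x₀)) = x₀ ∧
      ContDiffOn ℝ ∞ (f ∘ g) O' ∧ (∀ y ∈ O', g y ∈ O) ∧ (∀ y ∈ O', pr (f (g y)) = y) ∧
      (∀ y ∈ O', pr.comp (fderiv ℝ (f ∘ g) y) = .id ℝ E) ∧
      ∀ y ∈ O', ∃ A : E ≃L[ℝ] E, fderiv ℝ (f ∘ g) y = (fderiv ℝ f (g y)).comp (A : E →L[ℝ] E) := by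
  have hd : ∀ x ∈ O, HasFDerivAt f (fderiv ℝ f x) x := fun x hx =>
    ((hf.contDiffAt (hO.mem_nhds hx)).differentiableAt (by simp)).hasFDerivAt
  have hψ : ∀ x ∈ O, fderiv ℝ (fun x => pr (f x)) x = pr.comp (fderiv ℝ f x) := fun x hx =>
    (pr.hasFDerivAt.comp x (hd x hx)).fderiv
  obtain ⟨O', g, hO', h1, h2, h3, h4, h5⟩ := exists_local_inverse (ψ := fun x => pr (f x)) hO
    (pr.contDiff.comp_contDiffOn hf) (fun x hx => by rw [hψ x hx]; exact hsurj x hx) hx₀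
  have hfg : ContDiffOn ℝ ∞ (f ∘ g) O' := hf.comp h3 h4
  have hchain : ∀ y ∈ O', fderiv ℝ (f ∘ g) y = (fderiv ℝ f (g y)).comp (fderiv ℝ g y) := by
    intro y hy
    exact ((hd _ (h4 y hy)).comp y ((h3.contDiffAt (hO'.mem_nhds hy)).differentiableAt
      (by simp)).hasFDerivAt).fderiv
  have hpr : ∀ y ∈ O', pr.comp (fderiv ℝ (f ∘ g) y) = .id ℝ E := by
    intro y hy
    have h6 := pr.hasFDerivAt.comp y (((hfg.contDiffAt (hO'.mem_nhds hy)).differentiableAt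
      (by simp)).hasFDerivAt)
    have h7 : (fun y => pr ((f ∘ g) y)) =ᶠ[𝓝 y] id := by
      filter_upwards [hO'.mem_nhds hy] with y' hy' using h5 y' hy'
    exact h6.unique ((hasFDerivAt_id y).congr_of_eventuallyEq h7)
  refine ⟨O', g, hO', h1, h2, hfg, h4, h5, hpr, fun y hy => ?_⟩
  have hinj : Injective (fderiv ℝ g y) := by
    intro c c' hc
    have h6 := hpr y hy
    rw [hchain y hy] at h6
    have h7 := DFunLike.congr_fun h6 c
    have h8 := DFunLike.congr_fun h6 c'
    simp only [ContinuousLinearMap.comp_apply, ContinuousLinearMap.id_apply, hc] at h7 h8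
    exact h7.symm.trans h8
  refine ⟨ContinuousLinearEquiv.ofBijective (fderiv ℝ g y) (LinearMap.ker_eq_bot.2 hinj)
    (LinearMap.range_eq_top.2 (LinearMap.injective_iff_surjective
      (f := (fderiv ℝ g y : E →ₗ[ℝ] E)).1 hinj)), ?_⟩
  rw [ContinuousLinearEquiv.coe_ofBijective]
  exact hchain y hy

omit [FiniteDimensional ℝ E] in
theorem contDiffOn_extDeriv {k : ℕ} {O : Set E} (hO : IsOpen O) {τ : E → E [⋀^Fin k]→L[ℝ] ℝ}
    (hτ : ContDiffOn ℝ ∞ τ O) : ContDiffOn ℝ ∞ (extDeriv τ) O := by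
  have h1 := hτ.fderiv_of_isOpen hO (m := ∞) (by simp)
  have hA : ContDiff ℝ ∞ fun a : E →L[ℝ] E [⋀^Fin k]→L[ℝ] ℝ =>
      ContinuousAlternatingMap.alternatizeUncurryFin a :=
    ContinuousLinearMap.contDiff (𝕜 := ℝ) (E := E →L[ℝ] E [⋀^Fin k]→L[ℝ] ℝ)
      (F := E [⋀^Fin (k + 1)]→L[ℝ] ℝ) (n := ∞)
      (ContinuousAlternatingMap.alternatizeUncurryFinCLM ℝ E ℝ)
  exact hA.comp_contDiffOn h1

variable {F : Type*} [NormedAddCommGroup F] [NormedSpace ℝ F]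

/-- A family annihilated by the contact form and transverse to the fibres is locally a `1`-jet. -/
theorem exists_jetMap_of_contact {f : E → (E × F) × (E →L[ℝ] F)} {O : Set E} (hO : IsOpen O)
    (hf : ContDiffOn ℝ ∞ f O) (hcf : ∀ x ∈ O, (contactForm (f x)).comp (fderiv ℝ f x) = 0)
    (hsurj : ∀ x ∈ O, Surjective ((baseProj E F).comp (fderiv ℝ f x))) {x₀ : E} (hx₀ : x₀ ∈ O) :
    ∃ (O' : Set E) (u : E → F), IsOpen O' ∧ (f x₀).1.1 ∈ O' ∧ ContDiffOn ℝ ∞ u O' ∧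
      jetMap u (f x₀).1.1 = f x₀ ∧
      (∀ v, ∃ c, fderiv ℝ f x₀ v = fderiv ℝ (jetMap u) (f x₀).1.1 c) ∧
      ∀ y ∈ O', ∃ x ∈ O, jetMap u y = f x ∧ ∀ c, ∃ v, fderiv ℝ (jetMap u) y c = fderiv ℝ f x v := by
  obtain ⟨O', g, hO', h1, h2, h3, h4, h5, h6, h7⟩ :=
    exists_section_of_family (pr := baseProj E F) hO hf hsurj hx₀
  let u : E → F := fun y => (f (g y)).1.2
  have hu : ContDiffOn ℝ ∞ u O' := contDiff_snd.comp_contDiffOn (contDiff_fst.comp_contDiffOn h3)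
  have hjet : ∀ y ∈ O', jetMap u y = f (g y) := by
    intro y hy
    have hd : HasFDerivAt (f ∘ g) (fderiv ℝ (f ∘ g) y) y :=
      ((h3.contDiffAt (hO'.mem_nhds hy)).differentiableAt (by simp)).hasFDerivAt
    have hdu : fderiv ℝ u y = (ContinuousLinearMap.snd ℝ E F).comp
        ((ContinuousLinearMap.fst ℝ (E × F) (E →L[ℝ] F)).comp (fderiv ℝ (f ∘ g) y)) :=
      (hd.fst.snd).fderiv
    refine Prod.ext (Prod.ext (h5 y hy).symm rfl) ?_
    change fderiv ℝ u y = (f (g y)).2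
    rw [hdu]
    refine ContinuousLinearMap.ext fun c => ?_
    obtain ⟨A, hA⟩ := h7 y hy
    -- For the reparametrized family the contact condition says that its third component is the
    -- derivative of the second one.
    have h8 : contactForm (f (g y)) (fderiv ℝ (f ∘ g) y c) = 0 := by
      rw [hA]
      exact DFunLike.congr_fun (hcf _ (h4 y hy)) (A c)
    rw [contactForm_apply, sub_eq_zero] at h8
    have h9 : (fderiv ℝ (f ∘ g) y c).1.1 = c := DFunLike.congr_fun (h6 y hy) c
    rw [h9] at h8
    exact h8
  have hder : ∀ y ∈ O', fderiv ℝ (jetMap u) y = fderiv ℝ (f ∘ g) y := by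
    intro y hy
    refine Filter.EventuallyEq.fderiv_eq ?_
    filter_upwards [hO'.mem_nhds hy] with y' hy' using hjet y' hy'
  have h1' : (f x₀).1.1 ∈ O' := h1
  have h2' : g (f x₀).1.1 = x₀ := h2
  refine ⟨O', u, hO', h1, hu, ?_, fun v => ?_, fun y hy => ⟨g y, h4 y hy, hjet y hy, fun c => ?_⟩⟩
  · rw [hjet _ h1', h2']
  · obtain ⟨A, hA⟩ := h7 _ h1'
    refine ⟨A.symm v, ?_⟩
    rw [hder _ h1', hA, h2']
    simp
  · obtain ⟨A, hA⟩ := h7 y hy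
    exact ⟨A c, by rw [hder y hy, hA]; rfl⟩

variable {n : ℕ} [FiniteDimensional ℝ F]

/-- Propagation along the flow of a symmetry, in coordinates: a family of curves that at one time is
the `1`-jet of a solution is so at all times. -/
theorem propagation_model (hE : Module.finrank ℝ E = n + 1)
    {D : Set ((E × F) × (E →L[ℝ] F))} (hD : IsOpen D)
    {ξ : (E × F) × (E →L[ℝ] F) → (E × F) × (E →L[ℝ] F)} (hξ : ContDiffOn ℝ ∞ ξ D)
    (hker : ∀ w ∈ D, ∀ v, contactForm w v = 0 → lieContact ξ w v = 0)
    {η : E → E [⋀^Fin (n + 1)]→L[ℝ] ℝ} {L : (E × F) × (E →L[ℝ] F) → ℝ}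
    {p : (E × F) × (E →L[ℝ] F) → F →L[ℝ] E}
    {Θ τ : ((E × F) × (E →L[ℝ] F)) → ((E × F) × (E →L[ℝ] F)) [⋀^Fin (n + 1)]→L[ℝ] ℝ}
    (hΘ : ContDiffOn ℝ ∞ Θ D) (hΘpc : ∀ w ∈ D, Θ w = pcModel η L p w)
    (hL : ContDiffOn ℝ ∞ L D) (hp : ContDiffOn ℝ ∞ p D)
    (htr : ∀ w ∈ D, ∀ B : E →L[ℝ] F,
      LinearMap.trace ℝ E ((p w).comp B : E →L[ℝ] E) = fderiv ℝ L w (0, B))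
    (hτ : ContDiffOn ℝ ∞ τ D)
    (hnull : ∀ (O' : Set E) (u' : E → F), IsOpen O' → ContDiffOn ℝ ∞ u' O' → ∀ x ∈ O',
      jetMap u' x ∈ D → ∀ v : Fin (n + 1) → E,
        τ (jetMap u' x) (fun i => fderiv ℝ (jetMap u') x (v i)) = 0)
    (hτd : ∀ w ∈ D, extDeriv τ w = extDeriv (fun w => (extDeriv Θ w).curryLeft (ξ w)) w)
    {a b : ℝ} {O : Set E} (hO : IsOpen O) {q : ℝ × E → (E × F) × (E →L[ℝ] F)}
    (hq : ContDiffOn ℝ ∞ q (Ioo a b ×ˢ O)) (hqD : ∀ t ∈ Ioo a b, ∀ x ∈ O, q (t, x) ∈ D)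
    (hflow : ∀ t ∈ Ioo a b, ∀ x ∈ O, HasDerivAt (fun s => q (s, x)) (ξ (q (t, x))) t)
    (hsurj : ∀ t ∈ Ioo a b, ∀ x ∈ O,
      Surjective ((baseProj E F).comp (fderiv ℝ (fun x => q (t, x)) x)))
    {t₁ : ℝ} (ht₁ : t₁ ∈ Ioo a b)
    (hc₁ : ∀ x ∈ O, (contactForm (q (t₁, x))).comp (fderiv ℝ (fun x => q (t₁, x)) x) = 0)
    (hEL₁ : ∀ x ∈ O, ∀ ζ (v : Fin (n + 1) → E), extDeriv Θ (q (t₁, x))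
      (Fin.cons ζ fun i => fderiv ℝ (fun x => q (t₁, x)) x (v i)) = 0)
    {t : ℝ} (ht : t ∈ Ioo a b) {x : E} (hx : x ∈ O) :
    (contactForm (q (t, x))).comp (fderiv ℝ (fun x => q (t, x)) x) = 0 ∧
      ∀ ζ (v : Fin (n + 1) → E), extDeriv Θ (q (t, x))
        (Fin.cons ζ fun i => fderiv ℝ (fun x => q (t, x)) x (v i)) = 0 := by
  have hQ : IsOpen (Ioo a b ×ˢ O) := isOpen_Ioo.prod hO
  have hqd : ∀ t ∈ Ioo a b, ∀ x ∈ O, HasFDerivAt q (fderiv ℝ q (t, x)) (t, x) := fun t ht x hx =>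
    ((hq.contDiffAt (hQ.mem_nhds ⟨ht, hx⟩)).differentiableAt (by simp)).hasFDerivAt
  have hspat : ∀ t ∈ Ioo a b, ∀ x ∈ O, fderiv ℝ (fun x => q (t, x)) x =
      (fderiv ℝ q (t, x)).comp (ContinuousLinearMap.inr ℝ ℝ E) := fun t ht x hx =>
    ((hqd t ht x hx).comp x (hasFDerivAt_prodMk_right t x)).fderiv
  have hflow' : ∀ r ∈ Ioo a b ×ˢ O, fderiv ℝ q r (1, 0) = ξ (q r) := by
    rintro ⟨t, x⟩ ⟨ht, hx⟩
    have h1 : HasDerivAt (fun s : ℝ => (s, x)) ((1 : ℝ), (0 : E)) t :=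
      (hasDerivAt_id t).prodMk (hasDerivAt_const _ _)
    exact ((hqd t ht x hx).comp_hasDerivAt t h1).unique (hflow t ht x hx)
  let T : E → ℝ → E →L[ℝ] (E × F) × (E →L[ℝ] F) := fun x t => fderiv ℝ (fun x => q (t, x)) x
  have hT : ∀ x ∈ O, ∀ t ∈ Ioo a b, HasDerivAt (T x) ((fderiv ℝ ξ (q (t, x))).comp (T x t)) t := by
    intro x hx t ht
    have h1 := hasDerivAt_spatial_fderiv hQ hq hflow' (show (t, x) ∈ Ioo a b ×ˢ O from ⟨ht, hx⟩)
      ((hξ.contDiffAt (hD.mem_nhds (hqD t ht x hx))).differentiableAt (by simp))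
    rw [← hspat t ht x hx] at h1
    refine h1.congr_of_eventuallyEq ?_
    filter_upwards [Ioo_mem_nhds ht.1 ht.2] with s hs using hspat s hs x hx
  have hcf : ∀ t ∈ Ioo a b, ∀ x ∈ O, (contactForm (q (t, x))).comp (T x t) = 0 := fun t ht x hx =>
    contactForm_comp_eq_zero (q := fun s => q (s, x)) (h := T x) hD hξ hker
      (fun s hs => hflow s hs x hx) (fun s hs => hqD s hs x hx) (hT x hx) ht₁ (hc₁ x hx) t ht
  have hqt : ∀ t ∈ Ioo a b, ContDiffOn ℝ ∞ (fun x => q (t, x)) O := fun t ht =>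
    hq.comp (contDiff_prodMk_right t).contDiffOn fun x hx => ⟨ht, hx⟩
  -- The contact condition already holds at all times, so each time slice is a jet up to
  -- reparametrization. The vanishing along arbitrary jets then applies, before anything is known
  -- about the Euler-Lagrange equations.
  have hvert : ∀ t ∈ Ioo a b, ∀ x ∈ O, ∀ (B : E →L[ℝ] F) (v : Fin (n + 1) → E),
      extDeriv Θ (q (t, x)) (Fin.cons ((0, 0), B) fun i => T x t (v i)) = 0 := by
    intro t ht x hx B v
    obtain ⟨O', u, hO', h1, hu, h2, h3, -⟩ := exists_jetMap_of_contact hO (hqt t ht)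
      (hcf t ht) (hsurj t ht) hx
    choose c hc using h3
    have h4 := extDeriv_pcModel_cons_vertical hE hD hΘ hΘpc hL hp htr hO' hu h1
      (by rw [h2]; exact hqD t ht x hx) B (fun i => c (v i))
    rw [h2] at h4
    rw [← h4]
    congr 2
    funext i
    exact hc (v i)
  have hΩ : ContDiffOn ℝ ∞ (extDeriv Θ) D := contDiffOn_extDeriv hD hΘ
  have hΩd : ∀ w ∈ D, extDeriv (extDeriv Θ) w = 0 := fun w hw =>
    extDeriv_extDeriv_apply (hΘ.contDiffAt (hD.mem_nhds hw)) minSmoothness_two_le_infty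
  have hcontr : ∀ t ∈ Ioo a b, ∀ x ∈ O, ∀ (B : E →L[ℝ] F) (v : Fin (n + 1) → E),
      extDeriv (fun w => (extDeriv Θ w).curryLeft (ξ w)) (q (t, x))
        (Fin.cons ((0, 0), B) fun i => T x t (v i)) = 0 := fun t ht x hx B v =>
    extDeriv_contract_vertical (q := fun s => q (s, x)) (h := T x) hE hD hξ hΩ hΩd hker
      (fun s hs => hflow s hs x hx) (fun s hs => hqD s hs x hx) (hT x hx)
      (fun s hs => hcf s hs x hx) (fun s hs => hsurj s hs x hx) (fun s hs => hvert s hs x hx) ht B v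
  -- On `D`, `dτ` is the derivative of the contraction of `dΘ` with `ξ`, and `hcontr` gives its
  -- vanishing for `(0, 0, B)` along the whole slice. The null form argument extends this to `(0, V,
  -- 0)`.
  have hnull' : ∀ t ∈ Ioo a b, ∀ x ∈ O, ∀ (V : F) (v : Fin (n + 1) → E),
      extDeriv (fun w => (extDeriv Θ w).curryLeft (ξ w)) (q (t, x))
        (Fin.cons ((0, V), 0) fun i => T x t (v i)) = 0 := by
    intro t ht x hx V v
    obtain ⟨O', u, hO', h1, hu, h2, h3, h4⟩ := exists_jetMap_of_contact hO (hqt t ht)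
      (hcf t ht) (hsurj t ht) hx
    choose c hc using h3
    have huD : ∀ y ∈ O', jetMap u y ∈ D := by
      intro y hy
      obtain ⟨x', hx', h5, -⟩ := h4 y hy
      rw [h5]
      exact hqD t ht x' hx'
    have h6 := extDeriv_cons_eq_zero_of_null hE hD hτ hnull hO' hu huD (fun y hy B v => by
      obtain ⟨x', hx', h5, h6⟩ := h4 y hy
      choose c' hc' using h6
      rw [hτd _ (huD y hy), h5, ← hcontr t ht x' hx' B (fun i => c' (v i))]
      congr 2
      funext i
      exact hc' (v i)) h1 V (fun i => c (v i))
    rw [hτd _ (huD _ h1), h2] at h6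
    rw [← h6]
    congr 2
    funext i
    exact hc (v i)
  refine ⟨hcf t ht x hx, ?_⟩
  exact form_cons_eq_zero_of_propagation (q := fun s => q (s, x)) (h := T x) hE hD hξ hΩ hΩd
    (fun s hs => hflow s hs x hx) (fun s hs => hqD s hs x hx) (hT x hx)
    (fun s hs => hcf s hs x hx) (fun s hs => hsurj s hs x hx) (fun s hs => hvert s hs x hx)
    (fun s hs => hnull' s hs x hx) ht₁ (hEL₁ x hx) t ht

end LocalSection

/-! ### Lie derivatives and integral curves in charts -/

section LieDerivative

theorem extDeriv_add_sub_of_closed {E : Type*} [NormedAddCommGroup E] [NormedSpace ℝ E] {k : ℕ}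
    {a b c : E → E [⋀^Fin k]→L[ℝ] ℝ} {u : E} (ha : DifferentiableAt ℝ a u)
    (hb : DifferentiableAt ℝ b u) (hc : DifferentiableAt ℝ c u) (ha' : extDeriv a u = 0)
    (hb' : extDeriv b u = 0) : extDeriv (fun w => a w + c w - b w) u = extDeriv c u := by
  have h1 : (fun w => a w + c w - b w) = (a + c) + (-1 : ℝ) • b := by
    funext w
    refine ContinuousAlternatingMap.ext fun v => ?_
    change a w v + c w v - b w v = a w v + c w v + (-1 : ℝ) * b w v
    ring
  rw [h1, extDeriv_add (ha.add hc) (hb.const_smul (-1 : ℝ)), extDeriv_add ha hc, extDeriv_smul, ha',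
    hb', smul_zero, zero_add, add_zero]

variable {E : Type*} [NormedAddCommGroup E] [NormedSpace ℝ E] {H : Type*} [TopologicalSpace H]
  {I : ModelWithCorners ℝ E H} {M : Type*} [TopologicalSpace M] [ChartedSpace H M]
  [IsManifold I ∞ M] [IsManifold I 1 M]

/-- In `£_ξ τ - dα = d ι_ξ τ + ι_ξ dτ - dα` the first and the last terms are closed, so only `d (ι_ξ
dτ)` is left. -/
theorem extDeriv_chartRep_lieD_sub {k : ℕ} {ξ : (x : M) → TangentSpace I x}
    (hξ : IsSmoothField I ξ) {τ : Form I M (k + 1)} (hτ : IsSmoothForm I τ) {α : Form I M k}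
    (hα : IsSmoothForm I α) {x₀ : M} {u : E} (hu : u ∈ chartDomain I x₀) :
    extDeriv (chartRep I (lieD I ξ τ - extD I α) x₀) u =
      extDeriv (fun w => (extDeriv (chartRep I τ x₀) w).curryLeft (fieldRep ξ x₀ w)) u := by
  have hD := isOpen_chartDomain (I := I) x₀
  have hcurry : ∀ {j : ℕ} {f : E → E [⋀^Fin (j + 1)]→L[ℝ] ℝ}, ContDiffOn ℝ ∞ f (chartDomain I x₀) →
      ContDiffOn ℝ ∞ (fun w => (f w).curryLeft (fieldRep ξ x₀ w)) (chartDomain I x₀) := by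
    intro j f hf
    have h1 : ContDiffOn ℝ ∞ (fun w => (f w).curryLeft) (chartDomain I x₀) :=
      contDiff_curryLeft.comp_contDiffOn hf
    exact h1.clm_apply (contDiffOn_fieldRep hξ x₀)
  have hda : ∀ {j : ℕ} {f : E → E [⋀^Fin j]→L[ℝ] ℝ}, ContDiffOn ℝ ∞ f (chartDomain I x₀) →
      DifferentiableAt ℝ f u := fun hf => (hf.contDiffAt (hD.mem_nhds hu)).differentiableAt (by simp)
  have hdd : ∀ {j : ℕ} {f : E → E [⋀^Fin j]→L[ℝ] ℝ}, ContDiffOn ℝ ∞ f (chartDomain I x₀) →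
      extDeriv (extDeriv f) u = 0 := fun hf =>
    extDeriv_extDeriv_apply (hf.contDiffAt (hD.mem_nhds hu)) minSmoothness_two_le_infty
  have hτ' := hτ.contDiffOn x₀
  have hα' := hα.contDiffOn x₀
  refine Eq.trans (Filter.EventuallyEq.extDeriv_eq ?_) (extDeriv_add_sub_of_closed
    (hda (contDiffOn_extDeriv hD (hcurry hτ'))) (hda (contDiffOn_extDeriv hD hα'))
    (hda (hcurry (contDiffOn_extDeriv hD hτ'))) (hdd (hcurry hτ')) (hdd hα'))
  filter_upwards [hD.mem_nhds hu] with w hw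
  rw [← chartRep_lieD_of_mem_chartDomain hξ hτ hw, ← chartRep_extD_of_mem_chartDomain hα hw]
  rfl

omit [IsManifold I ∞ M] in
theorem hasDerivAt_extChartAt_comp {ξ : (x : M) → TangentSpace I x} {γ : ℝ → M} {a b t : ℝ}
    (hγ : IsMIntegralCurveOn (I := I) γ ξ (Ioo a b)) (ht : t ∈ Ioo a b) {x₀ : M}
    (hx : γ t ∈ (extChartAt I x₀).source) :
    HasDerivAt (fun s => extChartAt I x₀ (γ s)) (fieldRep ξ x₀ (extChartAt I x₀ (γ t))) t := by
  have h1 := (hγ t ht).hasMFDerivAt (Ioo_mem_nhds ht.1 ht.2)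
  have h2 := (mdifferentiableAt_extChartAt (I := I) (x := x₀) (y := γ t)
    (by rwa [← extChartAt_source (I := I)])).hasMFDerivAt
  have h3 : HasFDerivAt (fun s => extChartAt I x₀ (γ s)) ((tmap I 𝓘(ℝ, E) (extChartAt I x₀) (γ t)).comp
    ((1 : ℝ →L[ℝ] ℝ).smulRight (show E from ξ (γ t)))) t :=
    hasMFDerivAt_iff_hasFDerivAt.1 (h2.comp t h1)
  refine h3.hasDerivAt.congr_deriv ?_
  rw [fieldRep, (extChartAt I x₀).left_inv hx]
  change tmap I 𝓘(ℝ, E) (extChartAt I x₀) (γ t) ((1 : ℝ) • ξ (γ t)) = _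
  rw [one_smul]

end LieDerivative

/-! ### Local propagation on the manifold -/

section JetSolution
variable {n : ℕ} {H : Type*} [TopologicalSpace H]
  {I : ModelWithCorners ℝ (EuclideanSpace ℝ (Fin (n + 1))) H}
  {F : Type*} [NormedAddCommGroup F] [NormedSpace ℝ F]
  {X : Type*} [TopologicalSpace X] [ChartedSpace H X]
  {Y : Type*} [TopologicalSpace Y] [ChartedSpace (ModelProd H F) Y]

local notation "𝔼" => EuclideanSpace ℝ (Fin (n + 1))

namespace FiberedManifold
variable {π : FiberedManifold I F X Y}

/-- The map `f` is at `x` tangent to the contact distribution and a solution of the Euler-Lagrange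
equations. -/
def IsJetSolutionAt (π : FiberedManifold I F X Y) (η : Form I X (n + 1)) (L : π.Jet → ℝ)
    (f : X → π.Jet) (x : X) : Prop :=
  (∀ v, π.contactPart (f x) (tmap I (jetModel I F) f x v) = 0) ∧
    ∀ (ζ : (𝔼 × F) × (𝔼 →L[ℝ] F)) (v : Fin (n + 1) → 𝔼),
      formAt (extD (jetModel I F) (π.poincareCartan η L)) (f x)
        (Fin.cons ζ fun i => tmap I (jetModel I F) f x (v i)) = 0

variable [IsManifold I ∞ X] [IsManifold I 1 X]

omit [IsManifold I ∞ X] in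
theorem fderiv_mapRep {f : X → π.Jet} {x₀ x : X} {z₀ : π.Jet}
    (hx : x ∈ (extChartAt I x₀).source) (hx' : extChartAt I x₀ x ∈ chartDomain I x₀)
    (hf : MDifferentiableAt I (jetModel I F) f x)
    (hfx : f x ∈ (extChartAt (jetModel I F) z₀).source) (v : 𝔼) :
    fderiv ℝ (mapRep I (jetModel I F) f x₀ z₀) (extChartAt I x₀ x) v =
      tmap (jetModel I F) 𝓘(ℝ, (𝔼 × F) × (𝔼 →L[ℝ] F)) (extChartAt (jetModel I F) z₀) (f x)
        (tmap I (jetModel I F) f x (tmapSymm I x₀ (extChartAt I x₀ x) v)) := by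
  have : IsManifold (jetModel I F) 1 π.Jet := IsManifold.of_le (n := ∞) (by simp)
  have h0 : (extChartAt I x₀).symm (extChartAt I x₀ x) = x := (extChartAt I x₀).left_inv hx
  have h1 := tmap_extChartAt_comp_tmapSymm (I := I) (I' := jetModel I F) (f := f) (x₁ := z₀)
    (chartDomain_subset x₀ hx') (by rwa [h0]) (by rwa [h0])
  rw [fderivWithin_of_mem_nhds (range_mem_nhds hx'), h0] at h1
  exact (DFunLike.congr_fun h1 v).symm

variable [FiniteDimensional ℝ F]

/-- The tangent maps of the charts are bijective, so in coordinates `ζ` and `v` still range over all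
vectors. -/
theorem isJetSolutionAt_iff {η : Form I X (n + 1)} (hη : IsSmoothForm I η) {L : π.Jet → ℝ}
    (hL : ContMDiff (jetModel I F) 𝓘(ℝ, ℝ) ∞ L) {f : X → π.Jet} {x₀ x : X} {z₀ : π.Jet}
    (hx : x ∈ (extChartAt I x₀).source) (hx' : extChartAt I x₀ x ∈ chartDomain I x₀)
    (hf : MDifferentiableAt I (jetModel I F) f x)
    (hfx : f x ∈ (extChartAt (jetModel I F) z₀).source)
    (hfx' : extChartAt (jetModel I F) z₀ (f x) ∈ chartDomain (jetModel I F) z₀) :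
    π.IsJetSolutionAt η L f x ↔
      (contactForm (extChartAt (jetModel I F) z₀ (f x))).comp
        (fderiv ℝ (mapRep I (jetModel I F) f x₀ z₀) (extChartAt I x₀ x)) = 0 ∧
      ∀ (ζ : (𝔼 × F) × (𝔼 →L[ℝ] F)) (v : Fin (n + 1) → 𝔼),
        extDeriv (chartRep (jetModel I F) (π.poincareCartan η L) z₀)
          (extChartAt (jetModel I F) z₀ (f x)) (Fin.cons ζ fun i =>
            fderiv ℝ (mapRep I (jetModel I F) f x₀ z₀) (extChartAt I x₀ x) (v i)) = 0 := by
  have : IsManifold (jetModel I F) 1 π.Jet := IsManifold.of_le (n := ∞) (by simp)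
  have hder := fun v => fderiv_mapRep (z₀ := z₀) hx hx' hf hfx v
  have hpt := (π.mem_extChartAt_jet_source).1 hfx
  set T := tmap (jetModel I F) 𝓘(ℝ, (𝔼 × F) × (𝔼 →L[ℝ] F)) (extChartAt (jetModel I F) z₀) (f x)
    with hT
  have hS : ∀ v, ∃ v', tmapSymm I x₀ (extChartAt I x₀ x) v' = v := fun v =>
    ⟨_, tmapSymm_tmap hx v⟩
  have hTs : ∀ ζ, ∃ ζ', T ζ' = ζ := by
    intro ζ
    have h1 := tmap_tmapSymm (I := jetModel I F) (chartDomain_subset z₀ hfx') ζ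
    rw [(extChartAt (jetModel I F) z₀).left_inv hfx] at h1
    exact ⟨_, h1⟩
  have hform : ∀ (ζ : (𝔼 × F) × (𝔼 →L[ℝ] F)) (v : Fin (n + 1) → 𝔼),
      formAt (extD (jetModel I F) (π.poincareCartan η L)) (f x)
        (Fin.cons ζ fun i => tmap I (jetModel I F) f x
          (tmapSymm I x₀ (extChartAt I x₀ x) (v i))) =
      extDeriv (chartRep (jetModel I F) (π.poincareCartan η L) z₀)
          (extChartAt (jetModel I F) z₀ (f x)) (Fin.cons (T ζ) fun i =>
            fderiv ℝ (mapRep I (jetModel I F) f x₀ z₀) (extChartAt I x₀ x) (v i)) := by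
    intro ζ v
    rw [formAt_eq_chartRep _ hfx, chartRep_extD_of_mem_chartDomain
      (isSmoothForm_poincareCartan hη hL) hfx']
    congr 1
    funext i
    refine Fin.cases rfl (fun i => ?_) i
    exact (hder (v i)).symm
  constructor
  · rintro ⟨h1, h2⟩
    refine ⟨ContinuousLinearMap.ext fun v => ?_, fun ζ v => ?_⟩
    · have h3 := (π.contactPart_eq_zero_iff hpt _).1 (h1 (tmapSymm I x₀ (extChartAt I x₀ x) v))
      rw [← hder] at h3
      exact h3
    · obtain ⟨ζ', rfl⟩ := hTs ζ
      rw [← hform]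
      exact h2 _ _
  · rintro ⟨h1, h2⟩
    refine ⟨fun v => ?_, fun ζ v => ?_⟩
    · obtain ⟨v', rfl⟩ := hS v
      rw [π.contactPart_eq_zero_iff hpt]
      have h3 := DFunLike.congr_fun h1 v'
      rw [ContinuousLinearMap.comp_apply, hder] at h3
      exact h3
    · choose v' hv' using fun i => hS (v i)
      have h3 := h2 (T ζ) v'
      rw [← hform] at h3
      simp only [hv'] at h3
      exact h3

/-- Propagation along the flow of a symmetry, near an interior point. -/
theorem exists_propagation [T2Space Y] {η : Form I X (n + 1)} (hη : IsSmoothForm I η) {L : π.Jet → ℝ}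
    (hL : ContMDiff (jetModel I F) 𝓘(ℝ, ℝ) ∞ L)
    {ξ : (z : π.Jet) → TangentSpace (jetModel I F) z} (hξ : IsSmoothField (jetModel I F) ξ)
    (hlie : ∀ τ : Form (jetModel I F) π.Jet 1, π.InContactIdeal 1 τ →
      π.InContactIdeal 1 (lieD (jetModel I F) ξ τ))
    {α : Form (jetModel I F) π.Jet n} (hα : IsSmoothForm (jetModel I F) α)
    (hsymm : π.InContactIdeal (n + 1)
      (lieD (jetModel I F) ξ (π.poincareCartan η L) - extD (jetModel I F) α))
    {a b : ℝ} {W : Set X} (hW : IsOpen W) {Ψ : ℝ → X → π.Jet}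
    (hcurve : ∀ x ∈ W, IsMIntegralCurveOn (I := jetModel I F) (fun t => Ψ t x) ξ (Ioo a b))
    (hsmooth : ContMDiffOn (𝓘(ℝ, ℝ).prod I) (jetModel I F) ∞ (fun p : ℝ × X => Ψ p.1 p.2)
      (Ioo a b ×ˢ W))
    (hsurj : ∀ t ∈ Ioo a b, ∀ x ∈ W, Surjective (tmap I I (fun x => π.projX (Ψ t x)) x))
    {t₀ : ℝ} (ht₀ : t₀ ∈ Ioo a b) {x₀ : X} (hx₀ : x₀ ∈ W) (hxi : I.IsInteriorPoint x₀)
    (hzi : (jetModel I F).IsInteriorPoint (Ψ t₀ x₀)) :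
    ∃ (J : Set ℝ) (N : Set X), IsOpen J ∧ t₀ ∈ J ∧ IsOpen N ∧ x₀ ∈ N ∧ J ⊆ Ioo a b ∧
      ∀ O ⊆ N, IsOpen O → ∀ t₁ ∈ J, (∀ x ∈ O, π.IsJetSolutionAt η L (Ψ t₁) x) →
        ∀ t ∈ J, ∀ x ∈ O, π.IsJetSolutionAt η L (Ψ t) x := by
  have : IsManifold (jetModel I F) 1 π.Jet := IsManifold.of_le (n := ∞) (by simp)
  set z₀ := Ψ t₀ x₀ with hz₀
  set κ := extChartAt (jetModel I F) z₀ with hκ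
  set χ := extChartAt I x₀ with hχ
  obtain ⟨N₀, hN₀, hzN₀, hker⟩ := exists_lieContact_eq_zero hξ hlie z₀
  -- The chart is cut down to where `ξ` is known to preserve the kernel of the contact form.
  let D : Set ((𝔼 × F) × (𝔼 →L[ℝ] F)) := chartDomain (jetModel I F) z₀ ∩ κ.symm ⁻¹' N₀
  have hD : IsOpen D := ((continuousOn_extChartAt_symm z₀).mono
    (chartDomain_subset z₀)).isOpen_inter_preimage (isOpen_chartDomain z₀) hN₀
  have hDt : ∀ {w}, w ∈ D → w ∈ κ.target := fun hw => chartDomain_subset z₀ hw.1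
  let Φ : ℝ × 𝔼 → π.Jet := fun p => Ψ p.1 (χ.symm p.2)
  let U₀ : Set 𝔼 := chartDomain I x₀ ∩ χ.symm ⁻¹' W
  have hU₀ : IsOpen U₀ := ((continuousOn_extChartAt_symm x₀).mono
    (chartDomain_subset x₀)).isOpen_inter_preimage (isOpen_chartDomain x₀) hW
  have hΦ : ContMDiffOn 𝓘(ℝ, ℝ × 𝔼) (jetModel I F) ∞ Φ (Ioo a b ×ˢ U₀) := by
    have h1 : ContMDiffOn 𝓘(ℝ, ℝ × 𝔼) (𝓘(ℝ, ℝ).prod I) ∞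
        (fun p : ℝ × 𝔼 => ((p.1, χ.symm p.2) : ℝ × X)) (Ioo a b ×ˢ U₀) := by
      refine ContMDiffOn.prodMk (contDiff_fst.contMDiff.contMDiffOn) ?_
      refine ((contMDiffOn_extChartAt_symm x₀).mono fun u hu => chartDomain_subset x₀ hu).comp
        (contDiff_snd.contMDiff.contMDiffOn) fun p hp => hp.2.1
    exact hsmooth.comp h1 fun p hp => ⟨hp.1, hp.2.2⟩
  let V : Set π.Jet := κ.source ∩ κ ⁻¹' D
  have hV : IsOpen V :=
    (continuousOn_extChartAt z₀).isOpen_inter_preimage (isOpen_extChartAt_source z₀) hD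
  -- These are the times and base points at which the flow lies in `D`. A rectangle in this open set
  -- gives a time interval and a neighbourhood that serve all subsets `O` and all pairs of times.
  let R : Set (ℝ × 𝔼) := (Ioo a b ×ˢ U₀) ∩ Φ ⁻¹' V
  have hR : IsOpen R := hΦ.continuousOn.isOpen_inter_preimage (isOpen_Ioo.prod hU₀) hV
  have hχ₀ : χ.symm (χ x₀) = x₀ := χ.left_inv (mem_extChartAt_source x₀)
  have hR₀ : (t₀, χ x₀) ∈ R := by
    have h1 : Φ (t₀, χ x₀) = z₀ := congrArg (Ψ t₀) hχ₀
    refine ⟨⟨ht₀, ?_, ?_⟩, ?_⟩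
    · exact (isInteriorPoint_iff_mem_chartDomain (mem_extChartAt_source x₀)).1 hxi
    · rw [mem_preimage, hχ₀]
      exact hx₀
    · rw [mem_preimage, h1]
      refine ⟨mem_extChartAt_source z₀, ?_, ?_⟩
      · exact (isInteriorPoint_iff_mem_chartDomain (mem_extChartAt_source z₀)).1 hzi
      · rw [mem_preimage, κ.left_inv (mem_extChartAt_source z₀)]
        exact hzN₀
  obtain ⟨J₀, O₀, hJ₀, hO₀, ht₀J, hxO, hJO⟩ := isOpen_prod_iff.1 hR t₀ (χ x₀) hR₀
  obtain ⟨δ, hδ, hδJ⟩ := Metric.isOpen_iff.1 hJ₀ t₀ ht₀J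
  rw [Real.ball_eq_Ioo] at hδJ
  have htJ : t₀ ∈ Ioo (t₀ - δ) (t₀ + δ) := ⟨by linarith, by linarith⟩
  have hmem : ∀ t ∈ Ioo (t₀ - δ) (t₀ + δ), ∀ u ∈ O₀, (t, u) ∈ R := fun t ht u hu =>
    hJO ⟨hδJ ht, hu⟩
  have hJab : Ioo (t₀ - δ) (t₀ + δ) ⊆ Ioo a b := fun t ht => (hmem t ht _ hxO).1.1
  have hOd : O₀ ⊆ chartDomain I x₀ := fun u hu => (hmem t₀ htJ u hu).1.2.1
  refine ⟨Ioo (t₀ - δ) (t₀ + δ), χ.source ∩ χ ⁻¹' O₀, isOpen_Ioo, htJ,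
    (continuousOn_extChartAt x₀).isOpen_inter_preimage (isOpen_extChartAt_source x₀) hO₀,
    ⟨mem_extChartAt_source x₀, hxO⟩, hJab, ?_⟩
  intro O hON hO t₁ ht₁ hsol t ht x hx
  let U : Set 𝔼 := O₀ ∩ χ.symm ⁻¹' O
  have hU : IsOpen U := ((continuousOn_extChartAt_symm x₀).mono
    fun u hu => chartDomain_subset x₀ (hOd hu)).isOpen_inter_preimage hO₀ hO
  let q : ℝ × 𝔼 → (𝔼 × F) × (𝔼 →L[ℝ] F) := fun p => κ (Φ p)
  have hχu : ∀ u ∈ U, χ (χ.symm u) = u := fun u hu => χ.right_inv (chartDomain_subset x₀ (hOd hu.1))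
  have hxs : ∀ u ∈ U, χ.symm u ∈ χ.source := fun u hu =>
    χ.map_target (chartDomain_subset x₀ (hOd hu.1))
  have hxd : ∀ u ∈ U, χ (χ.symm u) ∈ chartDomain I x₀ := fun u hu => by
    rw [hχu u hu]
    exact hOd hu.1
  have hxW : ∀ u ∈ U, χ.symm u ∈ W := fun u hu => (hmem t₀ htJ u hu.1).1.2.2
  have hqV : ∀ t ∈ Ioo (t₀ - δ) (t₀ + δ), ∀ u ∈ U, Ψ t (χ.symm u) ∈ V := fun t ht u hu =>
    (hmem t ht u hu.1).2
  have hmd : ∀ t ∈ Ioo (t₀ - δ) (t₀ + δ), ∀ x ∈ W, MDifferentiableAt I (jetModel I F) (Ψ t) x := by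
    intro t ht x hx
    have h1 : ContMDiffAt (𝓘(ℝ, ℝ).prod I) (jetModel I F) ∞ (fun p : ℝ × X => Ψ p.1 p.2) (t, x) :=
      hsmooth.contMDiffAt ((isOpen_Ioo.prod hW).mem_nhds ⟨hJab ht, hx⟩)
    have h2 : ContMDiffAt I (𝓘(ℝ, ℝ).prod I) ∞ (fun x : X => ((t, x) : ℝ × X)) x :=
      contMDiffAt_const.prodMk contMDiffAt_id
    exact (ContMDiffAt.comp x h1 h2).mdifferentiableAt (by simp)
  have hder : ∀ t ∈ Ioo (t₀ - δ) (t₀ + δ), ∀ u ∈ U, ∀ v,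
      fderiv ℝ (fun u => q (t, u)) u v =
      tmap (jetModel I F) 𝓘(ℝ, (𝔼 × F) × (𝔼 →L[ℝ] F)) κ (Ψ t (χ.symm u))
        (tmap I (jetModel I F) (Ψ t) (χ.symm u) (tmapSymm I x₀ u v)) := by
    intro t ht u hu v
    have h1 := fderiv_mapRep (z₀ := z₀) (hxs u hu) (hxd u hu) (hmd t ht _ (hxW u hu))
      (hqV t ht u hu).1 v
    rw [← hχ, hχu u hu] at h1
    exact h1
  have hiff : ∀ t ∈ Ioo (t₀ - δ) (t₀ + δ), ∀ u ∈ U, π.IsJetSolutionAt η L (Ψ t) (χ.symm u) ↔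
      (contactForm (q (t, u))).comp (fderiv ℝ (fun u => q (t, u)) u) = 0 ∧
      ∀ (ζ : (𝔼 × F) × (𝔼 →L[ℝ] F)) (v : Fin (n + 1) → 𝔼),
        extDeriv (chartRep (jetModel I F) (π.poincareCartan η L) z₀) (q (t, u))
          (Fin.cons ζ fun i => fderiv ℝ (fun u => q (t, u)) u (v i)) = 0 := by
    intro t ht u hu
    have h1 := isJetSolutionAt_iff hη hL (z₀ := z₀) (hxs u hu) (hxd u hu) (hmd t ht _ (hxW u hu))
      (hqV t ht u hu).1 (hqV t ht u hu).2.1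
    rw [← hχ, hχu u hu] at h1
    exact h1
  have hΘ := isSmoothForm_poincareCartan (π := π) hη hL
  have hsub : Ioo (t₀ - δ) (t₀ + δ) ×ˢ U ⊆ R := fun p hp => hmem _ hp.1 _ hp.2.1
  have hq : ContDiffOn ℝ ∞ q (Ioo (t₀ - δ) (t₀ + δ) ×ˢ U) := by
    rw [← contMDiffOn_iff_contDiffOn]
    have h1 : ContMDiffOn (jetModel I F) 𝓘(ℝ, (𝔼 × F) × (𝔼 →L[ℝ] F)) ∞ κ κ.source := by
      rw [hκ, extChartAt_source]
      exact contMDiffOn_extChartAt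
    exact h1.comp (hΦ.mono fun p hp => (hsub hp).1) fun p hp => (hsub hp).2.1
  have hx' : χ x ∈ U := by
    refine ⟨(hON hx).2, ?_⟩
    rw [mem_preimage, χ.left_inv (hON hx).1]
    exact hx
  rw [← χ.left_inv (hON hx).1, hiff t ht (χ x) hx']
  have hrange : ∀ w ∈ D, range (jetModel I F) ∈ 𝓝 w := fun w hw => range_mem_nhds hw.1
  refine propagation_model (n := n) (by simp) hD
    ((contDiffOn_fieldRep hξ z₀).mono inter_subset_left) (fun w hw => hker w hw.1 hw.2)
    (Θ := chartRep (jetModel I F) (π.poincareCartan η L) z₀)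
    (τ := chartRep (jetModel I F)
      (lieD (jetModel I F) ξ (π.poincareCartan η L) - extD (jetModel I F) α) z₀)
    (L := funRep L z₀) (p := fun w => momentumModel (verticalDeriv L z₀ w))
    (η := baseRep η (π.baseChart z₀.pt))
    ((hΘ.contDiffOn z₀).mono inter_subset_left)
    (fun w hw => chartRep_poincareCartan η hL z₀ (hDt hw)) ?_ ?_ ?_
    ((((hΘ.lieD hξ).sub hα.extD).contDiffOn z₀).mono inter_subset_left) ?_
    (fun w hw => extDeriv_chartRep_lieD_sub hξ hΘ hα hw.1) hU hq
    (fun t ht u hu => (hqV t ht u hu).2) ?_ ?_ ht₁ ?_ ?_ ht hx'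
  · exact fun w hw => ((contDiffWithinAt_funRep hL (hDt hw)).contDiffAt (hrange w hw)).contDiffWithinAt
  · exact fun w hw => (contDiff_momentumModel.contDiffAt.comp w
      ((contDiffWithinAt_verticalDeriv hL z₀ (hDt hw)).contDiffAt (hrange w hw))).contDiffWithinAt
  · intro w hw B
    rw [trace_momentumModel_comp, verticalDeriv, fderivWithin_of_mem_nhds (hrange w hw)]
    rfl
  · intro O' u' hO' hu' y hy hyD v
    exact chartRep_jetMap_eq_zero (fun φ U hU hφ => hsymm.pullback_j1_eq_zero hφ hU) hO' hu' hy
      hyD.1 v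
  · intro t ht u hu
    exact hasDerivAt_extChartAt_comp (hcurve _ (hxW u hu)) (hJab ht) (hqV t ht u hu).1
  -- The base part of the derivative of `q` is the tangent map of `ψ_t`, read from the preferred
  -- chart of `X` at `x₀` into the base chart of `z₀`; it stays surjective since chart changes are
  -- invertible.
  · intro t ht u hu v
    have hpt := (π.mem_extChartAt_jet_source).1 (hqV t ht u hu).1
    have hc := (π.isAdaptedPair z₀.pt)
    have hsrc : π.projX (Ψ t (χ.symm u)) ∈ (π.baseChart z₀.pt).source := hc.mapsTo _ hpt
    have h1 := fun w => DFunLike.congr_fun (tmap_comp_symm I I hc.mdiff_base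
      ((π.baseChart z₀.pt).map_source hsrc)) w
    rw [(π.baseChart z₀.pt).left_inv hsrc] at h1
    obtain ⟨v₁, hv₁⟩ := hsurj t (hJab ht) _ (hxW u hu)
      (tmap I I (π.baseChart z₀.pt).symm (π.baseChart z₀.pt (π.projX (Ψ t (χ.symm u)))) v)
    have hv₂ := tmapSymm_tmap (hxs u hu) v₁
    rw [← hχ, hχu u hu] at hv₂
    refine ⟨tmap I 𝓘(ℝ, 𝔼) χ (χ.symm u) v₁, ?_⟩
    rw [ContinuousLinearMap.comp_apply, hder t ht u hu, hv₂]
    have h2 := DFunLike.congr_fun (π.tmap_baseChart_comp_projX hpt)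
      (tmap I (jetModel I F) (Ψ t) (χ.symm u) v₁)
    refine h2.symm.trans ?_
    have h3 : tmap I I (fun x => π.projX (Ψ t x)) (χ.symm u) =
      (tmap (jetModel I F) I π.projX (Ψ t (χ.symm u))).comp
        (tmap I (jetModel I F) (Ψ t) (χ.symm u)) :=
      tmap_comp ((π.contMDiff_projX _).mdifferentiableAt (by simp)) (hmd t ht _ (hxW u hu))
    rw [h3] at hv₁
    rw [ContinuousLinearMap.comp_apply]
    refine (congrArg _ hv₁).trans (h1 v)
  · exact fun u hu => ((hiff t₁ ht₁ u hu).1 (hsol _ hu.2)).1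
  · exact fun u hu => ((hiff t₁ ht₁ u hu).1 (hsol _ hu.2)).2

end FiberedManifold
end JetSolution

/-! ### Interior points -/

section Interior

variable {E : Type*} [NormedAddCommGroup E] [NormedSpace ℝ E] {H : Type*} [TopologicalSpace H]
  {I : ModelWithCorners ℝ E H} {M : Type*} [TopologicalSpace M] [ChartedSpace H M]
  [IsManifold I ∞ M]

/-- Every point is a limit of interior points, and limits in a Hausdorff space are unique. -/
theorem eqOn_of_eqOn_interior {N : Type*} [TopologicalSpace N] [T2Space N] {f g : M → N}
    {U : Set M} (hU : IsOpen U) (hf : ContinuousOn f U) (hg : ContinuousOn g U)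
    (h : ∀ x ∈ U, I.IsInteriorPoint x → f x = g x) : ∀ x ∈ U, f x = g x := by
  intro x hx
  have hu := mem_extChartAt_target (I := I) x
  have hux : (extChartAt I x).symm (extChartAt I x x) = x := extChartAt_to_inv x
  have huR := extChartAt_target_subset_range x hu
  have hne : (𝓝[interior (range I)] (extChartAt I x x)).NeBot :=
    mem_closure_iff_nhdsWithin_neBot.1 (I.range_subset_closure_interior huR)
  have h2 : Filter.Tendsto (extChartAt I x).symm (𝓝[interior (range I)] (extChartAt I x x))
      (𝓝 x) := by
    have h3 := (continuousAt_extChartAt_symm'' hu).continuousWithinAt (s := interior (range I))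
    rwa [ContinuousWithinAt, hux] at h3
  refine tendsto_nhds_unique_of_eventuallyEq ((hf.continuousAt (hU.mem_nhds hx)).tendsto.comp h2)
    ((hg.continuousAt (hU.mem_nhds hx)).tendsto.comp h2) ?_
  filter_upwards [nhdsWithin_mono _ interior_subset (extChartAt_target_mem_nhdsWithin_of_mem hu),
    h2 (hU.mem_nhds hx), self_mem_nhdsWithin] with w hw hw' hwi
  exact h _ hw' (isInteriorPoint_symm (mem_chartDomain_of_mem_interior_range hw hwi))

variable {F : Type*} [NormedAddCommGroup F] [NormedSpace ℝ F]
  {X : Type*} [TopologicalSpace X] [ChartedSpace H X]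
  {Y : Type*} [TopologicalSpace Y] [ChartedSpace (ModelProd H F) Y]

/-- The range of the jet model is the range of `I` times full vector spaces, so the boundary comes
from the base alone. -/
theorem FiberedManifold.isInteriorPoint_of_projX {π : FiberedManifold I F X Y} {z : π.Jet}
    (hz : I.IsInteriorPoint (π.projX z)) : (jetModel I F).IsInteriorPoint z := by
  have h := π.isAdaptedPair z.pt
  have hx : π.projX z ∈ (π.baseChart z.pt).source := h.mapsTo _ (π.mem_totalChart_source z.pt)
  have h1 : I.IsInteriorPoint (π.baseChart z.pt (π.projX z)) := by
    refine MDifferentiableAt.isInteriorPoint_of_surjective_mfderiv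
      (h.mdiff_base.mdifferentiableAt hx) ?_ hz
    intro v
    have h2 := DFunLike.congr_fun (tmap_comp_symm I I h.mdiff_base
      ((π.baseChart z.pt).map_source hx)) v
    rw [(π.baseChart z.pt).left_inv hx] at h2
    exact ⟨_, h2⟩
  have h2 : I (π.baseChart z.pt (π.projX z)) ∈ interior (range I) := h1
  rw [← π.extChartAt_jet_fst_fst (π.mem_totalChart_source z.pt)] at h2
  have h3 : range (jetModel I F) = (range I ×ˢ (univ : Set F)) ×ˢ (univ : Set (E →L[ℝ] F)) := by
    ext w
    constructor
    · rintro ⟨q, rfl⟩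
      exact ⟨⟨⟨q.1.1, rfl⟩, mem_univ _⟩, mem_univ _⟩
    · rintro ⟨⟨⟨p, hp⟩, -⟩, -⟩
      exact ⟨((p, w.1.2), w.2), Prod.ext (Prod.ext hp rfl) rfl⟩
  change extChartAt (jetModel I F) z z ∈ interior (range (jetModel I F))
  rw [h3, interior_prod_eq, interior_prod_eq, interior_univ, interior_univ]
  exact ⟨⟨h2, mem_univ _⟩, mem_univ _⟩

/-- The tangent map of a map with a differentiable left inverse. -/
theorem tmap_comp_tmap_of_leftInverse {ψ g : X → X} {W : Set X} (hW : IsOpen W) {x : X}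
    (hx : x ∈ W) (hψ : MDifferentiableAt I I ψ x) (hg : MDifferentiableAt I I g (ψ x))
    (h : ∀ x ∈ W, g (ψ x) = x) : (tmap I I g (ψ x)).comp (tmap I I ψ x) = .id ℝ E := by
  rw [← tmap_comp hg hψ]
  have h1 : g ∘ ψ =ᶠ[𝓝 x] id := by
    filter_upwards [hW.mem_nhds hx] with x' hx' using h x' hx'
  rw [tmap_congr h1]
  exact mfderiv_id

end Interior

/-! ### Solutions stay solutions along the flow -/

section Flow
variable {n : ℕ} {H : Type*} [TopologicalSpace H]
  {I : ModelWithCorners ℝ (EuclideanSpace ℝ (Fin (n + 1))) H}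
  {F : Type*} [NormedAddCommGroup F] [NormedSpace ℝ F]
  {X : Type*} [TopologicalSpace X] [ChartedSpace H X]
  {Y : Type*} [TopologicalSpace Y] [ChartedSpace (ModelProd H F) Y]

local notation "𝔼" => EuclideanSpace ℝ (Fin (n + 1))

namespace FiberedManifold
variable {π : FiberedManifold I F X Y} {ξ : (z : π.Jet) → TangentSpace (jetModel I F) z}
  {φ : X → Y} {a b : ℝ} {W U : Set X} {Ψ : ℝ → X → π.Jet} {t : ℝ} {x : X}

theorem IsFlowAlong.contMDiffAt (h : π.IsFlowAlong ξ φ a b W Ψ) (hW : IsOpen W) (ht : t ∈ Ioo a b)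
    (hx : x ∈ W) : ContMDiffAt I (jetModel I F) ∞ (Ψ t) x := by
  have h1 : ContMDiffAt (𝓘(ℝ, ℝ).prod I) (jetModel I F) ∞ (fun p : ℝ × X => Ψ p.1 p.2) (t, x) :=
    h.smooth.contMDiffAt ((isOpen_Ioo.prod hW).mem_nhds ⟨ht, hx⟩)
  have h2 : ContMDiffAt I (𝓘(ℝ, ℝ).prod I) ∞ (fun x : X => ((t, x) : ℝ × X)) x :=
    contMDiffAt_const.prodMk contMDiffAt_id
  exact ContMDiffAt.comp (g := fun p : ℝ × X => Ψ p.1 p.2) (f := fun x : X => ((t, x) : ℝ × X)) x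
    h1 h2

theorem IsFlowAlong.mdifferentiableAt (h : π.IsFlowAlong ξ φ a b W Ψ) (hW : IsOpen W)
    (ht : t ∈ Ioo a b) (hx : x ∈ W) : MDifferentiableAt I (jetModel I F) (Ψ t) x :=
  (h.contMDiffAt hW ht hx).mdifferentiableAt (by simp)

theorem IsFlowAlong.mdifferentiableAt_projX (h : π.IsFlowAlong ξ φ a b W Ψ) (hW : IsOpen W)
    (ht : t ∈ Ioo a b) (hx : x ∈ W) : MDifferentiableAt I I (fun x => π.projX (Ψ t x)) x :=
  ((π.contMDiff_projX _).comp x (h.contMDiffAt hW ht hx)).mdifferentiableAt (by simp)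

/-- A smooth left inverse makes the tangent map injective; source and target have the same finite
dimension. -/
theorem IsFlowAlong.surjective_tmap (h : π.IsFlowAlong ξ φ a b W Ψ) (hW : IsOpen W)
    (ht : t ∈ Ioo a b) (hx : x ∈ W) : Surjective (tmap I I (fun x => π.projX (Ψ t x)) x) := by
  obtain ⟨g, hg, hgψ⟩ := h.exists_inverse t ht
  have h1 := tmap_comp_tmap_of_leftInverse hW hx (h.mdifferentiableAt_projX hW ht hx)
    ((hg.contMDiffAt ((h.isOpen_image t ht).mem_nhds (mem_image_of_mem _ hx))).mdifferentiableAt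
      (by simp)) hgψ
  have hinj : Injective (tmap I I (fun x => π.projX (Ψ t x)) x) :=
    LeftInverse.injective (g := tmap I I g (π.projX (Ψ t x))) fun v => DFunLike.congr_fun h1 v
  exact LinearMap.injective_iff_surjective
    (f := (tmap I I (fun x => π.projX (Ψ t x)) x : 𝔼 →ₗ[ℝ] 𝔼)).1 hinj

/-- A map with surjective tangent map sends interior points to interior points. This applies to
`ψ_t` and to its inverse. -/
theorem IsFlowAlong.isInteriorPoint_iff [IsManifold I ∞ X] (h : π.IsFlowAlong ξ φ a b W Ψ)
    (hW : IsOpen W) (ht : t ∈ Ioo a b) (hx : x ∈ W) :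
    I.IsInteriorPoint (π.projX (Ψ t x)) ↔ I.IsInteriorPoint x := by
  constructor
  · intro hi
    obtain ⟨g, hg, hgψ⟩ := h.exists_inverse t ht
    have hgd := ((hg.contMDiffAt ((h.isOpen_image t ht).mem_nhds
      (mem_image_of_mem _ hx))).mdifferentiableAt (by simp))
    have h1 := tmap_comp_tmap_of_leftInverse hW hx (h.mdifferentiableAt_projX hW ht hx) hgd hgψ
    have h2 := hgd.isInteriorPoint_of_surjective_mfderiv (fun v => ⟨_, DFunLike.congr_fun h1 v⟩) hi
    rwa [hgψ x hx] at h2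
  · exact (h.mdifferentiableAt_projX hW ht hx).isInteriorPoint_of_surjective_mfderiv
      (h.surjective_tmap hW ht hx)

variable [IsManifold I ∞ X] [FiniteDimensional ℝ F] [T2Space Y]
  {η : Form I X (n + 1)} {L : π.Jet → ℝ} {α : Form (jetModel I F) π.Jet n}

omit [IsManifold I ∞ X] in
-- Any single vector at `j¹φ x` is the value of a smooth field, so the equations hold for each `ζ`
-- separately.
theorem isJetSolutionAt_j1 (hU : IsOpen U) (hφ : π.IsSectionOn φ U)
    (hEL : π.EulerLagrangeOn η L U φ) (hx : x ∈ U) : π.IsJetSolutionAt η L (π.j1 φ) x := by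
  have : IsManifold (jetModel I F) 1 π.Jet := IsManifold.of_le (n := ∞) (by simp)
  refine ⟨hφ.contactPart_comp_tmap_j1 hU hx, fun ζ v => ?_⟩
  obtain ⟨ζ', hζ', hζ⟩ := exists_isSmoothField_eq (I := jetModel I F) (π.j1 φ x) ζ
  have h1 := DFunLike.congr_fun (hEL ζ' hζ' x hx) v
  have h2 : -formAt (extD (jetModel I F) (π.poincareCartan η L)) (π.j1 φ x)
      (Fin.cons (ζ' (π.j1 φ x)) fun i => tmap I (jetModel I F) (π.j1 φ) x (v i)) = 0 := h1
  rw [hζ] at h2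
  exact neg_eq_zero.1 h2

omit [IsManifold I ∞ X] [FiniteDimensional ℝ F] [T2Space Y] in
theorem isJetSolutionAt_congr {f g : X → π.Jet} (h : f =ᶠ[𝓝 x] g) :
    π.IsJetSolutionAt η L f x ↔ π.IsJetSolutionAt η L g x := by
  rw [IsJetSolutionAt, IsJetSolutionAt, h.eq_of_nhds, tmap_congr h]

/-- Between nearby times the property passes in both directions by `exists_propagation`, and the
time interval is connected. The property is carried as one of germs at `x`, because the
neighbourhood may shrink at each step. -/
theorem IsFlowAlong.isJetSolutionAt (hη : IsSmoothForm I η)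
    (hL : ContMDiff (jetModel I F) 𝓘(ℝ, ℝ) ∞ L) (hξ : IsSmoothField (jetModel I F) ξ)
    (hlie : ∀ τ : Form (jetModel I F) π.Jet 1, π.InContactIdeal 1 τ →
      π.InContactIdeal 1 (lieD (jetModel I F) ξ τ))
    (hα : IsSmoothForm (jetModel I F) α)
    (hsymm : π.InContactIdeal (n + 1)
      (lieD (jetModel I F) ξ (π.poincareCartan η L) - extD (jetModel I F) α))
    (hU : IsOpen U) (hφ : π.IsSectionOn φ U) (hEL : π.EulerLagrangeOn η L U φ) (hW : IsOpen W)
    (hWU : W ⊆ U) (ha : a < 0) (hb : 0 < b) (h : π.IsFlowAlong ξ φ a b W Ψ) (ht : t ∈ Ioo a b)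
    (hx : x ∈ W) (hxi : I.IsInteriorPoint x) : π.IsJetSolutionAt η L (Ψ t) x := by
  have : IsManifold I 1 X := IsManifold.of_le (n := ∞) (by simp)
  have h0 : ∀ᶠ x' in 𝓝 x, π.IsJetSolutionAt η L (Ψ 0) x' := by
    filter_upwards [hW.mem_nhds hx] with x' hx'
    have h1 : Ψ 0 =ᶠ[𝓝 x'] π.j1 φ := by
      filter_upwards [hW.mem_nhds hx'] with x'' hx'' using h.start x'' hx''
    exact (isJetSolutionAt_congr h1).2 (isJetSolutionAt_j1 hU hφ hEL (hWU hx'))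
  have key := isPreconnected_Ioo.induction₂' (s := Ioo a b)
    (fun s s' : ℝ => (∀ᶠ x' in 𝓝 x, π.IsJetSolutionAt η L (Ψ s) x') →
      ∀ᶠ x' in 𝓝 x, π.IsJetSolutionAt η L (Ψ s') x') ?_
    (fun _ _ _ _ _ _ h1 h2 h3 => h2 (h1 h3)) (x := 0) (y := t) ⟨ha, hb⟩ ht
  · exact (key h0).self_of_nhds
  · intro t₀ ht₀
    obtain ⟨J, N, hJ, ht₀J, hN, hxN, hJab, hprop⟩ := exists_propagation hη hL hξ hlie hα hsymm hW
      h.integralCurve h.smooth (fun t ht x hx => h.surjective_tmap hW ht hx) ht₀ hx hxi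
      (isInteriorPoint_of_projX ((h.isInteriorPoint_iff hW ht₀ hx).2 hxi))
    have hJJ : ∀ s ∈ J, ∀ s' ∈ J, (∀ᶠ x' in 𝓝 x, π.IsJetSolutionAt η L (Ψ s) x') →
        ∀ᶠ x' in 𝓝 x, π.IsJetSolutionAt η L (Ψ s') x' := by
      intro s hs s' hs' h1
      obtain ⟨O, hO1, hO, hxO⟩ := eventually_nhds_iff.1 (h1.and (hN.mem_nhds hxN))
      filter_upwards [hO.mem_nhds hxO] with x' hx'
      exact hprop O (fun y hy => (hO1 y hy).2) hO s hs (fun y hy => (hO1 y hy).1) s' hs' x' hx'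
    filter_upwards [mem_nhdsWithin_of_mem_nhds (hJ.mem_nhds ht₀J)] with s hs
    exact ⟨hJJ t₀ ht₀J s hs, hJJ s hs t₀ ht₀J⟩

/-- The flow of a symmetry along a solution is at every time the prolongation of a solution. -/
theorem IsFlowAlong.exists_solution (hη : IsSmoothForm I η)
    (hL : ContMDiff (jetModel I F) 𝓘(ℝ, ℝ) ∞ L) (hξ : IsSmoothField (jetModel I F) ξ)
    (hlie : ∀ τ : Form (jetModel I F) π.Jet 1, π.InContactIdeal 1 τ →
      π.InContactIdeal 1 (lieD (jetModel I F) ξ τ))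
    (hα : IsSmoothForm (jetModel I F) α)
    (hsymm : π.InContactIdeal (n + 1)
      (lieD (jetModel I F) ξ (π.poincareCartan η L) - extD (jetModel I F) α))
    (hU : IsOpen U) (hφ : π.IsSectionOn φ U) (hEL : π.EulerLagrangeOn η L U φ) (hW : IsOpen W)
    (hWU : W ⊆ U) (ha : a < 0) (hb : 0 < b) (h : π.IsFlowAlong ξ φ a b W Ψ) (ht : t ∈ Ioo a b) :
    ∃ φt : X → Y, π.IsSectionOn φt ((fun x => π.projX (Ψ t x)) '' W) ∧
      (∀ x ∈ W, Ψ t x = π.j1 φt (π.projX (Ψ t x))) ∧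
      π.EulerLagrangeOn η L ((fun x => π.projX (Ψ t x)) '' W) φt := by
  have : IsManifold (jetModel I F) 1 π.Jet := IsManifold.of_le (n := ∞) (by simp)
  obtain ⟨g, hg, hgψ⟩ := h.exists_inverse t ht
  have hV := h.isOpen_image t ht
  set V := (fun x => π.projX (Ψ t x)) '' W with hVdef
  -- Reparametrized by the inverse of `ψ_t`, the flow becomes a section of the jet bundle over `X`;
  -- the solution is its projection to `Y`.
  let σ : X → π.Jet := fun y => Ψ t (g y)
  have hgW : ∀ y ∈ V, g y ∈ W ∧ π.projX (Ψ t (g y)) = y := by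
    rintro _ ⟨x, hx, rfl⟩
    simp only [hgψ x hx]
    exact ⟨hx, trivial⟩
  have hσ : ContMDiffOn I (jetModel I F) ∞ σ V := fun y hy =>
    ((h.contMDiffAt hW ht (hgW y hy).1).comp y
      (hg.contMDiffAt (hV.mem_nhds hy))).contMDiffWithinAt
  have hproj : ∀ y ∈ V, π.projX (σ y) = y := fun y hy => (hgW y hy).2
  have hs : π.IsSectionOn (π.projY ∘ σ) V := ⟨π.contMDiff_projY.comp_contMDiffOn hσ, hproj⟩
  have hsol : ∀ y ∈ V, I.IsInteriorPoint y → π.IsJetSolutionAt η L (Ψ t) (g y) := by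
    intro y hy hyi
    refine h.isJetSolutionAt hη hL hξ hlie hα hsymm hU hφ hEL hW hWU ha hb ht (hgW y hy).1 ?_
    rw [← h.isInteriorPoint_iff hW ht (hgW y hy).1, (hgW y hy).2]
    exact hyi
  have hσd : ∀ y ∈ V, tmap I (jetModel I F) σ y =
      (tmap I (jetModel I F) (Ψ t) (g y)).comp (tmap I I g y) := fun y hy =>
    tmap_comp (h.mdifferentiableAt hW ht (hgW y hy).1)
      ((hg.contMDiffAt (hV.mem_nhds hy)).mdifferentiableAt (by simp))
  have hj : ∀ y ∈ V, π.j1 (π.projY ∘ σ) y = σ y := by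
    -- The contact condition is known over interior points only; equality of `j¹` of the projection
    -- with `σ` extends to the boundary by continuity.
    refine eqOn_of_eqOn_interior (I := I) hV (contMDiffOn_j1 hs hV).continuousOn hσ.continuousOn ?_
    intro y hy hyi
    refine j1_projY_comp hσ hV hproj hy fun v => ?_
    rw [hσd y hy]
    exact (hsol y hy hyi).1 _
  refine ⟨π.projY ∘ σ, hs, fun x hx => ?_, fun ζ hζ => ?_⟩
  · rw [hj _ (mem_image_of_mem _ hx)]
    change _ = Ψ t (g _)
    rw [hgψ x hx]
  · refine pullback_eq_zero_of_interior ((isSmoothForm_poincareCartan hη hL).extD.neg.contract hζ)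
      (contMDiffOn_j1 hs hV) hV ?_
    intro y hy hyi
    have h1 : π.j1 (π.projY ∘ σ) =ᶠ[𝓝 y] σ := by
      filter_upwards [hV.mem_nhds hy] with y' hy' using hj y' hy'
    refine ContinuousAlternatingMap.ext fun v => ?_
    change -formAt (extD (jetModel I F) (π.poincareCartan η L)) (π.j1 (π.projY ∘ σ) y)
      (Fin.cons (ζ (π.j1 (π.projY ∘ σ) y)) fun i =>
        tmap I (jetModel I F) (π.j1 (π.projY ∘ σ)) y (v i)) = 0
    rw [tmap_congr h1, hj y hy, hσd y hy, neg_eq_zero]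
    exact (hsol y hy hyi).2 _ _

end FiberedManifold
end Flow

/-! ### Uniqueness of integral curves, also at the boundary -/

section Uniqueness

/-- A nonempty, relatively open and closed subset of an interval is the whole interval. -/
theorem Ioo_subset_of_nhds_of_closure {a b t₀ : ℝ} {s : Set ℝ} (ht₀ : t₀ ∈ Ioo a b) (hs₀ : t₀ ∈ s)
    (hopen : ∀ t ∈ Ioo a b, t ∈ s → s ∈ 𝓝 t)
    (hclosed : ∀ t ∈ Ioo a b, t ∈ closure (s ∩ Ioo a b) → t ∈ s) : Ioo a b ⊆ s := by
  refine fun t ht => (isPreconnected_Ioo.subset_of_closure_inter_subset (u := s ∩ Ioo a b) ?_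
    ⟨t₀, ht₀, hs₀, ht₀⟩ (fun t ht => ⟨hclosed t ht.2 ht.1, ht.2⟩) ht).1
  exact isOpen_iff_mem_nhds.2 fun t ht =>
    Filter.inter_mem (hopen t ht.2 ht.1) (Ioo_mem_nhds ht.2.1 ht.2.2)

variable {E : Type*} [NormedAddCommGroup E] [NormedSpace ℝ E] {H : Type*} [TopologicalSpace H]
  {I : ModelWithCorners ℝ E H} {M : Type*} [TopologicalSpace M] [ChartedSpace H M]
  [IsManifold I ∞ M] [IsManifold I 1 M] {ξ : (x : M) → TangentSpace I x} {γ γ' : ℝ → M} {a b t₀ : ℝ}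

omit [IsManifold I ∞ M] [IsManifold I 1 M] in
theorem continuousAt_of_isMIntegralCurveOn (hγ : IsMIntegralCurveOn (I := I) γ ξ (Ioo a b))
    (ht₀ : t₀ ∈ Ioo a b) : ContinuousAt γ t₀ :=
  (hγ.continuousWithinAt ht₀).continuousAt (Ioo_mem_nhds ht₀.1 ht₀.2)

/-- Integral curves are locally unique, also at boundary points. -/
theorem eventuallyEq_of_isMIntegralCurveOn (hξ : IsSmoothField I ξ)
    (hγ : IsMIntegralCurveOn (I := I) γ ξ (Ioo a b))
    (hγ' : IsMIntegralCurveOn (I := I) γ' ξ (Ioo a b)) (ht₀ : t₀ ∈ Ioo a b)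
    (h : γ t₀ = γ' t₀) : γ =ᶠ[𝓝 t₀] γ' := by
  have hmem := mem_extChartAt_source (I := I) (γ t₀)
  -- The range of the model is convex, so the field is Lipschitz near the point within the range.
  -- Both curves stay in the range, so the usual uniqueness theorem applies with a constraint set.
  obtain ⟨K, s, hs, hK⟩ := ((contDiffWithinAt_fieldRep hξ
    (mem_extChartAt_target (I := I) (γ t₀))).of_le (m := 1) (by simp)).exists_lipschitzOnWith
      I.convex_range
  have key : ∀ δ : ℝ → M, IsMIntegralCurveOn (I := I) δ ξ (Ioo a b) → δ t₀ = γ t₀ →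
      ∀ᶠ t in 𝓝 t₀, δ t ∈ (extChartAt I (γ t₀)).source ∧
        (HasDerivAt (fun s => extChartAt I (γ t₀) (δ s))
          (fieldRep ξ (γ t₀) (extChartAt I (γ t₀) (δ t))) t ∧
          extChartAt I (γ t₀) (δ t) ∈ s) := by
    intro δ hδ hδ0
    have hc : Filter.Tendsto δ (𝓝 t₀) (𝓝 (γ t₀)) := hδ0 ▸
      continuousAt_of_isMIntegralCurveOn hδ ht₀
    have hsrc := hc (extChartAt_source_mem_nhds (I := I) (γ t₀))
    have h1 : Filter.Tendsto (fun t => extChartAt I (γ t₀) (δ t)) (𝓝 t₀)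
        (𝓝[range I] (extChartAt I (γ t₀) (γ t₀))) := by
      refine tendsto_nhdsWithin_iff.2 ⟨(continuousAt_extChartAt (γ t₀)).tendsto.comp hc, ?_⟩
      filter_upwards [hsrc] with t ht
      exact extChartAt_target_subset_range _ ((extChartAt I (γ t₀)).map_source ht)
    filter_upwards [hsrc, h1 hs, Ioo_mem_nhds ht₀.1 ht₀.2] with t ht ht' ht''
    exact ⟨ht, hasDerivAt_extChartAt_comp hδ ht'' ht, ht'⟩
  have h1 := key γ hγ rfl
  have h2 := key γ' hγ' h.symm
  have h3 := ODE_solution_unique_of_eventually (v := fun _ => fieldRep ξ (γ t₀)) (s := fun _ => s)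
    (K := K) (.of_forall fun _ => hK) (h1.mono fun _ h => h.2) (h2.mono fun _ h => h.2)
    (by simp only [h])
  filter_upwards [h1, h2, h3] with t h1 h2 h3
  exact (extChartAt I (γ t₀)).injOn h1.1 h2.1 h3

/-- Integral curves are unique, also on manifolds with boundary. -/
theorem eqOn_of_isMIntegralCurveOn [T2Space M] (hξ : IsSmoothField I ξ)
    (hγ : IsMIntegralCurveOn (I := I) γ ξ (Ioo a b))
    (hγ' : IsMIntegralCurveOn (I := I) γ' ξ (Ioo a b)) (ht₀ : t₀ ∈ Ioo a b)
    (h : γ t₀ = γ' t₀) : EqOn γ γ' (Ioo a b) := by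
  refine Ioo_subset_of_nhds_of_closure (s := {t | γ t = γ' t}) ht₀ h
    (fun t ht hts => eventuallyEq_of_isMIntegralCurveOn hξ hγ hγ' ht hts) fun t ht htc => ?_
  have : (𝓝[{t | γ t = γ' t} ∩ Ioo a b] t).NeBot := mem_closure_iff_nhdsWithin_neBot.1 htc
  refine tendsto_nhds_unique_of_eventuallyEq
    ((continuousAt_of_isMIntegralCurveOn hγ ht).tendsto.mono_left nhdsWithin_le_nhds)
    ((continuousAt_of_isMIntegralCurveOn hγ' ht).tendsto.mono_left nhdsWithin_le_nhds)
    (f := γ) (g := γ') (l := 𝓝[{t | γ t = γ' t} ∩ Ioo a b] t) ?_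
  filter_upwards [self_mem_nhdsWithin] with s hs using hs.1

variable {E' : Type*} [NormedAddCommGroup E'] [NormedSpace ℝ E'] {H' : Type*} [TopologicalSpace H']
  {I' : ModelWithCorners ℝ E' H'} {B : Type*} [TopologicalSpace B] [ChartedSpace H' B]
  {ξB : (b : B) → TangentSpace I' b} {i : B → M}

omit [IsManifold I ∞ M] [IsManifold I 1 M] in
theorem isMIntegralCurveOn_comp {s : Set ℝ} {β : ℝ → B} (hi : MDifferentiable I' I i)
    (h : ∀ b, mfderiv I' I i b (ξB b) = ξ (i b)) (hβ : IsMIntegralCurveOn (I := I') β ξB s) :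
    IsMIntegralCurveOn (I := I) (i ∘ β) ξ s := by
  intro t ht
  have h1 := (hi (β t)).hasMFDerivAt.comp_hasMFDerivWithinAt t (hβ t ht)
  refine h1.congr_mfderiv (ContinuousLinearMap.ext_ring ?_)
  change mfderiv I' I i (β t) ((1 : ℝ) • ξB (β t)) = (1 : ℝ) • ξ (i (β t))
  rw [one_smul, one_smul, h]

/-- Integral curves that start in a closed submanifold without boundary, to which the vector field
is tangent, stay in it. -/
theorem mem_range_of_isMIntegralCurveOn [CompleteSpace E'] [IsManifold I' 1 B]
    [BoundarylessManifold I' B] (hξ : IsSmoothField I ξ) (hξB : IsSmoothField I' ξB)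
    (hi : MDifferentiable I' I i) (h : ∀ b, mfderiv I' I i b (ξB b) = ξ (i b))
    (hcl : IsClosed (range i)) (hγ : IsMIntegralCurveOn (I := I) γ ξ (Ioo a b))
    (ht₀ : t₀ ∈ Ioo a b) (h₀ : γ t₀ ∈ range i) : ∀ t ∈ Ioo a b, γ t ∈ range i := by
  refine Ioo_subset_of_nhds_of_closure (s := {t | γ t ∈ range i}) ht₀ h₀ ?_ ?_
  -- Openness: the submanifold has no boundary, so `ξB` has an integral curve through `c` for
  -- positive and negative times. Its image is an integral curve of `ξ` and coincides with `γ` near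
  -- `t`.
  · rintro t ht ⟨c, hc⟩
    obtain ⟨β, hβ0, hβ⟩ := exists_isMIntegralCurveAt_of_contMDiffAt_boundaryless (I := I') (v := ξB)
      (x₀ := c) t ((hξB c).of_le (by simp))
    obtain ⟨ε, hε, hβ⟩ := isMIntegralCurveAt_iff'.1 hβ
    rw [Real.ball_eq_Ioo] at hβ
    have h1 : t ∈ Ioo (max a (t - ε)) (min b (t + ε)) :=
      ⟨max_lt ht.1 (by linarith), lt_min ht.2 (by linarith)⟩
    have h2 := eventuallyEq_of_isMIntegralCurveOn hξ
      (hγ.mono (Ioo_subset_Ioo (le_max_left a (t - ε)) (min_le_left b (t + ε))))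
      ((isMIntegralCurveOn_comp hi h hβ).mono
        (Ioo_subset_Ioo (le_max_right a (t - ε)) (min_le_right b (t + ε)))) h1
      (by simp [hβ0, hc])
    filter_upwards [h2] with s hs
    exact ⟨β s, hs.symm⟩
  -- Closedness: `γ t` is a limit of points of the closed image of `i`.
  · intro t ht htc
    change γ t ∈ range i
    have : (𝓝[{t | γ t ∈ range i} ∩ Ioo a b] t).NeBot := mem_closure_iff_nhdsWithin_neBot.1 htc
    refine hcl.mem_of_tendsto (f := γ) (b := 𝓝[{t | γ t ∈ range i} ∩ Ioo a b] t)
      ((continuousAt_of_isMIntegralCurveOn hγ ht).tendsto.mono_left nhdsWithin_le_nhds) ?_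
    filter_upwards [self_mem_nhdsWithin] with s hs using hs.1

end Uniqueness

/-! ### The boundary condition along the flow -/

section Boundary
variable {n : ℕ} {H : Type*} [TopologicalSpace H]
  {I : ModelWithCorners ℝ (EuclideanSpace ℝ (Fin (n + 1))) H}
  {F : Type*} [NormedAddCommGroup F] [NormedSpace ℝ F]
  {X : Type*} [TopologicalSpace X] [ChartedSpace H X] [IsManifold I ∞ X]
  {Y : Type*} [TopologicalSpace Y] [ChartedSpace (ModelProd H F) Y]
  {B : Type*}

/-- `ψ_t` preserves interior points in both directions, so a boundary point of the image comes from
a boundary point of `W`. -/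
theorem FiberedManifold.IsFlowAlong.boundaryConditionOn {π : FiberedManifold I F X Y}
    {ξ : (z : π.Jet) → TangentSpace (jetModel I F) z} {φ φt : X → Y} {a b : ℝ} {W : Set X}
    {Ψ : ℝ → X → π.Jet} {t : ℝ} {iB : B → π.Jet} (h : π.IsFlowAlong ξ φ a b W Ψ) (hW : IsOpen W)
    (ht : t ∈ Ioo a b) (hφt : ∀ x ∈ W, Ψ t x = π.j1 φt (π.projX (Ψ t x)))
    (hB : ∀ x ∈ W, x ∈ I.boundary X → Ψ t x ∈ range iB) :
    π.BoundaryConditionOn iB ((fun x => π.projX (Ψ t x)) '' W) φt := by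
  rintro _ ⟨x, hx, rfl⟩ hbd
  have h1 : x ∈ I.boundary X := by
    change I.IsBoundaryPoint x
    rw [I.isBoundaryPoint_iff_not_isInteriorPoint, ← h.isInteriorPoint_iff hW ht hx,
      ← I.isBoundaryPoint_iff_not_isInteriorPoint]
    exact hbd
  have h2 := hB x hx h1
  rwa [hφt x hx] at h2

end Boundary

/-! ### Grönwall estimates for positive and negative times -/

section Gronwall
variable {V : Type*} [NormedAddCommGroup V] [NormedSpace ℝ V]

/-- From `exp s - 1 ≤ s * exp s`: the factor `e / K` is traded for `e * x`, which is visibly small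
for short times. -/
theorem gronwallBound_le {δ K e x : ℝ} (hK : 0 < K) (he : 0 ≤ e) :
    gronwallBound δ K e x ≤ (δ + e * x) * Real.exp (K * x) := by
  rw [gronwallBound_of_K_ne_0 hK.ne']
  have h1 : 1 - K * x ≤ Real.exp (-(K * x)) := by
    have := Real.add_one_le_exp (-(K * x)); linarith
  have h2 : Real.exp (K * x) * Real.exp (-(K * x)) = 1 := by rw [← Real.exp_add]; simp
  have h3 : Real.exp (K * x) - 1 ≤ K * x * Real.exp (K * x) := by
    have := mul_le_mul_of_nonneg_left h1 (Real.exp_pos (K * x)).le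
    rw [h2] at this; linarith
  have h4 : e / K * (Real.exp (K * x) - 1) ≤ e / K * (K * x * Real.exp (K * x)) :=
    mul_le_mul_of_nonneg_left h3 (by positivity)
  have h5 : e / K * (K * x * Real.exp (K * x)) = e * x * Real.exp (K * x) := by
    field_simp
  change δ * Real.exp (K * x) + e / K * (Real.exp (K * x) - 1) ≤ _
  linarith

theorem norm_le_of_norm_deriv_le_of_nonneg {u u' : ℝ → V} {K e ε : ℝ} (hK : 0 < K) (he : 0 ≤ e)
    (h : ∀ t ∈ Ioo (-ε) ε, HasDerivAt u (u' t) t)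
    (hb : ∀ t ∈ Ioo (-ε) ε, ‖u' t‖ ≤ K * ‖u t‖ + e) {t : ℝ} (ht : t ∈ Ioo (-ε) ε) (ht' : 0 ≤ t) :
    ‖u t‖ ≤ (‖u 0‖ + e * t) * Real.exp (K * t) := by
  have hsub : ∀ s ∈ Icc 0 t, s ∈ Ioo (-ε) ε := fun s hs =>
    ⟨by linarith [ht.2, hs.1], by linarith [ht.2, hs.2]⟩
  have h1 := norm_le_gronwallBound_of_norm_deriv_right_le (δ := ‖u 0‖) (K := K) (ε := e)
    (fun s hs => (h s (hsub s hs)).continuousAt.continuousWithinAt)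
    (fun s hs => (h s (hsub s (Ico_subset_Icc_self hs))).hasDerivWithinAt) le_rfl
    (fun s hs => hb s (hsub s (Ico_subset_Icc_self hs))) t (right_mem_Icc.2 ht')
  rw [sub_zero] at h1
  exact h1.trans (gronwallBound_le hK he)

/-- Grönwall's inequality on a symmetric interval. -/
theorem norm_le_of_norm_deriv_le {u u' : ℝ → V} {K e ε : ℝ} (hK : 0 < K) (he : 0 ≤ e)
    (h : ∀ t ∈ Ioo (-ε) ε, HasDerivAt u (u' t) t)
    (hb : ∀ t ∈ Ioo (-ε) ε, ‖u' t‖ ≤ K * ‖u t‖ + e) {t : ℝ} (ht : t ∈ Ioo (-ε) ε) :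
    ‖u t‖ ≤ (‖u 0‖ + e * |t|) * Real.exp (K * |t|) := by
  rcases le_total 0 t with h0 | h0
  · rw [abs_of_nonneg h0]
    exact norm_le_of_norm_deriv_le_of_nonneg hK he h hb ht h0
  · rw [abs_of_nonpos h0]
    have hneg : ∀ s ∈ Ioo (-ε) ε, -s ∈ Ioo (-ε) ε := fun s hs =>
      ⟨by linarith [hs.2], by linarith [hs.1]⟩
    have h1 := norm_le_of_norm_deriv_le_of_nonneg (u := fun s => u (-s)) (u' := fun s => -u' (-s))
      hK he (fun s hs => by simpa [comp_def] using (h _ (hneg s hs)).scomp s (hasDerivAt_neg s))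
      (fun s hs => by simpa using hb _ (hneg s hs)) (hneg t ht) (by linarith)
    simpa using h1

theorem norm_le_of_norm_deriv_le' {u u' : ℝ → V} {K e ε : ℝ} (hK : 0 < K) (he : 0 ≤ e)
    (h : ∀ t ∈ Ioo (-ε) ε, HasDerivAt u (u' t) t)
    (hb : ∀ t ∈ Ioo (-ε) ε, ‖u' t‖ ≤ K * ‖u t‖ + e) {t : ℝ} (ht : t ∈ Ioo (-ε) ε) :
    ‖u t‖ ≤ (‖u 0‖ + e * ε) * Real.exp (K * ε) := by
  have h1 : |t| ≤ ε := (abs_lt.2 ht).le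
  have h2 := norm_le_of_norm_deriv_le hK he h hb ht
  have h3 : 0 ≤ ε := (abs_nonneg t).trans h1
  refine h2.trans ?_
  gcongr

end Gronwall

/-! ### Linear equations by the Dyson series -/

section LinearODE
variable {V : Type*} [NormedAddCommGroup V] [NormedSpace ℝ V] [CompleteSpace V]

/-- The terms of the Dyson series of the linear equation `y' = M y`. -/
def dysonTerm (M : ℝ → V →L[ℝ] V) (y₀ : V) : ℕ → ℝ → V
  | 0 => fun _ => y₀
  | n + 1 => fun t => ∫ s in (0 : ℝ)..t, M s (dysonTerm M y₀ n s)

omit [CompleteSpace V] in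
-- Reversal of time replaces `M` by `-M (-·)`, so estimates are needed for nonnegative times only.
theorem dysonTerm_neg (M : ℝ → V →L[ℝ] V) (y₀ : V) (n : ℕ) (t : ℝ) :
    dysonTerm M y₀ n (-t) = dysonTerm (fun s => -M (-s)) y₀ n t := by
  induction n generalizing t with
  | zero => rfl
  | succ n ih =>
    have h1 := intervalIntegral.integral_comp_neg (a := 0) (b := t)
      (fun s => M s (dysonTerm M y₀ n s))
    rw [neg_zero, intervalIntegral.integral_symm 0 (-t)] at h1
    change ∫ s in (0 : ℝ)..-t, M s (dysonTerm M y₀ n s) =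
      ∫ s in (0 : ℝ)..t, (-M (-s)) (dysonTerm (fun s => -M (-s)) y₀ n s)
    rw [← neg_neg (∫ s in (0 : ℝ)..-t, M s (dysonTerm M y₀ n s)), ← h1,
      ← intervalIntegral.integral_neg]
    simp only [ih, neg_apply]

omit [CompleteSpace V] in
theorem norm_dysonTerm_le_of_nonneg {M : ℝ → V →L[ℝ] V} {K ε : ℝ} (hK0 : 0 ≤ K)
    (hK : ∀ t ∈ Ioo (-ε) ε, ‖M t‖ ≤ K) (y₀ : V) (n : ℕ) {t : ℝ} (ht : t ∈ Ioo (-ε) ε)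
    (h0 : 0 ≤ t) : ‖dysonTerm M y₀ n t‖ ≤ ‖y₀‖ * ((K * t) ^ n / n.factorial) := by
  induction n generalizing t with
  | zero => simp [dysonTerm]
  | succ n ih =>
    have h1 : ‖dysonTerm M y₀ (n + 1) t‖ ≤
        ∫ s in (0 : ℝ)..t, K * (‖y₀‖ * ((K * s) ^ n / n.factorial)) := by
      refine intervalIntegral.norm_integral_le_of_norm_le h0 (.of_forall fun s hs => ?_)
        (Continuous.intervalIntegrable (by fun_prop) _ _)
      have hs' : s ∈ Ioo (-ε) ε := ⟨by linarith [hs.1, ht.2], by linarith [hs.2, ht.2]⟩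
      refine (ContinuousLinearMap.le_opNorm _ _).trans ?_
      exact mul_le_mul (hK s hs') (ih hs' hs.1.le) (norm_nonneg _) hK0
    refine h1.trans (le_of_eq ?_)
    have h2 : (fun s : ℝ => K * (‖y₀‖ * ((K * s) ^ n / n.factorial))) =
        fun s => (K ^ (n + 1) * ‖y₀‖ / n.factorial) * s ^ n := by
      funext s; rw [mul_pow]; ring
    rw [h2, intervalIntegral.integral_const_mul, integral_pow, Nat.factorial_succ]
    push_cast
    field_simp
    rw [mul_pow]
    simp
    ring

omit [CompleteSpace V] in
theorem norm_dysonTerm_le {M : ℝ → V →L[ℝ] V} {K ε : ℝ} (hK0 : 0 ≤ K)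
    (hK : ∀ t ∈ Ioo (-ε) ε, ‖M t‖ ≤ K) (y₀ : V) (n : ℕ) {t : ℝ} (ht : t ∈ Ioo (-ε) ε) :
    ‖dysonTerm M y₀ n t‖ ≤ ‖y₀‖ * ((K * ε) ^ n / n.factorial) := by
  have hneg : ∀ s ∈ Ioo (-ε) ε, -s ∈ Ioo (-ε) ε := fun s hs =>
    ⟨by linarith [hs.2], by linarith [hs.1]⟩
  have hmono : ∀ s ∈ Ioo (-ε) ε, 0 ≤ s →
      ‖y₀‖ * ((K * s) ^ n / n.factorial) ≤ ‖y₀‖ * ((K * ε) ^ n / n.factorial) := by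
    intro s hs h0
    have := hs.2.le
    gcongr
  rcases le_total 0 t with h0 | h0
  · exact (norm_dysonTerm_le_of_nonneg hK0 hK y₀ n ht h0).trans (hmono t ht h0)
  · have h1 := dysonTerm_neg M y₀ n (-t)
    rw [neg_neg] at h1
    rw [h1]
    exact (norm_dysonTerm_le_of_nonneg hK0 (fun s hs => by simpa using hK _ (hneg s hs)) y₀ n
      (hneg t ht) (by linarith)).trans (hmono _ (hneg t ht) (by linarith))

/-- Linear equations have solutions on the whole interval on which the coefficients are bounded. -/
theorem exists_hasDerivAt_linear {M : ℝ → V →L[ℝ] V} {K ε : ℝ} (hε : 0 < ε)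
    (hM : ContinuousOn M (Ioo (-ε) ε)) (hK : ∀ t ∈ Ioo (-ε) ε, ‖M t‖ ≤ K) (y₀ : V) :
    ∃ y : ℝ → V, y 0 = y₀ ∧ ∀ t ∈ Ioo (-ε) ε, HasDerivAt y (M t (y t)) t := by
  have h0 : (0 : ℝ) ∈ Ioo (-ε) ε := ⟨by linarith, hε⟩
  have hK0 : 0 ≤ K := (norm_nonneg _).trans (hK 0 h0)
  set a := dysonTerm M y₀ with ha
  have ftc : ∀ g : ℝ → V, ContinuousOn g (Ioo (-ε) ε) → ∀ t ∈ Ioo (-ε) ε,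
      HasDerivAt (fun t => ∫ s in (0 : ℝ)..t, g s) (g t) t := by
    intro g hg t ht
    refine intervalIntegral.integral_hasDerivAt_right
      ((hg.mono (ordConnected_Ioo.uIcc_subset h0 ht)).intervalIntegrable)
      (hg.stronglyMeasurableAtFilter isOpen_Ioo t ht)
      (hg.continuousAt (Ioo_mem_nhds ht.1 ht.2))
  have hcont : ∀ n, ContinuousOn (a n) (Ioo (-ε) ε) := by
    intro n
    induction n with
    | zero => exact continuousOn_const
    | succ n ih => exact fun t ht => (ftc _ (hM.clm_apply ih) t ht).continuousAt.continuousWithinAt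
  have hderiv : ∀ n, ∀ t ∈ Ioo (-ε) ε, HasDerivAt (a (n + 1)) (M t (a n t)) t := fun n t ht =>
    ftc _ (hM.clm_apply (hcont n)) t ht
  have hsum : Summable fun n : ℕ => ‖y₀‖ * ((K * ε) ^ n / n.factorial) :=
    (Real.summable_pow_div_factorial _).mul_left _
  have hbound : ∀ n, ∀ t ∈ Ioo (-ε) ε, ‖M t (a n t)‖ ≤
      K * (‖y₀‖ * ((K * ε) ^ n / n.factorial)) := fun n t ht =>
    (ContinuousLinearMap.le_opNorm _ _).trans
      (mul_le_mul (hK t ht) (norm_dysonTerm_le hK0 hK y₀ n ht) (norm_nonneg _) hK0)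
  have hsuma : ∀ t ∈ Ioo (-ε) ε, Summable fun n => a n t := fun t ht =>
    .of_norm_bounded hsum fun n => norm_dysonTerm_le hK0 hK y₀ n ht
  have hzero : ∀ n, a (n + 1) 0 = 0 := fun n => intervalIntegral.integral_same
  refine ⟨fun t => y₀ + ∑' n, a (n + 1) t, by simp [hzero], fun t ht => ?_⟩
  -- The differentiated series is dominated by an exponential series uniformly on the interval, so
  -- it may be differentiated term by term; the derivative of each term is `M` applied to the
  -- previous one.
  have h1 := hasDerivAt_tsum_of_isPreconnected (hsum.mul_left K) isOpen_Ioo isPreconnected_Ioo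
    hderiv hbound h0 (by simp [hzero, summable_zero]) ht
  have h2 : M t (y₀ + ∑' n, a (n + 1) t) = ∑' n, M t (a n t) := by
    have h3 := (hsuma t ht).tsum_eq_zero_add
    rw [← (M t).map_tsum (hsuma t ht), h3]
    rfl
  rw [h2]
  exact h1.const_add y₀

end LinearODE

/-! ### Smooth dependence on initial values, up to the boundary -/

section SmoothDependence

/-- The derivative is uniformly continuous on the compact set; the mean value inequality on the
convex set `C ∩ ball w δ` does the rest. -/
theorem exists_uniform_linear_approx {G : Type*} [NormedAddCommGroup G] [NormedSpace ℝ G]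
    {f : G → G} {D : G → G →L[ℝ] G} {C : Set G} (hC : IsCompact C) (hC' : Convex ℝ C)
    (hf : ∀ w ∈ C, HasFDerivWithinAt f (D w) C w) (hD : ContinuousOn D C) {η : ℝ} (hη : 0 < η) :
    ∃ δ > 0, ∀ w ∈ C, ∀ w' ∈ C, ‖w' - w‖ < δ → ‖f w' - f w - D w (w' - w)‖ ≤ η * ‖w' - w‖ := by
  obtain ⟨δ, hδ, h⟩ := Metric.uniformContinuousOn_iff.1 (hC.uniformContinuousOn_of_continuous hD) η hη
  refine ⟨δ, hδ, fun w hw w' hw' hww' => ?_⟩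
  refine Convex.norm_image_sub_le_of_norm_hasFDerivWithin_le' (s := C ∩ Metric.ball w δ) (f' := D)
    (fun z hz => (hf z hz.1).mono inter_subset_left) (fun z hz => ?_)
    (hC'.inter (convex_ball w δ)) ⟨hw, Metric.mem_ball_self hδ⟩
    ⟨hw', by rwa [Metric.mem_ball, dist_eq_norm]⟩
  rw [← dist_eq_norm]
  exact (h z hz.1 w hw hz.2).le

variable {E G : Type*} [NormedAddCommGroup E] [NormedSpace ℝ E] [NormedAddCommGroup G]
  [NormedSpace ℝ G] {f : G → G} {D : G → G →L[ℝ] G} {C : Set G} {S : Set E} {q : ℝ → E → G}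
  {ε : ℝ} {x : E} {A : ℝ → E →L[ℝ] G}

/-- The solutions of an ordinary differential equation are differentiable in the initial value,
uniformly in time; the derivative solves the linearized equation. -/
theorem eventually_norm_sub_le (hε : 0 < ε) (hC : IsCompact C) (hC' : Convex ℝ C)
    (hf : ∀ w ∈ C, HasFDerivWithinAt f (D w) C w) (hD : ContinuousOn D C)
    (hq : ∀ x ∈ S, ∀ t ∈ Ioo (-ε) ε, HasDerivAt (fun t => q t x) (f (q t x)) t ∧ q t x ∈ C)
    (hx : x ∈ S) (hj : HasFDerivWithinAt (q 0) (A 0) S x)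
    (hA : ∀ t ∈ Ioo (-ε) ε, HasDerivAt A ((D (q t x)).comp (A t)) t) {η : ℝ} (hη : 0 < η) :
    ∀ᶠ x' in 𝓝[S] x, ∀ t ∈ Ioo (-ε) ε, ‖q t x' - q t x - A t (x' - x)‖ ≤ η * ‖x' - x‖ := by
  obtain ⟨K₀, hK₀⟩ := hC.exists_bound_of_continuousOn hD
  set K := max K₀ 1 with hKdef
  have hK1 : 1 ≤ K := le_max_right _ _
  have hK0 : 0 < K := by linarith
  have hK : ∀ w ∈ C, ‖D w‖ ≤ K := fun w hw => (hK₀ w hw).trans (le_max_left _ _)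
  set Γ := Real.exp (K * ε) with hΓ
  have hΓ0 : 0 < Γ := Real.exp_pos _
  -- Solutions depend on their initial values in a Lipschitz way, uniformly in time.
  have hlip : ∀ x' ∈ S, ∀ t ∈ Ioo (-ε) ε, ‖q t x' - q t x‖ ≤ Γ * ‖q 0 x' - q 0 x‖ := by
    intro x' hx' t ht
    have h1 := norm_le_of_norm_deriv_le' (u := fun t => q t x' - q t x)
      (u' := fun t => f (q t x') - f (q t x)) (K := K) (e := 0) hK0 le_rfl
      (fun s hs => (hq x' hx' s hs).1.sub (hq x hx s hs).1)
      (fun s hs => by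
        rw [add_zero]
        exact hC'.norm_image_sub_le_of_norm_hasFDerivWithin_le hf hK (hq x hx s hs).2
          (hq x' hx' s hs).2) ht
    rw [zero_mul, add_zero, mul_comm] at h1
    exact h1
  set c := ‖A 0‖ + 1 with hc
  have hc0 : 0 < c := by positivity
  -- The tolerances are chosen so that, after multiplication by the Grönwall factor `Γ`, the error
  -- of the initial values and the Taylor error of `f` each contribute half of `η`.
  obtain ⟨δ, hδ, happ⟩ := exists_uniform_linear_approx hC hC' hf hD
    (η := η / (2 * Γ * (Γ * c * ε))) (by positivity)
  have h1 := hj.isLittleO.def (c := η / (2 * Γ)) (by positivity)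
  have h2 := hj.isLittleO.def (c := 1) one_pos
  have h3 : ∀ᶠ x' in 𝓝[S] x, Γ * ‖q 0 x' - q 0 x‖ < δ := by
    have h4 : ContinuousWithinAt (fun x' => Γ * ‖q 0 x' - q 0 x‖) S x :=
      continuousWithinAt_const.mul (hj.continuousWithinAt.sub continuousWithinAt_const).norm
    have h5 := h4.tendsto
    simp only [sub_self, norm_zero, mul_zero] at h5
    exact h5.eventually (gt_mem_nhds hδ)
  filter_upwards [h1, h2, h3, self_mem_nhdsWithin] with x' h1 h2 h3 hx' t ht
  have h4 : ‖q 0 x' - q 0 x‖ ≤ c * ‖x' - x‖ := by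
    have h5 : q 0 x' - q 0 x = (q 0 x' - q 0 x - A 0 (x' - x)) + A 0 (x' - x) := by abel
    rw [h5, hc]
    refine (norm_add_le _ _).trans ?_
    have := (A 0).le_opNorm (x' - x)
    linarith
  set e := η / (2 * Γ * (Γ * c * ε)) * (Γ * (c * ‖x' - x‖)) with he
  have h6 := norm_le_of_norm_deriv_le' (u := fun t => q t x' - q t x - A t (x' - x))
      (u' := fun t => f (q t x') - f (q t x) - D (q t x) (A t (x' - x))) (K := K) (e := e) hK0
      (by positivity)
      (fun s hs => ((hq x' hx' s hs).1.sub (hq x hx s hs).1).sub (by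
        simpa using (hA s hs).clm_apply (hasDerivAt_const s (x' - x))))
      (fun s hs => by
        -- The difference satisfies the linearized equation up to the Taylor remainder of `f` at `q
        -- s x`.
        have h7 : f (q s x') - f (q s x) - D (q s x) (A s (x' - x)) =
            D (q s x) (q s x' - q s x - A s (x' - x)) +
              (f (q s x') - f (q s x) - D (q s x) (q s x' - q s x)) := by
          simp only [map_sub]; abel
        rw [h7]
        refine (norm_add_le _ _).trans (add_le_add ?_ ?_)
        · exact ((D (q s x)).le_opNorm _).trans (mul_le_mul_of_nonneg_right
            (hK _ (hq x hx s hs).2) (norm_nonneg _))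
        · have h8 := hlip x' hx' s hs
          refine (happ _ (hq x hx s hs).2 _ (hq x' hx' s hs).2 (h8.trans_lt h3)).trans ?_
          rw [he]
          gcongr
          exact h8.trans (by gcongr)) ht
  refine h6.trans ?_
  have h9 : (η / (2 * Γ) * ‖x' - x‖ + e * ε) * Γ = η * ‖x' - x‖ := by
    rw [he]; field_simp; ring
  rw [← h9]
  gcongr

/-- Joint differentiability of the solutions in time and initial value. -/
theorem hasFDerivWithinAt_uncurry (hε : 0 < ε) (hC : IsCompact C) (hC' : Convex ℝ C)
    (hf : ∀ w ∈ C, HasFDerivWithinAt f (D w) C w) (hD : ContinuousOn D C)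
    (hq : ∀ x ∈ S, ∀ t ∈ Ioo (-ε) ε, HasDerivAt (fun t => q t x) (f (q t x)) t ∧ q t x ∈ C)
    (hx : x ∈ S) (hj : HasFDerivWithinAt (q 0) (A 0) S x)
    (hA : ∀ t ∈ Ioo (-ε) ε, HasDerivAt A ((D (q t x)).comp (A t)) t) {t : ℝ}
    (ht : t ∈ Ioo (-ε) ε) :
    HasFDerivWithinAt (fun p : ℝ × E => q p.1 p.2)
      (((1 : ℝ →L[ℝ] ℝ).smulRight (f (q t x))).coprod (A t)) (Ioo (-ε) ε ×ˢ S) (t, x) := by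
  have hfst : Filter.Tendsto Prod.fst (𝓝[Ioo (-ε) ε ×ˢ S] (t, x)) (𝓝 t) :=
    (continuous_fst.tendsto (t, x)).mono_left nhdsWithin_le_nhds
  have hsnd : Filter.Tendsto Prod.snd (𝓝[Ioo (-ε) ε ×ˢ S] (t, x)) (𝓝[S] x) := by
    refine tendsto_nhdsWithin_iff.2 ⟨(continuous_snd.tendsto (t, x)).mono_left
      nhdsWithin_le_nhds, ?_⟩
    filter_upwards [self_mem_nhdsWithin] with p hp using hp.2
  refine .of_isLittleO ?_
  -- The increment has three parts: a change of the initial value at fixed time, where the uniform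
  -- estimate is needed; the change of `A` in time; and the motion along the solution through `x`.
  have h1 : (fun p : ℝ × E => q p.1 p.2 - q p.1 x - A p.1 (p.2 - x))
      =o[𝓝[Ioo (-ε) ε ×ˢ S] (t, x)] fun p => p - (t, x) := by
    refine Asymptotics.IsLittleO.of_bound fun η hη => ?_
    filter_upwards [hsnd.eventually (eventually_norm_sub_le hε hC hC' hf hD hq hx hj hA hη),
      self_mem_nhdsWithin] with p hp hp'
    exact (hp p.1 hp'.1).trans (mul_le_mul_of_nonneg_left (norm_snd_le (p - (t, x))) hη.le)
  have h2 : (fun p : ℝ × E => (A p.1 - A t) (p.2 - x))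
      =o[𝓝[Ioo (-ε) ε ×ˢ S] (t, x)] fun p => p - (t, x) := by
    refine Asymptotics.IsLittleO.of_bound fun η hη => ?_
    have h3 : Filter.Tendsto (fun s => ‖A s - A t‖) (𝓝 t) (𝓝 0) := by
      have := ((hA t ht).continuousAt.sub (continuousAt_const (y := A t))).norm.tendsto
      simpa using this
    filter_upwards [hfst.eventually (h3.eventually (gt_mem_nhds hη))] with p hp
    exact ((A p.1 - A t).le_opNorm _).trans (mul_le_mul hp.le (norm_snd_le (p - (t, x)))
      (norm_nonneg _) hη.le)
  have h3 : (fun p : ℝ × E => q p.1 x - q t x - (p.1 - t) • f (q t x))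
      =o[𝓝[Ioo (-ε) ε ×ˢ S] (t, x)] fun p => p - (t, x) := by
    refine ((hasDerivAt_iff_isLittleO.1 (hq x hx t ht).1).comp_tendsto hfst).trans_isBigO ?_
    exact Asymptotics.isBigO_of_le _ fun p => norm_fst_le (p - (t, x))
  refine ((h1.add h2).add h3).congr_left fun p => ?_
  change q p.1 p.2 - q p.1 x - A p.1 (p.2 - x) + (A p.1 (p.2 - x) - A t (p.2 - x)) +
    (q p.1 x - q t x - (p.1 - t) • f (q t x)) =
      q p.1 p.2 - q t x - ((p.1 - t) • f (q t x) + A t (p.2 - x))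
  abel

/-- The linearized equation along a solution has solutions. -/
theorem exists_linearization [CompleteSpace G] (hε : 0 < ε) (hC : IsCompact C)
    (hD : ContinuousOn D C) {γ : ℝ → G} (hγ : ∀ t ∈ Ioo (-ε) ε, ContinuousAt γ t ∧ γ t ∈ C)
    (A₀ : E →L[ℝ] G) : ∃ A : ℝ → E →L[ℝ] G, A 0 = A₀ ∧
      ∀ t ∈ Ioo (-ε) ε, HasDerivAt A ((D (γ t)).comp (A t)) t := by
  obtain ⟨K, hK⟩ := hC.exists_bound_of_continuousOn hD
  refine exists_hasDerivAt_linear (M := fun t => ContinuousLinearMap.compL ℝ E G G (D (γ t)))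
    (K := K) hε ?_ (fun t ht => ?_) A₀
  · exact (ContinuousLinearMap.continuous _).comp_continuousOn
      (hD.comp (fun t ht => (hγ t ht).1.continuousWithinAt) fun t ht => (hγ t ht).2)
  · refine ContinuousLinearMap.opNorm_le_bound _ ((norm_nonneg _).trans (hK _ (hγ t ht).2))
      fun B => ?_
    exact (ContinuousLinearMap.opNorm_comp_le (D (γ t)) B).trans
      (mul_le_mul_of_nonneg_right (hK _ (hγ t ht).2) (norm_nonneg _))

/-- The norm of a solution of the linearized equation is controlled by the initial value. -/
theorem norm_linearization_le {K : ℝ} (hK : 0 < K) {γ : ℝ → G}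
    (hγ : ∀ t ∈ Ioo (-ε) ε, ‖D (γ t)‖ ≤ K)
    (hA : ∀ t ∈ Ioo (-ε) ε, HasDerivAt A ((D (γ t)).comp (A t)) t) :
    ∀ t ∈ Ioo (-ε) ε, ‖A t‖ ≤ ‖A 0‖ * Real.exp (K * ε) := by
  intro t ht
  have h1 := norm_le_of_norm_deriv_le' hK le_rfl hA (fun s hs => by
    rw [add_zero]
    exact (ContinuousLinearMap.opNorm_comp_le _ _).trans
      (mul_le_mul_of_nonneg_right (hγ s hs) (norm_nonneg _))) ht
  rwa [zero_mul, add_zero] at h1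

/-- Smooth dependence of the solutions of an ordinary differential equation on time and initial
values. The domains of the initial values and of the equation may have a boundary. -/
theorem contDiffOn_nat_of_hasDerivAt (k : ℕ) {E : Type} [NormedAddCommGroup E] [NormedSpace ℝ E]
    [FiniteDimensional ℝ E] : ∀ {G : Type} [NormedAddCommGroup G] [NormedSpace ℝ G]
    [FiniteDimensional ℝ G] {f : G → G} {Ω C : Set G} {S : Set E} {q : ℝ → E → G} {ε : ℝ},
    0 < ε → UniqueDiffOn ℝ Ω → ContDiffOn ℝ ∞ f Ω → C ⊆ Ω → IsCompact C → Convex ℝ C →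
    UniqueDiffOn ℝ S → ContDiffOn ℝ ∞ (q 0) S →
    (∀ x ∈ S, ∀ t ∈ Ioo (-ε) ε, HasDerivAt (fun t => q t x) (f (q t x)) t ∧ q t x ∈ C) →
    ContDiffOn ℝ k (fun p : ℝ × E => q p.1 p.2) (Ioo (-ε) ε ×ˢ S) := by
  induction k with
  | zero =>
    intro G _ _ _ f Ω C S q ε hε hΩ hf hCΩ hC hC' hS hj hq
    have : CompleteSpace G := FiniteDimensional.complete ℝ G
    have hf' : ∀ w ∈ C, HasFDerivWithinAt f (fderivWithin ℝ f Ω w) C w := fun w hw =>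
      ((hf.differentiableOn (by simp) w (hCΩ hw)).hasFDerivWithinAt).mono hCΩ
    have hD : ContinuousOn (fderivWithin ℝ f Ω) C :=
      ((hf.fderivWithin hΩ (m := ∞) (by simp)).continuousOn).mono hCΩ
    rw [CharP.cast_eq_zero, contDiffOn_zero]
    rintro ⟨t, x⟩ ⟨ht, hx⟩
    obtain ⟨A, hA0, hA⟩ := exists_linearization hε hC hD (γ := fun t => q t x)
      (fun t ht => ⟨(hq x hx t ht).1.continuousAt, (hq x hx t ht).2⟩) (fderivWithin ℝ (q 0) S x)
    exact (hasFDerivWithinAt_uncurry hε hC hC' hf' hD hq hx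
      (hA0 ▸ (hj.differentiableOn (by simp) x hx).hasFDerivWithinAt) hA ht).continuousWithinAt
  | succ k ih =>
    intro G _ _ _ f Ω C S q ε hε hΩ hf hCΩ hC hC' hS hj hq
    have : CompleteSpace G := FiniteDimensional.complete ℝ G
    have h0 : (0 : ℝ) ∈ Ioo (-ε) ε := ⟨by linarith, hε⟩
    have hf' : ∀ w ∈ C, HasFDerivWithinAt f (fderivWithin ℝ f Ω w) C w := fun w hw =>
      ((hf.differentiableOn (by simp) w (hCΩ hw)).hasFDerivWithinAt).mono hCΩ
    have hDs : ContDiffOn ℝ ∞ (fderivWithin ℝ f Ω) Ω := hf.fderivWithin hΩ (m := ∞) (by simp)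
    have hD : ContinuousOn (fderivWithin ℝ f Ω) C := hDs.continuousOn.mono hCΩ
    have hjs : ContDiffOn ℝ ∞ (fderivWithin ℝ (q 0) S) S := hj.fderivWithin hS (m := ∞) (by simp)
    have hex : ∀ x : E, ∃ A : ℝ → E →L[ℝ] G, x ∈ S → A 0 = fderivWithin ℝ (q 0) S x ∧
        ∀ t ∈ Ioo (-ε) ε, HasDerivAt A ((fderivWithin ℝ f Ω (q t x)).comp (A t)) t := by
      intro x
      by_cases hx : x ∈ S
      · obtain ⟨A, hA0, hA⟩ := exists_linearization hε hC hD (γ := fun t => q t x)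
          (fun t ht => ⟨(hq x hx t ht).1.continuousAt, (hq x hx t ht).2⟩)
          (fderivWithin ℝ (q 0) S x)
        exact ⟨A, fun _ => ⟨hA0, hA⟩⟩
      · exact ⟨0, fun h => absurd h hx⟩
    choose A hA using hex
    have hder : ∀ p ∈ Ioo (-ε) ε ×ˢ S, HasFDerivWithinAt (fun p : ℝ × E => q p.1 p.2)
        (((1 : ℝ →L[ℝ] ℝ).smulRight (f (q p.1 p.2))).coprod (A p.2 p.1)) (Ioo (-ε) ε ×ˢ S) p :=
      fun p hp => hasFDerivWithinAt_uncurry hε hC hC' hf' hD hq hp.2 ((hA p.2 hp.2).1 ▸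
        (hj.differentiableOn (by simp) _ hp.2).hasFDerivWithinAt) (hA p.2 hp.2).2 hp.1
    have hqk := ih hε hΩ hf hCΩ hC hC' hS hj hq
    have hAk : ContDiffOn ℝ k (fun p : ℝ × E => A p.2 p.1) (Ioo (-ε) ε ×ˢ S) := by
      rintro ⟨t, x⟩ ⟨ht, hx⟩
      obtain ⟨K₀, hK₀⟩ := hC.exists_bound_of_continuousOn hD
      set K := max K₀ 1
      have hK0 : 0 < K := lt_of_lt_of_le one_pos (le_max_right _ _)
      set c := ‖fderivWithin ℝ (q 0) S x‖ + 1
      obtain ⟨u, hu, hxu, hSu⟩ : ∃ u : Set E, IsOpen u ∧ x ∈ u ∧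
          ∀ y ∈ S ∩ u, ‖fderivWithin ℝ (q 0) S y‖ ≤ c := by
        have h1 : ∀ᶠ y in 𝓝[S] x, ‖fderivWithin ℝ (q 0) S y‖ ≤ c :=
          ((hjs.continuousOn x hx).norm.tendsto.eventually
            (gt_mem_nhds (lt_add_one _))).mono fun y hy => hy.le
        obtain ⟨u, hu, hxu, h2⟩ := mem_nhdsWithin.1 h1
        exact ⟨u, hu, hxu, fun y hy => h2 ⟨hy.2, hy.1⟩⟩
      -- The pair `(q, A)` solves an equation of the same kind in a larger space, which is why `G`
      -- is quantified inside the induction. Restricting to `S ∩ u` bounds the initial values of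
      -- `A`, and the linear estimate then keeps `A` in a fixed closed ball, so the compact convex
      -- set can be enlarged by it.
      have h2 := ih (G := G × (E →L[ℝ] G)) (q := fun t x => (q t x, A x t)) (S := S ∩ u)
        (f := fun w => (f w.1, (fderivWithin ℝ f Ω w.1).comp w.2)) (Ω := Ω ×ˢ univ)
        (C := C ×ˢ Metric.closedBall 0 (c * Real.exp (K * ε))) hε
        (hΩ.prod uniqueDiffOn_univ)
        ((hf.comp contDiffOn_fst fun w hw => hw.1).prodMk
          ((hDs.comp contDiffOn_fst fun w hw => hw.1).clm_comp contDiffOn_snd))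
        (prod_mono hCΩ (subset_univ _)) (hC.prod (isCompact_closedBall _ _))
        (hC'.prod (convex_closedBall _ _)) (hS.inter hu)
        ((hj.mono inter_subset_left).prodMk ((hjs.mono inter_subset_left).congr
          fun y hy => (hA y hy.1).1))
        (fun y hy s hs => ⟨(hq y hy.1 s hs).1.prodMk ((hA y hy.1).2 s hs), (hq y hy.1 s hs).2, by
          rw [mem_closedBall_zero_iff]
          refine (norm_linearization_le hK0 (fun r hr => (hK₀ _ (hq y hy.1 r hr).2).trans
            (le_max_left _ _)) (hA y hy.1).2 s hs).trans ?_
          rw [(hA y hy.1).1]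
          gcongr
          exact hSu y hy⟩)
      have h3 : ContDiffWithinAt ℝ k (fun p : ℝ × E => A p.2 p.1) (Ioo (-ε) ε ×ˢ (S ∩ u)) (t, x) :=
        (contDiffOn_snd.comp h2 (mapsTo_univ _ _)) (t, x) ⟨ht, hx, hxu⟩
      refine h3.mono_of_mem_nhdsWithin ?_
      have h4 : Ioo (-ε) ε ×ˢ (S ∩ u) = (Ioo (-ε) ε ×ˢ S) ∩ (univ ×ˢ u) := by
        rw [prod_inter_prod, inter_univ]
      rw [h4]
      exact inter_mem_nhdsWithin _ ((isOpen_univ.prod hu).mem_nhds ⟨mem_univ _, hxu⟩)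
    have hfq : ContDiffOn ℝ k (fun p : ℝ × E => f (q p.1 p.2)) (Ioo (-ε) ε ×ˢ S) :=
      (hf.of_le (by exact_mod_cast le_top)).comp hqk
        fun p hp => hCΩ (hq p.2 hp.2 p.1 hp.1).2
    push_cast
    rw [contDiffOn_succ_iff_hasFDerivWithinAt_of_uniqueDiffOn
      ((isOpen_Ioo.uniqueDiffOn).prod hS)]
    refine ⟨by simp, _, ?_, hder⟩
    refine (((ContinuousLinearMap.smulRightL ℝ (ℝ × E) G
      (ContinuousLinearMap.fst ℝ ℝ E)).contDiff.comp_contDiffOn hfq).add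
      (((ContinuousLinearMap.compL ℝ (ℝ × E) E G).flip
        (ContinuousLinearMap.snd ℝ ℝ E)).contDiff.comp_contDiffOn hAk)).congr fun p _ => ?_
    refine ContinuousLinearMap.ext fun v => ?_
    rfl

theorem contDiffOn_of_hasDerivAt {E G : Type} [NormedAddCommGroup E] [NormedSpace ℝ E]
    [FiniteDimensional ℝ E] [NormedAddCommGroup G] [NormedSpace ℝ G]
    [FiniteDimensional ℝ G] {f : G → G} {Ω C : Set G} {S : Set E} {q : ℝ → E → G} {ε : ℝ}
    (hε : 0 < ε) (hΩ : UniqueDiffOn ℝ Ω) (hf : ContDiffOn ℝ ∞ f Ω) (hCΩ : C ⊆ Ω)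
    (hC : IsCompact C) (hC' : Convex ℝ C) (hS : UniqueDiffOn ℝ S) (hj : ContDiffOn ℝ ∞ (q 0) S)
    (hq : ∀ x ∈ S, ∀ t ∈ Ioo (-ε) ε, HasDerivAt (fun t => q t x) (f (q t x)) t ∧ q t x ∈ C) :
    ContDiffOn ℝ ∞ (fun p : ℝ × E => q p.1 p.2) (Ioo (-ε) ε ×ˢ S) :=
  contDiffOn_infty.2 fun k => contDiffOn_nat_of_hasDerivAt k hε hΩ hf hCΩ hC hC' hS hj hq

end SmoothDependence

/-! ### Flows on a half-space -/

section LocalFlow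

open scoped NNReal

/-- For a globally Lipschitz field the existence time depends only on the Lipschitz constant, hence
is the same for all initial points. -/
theorem exists_hasDerivAt_of_lipschitzWith {G : Type*} [NormedAddCommGroup G] [NormedSpace ℝ G]
    [CompleteSpace G] {v : G → G} {K : ℝ≥0} (hv : LipschitzWith K v) {ε : ℝ} (hε : 0 < ε)
    (hKε : K * ε ≤ 1 / 2) (w : G) :
    ∃ α : ℝ → G, α 0 = w ∧ ∀ t ∈ Ioo (-ε) ε, HasDerivAt α (v (α t)) t := by
  have h0 : (0 : ℝ) ∈ Icc (-ε) ε := ⟨by linarith, hε.le⟩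
  -- On the ball of radius `2 ‖v w‖ ε` the speed is at most `‖v w‖ + K * 2 ‖v w‖ ε ≤ 2 ‖v w‖`, so
  -- the curve cannot leave it before time `ε`.
  have hpl : IsPicardLindelof (fun _ => v) (⟨0, h0⟩ : Icc (-ε) ε) w (2 * ‖v w‖₊ * ⟨ε, hε.le⟩) 0
      (2 * ‖v w‖₊) K := by
    refine .of_time_independent (fun x hx => ?_) hv.lipschitzOnWith ?_
    · have h1 : ‖v x - v w‖ ≤ K * ‖x - w‖ := by simpa [dist_eq_norm] using hv.dist_le_mul x w
      have h2 : ‖x - w‖ ≤ 2 * ‖v w‖ * ε := by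
        have h3 := Metric.mem_closedBall.1 hx
        rw [dist_eq_norm] at h3
        exact h3
      have h3 : (K : ℝ) * ‖x - w‖ ≤ ‖v w‖ := by
        calc (K : ℝ) * ‖x - w‖ ≤ K * (2 * ‖v w‖ * ε) := by gcongr
          _ = 2 * ‖v w‖ * (K * ε) := by ring
          _ ≤ 2 * ‖v w‖ * (1 / 2) := by gcongr
          _ = ‖v w‖ := by ring
      have h4 : ‖v x‖ ≤ ‖v w‖ + ‖v x - v w‖ := by
        have := norm_add_le (v w) (v x - v w)
        rwa [add_sub_cancel] at this
      push_cast
      linarith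
    · push_cast
      simp only [sub_zero, zero_sub, neg_neg, max_self]
      exact le_refl _
  obtain ⟨α, h1, h2⟩ := hpl.exists_eq_forall_mem_Icc_hasDerivWithinAt
    (Metric.mem_closedBall_self le_rfl)
  exact ⟨α, h1, fun t ht => (h2 t (Ioo_subset_Icc_self ht)).hasDerivAt (Icc_mem_nhds ht.1 ht.2)⟩

theorem exp_le_two {s : ℝ} (hs : s ≤ 1 / 2) : Real.exp s ≤ 2 := by
  have h1 : Real.exp s ≤ Real.exp (1 / 2) := Real.exp_le_exp.2 hs
  have h2 : Real.exp (1 / 2) * Real.exp (1 / 2) = Real.exp 1 := by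
    rw [← Real.exp_add]; norm_num
  nlinarith [Real.exp_one_lt_three, Real.exp_pos (1 / 2)]

variable {E G : Type} [NormedAddCommGroup E] [NormedSpace ℝ E] [FiniteDimensional ℝ E]
  [NormedAddCommGroup G] [NormedSpace ℝ G] [FiniteDimensional ℝ G]

/-- The flow of a vector field `f` on a half-space `{0 ≤ ℓ ∘ p}`, along a map `j` from the
half-space `{0 ≤ ℓ}` with `p ∘ j = id`. The vector field is not supposed to be tangent to the
boundary, except along the solutions that start at `j x`, for boundary points `x`. -/
theorem exists_flow_of_halfSpace {p : G →L[ℝ] E} (hp : ∀ w, ‖p w‖ ≤ ‖w‖) {ℓ : E →L[ℝ] ℝ}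
    (hℓ : ∀ v, |ℓ v| ≤ ‖v‖) {e : E} (he : ℓ e = 1) (he' : ‖e‖ ≤ 1)
    (hΩ : UniqueDiffOn ℝ {w : G | 0 ≤ ℓ (p w)}) (hS : UniqueDiffOn ℝ {x : E | 0 ≤ ℓ x})
    {D T : Set G} (hD : IsOpen D) {f : G → G} (hf : ContDiffOn ℝ ∞ f ({w | 0 ≤ ℓ (p w)} ∩ D))
    {j : E → G} {x₀ : E} {r : ℝ} (hr : 0 < r)
    (hj : ContDiffOn ℝ ∞ j ({x | 0 ≤ ℓ x} ∩ Metric.ball x₀ r))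
    (hpj : ∀ x ∈ {x | 0 ≤ ℓ x} ∩ Metric.ball x₀ r, p (j x) = x) (hx₀ : 0 ≤ ℓ x₀) (hjD : j x₀ ∈ D)
    (hT : ∀ w ∈ T, ℓ (p w) = 0)
    (hbd : ∀ a > 0, ∃ δ > 0, ∀ x ∈ Metric.ball x₀ δ, ℓ x = 0 → ∃ β : ℝ → G, β 0 = j x ∧
      ∀ t ∈ Ioo (-δ) δ, HasDerivAt β (f (β t)) t ∧ β t ∈ T ∧ dist (β t) (j x₀) ≤ a) :
    ∃ ε > 0, ∃ ρ > 0, ρ ≤ r ∧ ∃ q : ℝ → E → G,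
      (∀ x ∈ {x | 0 ≤ ℓ x} ∩ Metric.ball x₀ ρ, q 0 x = j x ∧ ∀ t ∈ Ioo (-ε) ε,
        HasDerivAt (fun t => q t x) (f (q t x)) t ∧ 0 ≤ ℓ (p (q t x)) ∧ q t x ∈ D ∧
        (ℓ x = 0 → q t x ∈ T)) ∧
      (∀ x ∈ {x | 0 ≤ ℓ x} ∩ Metric.ball x₀ ρ, ∀ y ∈ {x | 0 ≤ ℓ x} ∩ Metric.ball x₀ ρ,
        ∀ t ∈ Ioo (-ε) ε, ‖p (q t x) - p (q t y) - (x - y)‖ ≤ 1 / 4 * ‖x - y‖) ∧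
      ContDiffOn ℝ ∞ (fun s : ℝ × E => q s.1 s.2)
        (Ioo (-ε) ε ×ˢ ({x | 0 ≤ ℓ x} ∩ Metric.ball x₀ ρ)) := by
  have : CompleteSpace G := FiniteDimensional.complete ℝ G
  have hΩc : Convex ℝ {w : G | 0 ≤ ℓ (p w)} :=
    (convex_halfSpace_ge (f := fun w => ℓ (p w)) (ℓ.comp p).isLinear 0)
  have hSc : Convex ℝ {x : E | 0 ≤ ℓ x} := convex_halfSpace_ge (f := ℓ) ℓ.isLinear 0
  set w₀ := j x₀ with hw₀
  have hpw₀ : p w₀ = x₀ := hpj x₀ ⟨hx₀, Metric.mem_ball_self hr⟩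
  have hw₀Ω : w₀ ∈ {w : G | 0 ≤ ℓ (p w)} := by rw [mem_ofPred_eq, hpw₀]; exact hx₀
  -- a Lipschitz extension of the vector field
  obtain ⟨a, ha, haD, K', v, hv, hvf⟩ : ∃ a > 0, Metric.closedBall w₀ a ⊆ D ∧
      ∃ (K' : ℝ≥0) (v : G → G), LipschitzWith K' v ∧
        EqOn f v ({w | 0 ≤ ℓ (p w)} ∩ Metric.closedBall w₀ a) := by
    have h1 : ContDiffWithinAt ℝ 1 f {w | 0 ≤ ℓ (p w)} w₀ :=
      ((hf w₀ ⟨hw₀Ω, hjD⟩).mono_of_mem_nhdsWithin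
        (inter_mem_nhdsWithin _ (hD.mem_nhds hjD))).of_le (by simp)
    obtain ⟨K, s, hs, hK⟩ := h1.exists_lipschitzOnWith hΩc
    obtain ⟨a₁, ha₁, hs'⟩ := Metric.mem_nhdsWithin_iff.1 hs
    obtain ⟨a₂, ha₂, hD'⟩ := Metric.isOpen_iff.1 hD w₀ hjD
    have hlt : min a₁ a₂ / 2 < min a₁ a₂ := half_lt_self (lt_min ha₁ ha₂)
    obtain ⟨v, hv, hvf⟩ := (hK.mono (t := s) le_rfl).extend_finite_dimension
    refine ⟨min a₁ a₂ / 2, half_pos (lt_min ha₁ ha₂), fun w hw => hD'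
      (Metric.closedBall_subset_ball (hlt.trans_le (min_le_right _ _)) hw), _, v, hv,
      fun w hw => hvf (hs' ⟨Metric.closedBall_subset_ball (hlt.trans_le (min_le_left _ _)) hw.2,
        hw.1⟩)⟩
  obtain ⟨Kj, r₁, hr₁, hr₁r, hKj⟩ : ∃ (Kj : ℝ≥0) (r₁ : ℝ), 0 < r₁ ∧ r₁ ≤ r ∧
      LipschitzOnWith Kj j ({x | 0 ≤ ℓ x} ∩ Metric.ball x₀ r₁) := by
    obtain ⟨K, s, hs, hK⟩ := ((hj x₀ ⟨hx₀, Metric.mem_ball_self hr⟩).of_le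
      (m := 1) (by simp)).exists_lipschitzOnWith (hSc.inter (convex_ball x₀ r))
    obtain ⟨a₁, ha₁, hs'⟩ := Metric.mem_nhdsWithin_iff.1 hs
    refine ⟨K, min a₁ r, lt_min ha₁ hr, min_le_right _ _, hK.mono fun x hx => hs'
      ⟨Metric.ball_subset_ball (min_le_left _ _) hx.2, hx.1,
        Metric.ball_subset_ball (min_le_right _ _) hx.2⟩⟩
  -- At an inner point `a₁ ≤ ℓ x₀` already keeps nearby curves in the half-space; at a boundary
  -- point a finer argument is needed.
  obtain ⟨a₁, ha₁, ha₁a, ha₁Ω⟩ : ∃ a₁ > 0, a₁ ≤ a ∧ (0 < ℓ x₀ → a₁ ≤ ℓ x₀) := by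
    rcases hx₀.eq_or_lt with h | h
    · exact ⟨a, ha, le_rfl, fun h' => absurd h' (by rw [← h]; exact lt_irrefl _)⟩
    · exact ⟨min a (ℓ x₀), lt_min ha h, min_le_left _ _, fun _ => min_le_right _ _⟩
  obtain ⟨δ, hδ, hβ⟩ := hbd a ha
  set K : ℝ := K' + 1 with hKdef
  have hK0 : 0 < K := by positivity
  have hKv : ∀ w w', ‖v w - v w'‖ ≤ K * ‖w - w'‖ := fun w w' => by
    have h1 : ‖v w - v w'‖ ≤ K' * ‖w - w'‖ := by simpa [dist_eq_norm] using hv.dist_le_mul w w'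
    have h2 := norm_nonneg (w - w')
    rw [hKdef]; linarith
  -- The conditions serve, in this order: comparison with the given boundary curves, existence and
  -- `exp ≤ 2`, the Lipschitz constant `1/4`, and confinement to the ball of radius `a₁`.
  obtain ⟨ε, hε, hεδ, hε1, hε2, hε3⟩ : ∃ ε > 0, ε ≤ δ ∧ K * ε ≤ 1 / 2 ∧ K * Kj * ε * 2 ≤ 1 / 4 ∧
      ‖v w₀‖ * ε * 2 ≤ a₁ / 2 := by
    refine ⟨min (min δ (1 / (2 * K))) (min (1 / (8 * (K * Kj + 1))) (a₁ / (4 * (‖v w₀‖ + 1)))),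
      by positivity, (min_le_left _ _).trans (min_le_left _ _), ?_, ?_, ?_⟩
    · refine (mul_le_mul_of_nonneg_left ((min_le_left _ _).trans (min_le_right _ _)) hK0.le).trans
        (le_of_eq ?_)
      field_simp
    · have h1 : K * Kj * (1 / (8 * (K * Kj + 1))) * 2 ≤ 1 / 4 := by
        have : 0 ≤ K * Kj := by positivity
        rw [mul_one_div, div_mul_eq_mul_div, div_le_iff₀ (by positivity)]
        linarith
      refine le_trans ?_ h1
      gcongr
      exact (min_le_right _ _).trans (min_le_left _ _)
    · have h1 : ‖v w₀‖ * (a₁ / (4 * (‖v w₀‖ + 1))) * 2 ≤ a₁ / 2 := by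
        rw [mul_div_assoc', div_mul_eq_mul_div, div_le_iff₀ (by positivity)]
        nlinarith [norm_nonneg (v w₀)]
      refine le_trans ?_ h1
      gcongr
      exact (min_le_right _ _).trans (min_le_right _ _)
  obtain ⟨ρ₁, hρ₁, hρ₁r, hρ₁δ, hρ₁a⟩ : ∃ ρ₁ > 0, ρ₁ ≤ r₁ ∧ ρ₁ ≤ δ ∧ Kj * ρ₁ * 2 ≤ a₁ / 2 := by
    refine ⟨min (min r₁ δ) (a₁ / (4 * (Kj + 1))), by positivity,
      (min_le_left _ _).trans (min_le_left _ _), (min_le_left _ _).trans (min_le_right _ _), ?_⟩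
    have h1 : Kj * (a₁ / (4 * (Kj + 1))) * 2 ≤ a₁ / 2 := by
      rw [mul_div_assoc', div_mul_eq_mul_div, div_le_iff₀ (by positivity)]
      nlinarith [Kj.coe_nonneg]
    refine le_trans ?_ h1
    gcongr
    exact min_le_right _ _
  have hexp : ∀ t ∈ Ioo (-ε) ε, Real.exp (K * |t|) ≤ 2 := fun t ht =>
    exp_le_two ((mul_le_mul_of_nonneg_left (abs_lt.2 ht).le hK0.le).trans hε1)
  choose q hq0 hq using fun x : E => exists_hasDerivAt_of_lipschitzWith hv hε
    ((mul_le_mul_of_nonneg_right (by rw [hKdef]; linarith) hε.le).trans hε1) (j x)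
  have hjlip : ∀ x ∈ {x | 0 ≤ ℓ x} ∩ Metric.ball x₀ ρ₁, ∀ y ∈ {x | 0 ≤ ℓ x} ∩ Metric.ball x₀ ρ₁,
      ‖j x - j y‖ ≤ Kj * ‖x - y‖ := fun x hx y hy => by
    simpa [dist_eq_norm] using hKj.dist_le_mul x ⟨hx.1, Metric.ball_subset_ball hρ₁r hx.2⟩ y
      ⟨hy.1, Metric.ball_subset_ball hρ₁r hy.2⟩
  have hx₀S : x₀ ∈ {x | 0 ≤ ℓ x} ∩ Metric.ball x₀ ρ₁ := ⟨hx₀, Metric.mem_ball_self hρ₁⟩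
  have hclose : ∀ x ∈ {x | 0 ≤ ℓ x} ∩ Metric.ball x₀ ρ₁, ∀ t ∈ Ioo (-ε) ε,
      ‖q x t - w₀‖ ≤ a₁ := by
    intro x hx t ht
    have h1 := norm_le_of_norm_deriv_le (u := fun t => q x t - w₀) (e := ‖v w₀‖) hK0
      (norm_nonneg _) (fun s hs => (hq x s hs).sub_const w₀) (fun s hs => by
        have h2 := norm_add_le (v (q x s) - v w₀) (v w₀)
        rw [sub_add_cancel] at h2
        have h3 := hKv (q x s) w₀
        linarith) ht
    have h2 : ‖q x 0 - w₀‖ ≤ Kj * ρ₁ := by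
      rw [hq0]
      refine (hjlip x hx x₀ hx₀S).trans ?_
      have := (Metric.mem_ball.1 hx.2).le
      rw [dist_eq_norm] at this
      gcongr
    have h3 := (abs_lt.2 ht).le
    calc ‖q x t - w₀‖ ≤ (‖q x 0 - w₀‖ + ‖v w₀‖ * |t|) * Real.exp (K * |t|) := h1
      _ ≤ (Kj * ρ₁ + ‖v w₀‖ * ε) * 2 := by gcongr; exact hexp t ht
      _ ≤ a₁ := by linarith
  -- The deviation `q x t - q y t - (j x - j y)` starts at zero, so Grönwall bounds it by a small
  -- multiple of `‖j x - j y‖`.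
  have hquarter : ∀ x ∈ {x | 0 ≤ ℓ x} ∩ Metric.ball x₀ ρ₁,
      ∀ y ∈ {x | 0 ≤ ℓ x} ∩ Metric.ball x₀ ρ₁, ∀ t ∈ Ioo (-ε) ε,
      ‖p (q x t) - p (q y t) - (x - y)‖ ≤ 1 / 4 * ‖x - y‖ := by
    intro x hx y hy t ht
    have h1 := norm_le_of_norm_deriv_le (u := fun t => q x t - q y t - (j x - j y))
      (e := K * ‖j x - j y‖) hK0 (by positivity)
      (fun s hs => ((hq x s hs).sub (hq y s hs)).sub_const _) (fun s hs => by
        refine (hKv _ _).trans ?_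
        rw [← mul_add]
        gcongr
        have h2 := norm_add_le (q x s - q y s - (j x - j y)) (j x - j y)
        rwa [sub_add_cancel] at h2) ht
    simp only [hq0, sub_self, norm_zero, zero_add] at h1
    have h2 : p (q x t) - p (q y t) - (x - y) = p (q x t - q y t - (j x - j y)) := by
      simp only [map_sub, hpj x ⟨hx.1, Metric.ball_subset_ball (hρ₁r.trans hr₁r) hx.2⟩,
        hpj y ⟨hy.1, Metric.ball_subset_ball (hρ₁r.trans hr₁r) hy.2⟩]
    rw [h2]
    have h3 := (abs_lt.2 ht).le
    have h4 := hjlip x hx y hy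
    calc ‖p (q x t - q y t - (j x - j y))‖ ≤ ‖q x t - q y t - (j x - j y)‖ := hp _
      _ ≤ K * ‖j x - j y‖ * |t| * Real.exp (K * |t|) := h1
      _ ≤ K * (Kj * ‖x - y‖) * ε * 2 := by gcongr; exact hexp t ht
      _ = K * Kj * ε * 2 * ‖x - y‖ := by ring
      _ ≤ 1 / 4 * ‖x - y‖ := by gcongr
  -- The given boundary curve lies where `f` and its extension agree, so it is also a solution for
  -- the extension and coincides with `q x`.
  have hqT : ∀ x ∈ Metric.ball x₀ ρ₁, ℓ x = 0 → ∀ t ∈ Ioo (-ε) ε, q x t ∈ T := by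
    intro x hx hx0 t ht
    obtain ⟨β, hβ0, hβ⟩ := hβ x (Metric.ball_subset_ball hρ₁δ hx) hx0
    have hsub : ∀ s ∈ Ioo (-ε) ε, s ∈ Ioo (-δ) δ := fun s hs =>
      ⟨by linarith [hs.1], by linarith [hs.2]⟩
    have h1 : EqOn (q x) β (Ioo (-ε) ε) := by
      refine ODE_solution_unique_of_mem_Ioo (v := fun _ => v) (s := fun _ => univ) (K := K')
        (t₀ := 0) (fun _ _ => hv.lipschitzOnWith) ⟨by linarith, hε⟩
        (fun s hs => ⟨hq x s hs, mem_univ _⟩) (fun s hs => ⟨?_, mem_univ _⟩) (by rw [hq0, hβ0])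
      obtain ⟨h2, h3, h4⟩ := hβ s (hsub s hs)
      rw [← hvf ⟨(hT _ h3).ge, Metric.mem_closedBall.2 h4⟩]
      exact h2
    rw [h1 ht]
    exact (hβ t (hsub t ht)).2.1
  have hsub : {x | 0 ≤ ℓ x} ∩ Metric.ball x₀ (ρ₁ / 2) ⊆ {x | 0 ≤ ℓ x} ∩ Metric.ball x₀ ρ₁ :=
    inter_subset_inter_right _ (Metric.ball_subset_ball (half_le_self hρ₁.le))
  have hqΩ : ∀ x ∈ {x | 0 ≤ ℓ x} ∩ Metric.ball x₀ (ρ₁ / 2), ∀ t ∈ Ioo (-ε) ε,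
      0 ≤ ℓ (p (q x t)) := by
    intro x hx t ht
    rcases hx₀.eq_or_lt with h | h
    -- `y` is the boundary point below `x`, at distance at most `ℓ x`. Its curve stays in the
    -- boundary, so the constant `1/4` gives `ℓ (p (q x t)) ≥ 3/4 * ℓ x`. Halving the radius keeps
    -- `y` in the ball `ρ₁`.
    · set y := x - ℓ x • e with hy
      have hy0 : ℓ y = 0 := by rw [hy]; simp [he]
      have hxy : x - y = ℓ x • e := by rw [hy]; abel
      have hnorm : ‖x - y‖ ≤ ℓ x := by
        rw [hxy, norm_smul, Real.norm_eq_abs, abs_of_nonneg hx.1]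
        exact mul_le_of_le_one_right hx.1 he'
      have h1 : ℓ x ≤ ‖x - x₀‖ := by
        have h2 := hℓ (x - x₀)
        rw [map_sub, ← h, sub_zero, abs_of_nonneg hx.1] at h2
        exact h2
      have h2 : ‖x - x₀‖ < ρ₁ / 2 := by
        have := Metric.mem_ball.1 hx.2
        rwa [dist_eq_norm] at this
      have hyball : y ∈ Metric.ball x₀ ρ₁ := by
        rw [Metric.mem_ball, dist_eq_norm]
        have h3 := norm_add_le (y - x) (x - x₀)
        rw [sub_add_sub_cancel, norm_sub_rev y x] at h3
        linarith
      have h3 := hquarter x (hsub hx) y ⟨hy0.ge, hyball⟩ t ht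
      have h4 := (abs_le.1 ((hℓ _).trans h3)).1
      rw [map_sub, map_sub, hT _ (hqT y hyball hy0 t ht), map_sub, hy0] at h4
      have h5 : 0 ≤ ℓ x := hx.1
      linarith
    · have h1 := (hp _).trans (hclose x (hsub hx) t ht)
      rw [map_sub, hpw₀] at h1
      have h2 := (abs_le.1 ((hℓ _).trans h1)).1
      rw [map_sub] at h2
      linarith [ha₁Ω h]
  have hqC : ∀ x ∈ {x | 0 ≤ ℓ x} ∩ Metric.ball x₀ (ρ₁ / 2), ∀ t ∈ Ioo (-ε) ε,
      q x t ∈ {w | 0 ≤ ℓ (p w)} ∩ Metric.closedBall w₀ a := fun x hx t ht =>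
    ⟨hqΩ x hx t ht, by
      rw [Metric.mem_closedBall, dist_eq_norm]
      exact (hclose x (hsub hx) t ht).trans ha₁a⟩
  have hqf : ∀ x ∈ {x | 0 ≤ ℓ x} ∩ Metric.ball x₀ (ρ₁ / 2), ∀ t ∈ Ioo (-ε) ε,
      HasDerivAt (q x) (f (q x t)) t := fun x hx t ht => by
    rw [hvf (hqC x hx t ht)]
    exact hq x t ht
  refine ⟨ε, hε, ρ₁ / 2, half_pos hρ₁, by linarith, fun t x => q x t, fun x hx => ⟨hq0 x,
    fun t ht => ⟨hqf x hx t ht, hqΩ x hx t ht, haD (hqC x hx t ht).2,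
      fun h => hqT x (hsub hx).2 h t ht⟩⟩,
    fun x hx y hy => hquarter x (hsub hx) y (hsub hy), ?_⟩
  refine contDiffOn_of_hasDerivAt hε (hΩ.inter hD) hf
    (C := {w | 0 ≤ ℓ (p w)} ∩ Metric.closedBall w₀ a) (inter_subset_inter_right _ haD)
    ((isCompact_closedBall w₀ a).inter_left (isClosed_le continuous_const (ℓ.comp p).continuous))
    (hΩc.inter (convex_closedBall _ _)) (hS.inter Metric.isOpen_ball) ?_
    (fun x hx t ht => ⟨hqf x hx t ht, hqC x hx t ht⟩)
  refine (hj.mono ?_).congr fun x _ => hq0 x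
  exact hsub.trans (inter_subset_inter_right _ (Metric.ball_subset_ball (hρ₁r.trans hr₁r)))

end LocalFlow

/-! ### Inversion of perturbations of the identity on a half-space -/

section InverseFunction

variable {E : Type*} [NormedAddCommGroup E] [NormedSpace ℝ E] [FiniteDimensional ℝ E]

theorem exists_continuousLinearEquiv_of_norm_sub_id_le {A : E →L[ℝ] E}
    (hA : ‖A - ContinuousLinearMap.id ℝ E‖ ≤ 1 / 4) : ∃ e : E ≃L[ℝ] E, (e : E →L[ℝ] E) = A := by
  have hinj : Injective A := by
    refine (injective_iff_map_eq_zero A).2 fun v hv => ?_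
    have h1 : ‖A v - v‖ ≤ 1 / 4 * ‖v‖ :=
      ContinuousLinearMap.le_of_opNorm_le (A - ContinuousLinearMap.id ℝ E) hA v
    rw [hv, zero_sub, norm_neg] at h1
    exact norm_eq_zero.1 (le_antisymm (by linarith [norm_nonneg v]) (norm_nonneg v))
  exact ⟨(LinearEquiv.ofInjectiveEndo (A : E →ₗ[ℝ] E) hinj).toContinuousLinearEquiv,
    ContinuousLinearMap.ext fun v => rfl⟩

/-- A continuous inverse of a smooth map with invertible derivative is smooth; the domains may have
a boundary. -/
theorem contDiffOn_of_leftInverse {ψ g : E → E} {S V : Set E} (hS : UniqueDiffOn ℝ S)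
    (hV : UniqueDiffOn ℝ V) (hψ : ContDiffOn ℝ ∞ ψ S) (hg : ContinuousOn g V) (hgS : MapsTo g V S)
    (hψg : ∀ y ∈ V, ψ (g y) = y)
    (hinv : ∀ x ∈ S, ∃ e : E ≃L[ℝ] E, (e : E →L[ℝ] E) = fderivWithin ℝ ψ S x) :
    ContDiffOn ℝ ∞ g V := by
  have : CompleteSpace E := FiniteDimensional.complete ℝ E
  have hder : ∀ y ∈ V, HasFDerivWithinAt g
      (ContinuousLinearMap.inverse (fderivWithin ℝ ψ S (g y))) V y := by
    intro y hy
    obtain ⟨e, he⟩ := hinv (g y) (hgS hy)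
    rw [← he, ContinuousLinearMap.inverse_equiv]
    refine HasFDerivWithinAt.of_local_left_inverse (f := ψ) (t := S) ?_ ?_ hy ?_
    · exact tendsto_nhdsWithin_iff.2 ⟨hg y hy, by
        filter_upwards [self_mem_nhdsWithin] with z hz using hgS hz⟩
    · rw [he]
      exact (hψ.differentiableOn (by simp) _ (hgS hy)).hasFDerivWithinAt
    · filter_upwards [self_mem_nhdsWithin] with z hz using hψg z hz
  -- The derivative of `g` is the inverse of the derivative of `ψ` at `g y`, hence as regular as `g`
  -- itself, which gains one order at each step.
  refine contDiffOn_infty.2 fun k => ?_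
  induction k with
  | zero => exact contDiffOn_zero.2 hg
  | succ k ih =>
    push_cast
    rw [contDiffOn_succ_iff_hasFDerivWithinAt_of_uniqueDiffOn hV]
    refine ⟨by simp, _, ?_, hder⟩
    have h1 : ContDiffOn ℝ k (fun y => fderivWithin ℝ ψ S (g y)) V :=
      ((hψ.fderivWithin hS (m := ∞) (by simp)).of_le (by exact_mod_cast le_top)).comp ih hgS
    intro y hy
    obtain ⟨e, he⟩ := hinv (g y) (hgS hy)
    have h2 : ContDiffAt ℝ k ContinuousLinearMap.inverse (fderivWithin ℝ ψ S (g y)) :=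
      he ▸ contDiffAt_map_inverse e
    exact ContDiffAt.comp_contDiffWithinAt (g := ContinuousLinearMap.inverse)
      (f := fun y => fderivWithin ℝ ψ S (g y)) y h2 (h1 y hy)

variable {ℓ : E →L[ℝ] ℝ} {e : E} {x₀ : E} {ρ : ℝ} {ψ : E → E}

omit [FiniteDimensional ℝ E] in
-- At inner points the Lipschitz bound for `ψ - id` bounds its derivative. Boundary points are
-- limits of the inner points `x + s e`, and the derivative is continuous.
theorem norm_fderivWithin_sub_id_le (he : ℓ e = 1) (hS : UniqueDiffOn ℝ {x : E | 0 ≤ ℓ x})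
    (hψ : ContDiffOn ℝ ∞ ψ ({x | 0 ≤ ℓ x} ∩ Metric.ball x₀ ρ))
    (hquarter : ∀ x ∈ {x | 0 ≤ ℓ x} ∩ Metric.ball x₀ ρ, ∀ y ∈ {x | 0 ≤ ℓ x} ∩ Metric.ball x₀ ρ,
      ‖ψ x - ψ y - (x - y)‖ ≤ 1 / 4 * ‖x - y‖) :
    ∀ x ∈ {x | 0 ≤ ℓ x} ∩ Metric.ball x₀ ρ,
      ‖fderivWithin ℝ ψ ({x | 0 ≤ ℓ x} ∩ Metric.ball x₀ ρ) x - .id ℝ E‖ ≤ 1 / 4 := by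
  set S := {x | 0 ≤ ℓ x} ∩ Metric.ball x₀ ρ with hSdef
  have hinner : ∀ x ∈ S, 0 < ℓ x → ‖fderivWithin ℝ ψ S x - .id ℝ E‖ ≤ 1 / 4 := by
    intro x hx hpos
    have hmem : S ∈ 𝓝 x := by
      refine Filter.inter_mem ?_ (Metric.isOpen_ball.mem_nhds hx.2)
      filter_upwards [(isOpen_lt continuous_const ℓ.continuous).mem_nhds hpos] with y hy
      exact le_of_lt hy
    have h1 : HasFDerivAt (fun x => ψ x - x) (fderivWithin ℝ ψ S x - .id ℝ E) x :=
      (((hψ.differentiableOn (by simp)) x hx).hasFDerivWithinAt.hasFDerivAt hmem).sub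
        (hasFDerivAt_id x)
    refine h1.le_of_lip' (by norm_num) ?_
    filter_upwards [hmem] with y hy
    have h2 := hquarter y hy x hx
    rwa [sub_sub_sub_comm] at h2
  intro x hx
  have hcont : ContinuousWithinAt (fun x => ‖fderivWithin ℝ ψ S x - .id ℝ E‖) S x :=
    (((hψ.fderivWithin (hS.inter Metric.isOpen_ball) (m := ∞) (by simp)).continuousOn x hx).sub
      continuousWithinAt_const).norm
  have hlin : Filter.Tendsto (fun s : ℝ => x + s • e) (𝓝[>] 0) (𝓝 x) := by
    have : Continuous fun s : ℝ => x + s • e := by fun_prop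
    have h2 := (this.tendsto 0).mono_left (nhdsWithin_le_nhds (s := Ioi 0))
    simpa using h2
  have hev : ∀ᶠ s in 𝓝[>] (0 : ℝ), x + s • e ∈ S ∧ 0 < ℓ (x + s • e) := by
    filter_upwards [hlin (Metric.isOpen_ball.mem_nhds hx.2), self_mem_nhdsWithin] with s hs hs0
    have h3 : 0 < ℓ (x + s • e) := by
      rw [map_add, map_smul, he, smul_eq_mul, mul_one]
      have h4 : 0 ≤ ℓ x := hx.1
      have h5 : 0 < s := hs0
      linarith
    exact ⟨⟨h3.le, hs⟩, h3⟩
  have h1 : Filter.Tendsto (fun s : ℝ => x + s • e) (𝓝[>] 0) (𝓝[S] x) :=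
    tendsto_nhdsWithin_iff.2 ⟨hlin, hev.mono fun s hs => hs.1⟩
  exact le_of_tendsto (hcont.tendsto.comp h1) (hev.mono fun s hs => hinner _ hs.1 hs.2)

/-- A map of a half-ball that is close to the identity, and maps boundary points to boundary points,
is a diffeomorphism onto a relatively open subset of the half-space. -/
theorem exists_inverse_of_halfSpace (hℓ : ∀ v, |ℓ v| ≤ ‖v‖) (he : ℓ e = 1) (he' : ‖e‖ ≤ 1)
    (hS : UniqueDiffOn ℝ {x : E | 0 ≤ ℓ x}) (hx₀ : 0 ≤ ℓ x₀)
    (hψ : ContDiffOn ℝ ∞ ψ ({x | 0 ≤ ℓ x} ∩ Metric.ball x₀ ρ))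
    (hquarter : ∀ x ∈ {x | 0 ≤ ℓ x} ∩ Metric.ball x₀ ρ, ∀ y ∈ {x | 0 ≤ ℓ x} ∩ Metric.ball x₀ ρ,
      ‖ψ x - ψ y - (x - y)‖ ≤ 1 / 4 * ‖x - y‖)
    (hmaps : ∀ x ∈ {x | 0 ≤ ℓ x} ∩ Metric.ball x₀ ρ, 0 ≤ ℓ (ψ x))
    (hbd : ∀ x ∈ {x | 0 ≤ ℓ x} ∩ Metric.ball x₀ ρ, ℓ x = 0 → ℓ (ψ x) = 0) (hρ : 0 < ρ) :
    ∃ O : Set E, IsOpen O ∧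
      ψ '' ({x | 0 ≤ ℓ x} ∩ Metric.ball x₀ (ρ / 2)) = {x | 0 ≤ ℓ x} ∩ O ∧
      ∃ g : E → E, ContDiffOn ℝ ∞ g (ψ '' ({x | 0 ≤ ℓ x} ∩ Metric.ball x₀ (ρ / 2))) ∧
        ∀ x ∈ {x | 0 ≤ ℓ x} ∩ Metric.ball x₀ (ρ / 2), g (ψ x) = x := by
  set S := {x | 0 ≤ ℓ x} ∩ Metric.ball x₀ ρ with hSdef
  set S' := {x | 0 ≤ ℓ x} ∩ Metric.ball x₀ (ρ / 2) with hS'def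
  have hsub : S' ⊆ S := inter_subset_inter_right _ (Metric.ball_subset_ball (half_le_self hρ.le))
  -- `R` projects the outside of the half-space onto its boundary along `e`; it is Lipschitz with
  -- constant `2`.
  let R : E → E := fun x => x + max (-ℓ x) 0 • e
  have hRlip : ∀ x y, ‖R x - R y‖ ≤ 2 * ‖x - y‖ := by
    intro x y
    have h1 : R x - R y = (x - y) + (max (-ℓ x) 0 - max (-ℓ y) 0) • e := by
      simp only [R, sub_smul]; abel
    have h2 : |max (-ℓ x) 0 - max (-ℓ y) 0| ≤ ‖x - y‖ := by
      refine (abs_max_sub_max_le_abs _ _ _).trans ?_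
      have h3 := hℓ (x - y)
      rw [map_sub, abs_sub_comm] at h3
      rwa [neg_sub_neg]
    rw [h1, two_mul]
    refine (norm_add_le _ _).trans (add_le_add_right ?_ _)
    rw [norm_smul, Real.norm_eq_abs]
    exact (mul_le_of_le_one_right (abs_nonneg _) he').trans h2
  have hRpos : ∀ x, 0 ≤ ℓ x → R x = x := fun x hx => by
    simp only [R, max_eq_right (neg_nonpos.2 hx), zero_smul, add_zero]
  have hRneg : ∀ x, ℓ x < 0 → ℓ (R x) = 0 := fun x hx => by
    simp only [R, max_eq_left (neg_nonneg.2 hx.le), map_add, map_smul, he, smul_eq_mul]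
    ring
  have hRΩ : ∀ x, 0 ≤ ℓ (R x) := fun x => by
    rcases lt_or_ge (ℓ x) 0 with h | h
    · exact (hRneg x h).ge
    · rwa [hRpos x h]
  have hRS : ∀ x ∈ Metric.ball x₀ (ρ / 2), R x ∈ S := fun x hx => by
    refine ⟨hRΩ x, ?_⟩
    have h1 := hRlip x x₀
    rw [hRpos x₀ hx₀] at h1
    rw [Metric.mem_ball, dist_eq_norm] at hx ⊢
    linarith
  -- This extends `ψ` across the boundary by extending `ψ - id` through `R`. The Lipschitz constant
  -- `1/4` becomes `1/2`, still less than one, so `ψ'` maps the ball onto an open set.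
  let ψ' : E → E := fun x => x + (ψ (R x) - R x)
  have hψ'pos : ∀ x, 0 ≤ ℓ x → ψ' x = ψ x := fun x hx => by
    simp only [ψ', hRpos x hx]; abel
  have happ : ApproximatesLinearOn ψ' (ContinuousLinearMap.id ℝ E) (Metric.ball x₀ (ρ / 2))
      (1 / 2) := by
    intro x hx y hy
    have h1 : ψ' x - ψ' y - ContinuousLinearMap.id ℝ E (x - y) =
        ψ (R x) - ψ (R y) - (R x - R y) := by
      simp only [ψ', ContinuousLinearMap.id_apply]; abel
    rw [h1]
    have h2 := hquarter _ (hRS x hx) _ (hRS y hy)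
    have h3 := hRlip x y
    push_cast
    linarith
  have hopen : IsOpen (ψ' '' Metric.ball x₀ (ρ / 2)) :=
    happ.open_image ⟨id, 1, fun y => by simp, fun y => rfl⟩ Metric.isOpen_ball
      (Or.inr (by simp; norm_num))
  have himage : ψ '' S' = {x | 0 ≤ ℓ x} ∩ ψ' '' Metric.ball x₀ (ρ / 2) := by
    ext y
    constructor
    · rintro ⟨x, hx, rfl⟩
      exact ⟨hmaps x (hsub hx), x, hx.2, hψ'pos x hx.1⟩
    · rintro ⟨hy, x, hx, rfl⟩
      -- For `ℓ x < 0` both `R x` and `ψ (R x)` are boundary points, so `ψ'` does not change `ℓ` and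
      -- the image stays outside. Thus no outer point is mapped into the half-space.
      have h1 : 0 ≤ ℓ x := by
        by_contra! h
        have h2 : ℓ (ψ' x) = ℓ x := by
          simp only [ψ', map_add, map_sub, hbd _ (hRS x hx) (hRneg x h), hRneg x h, sub_self,
            add_zero]
        have h3 : 0 ≤ ℓ (ψ' x) := hy
        linarith
      exact ⟨x, ⟨h1, hx⟩, (hψ'pos x h1).symm⟩
  have hdist : ∀ x ∈ S, ∀ y ∈ S, ‖x - y‖ ≤ 2 * ‖ψ x - ψ y‖ := by
    intro x hx y hy
    have h1 := hquarter x hx y hy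
    have h2 := norm_sub_le (ψ x - ψ y) (ψ x - ψ y - (x - y))
    rw [sub_sub_cancel] at h2
    have h3 := norm_nonneg (x - y)
    linarith
  have hinj : InjOn ψ S' := fun x hx y hy hxy => by
    have h1 := hdist x (hsub hx) y (hsub hy)
    rw [hxy, sub_self, norm_zero, mul_zero] at h1
    exact sub_eq_zero.1 (norm_le_zero_iff.1 h1)
  refine ⟨_, hopen, himage, invFunOn ψ S', ?_, fun x hx => hinj.leftInvOn_invFunOn hx⟩
  have hgS : MapsTo (invFunOn ψ S') (ψ '' S') S := fun y hy => hsub (invFunOn_mem hy)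
  have hψg : ∀ y ∈ ψ '' S', ψ (invFunOn ψ S' y) = y := fun y hy => invFunOn_eq hy
  refine contDiffOn_of_leftInverse (hS.inter Metric.isOpen_ball)
    (himage ▸ hS.inter hopen) hψ ?_ hgS hψg fun x hx =>
      exists_continuousLinearEquiv_of_norm_sub_id_le
        (norm_fderivWithin_sub_id_le he hS hψ hquarter x hx)
  refine (LipschitzOnWith.of_dist_le_mul (K := 2) fun y hy z hz => ?_).continuousOn
  have h1 := hdist _ (hgS hy) _ (hgS hz)
  rw [hψg y hy, hψg z hz] at h1
  simpa [dist_eq_norm] using h1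

end InverseFunction

/-! ### Integral curves and interior points in arbitrary charts -/

section IntegralCurves

variable {E : Type*} [NormedAddCommGroup E] [NormedSpace ℝ E] {H : Type*} [TopologicalSpace H]
  {I : ModelWithCorners ℝ E H} {M : Type*} [TopologicalSpace M] [ChartedSpace H M]

theorem isMIntegralCurveOn_extChartAt_symm [IsManifold I 1 M]
    {ξ : (x : M) → TangentSpace I x} {x₀ : M} {α : ℝ → E} {a b : ℝ}
    (hα : ∀ t ∈ Ioo a b, HasDerivAt α (fieldRep ξ x₀ (α t)) t ∧ α t ∈ (extChartAt I x₀).target) :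
    IsMIntegralCurveOn (I := I) (fun t => (extChartAt I x₀).symm (α t)) ξ (Ioo a b) := by
  intro t ht
  have h1 := ((hα t ht).1.hasFDerivAt.hasFDerivWithinAt (s := Ioo a b)).hasMFDerivWithinAt
  have h2 := (mdifferentiableWithinAt_extChartAt_symm (I := I) (hα t ht).2).hasMFDerivWithinAt
  have h3 := h2.comp t h1 fun s hs => extChartAt_target_subset_range x₀ (hα s hs).2
  refine h3.congr_mfderiv (ContinuousLinearMap.ext_ring ?_)
  change tmapSymm I x₀ (α t) ((1 : ℝ) • fieldRep ξ x₀ (α t)) =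
    (1 : ℝ) • ξ ((extChartAt I x₀).symm (α t))
  rw [one_smul, one_smul]
  exact tmapSymm_fieldRep ξ (hα t ht).2

/-- A chart and its inverse both have surjective tangent maps, and such maps preserve interior
points. This allows base charts that are not the preferred ones. -/
theorem isInteriorPoint_iff_of_mem_maximalAtlas [IsManifold I ∞ M] {c : OpenPartialHomeomorph M H}
    (hc : c ∈ IsManifold.maximalAtlas I ∞ M) {x : M} (hx : x ∈ c.source) :
    I.IsInteriorPoint x ↔ I (c x) ∈ interior (range I) := by
  have hd : c.MDifferentiable I I :=
    ⟨(contMDiffOn_of_mem_maximalAtlas hc).mdifferentiableOn (by simp),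
      (contMDiffOn_symm_of_mem_maximalAtlas hc).mdifferentiableOn (by simp)⟩
  constructor
  · intro h
    have h1 : I.IsInteriorPoint (c x) := by
      refine (hd.mdifferentiableAt hx).isInteriorPoint_of_surjective_mfderiv (fun v => ?_) h
      have h2 := DFunLike.congr_fun (tmap_comp_symm I I hd (c.map_source hx)) v
      rw [c.left_inv hx] at h2
      exact ⟨_, h2⟩
    exact h1
  · intro h
    have h1 : I.IsInteriorPoint (c x) := h
    have h2 := (hd.mdifferentiableAt_symm (c.map_source hx)).isInteriorPoint_of_surjective_mfderiv
      (fun v => ?_) h1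
    · rwa [c.left_inv hx] at h2
    · have h2 := DFunLike.congr_fun (tmap_symm_comp I I hd hx) v
      exact ⟨_, h2⟩

end IntegralCurves

/-! ### Local flows on the boundary condition -/

section Boundaryless

variable {E : Type*} [NormedAddCommGroup E] [NormedSpace ℝ E] [CompleteSpace E]
  {B : Type*} [TopologicalSpace B] [ChartedSpace E B] [IsManifold 𝓘(ℝ, E) ∞ B]
  [IsManifold 𝓘(ℝ, E) 1 B]

/-- Near a point of a manifold without boundary, the integral curves exist for a uniform time, and
stay close to the point. -/
theorem exists_integralCurve_mem_nhds {ξ : (b : B) → TangentSpace 𝓘(ℝ, E) b}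
    (hξ : IsSmoothField 𝓘(ℝ, E) ξ) {b₀ : B} {N : Set B} (hN : N ∈ 𝓝 b₀) :
    ∃ δ > 0, ∀ᶠ b in 𝓝 b₀, ∃ β : ℝ → B, β 0 = b ∧
      IsMIntegralCurveOn (I := 𝓘(ℝ, E)) β ξ (Ioo (-δ) δ) ∧ ∀ t ∈ Ioo (-δ) δ, β t ∈ N := by
  set χ := extChartAt 𝓘(ℝ, E) b₀ with hχ
  set y₀ := χ b₀ with hy₀
  have hy₀t : y₀ ∈ χ.target := mem_extChartAt_target b₀
  have hf : ContDiffAt ℝ 1 (fieldRep ξ b₀) y₀ := by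
    have h1 := contDiffWithinAt_fieldRep hξ hy₀t
    rw [ModelWithCorners.range_eq_univ, contDiffWithinAt_univ] at h1
    exact h1.of_le (by simp)
  obtain ⟨ε, hε, a, r, L, K, hr, hpl⟩ := IsPicardLindelof.of_contDiffAt_one hf
  obtain ⟨α, hα, hαc⟩ := (hpl 0).exists_forall_mem_closedBall_eq_hasDerivWithinAt_continuousOn
  simp only [zero_sub, zero_add] at hα hαc
  have hO : χ.target ∩ χ.symm ⁻¹' N ∈ 𝓝 y₀ := by
    refine Filter.inter_mem (extChartAt_target_mem_nhds b₀) ?_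
    refine (continuousAt_extChartAt_symm (I := 𝓘(ℝ, E)) b₀).preimage_mem_nhds ?_
    rw [extChartAt_to_inv]
    exact hN
  have hy₀r : y₀ ∈ Metric.closedBall y₀ (r : ℝ) := Metric.mem_closedBall_self r.coe_nonneg
  have h0 : α (y₀, 0) = y₀ := (hα y₀ hy₀r).1
  -- Joint continuity of the local flow at `(y₀, 0)` gives one time `δ` for all nearby initial
  -- points.
  have h1 : α ⁻¹' (χ.target ∩ χ.symm ⁻¹' N) ∈ 𝓝 (y₀, (0 : ℝ)) := by
    refine (hαc.continuousAt ?_).preimage_mem_nhds (by rwa [h0])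
    exact prod_mem_nhds (Metric.closedBall_mem_nhds _ (by exact_mod_cast hr))
      (Icc_mem_nhds (by linarith) hε)
  obtain ⟨u, hu, v, hv, huv⟩ := mem_nhds_prod_iff.1 h1
  obtain ⟨δ₁, hδ₁, hδv⟩ := Metric.mem_nhds_iff.1 hv
  rw [Real.ball_eq_Ioo, zero_sub, zero_add] at hδv
  refine ⟨min δ₁ ε, lt_min hδ₁ hε, ?_⟩
  have h2 : Filter.Tendsto χ (𝓝 b₀) (𝓝 y₀) := continuousAt_extChartAt b₀
  filter_upwards [extChartAt_source_mem_nhds (I := 𝓘(ℝ, E)) b₀, h2 hu,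
    h2 (Metric.closedBall_mem_nhds y₀ (by exact_mod_cast hr : (0 : ℝ) < r))] with b hb hbu hbr
  have h3 : ∀ t ∈ Ioo (-min δ₁ ε) (min δ₁ ε), t ∈ Ioo (-δ₁) δ₁ ∧ t ∈ Ioo (-ε) ε := fun t ht =>
    ⟨⟨by linarith [ht.1, min_le_left δ₁ ε], by linarith [ht.2, min_le_left δ₁ ε]⟩,
      ⟨by linarith [ht.1, min_le_right δ₁ ε], by linarith [ht.2, min_le_right δ₁ ε]⟩⟩
  have h4 : ∀ t ∈ Ioo (-min δ₁ ε) (min δ₁ ε), α (χ b, t) ∈ χ.target ∩ χ.symm ⁻¹' N :=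
    fun t ht => huv ⟨hbu, hδv (h3 t ht).1⟩
  refine ⟨fun t => χ.symm (α (χ b, t)), ?_, isMIntegralCurveOn_extChartAt_symm fun t ht =>
    ⟨?_, (h4 t ht).1⟩, fun t ht => (h4 t ht).2⟩
  · change χ.symm (α (χ b, 0)) = b
    rw [(hα _ hbr).1]
    exact χ.left_inv hb
  · exact ((hα _ hbr).2 t (Ioo_subset_Icc_self (h3 t ht).2)).hasDerivAt
      (Icc_mem_nhds (h3 t ht).2.1 (h3 t ht).2.2)

end Boundaryless

/-! ### Base coordinates adapted to a jet chart -/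

section Coordinates

variable {E : Type*} [NormedAddCommGroup E] [NormedSpace ℝ E] {H : Type*} [TopologicalSpace H]
  {I : ModelWithCorners ℝ E H} {F : Type*} [NormedAddCommGroup F] [NormedSpace ℝ F]
  {X : Type*} [TopologicalSpace X] [ChartedSpace H X]
  {Y : Type*} [TopologicalSpace Y] [ChartedSpace (ModelProd H F) Y]

namespace FiberedManifold

theorem range_jetModel : range (jetModel I F) = {w | w.1.1 ∈ range I} := by
  ext w
  constructor
  · rintro ⟨q, rfl⟩
    exact ⟨q.1.1, rfl⟩
  · rintro ⟨p, hp⟩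
    exact ⟨((p, w.1.2), w.2), Prod.ext (Prod.ext hp rfl) rfl⟩

variable (π : FiberedManifold I F X Y) {φ : X → Y} {U : Set X}

/-- The coordinates `x^μ` around the jet `z₀`. -/
def baseCoord (z₀ : π.Jet) : PartialEquiv X E := (π.baseChart z₀.pt).extend I

theorem projX_mem_baseCoord_source {z₀ z : π.Jet} (hz : z ∈ (extChartAt (jetModel I F) z₀).source) :
    π.projX z ∈ (π.baseCoord z₀).source := by
  rw [baseCoord, OpenPartialHomeomorph.extend_source]
  exact (π.isAdaptedPair z₀.pt).mapsTo _ (π.mem_extChartAt_jet_source.1 hz)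

theorem baseCoord_projX {z₀ z : π.Jet} (hz : z ∈ (extChartAt (jetModel I F) z₀).source) :
    π.baseCoord z₀ (π.projX z) = (extChartAt (jetModel I F) z₀ z).1.1 :=
  (π.extChartAt_jet_fst_fst (π.mem_extChartAt_jet_source.1 hz)).symm

theorem projX_extChartAt_symm {z₀ : π.Jet} {w : (E × F) × (E →L[ℝ] F)}
    (hw : w ∈ (extChartAt (jetModel I F) z₀).target) :
    π.projX ((extChartAt (jetModel I F) z₀).symm w) = (π.baseCoord z₀).symm w.1.1 := by
  have h1 := (extChartAt (jetModel I F) z₀).map_target hw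
  have h2 := π.baseCoord_projX h1
  rw [(extChartAt (jetModel I F) z₀).right_inv hw] at h2
  rw [← h2, (π.baseCoord z₀).left_inv (π.projX_mem_baseCoord_source h1)]

theorem fst_fst_mem_baseCoord_target {z₀ : π.Jet} {w : (E × F) × (E →L[ℝ] F)}
    (hw : w ∈ (extChartAt (jetModel I F) z₀).target) : w.1.1 ∈ (π.baseCoord z₀).target := by
  have h1 := (extChartAt (jetModel I F) z₀).map_target hw
  have h2 := π.baseCoord_projX h1
  rw [(extChartAt (jetModel I F) z₀).right_inv hw] at h2
  rw [← h2]
  exact (π.baseCoord z₀).map_source (π.projX_mem_baseCoord_source h1)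

theorem isOpen_baseCoord_source (z₀ : π.Jet) : IsOpen (π.baseCoord z₀).source :=
  (π.baseChart z₀.pt).isOpen_extend_source

theorem contMDiffOn_baseCoord (z₀ : π.Jet) :
    ContMDiffOn I 𝓘(ℝ, E) ∞ (π.baseCoord z₀) (π.baseCoord z₀).source := by
  rw [baseCoord, OpenPartialHomeomorph.extend_source]
  exact (π.baseChart z₀.pt).contMDiffOn_extend (π.isAdaptedPair z₀.pt).base_mem

theorem contMDiffOn_baseCoord_symm (z₀ : π.Jet) :
    ContMDiffOn 𝓘(ℝ, E) I ∞ (π.baseCoord z₀).symm (π.baseCoord z₀).target := by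
  rw [baseCoord, OpenPartialHomeomorph.extend_target']
  exact contMDiffOn_extend_symm (π.isAdaptedPair z₀.pt).base_mem

theorem isInteriorPoint_iff_baseCoord [IsManifold I ∞ X] {z₀ : π.Jet} {x : X}
    (hx : x ∈ (π.baseCoord z₀).source) :
    I.IsInteriorPoint x ↔ π.baseCoord z₀ x ∈ interior (range I) :=
  isInteriorPoint_iff_of_mem_maximalAtlas (π.isAdaptedPair z₀.pt).base_mem
    (by rwa [baseCoord, OpenPartialHomeomorph.extend_source] at hx)

theorem baseCoord_target_mem_nhdsWithin {z₀ : π.Jet} {x : X} (hx : x ∈ (π.baseCoord z₀).source) :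
    (π.baseCoord z₀).target ∈ 𝓝[range I] (π.baseCoord z₀ x) :=
  (π.baseChart z₀.pt).extend_target_mem_nhdsWithin
    (by rwa [baseCoord, OpenPartialHomeomorph.extend_source] at hx)

theorem continuousAt_baseCoord_symm {z₀ : π.Jet} {x : X} (hx : x ∈ (π.baseCoord z₀).source) :
    ContinuousAt (π.baseCoord z₀).symm (π.baseCoord z₀ x) :=
  (π.baseChart z₀.pt).continuousAt_extend_symm
    (by rwa [baseCoord, OpenPartialHomeomorph.extend_source] at hx)

variable {π} {x₀ : X}

theorem mem_baseCoord_source_j1 (hφ : π.IsSectionOn φ U) (hU : IsOpen U) (hx₀ : x₀ ∈ U) :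
    x₀ ∈ (π.baseCoord (π.j1 φ x₀)).source := by
  have h := π.projX_mem_baseCoord_source (mem_extChartAt_source (I := jetModel I F) (π.j1 φ x₀))
  rwa [hφ.projX_j1 hU hx₀] at h

theorem exists_ball_baseCoord (hφ : π.IsSectionOn φ U) (hU : IsOpen U) (hx₀ : x₀ ∈ U) {N : Set X}
    (hN : N ∈ 𝓝 x₀) : ∃ r > 0, ∀ u ∈ range I ∩ Metric.ball (π.baseCoord (π.j1 φ x₀) x₀) r,
      u ∈ (π.baseCoord (π.j1 φ x₀)).target ∧ (π.baseCoord (π.j1 φ x₀)).symm u ∈ N := by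
  have hs := mem_baseCoord_source_j1 hφ hU hx₀
  have h1 : ∀ᶠ u in 𝓝[range I] (π.baseCoord (π.j1 φ x₀) x₀),
      (π.baseCoord (π.j1 φ x₀)).symm u ∈ N := by
    refine nhdsWithin_le_nhds ((π.continuousAt_baseCoord_symm hs).preimage_mem_nhds ?_)
    rwa [(π.baseCoord (π.j1 φ x₀)).left_inv hs]
  obtain ⟨r, hr, h⟩ := Metric.mem_nhdsWithin_iff.1
    (Filter.inter_mem (π.baseCoord_target_mem_nhdsWithin hs) h1)
  exact ⟨r, hr, fun u hu => h ⟨hu.2, hu.1⟩⟩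

/-- The prolongation of a section in coordinates. -/
def j1Coord (π : FiberedManifold I F X Y) (φ : X → Y) (x₀ : X) (u : E) : (E × F) × (E →L[ℝ] F) :=
  extChartAt (jetModel I F) (π.j1 φ x₀) (π.j1 φ ((π.baseCoord (π.j1 φ x₀)).symm u))

theorem contDiffOn_j1Coord (hφ : π.IsSectionOn φ U) (hU : IsOpen U) {S : Set E}
    (hS : ∀ u ∈ S, u ∈ (π.baseCoord (π.j1 φ x₀)).target ∧
      (π.baseCoord (π.j1 φ x₀)).symm u ∈
        U ∩ π.j1 φ ⁻¹' (extChartAt (jetModel I F) (π.j1 φ x₀)).source) :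
    ContDiffOn ℝ ∞ (π.j1Coord φ x₀) S := by
  rw [← contMDiffOn_iff_contDiffOn]
  have h1 := (π.contMDiffOn_baseCoord_symm (π.j1 φ x₀)).mono fun u hu => (hS u hu).1
  have h2 := (contMDiffOn_j1 hφ hU).comp h1 fun u hu => (hS u hu).2.1
  refine (contMDiffOn_extChartAt (I := jetModel I F) (x := π.j1 φ x₀)).comp h2 fun u hu => ?_
  rw [← extChartAt_source (I := jetModel I F)]
  exact (hS u hu).2.2

theorem fst_fst_j1Coord (hφ : π.IsSectionOn φ U) (hU : IsOpen U) {u : E}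
    (hu : u ∈ (π.baseCoord (π.j1 φ x₀)).target) (huU : (π.baseCoord (π.j1 φ x₀)).symm u ∈ U)
    (hus : π.j1 φ ((π.baseCoord (π.j1 φ x₀)).symm u) ∈
      (extChartAt (jetModel I F) (π.j1 φ x₀)).source) : (π.j1Coord φ x₀ u).1.1 = u := by
  rw [j1Coord, ← π.baseCoord_projX hus, hφ.projX_j1 hU huU,
    (π.baseCoord (π.j1 φ x₀)).right_inv hu]

end FiberedManifold

end Coordinates

/-! ### Curves in the boundary condition over boundary points -/

section BoundaryCurves

variable {E : Type*} [NormedAddCommGroup E] [NormedSpace ℝ E] {H : Type*} [TopologicalSpace H]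
  {I : ModelWithCorners ℝ E H} {F : Type*} [NormedAddCommGroup F] [NormedSpace ℝ F]
  {X : Type*} [TopologicalSpace X] [ChartedSpace H X] [IsManifold I ∞ X]
  {Y : Type*} [TopologicalSpace Y] [ChartedSpace (ModelProd H F) Y]
  {E' : Type*} [NormedAddCommGroup E'] [NormedSpace ℝ E'] [CompleteSpace E']
  {B : Type*} [TopologicalSpace B] [ChartedSpace E' B] [IsManifold 𝓘(ℝ, E') ∞ B]
  [IsManifold 𝓘(ℝ, E') 1 B]

namespace FiberedManifold

variable {π : FiberedManifold I F X Y} {φ : X → Y} {U : Set X} {x₀ : X}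
  {ξ : (z : π.Jet) → TangentSpace (jetModel I F) z} {ξB : (b : B) → TangentSpace 𝓘(ℝ, E') b}
  {iB : B → π.Jet}

/-- In coordinates, the integral curves of a vector field tangent to `B` through the boundary values
of a section that satisfies the boundary condition. -/
theorem exists_boundary_curve (hU : IsOpen U) (hφ : π.IsSectionOn φ U)
    (hi : MDifferentiable 𝓘(ℝ, E') (jetModel I F) iB) (hind : Topology.IsInducing iB)
    (hξB : IsSmoothField 𝓘(ℝ, E') ξB)
    (htan : ∀ b, mfderiv 𝓘(ℝ, E') (jetModel I F) iB b (ξB b) = ξ (iB b))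
    (hBC : ∀ x ∈ U, x ∈ I.boundary X → π.j1 φ x ∈ range iB) (hx₀ : x₀ ∈ U) {a : ℝ} (ha : 0 < a) :
    ∃ δ > 0, ∀ u ∈ Metric.ball (π.baseCoord (π.j1 φ x₀) x₀) δ, u ∈ range I →
      u ∉ interior (range I) → ∃ β : ℝ → (E × F) × (E →L[ℝ] F), β 0 = π.j1Coord φ x₀ u ∧
        ∀ t ∈ Ioo (-δ) δ, HasDerivAt β (fieldRep ξ (π.j1 φ x₀) (β t)) t ∧
          (β t ∈ (extChartAt (jetModel I F) (π.j1 φ x₀)).target ∧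
            (extChartAt (jetModel I F) (π.j1 φ x₀)).symm (β t) ∈ range iB) ∧
          dist (β t) (π.j1Coord φ x₀ (π.baseCoord (π.j1 φ x₀) x₀)) ≤ a := by
  have hs := mem_baseCoord_source_j1 hφ hU hx₀
  -- Around an interior point there is nothing to do: a small ball contains no boundary points.
  by_cases hinner : π.baseCoord (π.j1 φ x₀) x₀ ∈ interior (range I)
  · obtain ⟨δ, hδ, h⟩ := Metric.isOpen_iff.1 isOpen_interior _ hinner
    exact ⟨δ, hδ, fun u hu _ hu' => absurd (h hu) hu'⟩
  have hx₀b : x₀ ∈ I.boundary X := by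
    change I.IsBoundaryPoint x₀
    rwa [I.isBoundaryPoint_iff_not_isInteriorPoint, π.isInteriorPoint_iff_baseCoord hs]
  obtain ⟨b₀, hb₀⟩ := hBC x₀ hx₀ hx₀b
  set κ := extChartAt (jetModel I F) (π.j1 φ x₀) with hκ
  have hcenter : π.j1Coord φ x₀ (π.baseCoord (π.j1 φ x₀) x₀) = κ (π.j1 φ x₀) := by
    rw [j1Coord, (π.baseCoord (π.j1 φ x₀)).left_inv hs]
  rw [hcenter]
  have hN : {b | iB b ∈ κ.source ∧ dist (κ (iB b)) (κ (π.j1 φ x₀)) ≤ a} ∈ 𝓝 b₀ := by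
    have hc : Filter.Tendsto iB (𝓝 b₀) (𝓝 (π.j1 φ x₀)) := hb₀ ▸ hind.continuous.continuousAt
    have h1 : Filter.Tendsto (fun b => κ (iB b)) (𝓝 b₀) (𝓝 (κ (π.j1 φ x₀))) :=
      (continuousAt_extChartAt (I := jetModel I F) (π.j1 φ x₀)).tendsto.comp hc
    exact Filter.inter_mem (hc (extChartAt_source_mem_nhds (π.j1 φ x₀)))
      (h1 (Metric.closedBall_mem_nhds _ ha))
  obtain ⟨δ₁, hδ₁, hev⟩ := exists_integralCurve_mem_nhds hξB hN
  -- `B` carries the induced topology, so closeness in the jet bundle suffices: the uniform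
  -- existence time at `b₀` serves every `b` with `iB b = j¹φ x`, for `x` near `x₀`.
  rw [hind.nhds_eq_comap, hb₀, Filter.eventually_comap] at hev
  have hN' : {x | x ∈ U ∧ π.j1 φ x ∈ κ.source ∧ ∀ b, iB b = π.j1 φ x → ∃ β : ℝ → B, β 0 = b ∧
      IsMIntegralCurveOn (I := 𝓘(ℝ, E')) β ξB (Ioo (-δ₁) δ₁) ∧ ∀ t ∈ Ioo (-δ₁) δ₁,
        β t ∈ {b | iB b ∈ κ.source ∧ dist (κ (iB b)) (κ (π.j1 φ x₀)) ≤ a}} ∈ 𝓝 x₀ := by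
    have hc : Filter.Tendsto (π.j1 φ) (𝓝 x₀) (𝓝 (π.j1 φ x₀)) :=
      ((contMDiffOn_j1 hφ hU).continuousOn.continuousAt (hU.mem_nhds hx₀))
    filter_upwards [hU.mem_nhds hx₀, hc (extChartAt_source_mem_nhds (I := jetModel I F) (π.j1 φ x₀)),
      hc.eventually hev] with x h1 h2 h3
    exact ⟨h1, h2, h3⟩
  obtain ⟨r, hr, hball⟩ := exists_ball_baseCoord hφ hU hx₀ hN'
  refine ⟨min δ₁ r, lt_min hδ₁ hr, fun u hu huR hui => ?_⟩
  obtain ⟨hut, hxU, hxs, hcurve⟩ := hball u ⟨huR, Metric.ball_subset_ball (min_le_right _ _) hu⟩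
  have hxb : (π.baseCoord (π.j1 φ x₀)).symm u ∈ I.boundary X := by
    change I.IsBoundaryPoint _
    rw [I.isBoundaryPoint_iff_not_isInteriorPoint,
      π.isInteriorPoint_iff_baseCoord ((π.baseCoord (π.j1 φ x₀)).map_target hut),
      (π.baseCoord (π.j1 φ x₀)).right_inv hut]
    exact hui
  obtain ⟨b, hb⟩ := hBC _ hxU hxb
  obtain ⟨β, hβ0, hβ, hβN⟩ := hcurve b hb
  have hsub : ∀ t ∈ Ioo (-min δ₁ r) (min δ₁ r), t ∈ Ioo (-δ₁) δ₁ := fun t ht =>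
    ⟨by linarith [ht.1, min_le_left δ₁ r], by linarith [ht.2, min_le_left δ₁ r]⟩
  refine ⟨fun t => κ (iB (β t)), ?_, fun t ht => ⟨?_, ⟨κ.map_source (hβN t (hsub t ht)).1, ?_⟩,
    (hβN t (hsub t ht)).2⟩⟩
  · change κ (iB (β 0)) = _
    rw [hβ0, hb]
    rfl
  · exact hasDerivAt_extChartAt_comp (isMIntegralCurveOn_comp hi htan hβ) (hsub t ht)
      (hβN t (hsub t ht)).1
  · exact ⟨β t, (κ.left_inv (hβN t (hsub t ht)).1).symm⟩

end FiberedManifold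

end BoundaryCurves

/-! ### The flow along a solution in half-space coordinates -/

section LocalFlowAlong

variable {n : ℕ} {H : Type*} [TopologicalSpace H]
  {I : ModelWithCorners ℝ (EuclideanSpace ℝ (Fin (n + 1))) H}
  {F : Type} [NormedAddCommGroup F] [NormedSpace ℝ F] [FiniteDimensional ℝ F]
  {X : Type*} [TopologicalSpace X] [ChartedSpace H X] [IsManifold I ∞ X]
  {Y : Type*} [TopologicalSpace Y] [ChartedSpace (ModelProd H F) Y]
  {E' : Type*} [NormedAddCommGroup E'] [NormedSpace ℝ E'] [CompleteSpace E']
  {B : Type*} [TopologicalSpace B] [ChartedSpace E' B] [IsManifold 𝓘(ℝ, E') ∞ B]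
  [IsManifold 𝓘(ℝ, E') 1 B]

local notation "𝔼" => EuclideanSpace ℝ (Fin (n + 1))

namespace FiberedManifold

variable {π : FiberedManifold I F X Y} {φ : X → Y} {U : Set X} {x₀ : X}
  {ξ : (z : π.Jet) → TangentSpace (jetModel I F) z} {ξB : (b : B) → TangentSpace 𝓘(ℝ, E') b}
  {iB : B → π.Jet}

/-- The flow along a solution near a point, in coordinates. -/
theorem exists_local_flow_coord (hR : range I = {x | 0 ≤ x 0})
    (hRi : interior (range I) = {x | 0 < x 0}) (hU : IsOpen U) (hφ : π.IsSectionOn φ U)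
    (hi : MDifferentiable 𝓘(ℝ, E') (jetModel I F) iB) (hind : Topology.IsInducing iB)
    (hrg : range (π.projX ∘ iB) ⊆ I.boundary X) (hξ : IsSmoothField (jetModel I F) ξ)
    (hξB : IsSmoothField 𝓘(ℝ, E') ξB)
    (htan : ∀ b, mfderiv 𝓘(ℝ, E') (jetModel I F) iB b (ξB b) = ξ (iB b))
    (hBC : ∀ x ∈ U, x ∈ I.boundary X → π.j1 φ x ∈ range iB) (hx₀ : x₀ ∈ U) :
    ∃ ε > 0, ∃ ρ > 0, ∃ q : ℝ → 𝔼 → (𝔼 × F) × (𝔼 →L[ℝ] F),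
      (∀ u ∈ range I ∩ Metric.ball (π.baseCoord (π.j1 φ x₀) x₀) ρ,
        u ∈ (π.baseCoord (π.j1 φ x₀)).target ∧ (π.baseCoord (π.j1 φ x₀)).symm u ∈ U ∧
        π.j1 φ ((π.baseCoord (π.j1 φ x₀)).symm u) ∈
          (extChartAt (jetModel I F) (π.j1 φ x₀)).source ∧ q 0 u = π.j1Coord φ x₀ u ∧
        ∀ t ∈ Ioo (-ε) ε, HasDerivAt (fun t => q t u) (fieldRep ξ (π.j1 φ x₀) (q t u)) t ∧
          q t u ∈ (extChartAt (jetModel I F) (π.j1 φ x₀)).target ∧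
          (u ∉ interior (range I) →
            (extChartAt (jetModel I F) (π.j1 φ x₀)).symm (q t u) ∈ range iB)) ∧
      ContDiffOn ℝ ∞ (fun s : ℝ × 𝔼 => q s.1 s.2)
        (Ioo (-ε) ε ×ˢ (range I ∩ Metric.ball (π.baseCoord (π.j1 φ x₀) x₀) ρ)) ∧
      ∀ t ∈ Ioo (-ε) ε, ∃ O : Set 𝔼, IsOpen O ∧ (fun u => (q t u).1.1) ''
          (range I ∩ Metric.ball (π.baseCoord (π.j1 φ x₀) x₀) ρ) = range I ∩ O ∧
        ∃ g : 𝔼 → 𝔼, ContDiffOn ℝ ∞ g ((fun u => (q t u).1.1) ''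
            (range I ∩ Metric.ball (π.baseCoord (π.j1 φ x₀) x₀) ρ)) ∧
          ∀ u ∈ range I ∩ Metric.ball (π.baseCoord (π.j1 φ x₀) x₀) ρ, g (q t u).1.1 = u := by
  have : IsManifold (jetModel I F) 1 π.Jet := IsManifold.of_le (n := ∞) (by simp)
  have hs := mem_baseCoord_source_j1 hφ hU hx₀
  have hNnhds : U ∩ π.j1 φ ⁻¹' (extChartAt (jetModel I F) (π.j1 φ x₀)).source ∈ 𝓝 x₀ :=
    Filter.inter_mem (hU.mem_nhds hx₀) (((contMDiffOn_j1 hφ hU).continuousOn.continuousAt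
      (hU.mem_nhds hx₀)).preimage_mem_nhds
        (extChartAt_source_mem_nhds (I := jetModel I F) (π.j1 φ x₀)))
  obtain ⟨r, hr, hball⟩ := exists_ball_baseCoord hφ hU hx₀ hNnhds
  have hbd := fun a (ha : (0 : ℝ) < a) =>
    exists_boundary_curve hU hφ hi hind hξB htan hBC hx₀ ha
  have hj := contDiffOn_j1Coord (x₀ := x₀) hφ hU hball
  have hpj : ∀ u ∈ range I ∩ Metric.ball (π.baseCoord (π.j1 φ x₀) x₀) r,
      (π.j1Coord φ x₀ u).1.1 = u := fun u hu =>
    fst_fst_j1Coord hφ hU (hball u hu).1 (hball u hu).2.1 (hball u hu).2.2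
  -- `B` lies over `∂X`, so its points have boundary base coordinates.
  have htarget : ∀ w ∈ (extChartAt (jetModel I F) (π.j1 φ x₀)).target,
      (extChartAt (jetModel I F) (π.j1 φ x₀)).symm w ∈ range iB → w.1.1 ∉ interior (range I) := by
    rintro w hw ⟨b, hb⟩ hwi
    have h1 := (extChartAt (jetModel I F) (π.j1 φ x₀)).map_target hw
    have h2 : (π.projX ∘ iB) b ∈ I.boundary X := hrg (mem_range_self b)
    have h3 : I.IsBoundaryPoint (π.projX (iB b)) := h2
    rw [hb, ModelWithCorners.isBoundaryPoint_iff_not_isInteriorPoint,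
      π.isInteriorPoint_iff_baseCoord (π.projX_mem_baseCoord_source h1), π.baseCoord_projX h1,
      (extChartAt (jetModel I F) (π.j1 φ x₀)).right_inv hw] at h3
    exact h3 hwi
  have hf : ContDiffOn ℝ ∞ (fieldRep ξ (π.j1 φ x₀))
      (extChartAt (jetModel I F) (π.j1 φ x₀)).target := fun w hw =>
    (contDiffWithinAt_fieldRep hξ hw).mono (extChartAt_target_subset_range _)
  have hjt : π.j1Coord φ x₀ (π.baseCoord (π.j1 φ x₀) x₀) ∈
      (extChartAt (jetModel I F) (π.j1 φ x₀)).target := by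
    rw [j1Coord, (π.baseCoord (π.j1 φ x₀)).left_inv hs]
    exact mem_extChartAt_target _
  have hu₀ : π.baseCoord (π.j1 φ x₀) x₀ ∈ range I := mem_range_self _
  set u₀ := π.baseCoord (π.j1 φ x₀) x₀ with hu₀def
  set κ := extChartAt (jetModel I F) (π.j1 φ x₀) with hκ
  set D := (jetModel I F).symm ⁻¹' (chartAt _ (π.j1 φ x₀)).target with hDdef
  have hD : IsOpen D := (chartAt _ (π.j1 φ x₀)).open_target.preimage (jetModel I F).continuous_symm
  let ℓ : 𝔼 →L[ℝ] ℝ := EuclideanSpace.proj 0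
  let p : (𝔼 × F) × (𝔼 →L[ℝ] F) →L[ℝ] 𝔼 :=
    (ContinuousLinearMap.fst ℝ 𝔼 F).comp (ContinuousLinearMap.fst ℝ (𝔼 × F) (𝔼 →L[ℝ] F))
  replace hR : range I = {x : 𝔼 | 0 ≤ ℓ x} := hR
  replace hRi : interior (range I) = {x : 𝔼 | 0 < ℓ x} := hRi
  have hnot : ∀ u ∈ range I, (u ∉ interior (range I) ↔ ℓ u = 0) := fun u hu => by
    rw [hR] at hu
    rw [hRi, mem_ofPred_eq, not_lt]
    exact ⟨fun h => le_antisymm h hu, fun h => h.le⟩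
  have hΩ : range (jetModel I F) = {w | 0 ≤ ℓ (p w)} := by
    rw [range_jetModel, hR]
    rfl
  have ht : κ.target = {w | 0 ≤ ℓ (p w)} ∩ D := by
    rw [← hΩ, inter_comm]
    exact extChartAt_target (I := jetModel I F) (π.j1 φ x₀)
  have hℓ : ∀ v, |ℓ v| ≤ ‖v‖ := fun v => PiLp.norm_apply_le v 0
  have he : ℓ (EuclideanSpace.single 0 1) = 1 := by simp [ℓ]
  have he' : ‖(EuclideanSpace.single 0 1 : 𝔼)‖ ≤ 1 := by simp
  have hS : UniqueDiffOn ℝ {x : 𝔼 | 0 ≤ ℓ x} := hR ▸ I.uniqueDiffOn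
  have hp : ∀ w, ‖p w‖ ≤ ‖w‖ := fun w => (norm_fst_le w.1).trans (norm_fst_le w)
  have hx₀R : 0 ≤ ℓ u₀ := by
    rw [hR] at hu₀; exact hu₀
  rw [hR] at hj hpj
  -- The set that confines the boundary curves is `B` in coordinates. The flow theorem then also
  -- records that curves from boundary points remain in `B`.
  have hT : ∀ w ∈ {w | w ∈ κ.target ∧ κ.symm w ∈ range iB}, ℓ (p w) = 0 := fun w hw => by
    refine (hnot w.1.1 ?_).1 (htarget w hw.1 hw.2)
    rw [hR]
    exact (ht ▸ hw.1 : w ∈ {w | 0 ≤ ℓ (p w)} ∩ D).1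
  obtain ⟨ε, hε, ρ, hρ, hρr, q, hq, hquarter, hqs⟩ := exists_flow_of_halfSpace (p := p) hp hℓ he he'
    (hΩ ▸ (jetModel I F).uniqueDiffOn) hS hD (ht ▸ hf) hr hj hpj hx₀R (ht ▸ hjt : _ ∈ _ ∩ D).2
    hT (fun a ha => by
      obtain ⟨δ, hδ, h⟩ := hbd a ha
      refine ⟨δ, hδ, fun u hu hu0 => ?_⟩
      have huR : u ∈ range I := by rw [hR]; exact hu0.ge
      exact h u hu huR ((hnot u huR).2 hu0))
  have hsub : range I ∩ Metric.ball u₀ (ρ / 2) ⊆ {x | 0 ≤ ℓ x} ∩ Metric.ball u₀ ρ := by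
    rw [hR]
    exact inter_subset_inter_right _ (Metric.ball_subset_ball (half_le_self hρ.le))
  refine ⟨ε, hε, ρ / 2, half_pos hρ, q, fun u hu => ?_, hqs.mono (prod_mono le_rfl hsub),
    fun t ht => ?_⟩
  · obtain ⟨h1, h2, h3⟩ := hball u ⟨hu.1, Metric.ball_subset_ball (by linarith) hu.2⟩
    refine ⟨h1, h2, h3, (hq u (hsub hu)).1, fun t ht' => ?_⟩
    obtain ⟨h4, h5, h6, h7⟩ := (hq u (hsub hu)).2 t ht'
    refine ⟨h4, ?_, fun h => (h7 ((hnot u hu.1).1 h)).2⟩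
    rw [ht]
    exact ⟨h5, h6⟩
  · have h1 := exists_inverse_of_halfSpace (ψ := fun u => p (q t u)) hℓ he he' hS hx₀R
      (p.contDiff.comp_contDiffOn (hqs.comp (contDiffOn_const.prodMk contDiffOn_id)
        fun u hu => ⟨ht, hu⟩)) (fun x hx y hy => hquarter x hx y hy t ht)
      (fun x hx => ((hq x hx).2 t ht).2.1)
      (fun x hx hx0 => hT _ (((hq x hx).2 t ht).2.2.2 hx0)) hρ
    rw [hR]
    exact h1

end FiberedManifold

end LocalFlowAlong

/-! ### The local flow on the manifold -/

section LocalFlow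

variable {n : ℕ} {H : Type*} [TopologicalSpace H]
  {I : ModelWithCorners ℝ (EuclideanSpace ℝ (Fin (n + 1))) H}
  {F : Type} [NormedAddCommGroup F] [NormedSpace ℝ F] [FiniteDimensional ℝ F]
  {X : Type*} [TopologicalSpace X] [ChartedSpace H X] [IsManifold I ∞ X]
  {Y : Type*} [TopologicalSpace Y] [ChartedSpace (ModelProd H F) Y]
  {E' : Type*} [NormedAddCommGroup E'] [NormedSpace ℝ E'] [CompleteSpace E']
  {B : Type*} [TopologicalSpace B] [ChartedSpace E' B] [IsManifold 𝓘(ℝ, E') ∞ B]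
  [IsManifold 𝓘(ℝ, E') 1 B]

local notation "𝔼" => EuclideanSpace ℝ (Fin (n + 1))

namespace FiberedManifold

variable {π : FiberedManifold I F X Y} {φ : X → Y} {U : Set X} {x₀ : X}
  {ξ : (z : π.Jet) → TangentSpace (jetModel I F) z} {ξB : (b : B) → TangentSpace 𝓘(ℝ, E') b}
  {iB : B → π.Jet}

/-- The flow along a solution is defined and projectable near every point, and preserves the
boundary condition. -/
theorem exists_isFlowAlong_nhds (hR : range I = {x | 0 ≤ x 0})
    (hRi : interior (range I) = {x | 0 < x 0}) (hU : IsOpen U) (hφ : π.IsSectionOn φ U)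
    (hi : MDifferentiable 𝓘(ℝ, E') (jetModel I F) iB) (hind : Topology.IsInducing iB)
    (hrg : range (π.projX ∘ iB) ⊆ I.boundary X) (hξ : IsSmoothField (jetModel I F) ξ)
    (hξB : IsSmoothField 𝓘(ℝ, E') ξB)
    (htan : ∀ b, mfderiv 𝓘(ℝ, E') (jetModel I F) iB b (ξB b) = ξ (iB b))
    (hBC : ∀ x ∈ U, x ∈ I.boundary X → π.j1 φ x ∈ range iB) (hx₀ : x₀ ∈ U) :
    ∃ ε > 0, ∃ N : Set X, IsOpen N ∧ x₀ ∈ N ∧ N ⊆ U ∧ ∃ Ψ : ℝ → X → π.Jet,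
      π.IsFlowAlong ξ φ (-ε) ε N Ψ ∧
      ∀ t ∈ Ioo (-ε) ε, ∀ x ∈ N, x ∈ I.boundary X → Ψ t x ∈ range iB := by
  obtain ⟨ε, hε, ρ, hρ, q, hq, hqs, hinv⟩ :=
    exists_local_flow_coord hR hRi hU hφ hi hind hrg hξ hξB htan hBC hx₀
  have hs := mem_baseCoord_source_j1 hφ hU hx₀
  have hcc := π.contMDiffOn_baseCoord (π.j1 φ x₀)
  have hcs := π.contMDiffOn_baseCoord_symm (π.j1 φ x₀)
  have hco := π.isOpen_baseCoord_source (π.j1 φ x₀)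
  have hrange : ∀ x, π.baseCoord (π.j1 φ x₀) x ∈ range I := fun x => mem_range_self _
  have hκ : ContMDiffOn 𝓘(ℝ, (𝔼 × F) × (𝔼 →L[ℝ] F)) (jetModel I F) ∞
      (extChartAt (jetModel I F) (π.j1 φ x₀)).symm
      (extChartAt (jetModel I F) (π.j1 φ x₀)).target := contMDiffOn_extChartAt_symm _
  have hproj : ∀ t ∈ Ioo (-ε) ε, ∀ u ∈ range I ∩ Metric.ball (π.baseCoord (π.j1 φ x₀) x₀) ρ,
      π.projX ((extChartAt (jetModel I F) (π.j1 φ x₀)).symm (q t u)) =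
        (π.baseCoord (π.j1 φ x₀)).symm (q t u).1.1 ∧
      (q t u).1.1 ∈ (π.baseCoord (π.j1 φ x₀)).target := fun t ht u hu =>
    ⟨π.projX_extChartAt_symm ((hq u hu).2.2.2.2 t ht).2.1,
      π.fst_fst_mem_baseCoord_target ((hq u hu).2.2.2.2 t ht).2.1⟩
  have hinner : ∀ x ∈ (π.baseCoord (π.j1 φ x₀)).source, x ∈ I.boundary X →
      π.baseCoord (π.j1 φ x₀) x ∉ interior (range I) := fun x hx hxb => by
    rwa [← π.isInteriorPoint_iff_baseCoord hx, ← I.isBoundaryPoint_iff_not_isInteriorPoint]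
  have hj1 : ∀ x ∈ (π.baseCoord (π.j1 φ x₀)).source,
      π.j1Coord φ x₀ (π.baseCoord (π.j1 φ x₀) x) =
        extChartAt (jetModel I F) (π.j1 φ x₀) (π.j1 φ x) := fun x hx => by
    rw [j1Coord, (π.baseCoord (π.j1 φ x₀)).left_inv hx]
  set κ := extChartAt (jetModel I F) (π.j1 φ x₀)
  set c := π.baseCoord (π.j1 φ x₀)
  set N := c.source ∩ c ⁻¹' Metric.ball (c x₀) ρ
  have hNc : ∀ x ∈ N, c x ∈ range I ∩ Metric.ball (c x₀) ρ := fun x hx => ⟨hrange x, hx.2⟩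
  have hN : IsOpen N := hcc.continuousOn.isOpen_inter_preimage hco Metric.isOpen_ball
  have himg : ∀ t ∈ Ioo (-ε) ε, (fun x => π.projX (κ.symm (q t (c x)))) '' N =
      c.source ∩ c ⁻¹' ((fun u => (q t u).1.1) '' (range I ∩ Metric.ball (c x₀) ρ)) := by
    intro t ht
    ext y
    constructor
    · rintro ⟨x, hx, rfl⟩
      obtain ⟨h1, h2⟩ := hproj t ht _ (hNc x hx)
      change π.projX (κ.symm (q t (c x))) ∈ _
      rw [h1]
      exact ⟨c.map_target h2, by
        rw [mem_preimage, c.right_inv h2]; exact mem_image_of_mem _ (hNc x hx)⟩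
    · rintro ⟨hy, u, hu, huy⟩
      have hut := (hq u hu).1
      refine ⟨c.symm u, ⟨c.map_target hut, ?_⟩, ?_⟩
      · rw [mem_preimage, c.right_inv hut]
        exact hu.2
      · change π.projX (κ.symm (q t (c (c.symm u)))) = y
        have huy' : (q t u).1.1 = c y := huy
        rw [c.right_inv hut, (hproj t ht u hu).1, huy', c.left_inv hy]
  refine ⟨ε, hε, N, hN, ⟨hs, Metric.mem_ball_self hρ⟩, fun x hx => ?_,
    fun t x => κ.symm (q t (c x)), ⟨fun x hx => ?_, fun x hx => ?_, ?_, fun t ht => ?_,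
      fun t ht => ?_⟩, fun t ht x hx hxb => ?_⟩
  · have h := (hq _ (hNc x hx)).2.1
    rwa [c.left_inv hx.1] at h
  · obtain ⟨-, -, h1, h2, -⟩ := hq _ (hNc x hx)
    change κ.symm (q 0 (c x)) = _
    rw [h2, hj1 x hx.1]
    rw [c.left_inv hx.1] at h1
    exact κ.left_inv h1
  · have : IsManifold (jetModel I F) 1 π.Jet := IsManifold.of_le (n := ∞) (by simp)
    exact isMIntegralCurveOn_extChartAt_symm (I := jetModel I F) (α := fun t => q t (c x))
      fun t ht => ⟨((hq _ (hNc x hx)).2.2.2.2 t ht).1, ((hq _ (hNc x hx)).2.2.2.2 t ht).2.1⟩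
  · have h1 : ContMDiffOn (𝓘(ℝ, ℝ).prod I) 𝓘(ℝ, ℝ × 𝔼) ∞ (fun p : ℝ × X => (p.1, c p.2))
        (Ioo (-ε) ε ×ˢ N) :=
      contMDiffOn_fst.prodMk_space ((hcc.mono inter_subset_left).comp contMDiffOn_snd
        fun p hp => hp.2)
    have h2 : ContMDiffOn (𝓘(ℝ, ℝ).prod I) 𝓘(ℝ, (𝔼 × F) × (𝔼 →L[ℝ] F)) ∞
        (fun p : ℝ × X => q p.1 (c p.2)) (Ioo (-ε) ε ×ˢ N) :=
      hqs.contMDiffOn.comp h1 fun p hp => ⟨hp.1, hNc _ hp.2⟩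
    exact hκ.comp h2 fun p hp => ((hq _ (hNc _ hp.2)).2.2.2.2 p.1 hp.1).2.1
  · obtain ⟨O, hO, hO', -⟩ := hinv t ht
    rw [himg t ht, hO']
    -- The base coordinates take values in `range I`, so a relatively open image in the half-space
    -- pulls back to an open set of `X`.
    have : c.source ∩ c ⁻¹' (range I ∩ O) = c.source ∩ c ⁻¹' O := by
      ext y
      exact ⟨fun h => ⟨h.1, h.2.2⟩, fun h => ⟨h.1, hrange y, h.2⟩⟩
    rw [this]
    exact hcc.continuousOn.isOpen_inter_preimage hco hO
  · obtain ⟨-, -, -, g, hg, hgu⟩ := hinv t ht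
    refine ⟨fun y => c.symm (g (c y)), ?_, fun x hx => ?_⟩
    · rw [himg t ht]
      refine hcs.comp (hg.contMDiffOn.comp (hcc.mono inter_subset_left) fun y hy => hy.2) ?_
      rintro y ⟨hy, u, hu, huy⟩
      change g (c y) ∈ c.target
      have huy' : (q t u).1.1 = c y := huy
      rw [← huy', hgu u hu]
      exact (hq u hu).1
    · obtain ⟨h1, h2⟩ := hproj t ht _ (hNc x hx)
      change c.symm (g (c (π.projX (κ.symm (q t (c x)))))) = x
      rw [h1, c.right_inv h2, hgu _ (hNc x hx), c.left_inv hx.1]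
  · exact ((hq _ (hNc x hx)).2.2.2.2 t ht).2.2 (hinner x hx.1 hxb)

end FiberedManifold

end LocalFlow

/-! ### Gluing local flows near a compact set -/

/-- A homotopy of locally injective maps that starts at the inclusion of a compact set stays
injective near it for small times. -/
theorem exists_injOn_of_isCompact {X ι : Type*} [TopologicalSpace X] [T2Space X] {K : Set X}
    (hK : IsCompact K) {N : ι → Set X} (hN : ∀ i, IsOpen (N i)) (hKN : K ⊆ ⋃ i, N i) {ε : ℝ}
    (hε : 0 < ε) {ψ : ℝ → X → X}
    (hψ : ContinuousOn (fun p : ℝ × X => ψ p.1 p.2) (Ioo (-ε) ε ×ˢ ⋃ i, N i))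
    (hψ₀ : ∀ x ∈ K, ψ 0 x = x) (hinj : ∀ i, ∀ t ∈ Ioo (-ε) ε, InjOn (ψ t) (N i)) :
    ∃ δ > 0, δ ≤ ε ∧ ∃ W, IsOpen W ∧ K ⊆ W ∧ W ⊆ ⋃ i, N i ∧
      ∀ t ∈ Ioo (-δ) δ, InjOn (ψ t) W := by
  set S := ⋃ i, N i with hS
  have hSo : IsOpen S := isOpen_iUnion hN
  have hDo : IsOpen (Ioo (-ε) ε ×ˢ (S ×ˢ S)) := isOpen_Ioo.prod (hSo.prod hSo)
  -- Good triples `(t, x, y)`: either both points lie in one `N i`, where injectivity is known, or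
  -- their images are already distinct, an open condition as `X` is Hausdorff.
  let A : Set (ℝ × (X × X)) := (⋃ i, univ ×ˢ (N i ×ˢ N i)) ∪
    (Ioo (-ε) ε ×ˢ (S ×ˢ S) ∩ (fun p => (ψ p.1 p.2.1, ψ p.1 p.2.2)) ⁻¹' (diagonal X)ᶜ)
  have hA : IsOpen A := by
    refine (isOpen_iUnion fun i => isOpen_univ.prod ((hN i).prod (hN i))).union
      (ContinuousOn.isOpen_inter_preimage (ContinuousOn.prodMk ?_ ?_) hDo
        isClosed_diagonal.isOpen_compl)
    · exact hψ.comp (by fun_prop : Continuous fun p : ℝ × (X × X) => (p.1, p.2.1)).continuousOn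
        fun p hp => ⟨hp.1, hp.2.1⟩
    · exact hψ.comp (by fun_prop : Continuous fun p : ℝ × (X × X) => (p.1, p.2.2)).continuousOn
        fun p hp => ⟨hp.1, hp.2.2⟩
  have hsub : ({0} : Set ℝ) ×ˢ (K ×ˢ K) ⊆ A := by
    rintro ⟨t, x, y⟩ ⟨rfl, hx, hy⟩
    by_cases hxy : x = y
    · obtain ⟨i, hi⟩ := mem_iUnion.1 (hKN hx)
      exact Or.inl (mem_iUnion.2 ⟨i, mem_univ _, hi, hxy ▸ hi⟩)
    · refine Or.inr ⟨⟨⟨neg_lt_zero.2 hε, hε⟩, hKN hx, hKN hy⟩, fun h => hxy ?_⟩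
      have h' : ψ 0 x = ψ 0 y := h
      rwa [hψ₀ x hx, hψ₀ y hy] at h'
  -- `A` is open and contains `{0} × K × K`, so by compactness it contains a product neighbourhood,
  -- which provides `δ` and `W`.
  obtain ⟨u, v, hu, hv, h0u, hKv, huv⟩ :=
    generalized_tube_lemma isCompact_singleton (hK.prod hK) hA hsub
  obtain ⟨w, w', hw, hw', hKw, hKw', hww⟩ := generalized_tube_lemma hK hK hv hKv
  obtain ⟨δ, hδ, hδu⟩ := Metric.isOpen_iff.1 hu 0 (h0u rfl)
  refine ⟨min δ ε, lt_min hδ hε, min_le_right _ _, w ∩ w' ∩ S, (hw.inter hw').inter hSo,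
    fun x hx => ⟨⟨hKw hx, hKw' hx⟩, hKN hx⟩, inter_subset_right, fun t ht x hx y hy hxy => ?_⟩
  have ht' : t ∈ Ioo (-ε) ε := Ioo_subset_Ioo (neg_le_neg (min_le_right _ _)) (min_le_right _ _) ht
  have htu : t ∈ u := hδu <| by
    rw [Real.ball_eq_Ioo, zero_sub, zero_add]
    exact Ioo_subset_Ioo (neg_le_neg (min_le_left _ _)) (min_le_left _ _) ht
  obtain h | h := huv (⟨htu, hww ⟨hx.1.1, hy.1.2⟩⟩ : (t, (x, y)) ∈ u ×ˢ v)
  · obtain ⟨i, -, hxi, hyi⟩ := mem_iUnion.1 h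
    exact hinj i t ht' hxi hyi hxy
  · exact absurd hxy h.2

section Gluing

variable {n : ℕ} {H : Type*} [TopologicalSpace H]
  {I : ModelWithCorners ℝ (EuclideanSpace ℝ (Fin (n + 1))) H}
  {F : Type*} [NormedAddCommGroup F] [NormedSpace ℝ F]
  {X : Type*} [TopologicalSpace X] [ChartedSpace H X]
  {Y : Type*} [TopologicalSpace Y] [ChartedSpace (ModelProd H F) Y]

namespace FiberedManifold

variable {π : FiberedManifold I F X Y} {φ : X → Y} {U K W : Set X}
  {ξ : (z : π.Jet) → TangentSpace (jetModel I F) z} {Ψ : ℝ → X → π.Jet} {a b : ℝ}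

/-- Being the flow along `j¹φ` is local, apart from injectivity. -/
theorem isFlowAlong_of_locally (h₀ : ∀ x ∈ W, Ψ 0 x = π.j1 φ x)
    (hγ : ∀ x ∈ W, IsMIntegralCurveOn (I := jetModel I F) (fun t => Ψ t x) ξ (Ioo a b))
    (hW : IsOpen W) (hloc : ∀ x ∈ W, ∃ N, IsOpen N ∧ x ∈ N ∧ ∃ Ψ' : ℝ → X → π.Jet,
      ∃ a' b' : ℝ, Ioo a b ⊆ Ioo a' b' ∧
      π.IsFlowAlong ξ φ a' b' N Ψ' ∧ ∀ y ∈ N, EqOn (fun t => Ψ t y) (fun t => Ψ' t y) (Ioo a b))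
    (hinj : ∀ t ∈ Ioo a b, InjOn (fun x => π.projX (Ψ t x)) W) : π.IsFlowAlong ξ φ a b W Ψ := by
  -- Local inverses of `ψ_t` come from the local flows, with a domain small enough that they land in
  -- `W`. Global injectivity then joins them into one smooth inverse.
  have key : ∀ t ∈ Ioo a b, ∀ x ∈ W, ∃ (V : Set X) (g : X → X), IsOpen V ∧ π.projX (Ψ t x) ∈ V ∧
      V ⊆ (fun x => π.projX (Ψ t x)) '' W ∧ ContMDiffOn I I ∞ g V ∧
      ∀ y ∈ V, g y ∈ W ∧ π.projX (Ψ t (g y)) = y := by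
    intro t ht x hx
    obtain ⟨N, hN, hxN, Ψ', a', b', hab, h, heq⟩ := hloc x hx
    obtain ⟨g, hg, hgN⟩ := h.exists_inverse t (hab ht)
    have hgV : ∀ y ∈ (fun x => π.projX (Ψ' t x)) '' N ∩ g ⁻¹' (W ∩ N),
        g y ∈ W ∧ π.projX (Ψ t (g y)) = y := by
      rintro _ ⟨⟨x', hx', rfl⟩, hgx⟩
      refine ⟨hgx.1, ?_⟩
      have h1 : g (π.projX (Ψ' t x')) = x' := hgN x' hx'
      have h2 : Ψ t x' = Ψ' t x' := heq x' hx' ht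
      change π.projX (Ψ t (g (π.projX (Ψ' t x')))) = π.projX (Ψ' t x')
      rw [h1, h2]
    refine ⟨(fun x => π.projX (Ψ' t x)) '' N ∩ g ⁻¹' (W ∩ N), g,
      hg.continuousOn.isOpen_inter_preimage (h.isOpen_image t (hab ht)) (hW.inter hN), ?_,
      fun y hy => ⟨g y, hgV y hy⟩, hg.mono inter_subset_left, hgV⟩
    have h2 : Ψ t x = Ψ' t x := heq x hxN ht
    rw [h2]
    exact ⟨mem_image_of_mem _ hxN, by rw [mem_preimage, hgN x hxN]; exact ⟨hx, hxN⟩⟩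
  refine ⟨h₀, hγ, ?_, fun t ht => ?_, fun t ht => ?_⟩
  · rintro ⟨t, x⟩ ⟨ht, hx⟩
    obtain ⟨N, hN, hxN, Ψ', a', b', hab, h, heq⟩ := hloc x hx
    have h1 : ContMDiffOn (𝓘(ℝ, ℝ).prod I) (jetModel I F) ∞ (fun p : ℝ × X => Ψ p.1 p.2)
        (Ioo a b ×ˢ N) :=
      (h.smooth.mono (prod_mono hab le_rfl)).congr fun p hp => heq p.2 hp.2 hp.1
    exact (h1.contMDiffAt ((isOpen_Ioo.prod hN).mem_nhds ⟨ht, hxN⟩)).contMDiffWithinAt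
  · refine isOpen_iff_forall_mem_open.2 ?_
    rintro _ ⟨x, hx, rfl⟩
    obtain ⟨V, g, hV, hxV, hVW, -⟩ := key t ht x hx
    exact ⟨V, hVW, hV, hxV⟩
  · cases isEmpty_or_nonempty X
    · exact ⟨id, fun x => isEmptyElim x, fun x => isEmptyElim x⟩
    have hleft : ∀ x ∈ W, invFunOn (fun x => π.projX (Ψ t x)) W (π.projX (Ψ t x)) = x :=
      fun x hx => (hinj t ht).leftInvOn_invFunOn hx
    refine ⟨invFunOn (fun x => π.projX (Ψ t x)) W, ?_, hleft⟩
    rintro _ ⟨x, hx, rfl⟩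
    obtain ⟨V, g, hV, hxV, hVW, hg, hgV⟩ := key t ht x hx
    refine ((hg.contMDiffAt (hV.mem_nhds hxV)).congr_of_eventuallyEq ?_).contMDiffWithinAt
    filter_upwards [hV.mem_nhds hxV] with y hy
    obtain ⟨h1, h2⟩ := hgV y hy
    rw [← hleft _ h1, h2]

/-- Local flows along `j¹φ` give a flow near every compact set. -/
theorem exists_isFlowAlong_of_isCompact [T2Space X] [T2Space Y] (hU : IsOpen U)
    (hφ : π.IsSectionOn φ U) (hξ : IsSmoothField (jetModel I F) ξ) {T : Set π.Jet}
    (hloc : ∀ x₀ ∈ U, ∃ ε > 0, ∃ N : Set X, IsOpen N ∧ x₀ ∈ N ∧ N ⊆ U ∧ ∃ Ψ : ℝ → X → π.Jet,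
      π.IsFlowAlong ξ φ (-ε) ε N Ψ ∧ ∀ t ∈ Ioo (-ε) ε, ∀ x ∈ N, x ∈ I.boundary X → Ψ t x ∈ T)
    (hK : IsCompact K) (hKU : K ⊆ U) :
    ∃ (ε : ℝ) (W : Set X) (Ψ : ℝ → X → π.Jet), 0 < ε ∧ IsOpen W ∧ K ⊆ W ∧ W ⊆ U ∧
      π.IsFlowAlong ξ φ (-ε) ε W Ψ ∧
      ∀ t ∈ Ioo (-ε) ε, ∀ x ∈ W, x ∈ I.boundary X → Ψ t x ∈ T := by
  -- The choices below need a default jet, which a point of `K` provides; an empty `K` is served by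
  -- the empty `W`.
  obtain rfl | ⟨x₁, hx₁⟩ := K.eq_empty_or_nonempty
  · refine ⟨1, ∅, fun _ => π.j1 φ, one_pos, isOpen_empty, le_rfl, empty_subset _,
      ⟨by simp, by simp, fun p hp => hp.2.elim, by simp, fun t _ => ⟨id, by simp, by simp⟩⟩,
      by simp⟩
  have : Nonempty π.Jet := ⟨π.j1 φ x₁⟩
  choose! ε hε N hN hxN hNU Ψ hΨ hT using hloc
  obtain ⟨s, hsK, hs⟩ := hK.elim_nhds_subcover N fun x hx =>
    (hN x (hKU hx)).mem_nhds (hxN x (hKU hx))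
  have hsU : ∀ i : s, (i : X) ∈ U := fun i => hKU (hsK i i.2)
  have hcover : K ⊆ ⋃ i : s, N i := fun x hx => by
    obtain ⟨i, hi, hxi⟩ := mem_iUnion₂.1 (hs hx)
    exact mem_iUnion.2 ⟨⟨i, hi⟩, hxi⟩
  obtain ⟨ε₀, hε₀, hle⟩ : ∃ ε₀ > 0, ∀ i : s, ε₀ ≤ ε i := by
    have h : ∀ᶠ δ in 𝓝[>] (0 : ℝ), ∀ i : s, δ ≤ ε i :=
      Filter.eventually_all.2 fun i => mem_nhdsWithin_of_mem_nhds
        (Iic_mem_nhds (hε i (hsU i)))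
    obtain ⟨δ, h1, h2⟩ := (h.and self_mem_nhdsWithin).exists
    exact ⟨δ, h2, h1⟩
  have hsubI : ∀ i : s, ∀ {δ : ℝ}, δ ≤ ε₀ → Ioo (-δ) δ ⊆ Ioo (-ε i) (ε i) := fun i δ hδ =>
    Ioo_subset_Ioo (neg_le_neg (hδ.trans (hle i))) (hδ.trans (hle i))
  have h0 : (0 : ℝ) ∈ Ioo (-ε₀) ε₀ := ⟨neg_lt_zero.2 hε₀, hε₀⟩
  have hidx : ∀ x ∈ ⋃ i : s, N i, ∃ i : s, x ∈ N i := fun x hx => mem_iUnion.1 hx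
  have : Nonempty s := ⟨(hidx x₁ (hcover hx₁)).choose⟩
  choose! i hi using hidx
  -- The index `i x` is chosen pointwise, without any continuity. Uniqueness of integral curves
  -- makes the choice immaterial, so the glued flow inherits all local properties.
  have hagree : ∀ (j : s), ∀ x ∈ N j,
      EqOn (fun t => Ψ (i x) t x) (fun t => Ψ j t x) (Ioo (-ε₀) ε₀) := by
    intro j x hx
    have hxi := hi x (mem_iUnion.2 ⟨j, hx⟩)
    refine eqOn_of_isMIntegralCurveOn (I := jetModel I F) hξ
      (((hΨ _ (hsU (i x))).integralCurve x hxi).mono (hsubI _ le_rfl))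
      (((hΨ _ (hsU j)).integralCurve x hx).mono (hsubI _ le_rfl)) h0 ?_
    exact ((hΨ _ (hsU (i x))).start x hxi).trans ((hΨ _ (hsU j)).start x hx).symm
  have hproj := π.contMDiff_projX.continuous
  have hcont : ContinuousOn (fun p : ℝ × X => π.projX (Ψ (i p.2) p.1 p.2))
      (Ioo (-ε₀) ε₀ ×ˢ ⋃ i : s, N i) := by
    rintro ⟨t, x⟩ ⟨ht, hx⟩
    have h1 : ContinuousOn (fun p : ℝ × X => Ψ (i p.2) p.1 p.2) (Ioo (-ε₀) ε₀ ×ˢ N (i x)) :=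
      ((hΨ _ (hsU (i x))).smooth.continuousOn.mono (prod_mono (hsubI _ le_rfl) le_rfl)).congr
        fun p hp => hagree (i x) p.2 hp.2 hp.1
    exact (hproj.comp_continuousOn h1).continuousAt
      ((isOpen_Ioo.prod (hN _ (hsU (i x)))).mem_nhds ⟨ht, hi x hx⟩) |>.continuousWithinAt
  obtain ⟨δ, hδ, hδε, W, hW, hKW, hWN, hinj⟩ := exists_injOn_of_isCompact hK
    (N := fun j : s => N j) (fun j => hN j (hsU j)) hcover hε₀
    (ψ := fun t x => π.projX (Ψ (i x) t x)) hcont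
    (fun x hx => by
      rw [(hΨ _ (hsU (i x))).start x (hi x (hcover hx)), hφ.projX_j1 hU (hKU hx)])
    (fun j t ht x hx y hy hxy => by
      obtain ⟨g, -, hg⟩ := (hΨ _ (hsU j)).exists_inverse t (hsubI j le_rfl ht)
      have hxj : Ψ (i x) t x = Ψ j t x := hagree j x hx ht
      have hyj : Ψ (i y) t y = Ψ j t y := hagree j y hy ht
      have hxy' : π.projX (Ψ (i x) t x) = π.projX (Ψ (i y) t y) := hxy
      rw [hxj, hyj] at hxy'
      rw [← hg x hx, hxy', hg y hy])
  have hIoo : Ioo (-δ) δ ⊆ Ioo (-ε₀) ε₀ := Ioo_subset_Ioo (neg_le_neg hδε) hδε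
  refine ⟨δ, W, fun t x => Ψ (i x) t x, hδ, hW, hKW,
    fun x hx => hNU _ (hsU (i x)) (hi x (hWN hx)), ?_, fun t ht x hx hxb =>
      hT _ (hsU (i x)) t (hsubI _ hδε ht) x (hi x (hWN hx)) hxb⟩
  exact isFlowAlong_of_locally (fun x hx => (hΨ _ (hsU (i x))).start x (hi x (hWN hx)))
    (fun x hx => ((hΨ _ (hsU (i x))).integralCurve x (hi x (hWN hx))).mono (hsubI _ hδε)) hW
    (fun x hx => ⟨N (i x), hN _ (hsU (i x)), hi x (hWN hx), Ψ (i x), -ε (i x), ε (i x),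
      hsubI _ hδε, hΨ _ (hsU (i x)), fun y hy => (hagree (i x) y hy).mono hIoo⟩) hinj

end FiberedManifold

end Gluing

end FieldTheory

end

/-! ### The proposition -/

theorem mainTheorem4 {n m k : ℕ}
    {X : Type*} [TopologicalSpace X] [T2Space X] [SecondCountableTopology X]
    [ChartedSpace (EuclideanHalfSpace (n + 1)) X] [IsManifold (𝓡∂ (n + 1)) ∞ X]
    {Y : Type*} [TopologicalSpace Y] [T2Space Y] [SecondCountableTopology Y]
    [ChartedSpace (ModelProd (EuclideanHalfSpace (n + 1)) (EuclideanSpace ℝ (Fin m))) Y]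
    [IsManifold ((𝓡∂ (n + 1)).prod (𝓡 m)) ∞ Y]
    (π : FieldTheory.FiberedManifold (𝓡∂ (n + 1)) (EuclideanSpace ℝ (Fin m)) X Y)
    -- the volume form and the Lagrangian
    (η : FieldTheory.Form (𝓡∂ (n + 1)) X (n + 1))
    (hη : FieldTheory.IsSmoothForm (𝓡∂ (n + 1)) η) (hη0 : ∀ x, η x ≠ 0)
    (L : π.Jet → ℝ)
    (hL : ContMDiff (FieldTheory.FiberedManifold.jetModel (𝓡∂ (n + 1)) (EuclideanSpace ℝ (Fin m)))
      𝓘(ℝ, ℝ) ∞ L)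
    -- the boundary condition
    {B : Type*} [TopologicalSpace B] [ChartedSpace (EuclideanSpace ℝ (Fin k)) B]
    [IsManifold (𝓡 k) ∞ B]
    (iB : B → π.Jet) (hB : π.IsBoundarySubbundle k iB)
    (P : FieldTheory.Form (𝓡 k) B n) (hP : FieldTheory.IsSmoothForm (𝓡 k) P)
    (hP' : FieldTheory.pullback (𝓡 k)
      (FieldTheory.FiberedManifold.jetModel (𝓡∂ (n + 1)) (EuclideanSpace ℝ (Fin m))) iB
      (π.poincareCartan η L) = FieldTheory.extD (𝓡 k) P)
    -- the Cartan symmetry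
    (ξ : (z : π.Jet) → TangentSpace
      (FieldTheory.FiberedManifold.jetModel (𝓡∂ (n + 1)) (EuclideanSpace ℝ (Fin m))) z)
    (hξ : π.IsCartanSymmetry k η L iB P ξ)
    -- the solution, over an open set
    (U : Set X) (hU : IsOpen U) (φ : X → Y) (hφ : π.IsSectionOn φ U)
    (hEL : π.EulerLagrangeOn η L U φ) (hBC : π.BoundaryConditionOn iB U φ) :
    -- for small times, near every compact set
    (∀ K : Set X, IsCompact K → K ⊆ U →
      ∃ (ε : ℝ) (W : Set X) (Ψ : ℝ → X → π.Jet), 0 < ε ∧ IsOpen W ∧ K ⊆ W ∧ W ⊆ U ∧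
        π.IsFlowAlong ξ φ (-ε) ε W Ψ ∧
        ∀ t ∈ Set.Ioo (-ε) ε, ∃ φt : X → Y,
          π.IsSectionOn φt ((fun x => π.projX (Ψ t x)) '' W) ∧
          (∀ x ∈ W, Ψ t x = π.j1 φt (π.projX (Ψ t x))) ∧
          π.EulerLagrangeOn η L ((fun x => π.projX (Ψ t x)) '' W) φt ∧
          π.BoundaryConditionOn iB ((fun x => π.projX (Ψ t x)) '' W) φt) ∧
    -- on every time interval on which the flow stays projectable along the solution
    (∀ (a b : ℝ) (W : Set X) (Ψ : ℝ → X → π.Jet), a < 0 → 0 < b → IsOpen W → W ⊆ U →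
      π.IsFlowAlong ξ φ a b W Ψ →
        ∀ t ∈ Set.Ioo a b, ∃ φt : X → Y,
          π.IsSectionOn φt ((fun x => π.projX (Ψ t x)) '' W) ∧
          (∀ x ∈ W, Ψ t x = π.j1 φt (π.projX (Ψ t x))) ∧
          π.EulerLagrangeOn η L ((fun x => π.projX (Ψ t x)) '' W) φt ∧
          (IsClosed (Set.range iB) →
            π.BoundaryConditionOn iB ((fun x => π.projX (Ψ t x)) '' W) φt)) := by
  obtain ⟨α, hα, -, hsymm⟩ := hξ.exists_form
  obtain ⟨ξB, hξB, htan, -⟩ := hξ.tangent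
  have hi : MDifferentiable (𝓡 k) (FieldTheory.FiberedManifold.jetModel (𝓡∂ (n + 1))
      (EuclideanSpace ℝ (Fin m))) iB := hB.embedding.contMDiff.mdifferentiable (by simp)
  have hind : Topology.IsInducing iB := hB.embedding.isEmbedding.isInducing
  have hsol : ∀ {a b : ℝ} {W : Set X} {Ψ : ℝ → X → π.Jet}, a < 0 → 0 < b → IsOpen W → W ⊆ U →
      π.IsFlowAlong ξ φ a b W Ψ → ∀ t ∈ Set.Ioo a b, ∃ φt : X → Y,
        π.IsSectionOn φt ((fun x => π.projX (Ψ t x)) '' W) ∧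
        (∀ x ∈ W, Ψ t x = π.j1 φt (π.projX (Ψ t x))) ∧
        π.EulerLagrangeOn η L ((fun x => π.projX (Ψ t x)) '' W) φt :=
    fun ha hb hW hWU h t ht => h.exists_solution hη hL hξ.smooth (hξ.lieD_mem 1) hα hsymm hU hφ hEL
      hW hWU ha hb ht
  refine ⟨fun K hK hKU => ?_, fun a b W Ψ ha hb hW hWU h t ht => ?_⟩
  -- Here `B` need not be closed: the local flows are built so that curves from boundary points run
  -- in `B` for the whole short time interval.
  · obtain ⟨ε, W, Ψ, hε, hW, hKW, hWU, h, hT⟩ :=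
      FieldTheory.FiberedManifold.exists_isFlowAlong_of_isCompact hU hφ hξ.smooth
        (fun x₀ hx₀ => FieldTheory.FiberedManifold.exists_isFlowAlong_nhds
          (range_modelWithCornersEuclideanHalfSpace (n + 1))
          (interior_range_modelWithCornersEuclideanHalfSpace (n + 1)) hU hφ hi hind
          hB.range_proj.subset hξ.smooth hξB htan hBC hx₀) hK hKU
    refine ⟨ε, W, Ψ, hε, hW, hKW, hWU, h, fun t ht => ?_⟩
    obtain ⟨φt, h1, h2, h3⟩ := hsol (neg_lt_zero.2 hε) hε hW hWU h t ht
    exact ⟨φt, h1, h2, h3, h.boundaryConditionOn hW ht h2 (hT t ht)⟩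
  · obtain ⟨φt, h1, h2, h3⟩ := hsol ha hb hW hWU h t ht
    -- On a long interval a curve could leave `B` through a limit point; closedness excludes this,
    -- starting from the boundary condition at time `0`.
    refine ⟨φt, h1, h2, h3, fun hcl => h.boundaryConditionOn hW ht h2 fun x hx hxb => ?_⟩
    have h₀ : Ψ 0 x ∈ Set.range iB := by
      rw [h.start x hx]
      exact hBC x (hWU hx) hxb
    exact FieldTheory.mem_range_of_isMIntegralCurveOn hξ.smooth hξB hi htan hcl
      (h.integralCurve x hx) ⟨ha, hb⟩ h₀ t ht
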